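/- **Setting.** Let $T$ be a string of length $n\ge 1$ over the alphabet $\{1,2,3,\dots\}$ whose last character is the smallest character $\$=1$ and in which $\$$ does not occur elsewhere; let $T_\delta$ be its suffix of length $\delta$. For such a string $S$ of length $\delta$ let $x_1,\dots,x_\delta$ be the starting positions of its suffixes in lexicographic order; $L=L_S$ (the BWT) and $F=F_S$ are the strings with $L[i]=S[x_i-1]$ (where $S[0]=S[\delta]$) and $F[i]=S[x_i]$, and $\mathsf{LF}(i)=j$ iff $x_j=x_i-1$, or $x_i=1$ and $x_j=\delta$. Let $r$ be the number of maximal runs of equal characters of $L_T$. A *DBWT* $D$ of $L$ is a factorization of $L$ into $k=|D|$ nonempty repetitions $L[p_i..p_{i+1}-1]$ of one character each; the F-interval of the $i$-th repetition is $[\mathsf{LF}(p_i),\mathsf{LF}(p_{i+1}-1)]$. A repetition is *$\alpha$-heavy* if its interval $[p_i,p_{i+1}-1]$ contains at least $\alpha$ starting positions of F-intervals; an F-interval is $\alpha$-heavy if it contains at least $\alpha$ starting positions of repetitions; $D$ is *$\alpha$-balanced* if nothing is $\alpha$-heavy. The *LF-interval graph* $\mathsf{Grp}(D)$ has nodes $u_i$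 (the $i$-th repetition) and $v_i$ (its F-interval), labelled with their character and length, edges $u_iv_i$, a directed edge $(u_i,v_j)$ labelled $p_i-\mathsf{LF}(p_j)$ whenever $p_i$ lies in the F-interval of $v_j$, and a directed edge $(v_j,u_i)$ labelled $\mathsf{LF}(p_j)-p_i$ whenever $\mathsf{LF}(p_j)\in[p_i,p_{i+1}-1]$. It is stored with doubly linked lists of the $u_i$ (in the order of $i$) and of the $v_i$ (in the order of their F-intervals), an order maintenance structure on the $u_i$, arrays of the $\alpha$-heavy nodes, and a B-tree of some of the nodes $v_i$ ordered by (character, $i$). The *three conditions* on a node $v_g$ of the B-tree are: (1) $u_{g+1}$ exists, its character is not $\$$ and differs from that of $u_g$; (2) $u_{g+1}$ has character $\$$, $u_{g+2}$ exists, and its character differs from that of $u_g$; (3) $u_g$ has character $\$$. **Operations.** Let $D$ be a DBWT of $L_S$ and $c\neq\$$ the character to be prepended to $S$; let $u_i$ be the node of $\$$ and $\mathsf{rep}$ its position. Let $\mathsf{ins}$ be $1$ plus the number of characters of $L_S$ smaller than $c$ plus the number of occurrences of $c$ in $L_S[1..\mathsf{rep}]$. The *update* replaces the repetition $\$$ by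 a repetition $c$ of length 1 (node $u_{i'}$), splits the repetition with $p_j<\mathsf{ins}<p_{j+1}$ in front of position $\mathsf{ins}$ if there is one ("the update splits a node"), and inserts a repetition $\$$ in front of position $\mathsf{ins}$ (at the end if $\mathsf{ins}$ exceeds $|L_S|$). It is applied without further changes if neither $u_{i-1}$ nor $u_{i+1}$ has character $c$. Otherwise the *modified fast update* is applied: it performs the same steps and then, with $u_{i'-1},u_{i'+1}$ the neighbours of $u_{i'}$ after them, - case A′ ($u_{i'-1}$ has character $c$, and either $u_{i'+1}$ does not, or it does and the previous update operation did not split a node): merges $u_{i'-1},u_{i'}$; - case B (only $u_{i'+1}$ has character $c$): merges $u_{i'},u_{i'+1}$; - case C′ (both have character $c$ and the previous update operation split a node): merges $u_{i'-1},u_{i'},u_{i'+1}$. The *balancing operation* repeats the following iteration until the DBWT is $\alpha$-balanced: choose any $i$ such that the $i$-th repetition or its F-interval is $\alpha$-heavy. If the $i$-th repetition is $\alpha$-heavy and $f_0<\dots<f_{t-1}$ are the starting positions of F-intervals in $[p_i,p_{i+1}-1]$, split the repetition after its first $f_{\lceil t/2\rceil}-p_i$ characters; otherwise, if $q_0<\dots<q_{t-1}$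 are the starting positions of repetitions in the F-interval, split the repetition after its first $q_{\lceil t/2\rceil}-\mathsf{LF}(p_i)$ characters. *R-comp* with parameter $\alpha\ge2$ starts with the DBWT $\$$ of $L_{T_1}$ and for $\delta=1,\dots,n-1$ applies the update or the modified fast update with $c=T[n-\delta]$ and then the balancing operation. (Before the first update operation, no update has split a node.) Let $k$ be the number of repetitions of the DBWT of $L_T$ obtained at the end and $k_{\mathsf{split}}$ the total number of iterations of the balancing operations. **Statement.** (i) *The modification preserves the guarantees of the fast update.* Let $\alpha\ge 2$, let $D$ be any $\alpha$-balanced DBWT of $L_S$, and suppose that the B-tree stored with $\mathsf{Grp}(D)$ contains only nodes that satisfy one of the three conditions. If the fast update applies to $D$ and $c$, then one of the cases A′, B, C′ holds, and, whether or not the previous update split a node: on a unit-cost word RAM (with constant-time order maintenance and constant-time replacement of a key in its place in the B-tree) the modified fast update, including the maintenance of all data structures, takes $O(\alpha)$ time with an absolute constant; its output is the LF-interval graph of a $(2\alpha+1)$-balanced DBWT of $L_{cS}$ with at most two $\alpha$-heavy repetitions and at most two $\alpha$-heavy F-intervals; and the B-tree of the output contains only nodes that satisfy one of the three conditions (and all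 of these nodes, if this was so in the input). (ii) For every $\alpha\ge2$, r-comp can be carried out to the end, and every execution ends with an $\alpha$-balanced DBWT of $L_T$ and satisfies $k\le r+k_{\mathsf{split}}$. (iii) For every $\alpha\ge16$, every execution satisfies $k_{\mathsf{split}}\le\dfrac{2r}{\lceil\alpha/2\rceil-7}$. -/

import Mathlib

namespace RComp

/-! ### Strings, BWT and LF function.  All positions and indices are 0-based. -/

/-- The alphabet is `{1, 2, 3, …}` and the special character is its smallest element. -/
def dollar : ℕ := 1

/-- The special character occurs at the end of the string and nowhere else. -/
def IsText (S : List ℕ) : Prop :=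
  ∃ s : List ℕ, S = s ++ [dollar] ∧ ∀ c ∈ s, dollar < c

/-- The suffix of `T` of length `δ`. -/
def suffix (T : List ℕ) (δ : ℕ) : List ℕ := T.drop (T.length - δ)

/-- Starting positions of the suffixes of `S` in lexicographic order of the suffixes. -/
def sa (S : List ℕ) : List ℕ :=
  (List.range S.length).mergeSort (fun i j => decide (S.drop i ≤ S.drop j))

/-- The cyclically preceding position in `S`. -/
def prevPos (S : List ℕ) (x : ℕ) : ℕ := if x = 0 then S.length - 1 else x - 1

/-- The string `L`, i.e. the BWT of `S`. -/
def bwt (S : List ℕ) : List ℕ := (sa S).map (fun x => S.getD (prevPos S x) 0)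

/-- The string `F`, i.e. the first characters of the sorted suffixes. -/
def fcol (S : List ℕ) : List ℕ := (sa S).map (fun x => S.getD x 0)

/-- The LF function: the rank of the suffix that starts one position earlier (cyclically). -/
def lf (S : List ℕ) (i : ℕ) : ℕ := (sa S).idxOf (prevPos S ((sa S).getD i 0))

/-- The number of maximal runs of equal characters of `L` (one for each starting position). -/
def numRuns (L : List ℕ) : ℕ :=
  ((List.range L.length).filter
    (fun i => decide (i = 0 ∨ L.getD (i - 1) 0 ≠ L.getD i 0))).length

/-! ### DBWTs -/

/-- A sequence of repetitions, each given as (character, length). -/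
abbrev DBWT := List (ℕ × ℕ)

/-- The string spelled by a sequence of repetitions. -/
def expand (D : DBWT) : List ℕ := D.flatMap (fun p => List.replicate p.2 p.1)

/-- `D` is a DBWT of the string `L`. -/
def IsDBWT (D : DBWT) (L : List ℕ) : Prop := (∀ p ∈ D, 0 < p.2) ∧ expand D = L

/-- Total length of a sequence of repetitions. -/
def width (D : DBWT) : ℕ := (D.map Prod.snd).sum

/-- Starting position of the `i`-th repetition; `start D D.length` is the length of the string. -/
def start (D : DBWT) (i : ℕ) : ℕ := width (D.take i)

/-- Character of the `i`-th repetition. -/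
def chr (D : DBWT) (i : ℕ) : ℕ := (D.getD i (0, 0)).1

/-- First and last position of the F-interval of the `i`-th repetition. -/
def fFirst (S : List ℕ) (D : DBWT) (i : ℕ) : ℕ := lf S (start D i)

def fLast (S : List ℕ) (D : DBWT) (i : ℕ) : ℕ := lf S (start D (i + 1) - 1)

/-- Starting positions of F-intervals covered by the `i`-th repetition, in increasing order. -/
def coveredByL (S : List ℕ) (D : DBWT) (i : ℕ) : List ℕ :=
  (List.range S.length).filter (fun x =>
    decide ((∃ j, j < D.length ∧ fFirst S D j = x) ∧ start D i ≤ x ∧ x ≤ start D (i + 1) - 1))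

/-- Starting positions of repetitions covered by the `i`-th F-interval, in increasing order. -/
def coveredByF (S : List ℕ) (D : DBWT) (i : ℕ) : List ℕ :=
  (List.range S.length).filter (fun x =>
    decide ((∃ j, j < D.length ∧ start D j = x) ∧ fFirst S D i ≤ x ∧ x ≤ fLast S D i))

/-- The `i`-th repetition is `α`-heavy. -/
def HeavyL (S : List ℕ) (D : DBWT) (α i : ℕ) : Prop := α ≤ (coveredByL S D i).length

/-- The `i`-th F-interval is `α`-heavy. -/
def HeavyF (S : List ℕ) (D : DBWT) (α i : ℕ) : Prop := α ≤ (coveredByF S D i).length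

instance (S : List ℕ) (D : DBWT) (α i : ℕ) : Decidable (HeavyL S D α i) := by
  unfold HeavyL; infer_instance

instance (S : List ℕ) (D : DBWT) (α i : ℕ) : Decidable (HeavyF S D α i) := by
  unfold HeavyF; infer_instance

/-- Indices of the `α`-heavy repetitions and of the `α`-heavy F-intervals. -/
def heavyLs (S : List ℕ) (D : DBWT) (α : ℕ) : List ℕ :=
  (List.range D.length).filter (fun i => decide (HeavyL S D α i))

def heavyFs (S : List ℕ) (D : DBWT) (α : ℕ) : List ℕ :=
  (List.range D.length).filter (fun i => decide (HeavyF S D α i))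

/-- `D` is `α`-balanced. -/
def Balanced (S : List ℕ) (D : DBWT) (α : ℕ) : Prop :=
  ∀ i < D.length, ¬ HeavyL S D α i ∧ ¬ HeavyF S D α i

/-! ### Update operations, as transformations of the DBWT

The nodes `u_0, …, u_{k-1}` (and `v_0, …, v_{k-1}`) of the LF-interval graph of `D` are the entries
of the list `D`. -/

/-- Insertion position of the special character when the first character of the new suffix
is `c`: `occ_<(L, c) + rank(L, rep, c)`, with `L` the string spelled by `D`. -/
def ins (D : DBWT) (c : ℕ) : ℕ :=
  (expand D).countP (fun x => decide (x < c)) +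
    ((expand D).take ((expand D).idxOf dollar + 1)).count c

/-- Index of the node that represents the special character. -/
def dollarIdx (D : DBWT) : ℕ := D.idxOf (dollar, 1)

/-- Split-node and insert-node steps: the special character is inserted at position `p` of the
string spelled by the list, splitting the repetition that contains `p` as an inner position,
if there is one. -/
def insertDollar : ℕ → DBWT → DBWT
  | 0, D => (dollar, 1) :: D
  | _ + 1, [] => [(dollar, 1)]
  | p + 1, (x, l) :: D =>
    if p + 1 < l then (x, p + 1) :: (dollar, 1) :: (x, l - (p + 1)) :: D
    else (x, l) :: insertDollar (p + 1 - l) D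

/-- The update splits a node in the split-node step. -/
def Splits (D : DBWT) (c : ℕ) : Prop :=
  ∃ j, j < D.length ∧ start D j < ins D c ∧ ins D c < start D (j + 1)

instance (D : DBWT) (c : ℕ) : Decidable (Splits D c) := by unfold Splits; infer_instance

/-- The nodes before and after the node that replaces the special character by `c`, after the
replace-node, split-node and insert-node steps. -/
def updateParts (D : DBWT) (c : ℕ) : DBWT × DBWT :=
  let A := D.take (dollarIdx D)
  let B := D.drop (dollarIdx D + 1)
  if ins D c ≤ width A then (insertDollar (ins D c) A, B)
  else (A, insertDollar (ins D c - width A - 1) B)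

/-- The update operation without merging. -/
def slowUpdate (D : DBWT) (c : ℕ) : DBWT :=
  (updateParts D c).1 ++ (c, 1) :: (updateParts D c).2

def lastHas (c : ℕ) (A : DBWT) : Prop := A.getLast?.map Prod.fst = some c
def headHas (c : ℕ) (B : DBWT) : Prop := B.head?.map Prod.fst = some c

instance (c : ℕ) (A : DBWT) : Decidable (lastHas c A) := by unfold lastHas; infer_instance
instance (c : ℕ) (A : DBWT) : Decidable (headHas c A) := by unfold headHas; infer_instance

/-- The fast update is applied if a neighbour of the node of the special character has a label
with the character `c`; otherwise the update without merging is applied. -/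
def FastApplies (D : DBWT) (c : ℕ) : Prop :=
  lastHas c (D.take (dollarIdx D)) ∨ headHas c (D.drop (dollarIdx D + 1))

def mergeLeft (A : DBWT) (c : ℕ) (B : DBWT) : DBWT :=
  A.dropLast ++ (c, (A.getLastD (0, 0)).2 + 1) :: B

def mergeRight (A : DBWT) (c : ℕ) (B : DBWT) : DBWT :=
  A ++ (c, 1 + (B.headD (0, 0)).2) :: B.tail

def mergeBoth (A : DBWT) (c : ℕ) (B : DBWT) : DBWT :=
  A.dropLast ++ (c, (A.getLastD (0, 0)).2 + 1 + (B.headD (0, 0)).2) :: B.tail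

/-- Cases A, B and C, evaluated at the nodes adjacent to the new node with label `(c, 1)`. -/
def CaseA (D : DBWT) (c : ℕ) : Prop :=
  lastHas c (updateParts D c).1 ∧ ¬ headHas c (updateParts D c).2

def CaseB (D : DBWT) (c : ℕ) : Prop :=
  ¬ lastHas c (updateParts D c).1 ∧ headHas c (updateParts D c).2

def CaseC (D : DBWT) (c : ℕ) : Prop :=
  lastHas c (updateParts D c).1 ∧ headHas c (updateParts D c).2

instance (D : DBWT) (c : ℕ) : Decidable (CaseA D c) := by unfold CaseA; infer_instance
instance (D : DBWT) (c : ℕ) : Decidable (CaseB D c) := by unfold CaseB; infer_instance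
instance (D : DBWT) (c : ℕ) : Decidable (CaseC D c) := by unfold CaseC; infer_instance

/-- The modified fast update operation (cases A', B and C'); `prev` tells whether the previous
update operation split a node in the split-node step.  It is undefined if no case applies. -/
def fastUpdate (D : DBWT) (c : ℕ) (prev : Bool) : Option DBWT :=
  if CaseA D c ∨ (CaseC D c ∧ prev = false) then
    some (mergeLeft (updateParts D c).1 c (updateParts D c).2)
  else if CaseB D c then
    some (mergeRight (updateParts D c).1 c (updateParts D c).2)
  else if CaseC D c ∧ prev = true then
    some (mergeBoth (updateParts D c).1 c (updateParts D c).2)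
  else none

/-! ### Balancing operation and r-comp -/

/-- The `i`-th repetition is split into two repetitions, the first one of length `ℓ`. -/
def splitNode (D : DBWT) (i ℓ : ℕ) : DBWT :=
  D.take i ++ (chr D i, ℓ) :: (chr D i, (D.getD i (0, 0)).2 - ℓ) :: D.drop (i + 1)

/-- One iteration of the balancing operation; any heavy node may be chosen. -/
inductive BalanceStep (S : List ℕ) (α : ℕ) : DBWT → DBWT → Prop
  | case1 (D : DBWT) (i : ℕ) (hi : i < D.length) (h : HeavyL S D α i) :
      BalanceStep S α D (splitNode D i
        ((coveredByL S D i).getD (((coveredByL S D i).length + 1) / 2) 0 - start D i))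
  | case2 (D : DBWT) (i : ℕ) (hi : i < D.length) (h : ¬ HeavyL S D α i) (h' : HeavyF S D α i) :
      BalanceStep S α D (splitNode D i
        ((coveredByF S D i).getD (((coveredByF S D i).length + 1) / 2) 0 - fFirst S D i))

/-- `BalanceRun S α D s D'`: the balancing operation may turn `D` into `D'` with `s` iterations. -/
inductive BalanceRun (S : List ℕ) (α : ℕ) : DBWT → ℕ → DBWT → Prop
  | done (D : DBWT) (h : Balanced S D α) : BalanceRun S α D 0 D
  | step (D D' D'' : DBWT) (s : ℕ) (h : BalanceStep S α D D') (h' : BalanceRun S α D' s D'') :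
      BalanceRun S α D (s + 1) D''

/-- `Run T α δ D b m`: r-comp on `T` with parameter `α` may reach the DBWT `D` of the suffix of
length `δ`, after `m` iterations of balancing operations altogether; `b` tells whether the last
update operation split a node in the split-node step. -/
inductive Run (T : List ℕ) (α : ℕ) : ℕ → DBWT → Bool → ℕ → Prop
  | init : Run T α 1 [(dollar, 1)] false 0
  | slow (δ : ℕ) (D : DBWT) (b : Bool) (m : ℕ) (c : ℕ) (s : ℕ) (D' : DBWT)
      (h : Run T α δ D b m) (hδ : δ < T.length) (hc : c = T.getD (T.length - δ - 1) 0)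
      (hf : ¬ FastApplies D c)
      (hb : BalanceRun (suffix T (δ + 1)) α (slowUpdate D c) s D') :
      Run T α (δ + 1) D' (decide (Splits D c)) (m + s)
  | fast (δ : ℕ) (D : DBWT) (b : Bool) (m : ℕ) (c : ℕ) (s : ℕ) (D₁ D' : DBWT)
      (h : Run T α δ D b m) (hδ : δ < T.length) (hc : c = T.getD (T.length - δ - 1) 0)
      (hf : FastApplies D c) (hu : fastUpdate D c b = some D₁)
      (hb : BalanceRun (suffix T (δ + 1)) α D₁ s D') :
      Run T α (δ + 1) D' (decide (Splits D c)) (m + s)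

/-! ### LF-interval graphs -/

/-- An LF-interval graph on nodes `u_0, …, u_{k-1}` and `v_0, …, v_{k-1}`. -/
structure LFGraph where
  k : ℕ
  /-- undirected edges `{u_i, v_j}` -/
  ELF : ℕ → ℕ → Prop
  /-- directed edges `(u_i, v_j)` -/
  EL : ℕ → ℕ → Prop
  /-- directed edges `(v_j, u_i)` -/
  EF : ℕ → ℕ → Prop
  BU : ℕ → ℕ × ℕ
  BV : ℕ → ℕ × ℕ
  /-- label of the edge `(u_i, v_j)` -/
  BL : ℕ → ℕ → ℕ
  /-- label of the edge `(v_j, u_i)` -/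
  BF : ℕ → ℕ → ℕ

/-- The LF-interval graph of the DBWT `D` of the BWT of `S`. -/
def grp (S : List ℕ) (D : DBWT) : LFGraph where
  k := D.length
  ELF i j := i < D.length ∧ i = j
  EL i j := i < D.length ∧ j < D.length ∧ fFirst S D j ≤ start D i ∧ start D i ≤ fLast S D j
  EF j i := i < D.length ∧ j < D.length ∧
    start D i ≤ fFirst S D j ∧ fFirst S D j ≤ start D (i + 1) - 1
  BU i := ((bwt S).getD (start D i) 0, start D (i + 1) - start D i)
  BV i := ((fcol S).getD (fFirst S D i) 0, fLast S D i - fFirst S D i + 1)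
  BL i j := start D i - fFirst S D j
  BF j i := fFirst S D j - start D i

/-- The nodes of `V` in the order of their F-intervals. -/
def vOrder (S : List ℕ) (D : DBWT) : List ℕ :=
  (List.range D.length).mergeSort (fun i j => decide (fFirst S D i ≤ fFirst S D j))

/-- The order of the keys `(u_i, character)` in the B-tree of `V`. -/
def keyLt (D : DBWT) (i j : ℕ) : Prop := chr D i < chr D j ∨ (chr D i = chr D j ∧ i < j)

/-- The three conditions on a node `v_g` that is stored in the B-tree of `V`. -/
def BTreeCond (D : DBWT) (g : ℕ) : Prop :=
  (g + 1 < D.length ∧ chr D g ≠ chr D (g + 1) ∧ chr D (g + 1) ≠ dollar) ∨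
  (g + 2 < D.length ∧ chr D g ≠ chr D (g + 2) ∧ chr D (g + 1) = dollar) ∨
  chr D g = dollar

/-! ### The machine model

A unit-cost word RAM: registers, a memory of records with constantly many fields, `W` word values,
addition modulo `W`, truncated subtraction.  The order maintenance structure and the B-tree are
components of the machine state.  The operations of the former take unit time.  The only
unit-time operations on the latter are the membership test and the replacement of one stored key
by another one in the same place of the tree; no other operations on the tree are available. -/

/-- B-trees (of order 3). -/
inductive BTree
  | nil : BTree
  | two : BTree → ℕ → BTree → BTree
  | three : BTree → ℕ → BTree → ℕ → BTree → BTree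

/-- The stored elements from left to right. -/
def BTree.inorder : BTree → List ℕ
  | .nil => []
  | .two l x r => l.inorder ++ x :: r.inorder
  | .three l x m y r => l.inorder ++ x :: (m.inorder ++ y :: r.inorder)

/-- All leaves have depth `h`. -/
def BTree.HasHeight : BTree → ℕ → Prop
  | .nil, h => h = 0
  | .two l _ r, h => ∃ h', h = h' + 1 ∧ l.HasHeight h' ∧ r.HasHeight h'
  | .three l _ m _ r, h => ∃ h', h = h' + 1 ∧ l.HasHeight h' ∧ m.HasHeight h' ∧ r.HasHeight h'

/-- Replaces the element `a` by `b`, without changing the shape of the tree. -/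
def BTree.replace (a b : ℕ) : BTree → BTree
  | .nil => .nil
  | .two l x r => .two (l.replace a b) (if x = a then b else x) (r.replace a b)
  | .three l x m y r =>
    .three (l.replace a b) (if x = a then b else x) (m.replace a b) (if y = a then b else y)
      (r.replace a b)

structure State where
  reg : ℕ → ℕ
  /-- `heap a f` is the field `f` of the record with address `a` -/
  heap : ℕ → ℕ → ℕ
  /-- the list stored in the order maintenance structure -/
  order : List ℕ
  btree : BTree

def State.setReg (σ : State) (d v : ℕ) : State := { σ with reg := Function.update σ.reg d v }

/-- Inserts `y` right after `x`. -/
def insertAfter (x y : ℕ) : List ℕ → List ℕ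
  | [] => []
  | z :: l => if z = x then z :: y :: l else z :: insertAfter x y l

/-- Elementary instructions; `d`, `x`, `y` are numbers of registers, `f` is a field. -/
inductive Instr
  | const (d n : ℕ)
  | copy (d x : ℕ)
  | add (d x y : ℕ)
  | sub (d x y : ℕ)
  | load (d x f : ℕ)
  | store (x f y : ℕ)
  | omFirst (y : ℕ)
  | omAfter (x y : ℕ)
  | omDelete (x : ℕ)
  | omLess (d x y : ℕ)
  | btMem (d x : ℕ)
  | btReplace (x y : ℕ)

def Instr.run (W : ℕ) : Instr → State → State
  | .const d n, σ => σ.setReg d (n % W)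
  | .copy d x, σ => σ.setReg d (σ.reg x)
  | .add d x y, σ => σ.setReg d ((σ.reg x + σ.reg y) % W)
  | .sub d x y, σ => σ.setReg d (σ.reg x - σ.reg y)
  | .load d x f, σ => σ.setReg d (σ.heap (σ.reg x) f)
  | .store x f y, σ =>
    { σ with
      heap := fun p q => if p = σ.reg x ∧ q = f then σ.reg y else σ.heap p q }
  | .omFirst y, σ => { σ with order := σ.reg y :: σ.order }
  | .omAfter x y, σ => { σ with order := insertAfter (σ.reg x) (σ.reg y) σ.order }
  | .omDelete x, σ => { σ with order := σ.order.erase (σ.reg x) }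
  | .omLess d x y, σ =>
    σ.setReg d (if σ.order.idxOf (σ.reg x) < σ.order.idxOf (σ.reg y) then 1 else 0)
  | .btMem d x, σ => σ.setReg d (if σ.reg x ∈ σ.btree.inorder then 1 else 0)
  | .btReplace x y, σ => { σ with btree := σ.btree.replace (σ.reg x) (σ.reg y) }

/-- Tests on the contents of two registers. -/
inductive Test
  | eq (x y : ℕ)
  | lt (x y : ℕ)

def Test.Holds : Test → State → Prop
  | .eq x y, σ => σ.reg x = σ.reg y
  | .lt x y, σ => σ.reg x < σ.reg y

inductive Program
  | skip : Program
  | instr : Instr → Program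
  | seq : Program → Program → Program
  | ite : Test → Program → Program → Program
  | loop : Test → Program → Program

/-- `Exec W P σ t σ'`: the program `P`, started in `σ`, halts in `σ'` after `t` steps. -/
inductive Exec (W : ℕ) : Program → State → ℕ → State → Prop
  | skip (σ : State) : Exec W .skip σ 0 σ
  | instr (i : Instr) (σ : State) : Exec W (.instr i) σ 1 (i.run W σ)
  | seq (P Q : Program) (σ σ' σ'' : State) (t t' : ℕ) (h : Exec W P σ t σ')
      (h' : Exec W Q σ' t' σ'') : Exec W (.seq P Q) σ (t + t') σ''
  | iteTrue (b : Test) (P Q : Program) (σ σ' : State) (t : ℕ) (hb : b.Holds σ)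
      (h : Exec W P σ t σ') : Exec W (.ite b P Q) σ (t + 1) σ'
  | iteFalse (b : Test) (P Q : Program) (σ σ' : State) (t : ℕ) (hb : ¬ b.Holds σ)
      (h : Exec W Q σ t σ') : Exec W (.ite b P Q) σ (t + 1) σ'
  | loopDone (b : Test) (P : Program) (σ : State) (hb : ¬ b.Holds σ) :
      Exec W (.loop b P) σ 1 σ
  | loopStep (b : Test) (P : Program) (σ σ' σ'' : State) (t t' : ℕ) (hb : b.Holds σ)
      (h : Exec W P σ t σ') (h' : Exec W (.loop b P) σ' t' σ'') :
      Exec W (.loop b P) σ (t + t' + 1) σ''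

/-! ### The LF-interval graph in memory

The nodes `u_i` and `v_i`, which are joined by an edge of `E_LF` and carry the same label, share
the record with address `a i`.  The address `0` is the null pointer. -/

/-- Fields of a record: label, links of the lists of `U` and `V`, the edge of `E_L` that starts at
`u_i` and its label, the edge of `E_F` that starts at `v_i` and its label. -/
def fChar : ℕ := 0
def fLen : ℕ := 1
def fPrevU : ℕ := 2
def fNextU : ℕ := 3
def fPrevV : ℕ := 4
def fNextV : ℕ := 5
def fEL : ℕ := 6
def fBL : ℕ := 7
def fEF : ℕ := 8
def fBF : ℕ := 9
/-- The arrays of heavy nodes: the `q`-th entry is this field of the record with address `q`. -/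
def fArrU : ℕ := 10
def fArrV : ℕ := 11

/-- Registers: input character, parameter `α`, split flag, node of the special character, ends of
the two lists, sizes of the two arrays, first address that is not in use. -/
def rChar : ℕ := 0
def rAlpha : ℕ := 1
def rSplit : ℕ := 2
def rDollar : ℕ := 3
def rHeadU : ℕ := 4
def rTailU : ℕ := 5
def rHeadV : ℕ := 6
def rTailV : ℕ := 7
def rNumU : ℕ := 8
def rNumV : ℕ := 9
def rFresh : ℕ := 10

/-- The records of `l` form a doubly linked list with link fields `fp` and `fn`. -/
def IsLinkedList (heap : ℕ → ℕ → ℕ) (fp fn : ℕ) (l : List ℕ) (hd tl : ℕ) : Prop :=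
  hd = l.headD 0 ∧ tl = l.getLastD 0 ∧
  ∀ t < l.length, heap (l.getD t 0) fn = l.getD (t + 1) 0 ∧
    heap (l.getD t 0) fp = if t = 0 then 0 else l.getD (t - 1) 0

/-- The state `σ` stores the LF-interval graph of `D` with its data structures, where `a i` is the
address of the record of `u_i` and `v_i`. -/
structure Stores (S : List ℕ) (D : DBWT) (α : ℕ) (σ : State) (a : ℕ → ℕ) : Prop where
  alpha : σ.reg rAlpha = α
  addr_pos : ∀ i < D.length, 0 < a i
  addr_lt : ∀ i < D.length, a i < σ.reg rFresh
  addr_inj : ∀ i < D.length, ∀ j < D.length, a i = a j → i = j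
  labelU : ∀ i < D.length, (grp S D).BU i = (σ.heap (a i) fChar, σ.heap (a i) fLen)
  labelV : ∀ i < D.length, (grp S D).BV i = (σ.heap (a i) fChar, σ.heap (a i) fLen)
  listU : IsLinkedList σ.heap fPrevU fNextU ((List.range D.length).map a)
    (σ.reg rHeadU) (σ.reg rTailU)
  listV : IsLinkedList σ.heap fPrevV fNextV ((vOrder S D).map a) (σ.reg rHeadV) (σ.reg rTailV)
  edgeL : ∀ i j, (grp S D).EL i j →
    σ.heap (a i) fEL = a j ∧ σ.heap (a i) fBL = (grp S D).BL i j
  edgeF : ∀ j i, (grp S D).EF j i →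
    σ.heap (a j) fEF = a i ∧ σ.heap (a j) fBF = (grp S D).BF j i
  dollarNode : σ.reg rDollar = a (dollarIdx D)
  order : σ.order = (List.range D.length).map a
  arrU : ((List.range (σ.reg rNumU)).map (fun q => σ.heap q fArrU)).Perm ((heavyLs S D α).map a)
  arrV : ((List.range (σ.reg rNumV)).map (fun q => σ.heap q fArrV)).Perm ((heavyFs S D α).map a)
  btreeShape : ∃ h, σ.btree.HasHeight h
  btreeSorted : ∃ js : List ℕ, σ.btree.inorder = js.map a ∧ (∀ j ∈ js, j < D.length) ∧
    js.Pairwise (keyLt D)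

/-- The B-tree of `V` contains only nodes that satisfy one of the three conditions. -/
def BTreeOnly (D : DBWT) (σ : State) (a : ℕ → ℕ) : Prop :=
  ∀ g < D.length, a g ∈ σ.btree.inorder → BTreeCond D g

/-- The B-tree of `V` contains all nodes that satisfy one of the three conditions. -/
def BTreeAll (D : DBWT) (σ : State) (a : ℕ → ℕ) : Prop :=
  ∀ g < D.length, BTreeCond D g → a g ∈ σ.btree.inorder

end RComp

namespace RComp

/-! ### Sorted suffixes -/

lemma sa_perm (S : List ℕ) : (sa S).Perm (List.range S.length) := List.mergeSort_perm _ _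

lemma sa_length (S : List ℕ) : (sa S).length = S.length := by
  simpa using (sa_perm S).length_eq

lemma sa_nodup (S : List ℕ) : (sa S).Nodup := (sa_perm S).nodup_iff.2 List.nodup_range

lemma mem_sa {S : List ℕ} {x : ℕ} : x ∈ sa S ↔ x < S.length := by grind [sa_perm]

lemma drop_inj {S : List ℕ} {x y : ℕ} (hx : x < S.length) (hy : y < S.length)
    (h : S.drop x = S.drop y) : x = y := by grind [List.length_drop]

lemma sa_sorted (S : List ℕ) :
    (sa S).Pairwise (fun i j => S.drop i < S.drop j) := by
  have h1 : (sa S).Pairwise (fun i j => S.drop i ≤ S.drop j) := by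
    grind [List.pairwise_mergeSort, le_trans, le_total, sa]
  have h2 := (sa_nodup S)
  rw [List.Nodup] at h2
  refine (h1.and h2).imp_of_mem ?_
  grind [lt_of_le_of_ne, drop_inj, mem_sa]

/-- The rank of a suffix. -/
def rk (S : List ℕ) (x : ℕ) : ℕ := (sa S).idxOf x

lemma rk_lt {S : List ℕ} {x : ℕ} (hx : x < S.length) : rk S x < S.length := by
  rw [← sa_length S]; exact List.idxOf_lt_length_iff.2 (mem_sa.2 hx)

lemma sa_rk {S : List ℕ} {x : ℕ} (hx : x < S.length) : (sa S).getD (rk S x) 0 = x := by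
  grind [rk, sa, sa_length, rk_lt, List.getD_eq_getElem]

lemma sa_lt {S : List ℕ} {q : ℕ} (hq : q < S.length) : (sa S).getD q 0 < S.length := by
  grind [sa_length, List.getD_eq_getElem, mem_sa, List.getElem_mem]

lemma rk_sa {S : List ℕ} {q : ℕ} (hq : q < S.length) : rk S ((sa S).getD q 0) = q := by
  rw [← sa_length S] at hq
  rw [List.getD_eq_getElem _ _ hq]
  exact (sa_nodup S).idxOf_getElem q hq

lemma rk_inj {S : List ℕ} {x y : ℕ} (hx : x < S.length) (hy : y < S.length)
    (h : rk S x = rk S y) : x = y := by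
  rw [← sa_rk hx, h, sa_rk hy]

lemma lf_eq_rk (S : List ℕ) (p : ℕ) : lf S p = rk S (prevPos S ((sa S).getD p 0)) := rfl

/-- In a list on which `p` is downward closed, `p` holds exactly on a prefix. -/
lemma lt_countP_iff {β : Type*} (p : β → Bool) :
    ∀ (l : List β) (_ : l.Pairwise (fun a b => p b = true → p a = true)) (q : ℕ)
      (h : q < l.length), q < l.countP p ↔ p l[q] = true
  | [], _, q, h => by simp at h
  | a :: l, hl, q, h => by
    rw [List.pairwise_cons] at hl
    by_cases ha : p a = true
    · rw [List.countP_cons_of_pos ha]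
      cases q with
      | zero => simp [ha]
      | succ q =>
        have := lt_countP_iff p l hl.2 q (by simpa using h)
        simpa using this
    · have h0 : l.countP p = 0 := by
        rw [List.countP_eq_zero]
        intro b hb hpb
        exact ha (hl.1 b hb hpb)
      rw [List.countP_cons_of_neg ha, h0]
      cases q with
      | zero => simp [ha]
      | succ q =>
        simp only [not_lt_zero, List.getElem_cons_succ, false_iff]
        intro h'
        exact ha (hl.1 _ (List.getElem_mem _) h')

/-- The number of suffixes of `S` that are smaller than `w`. -/
def below (S w : List ℕ) : ℕ := (sa S).countP (fun y => decide (S.drop y < w))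

lemma lt_below_iff {S w : List ℕ} {q : ℕ} (hq : q < S.length) :
    q < below S w ↔ S.drop ((sa S).getD q 0) < w := by
  have hq' : q < (sa S).length := by rwa [sa_length]
  rw [below, lt_countP_iff _ _ ?_ q hq', List.getD_eq_getElem _ _ hq']
  · simp
  · refine (sa_sorted S).imp ?_
    grind

lemma below_le (S w : List ℕ) : below S w ≤ S.length := by
  rw [← sa_length S]; exact List.countP_le_length

lemma sa_drop_lt {S : List ℕ} {p q : ℕ} (hp : p < S.length) (hq : q < S.length) :
    S.drop ((sa S).getD p 0) < S.drop ((sa S).getD q 0) ↔ p < q := by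
  grind [sa, sa_length, List.getD_eq_getElem, List.pairwise_iff_getElem, sa_sorted,
    lt_trichotomy, lt_irrefl, not_lt]

lemma rk_eq_below {S : List ℕ} {x : ℕ} (hx : x < S.length) : rk S x = below S (S.drop x) := by
  have h1 := rk_lt hx
  apply le_antisymm
  · by_contra! h
    have h2 : below S (S.drop x) < S.length := h.trans h1
    have := (lt_below_iff h2 (w := S.drop x)).2 (by grind [sa_rk, sa_drop_lt])
    exact lt_irrefl _ this
  grind [lt_below_iff, sa_rk, lt_irrefl]

/-! ### Texts -/

lemma IsText.length_pos {S : List ℕ} (h : IsText S) : 0 < S.length := by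
  obtain ⟨s, rfl, -⟩ := h; simp

lemma IsText.getD_eq_dollar {S : List ℕ} (h : IsText S) {y : ℕ} (hy : y < S.length) :
    S.getD y 0 = dollar ↔ y = S.length - 1 := by
  obtain ⟨s, rfl, hs⟩ := h
  grind [List.length_append, List.length_singleton, Nat.lt_or_ge, dollar, List.getD_eq_getElem,
    List.getElem_append_left, List.getElem_mem]

lemma IsText.cons {S : List ℕ} (h : IsText S) {c : ℕ} (hc : dollar < c) : IsText (c :: S) := by
  obtain ⟨s, rfl, hs⟩ := h
  exact ⟨c :: s, by simp, by simpa using ⟨hc, hs⟩⟩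

lemma IsText.one_le {S : List ℕ} (h : IsText S) {x : ℕ} (hx : x ∈ S) : dollar ≤ x := by
  obtain ⟨s, rfl, hs⟩ := h
  grind

lemma drop_eq_getD_cons {S : List ℕ} {y : ℕ} (hy : y < S.length) :
    S.drop y = S.getD y 0 :: S.drop (y + 1) := by simp_all

/-! ### The BWT -/

lemma prevPos_lt {S : List ℕ} {x : ℕ} (hx : x < S.length) : prevPos S x < S.length := by
  grind [prevPos]

lemma prevPos_inj {S : List ℕ} {x y : ℕ} (hx : x < S.length) (hy : y < S.length)
    (h : prevPos S x = prevPos S y) : x = y := by grind [prevPos]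

lemma bwt_length (S : List ℕ) : (bwt S).length = S.length := by simp [bwt, sa_length]

lemma bwt_getD {S : List ℕ} {p : ℕ} (hp : p < S.length) :
    (bwt S).getD p 0 = S.getD (prevPos S ((sa S).getD p 0)) 0 := by
  grind [sa, sa_length, List.getD_eq_getElem, bwt_length, bwt]

lemma fcol_getD {S : List ℕ} {p : ℕ} (hp : p < S.length) :
    (fcol S).getD p 0 = S.getD ((sa S).getD p 0) 0 := by
  grind [sa, sa_length, List.getD_eq_getElem, fcol]

lemma map_prevPos_perm (S : List ℕ) :
    ((sa S).map (prevPos S)).Perm (List.range S.length) := by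
  have hnd : ((sa S).map (prevPos S)).Nodup := by
    grind [List.Nodup.map_on, sa_nodup, prevPos_inj, mem_sa]
  refine (List.subperm_of_subset hnd ?_).perm_of_length_le (by simp [sa_length])
  grind [prevPos_lt, mem_sa]

lemma map_getD_range (S : List ℕ) : (List.range S.length).map (fun y => S.getD y 0) = S := by
  apply List.ext_getElem (by simp)
  intro i h1 h2
  simp [h2]

lemma bwt_perm (S : List ℕ) : (bwt S).Perm S := by
  have h := (map_prevPos_perm S).map (fun y => S.getD y 0)
  grind [map_getD_range, bwt, Function.comp_def]

/-- The rank of a string `c :: S.drop x` in terms of the BWT. -/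
lemma below_cons {S : List ℕ} (hS : IsText S) {p c : ℕ} (hp : p < S.length) (hc : c ≠ dollar) :
    below S (c :: S.drop ((sa S).getD p 0)) =
      (bwt S).countP (fun x => decide (x < c)) + ((bwt S).take p).count c := by
  set x := (sa S).getD p 0 with hx
  have h1 : below S (c :: S.drop x) = (List.range S.length).countP
      (fun y => decide (S.getD y 0 < c)) + (List.range S.length).countP
      (fun y => decide (S.getD y 0 = c ∧ S.drop (y + 1) < S.drop x)) := by
    rw [below, (sa_perm S).countP_eq]
    have : ∀ l : List ℕ, (∀ y ∈ l, y < S.length) →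
        l.countP (fun y => decide (S.drop y < c :: S.drop x)) =
        l.countP (fun y => decide (S.getD y 0 < c)) +
        l.countP (fun y => decide (S.getD y 0 = c ∧ S.drop (y + 1) < S.drop x)) := by
      intro l
      induction l with
      | nil => simp
      | cons y l ih => grind [drop_eq_getD_cons, List.cons_lt_cons_iff, lt_trichotomy, lt_irrefl]
    grind
  have h2 : (List.range S.length).countP (fun y => decide (S.getD y 0 < c)) =
      (bwt S).countP (fun x => decide (x < c)) := by
    rw [(bwt_perm S).countP_eq]
    conv_rhs => rw [← map_getD_range S, List.countP_map]
    rfl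
  rw [h1, h2]
  congr 1
  rw [← (map_prevPos_perm S).countP_eq, List.countP_map]
  have h3 : (sa S).countP ((fun y => decide (S.getD y 0 = c ∧ S.drop (y + 1) < S.drop x)) ∘
      prevPos S) = (sa S).countP
        (fun y => decide (S.getD (prevPos S y) 0 = c ∧ S.drop y < S.drop x)) := by
    apply List.countP_congr
    intro y hy
    simp only [Function.comp_apply, decide_eq_true_eq]
    have hy := mem_sa.1 hy
    by_cases h0 : y = 0
    · have : S.getD (prevPos S y) 0 = dollar :=
        (hS.getD_eq_dollar (prevPos_lt hy)).2 (by simp [prevPos, h0])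
      grind
    grind [prevPos]
  rw [h3]
  have h4 : (bwt S).take p = ((sa S).take p).map (fun y => S.getD (prevPos S y) 0) := by
    rw [bwt, List.map_take]
  rw [h4, List.count, List.countP_map]
  conv_lhs => rw [← List.take_append_drop p (sa S), List.countP_append]
  have h5 : ((sa S).drop p).countP
      (fun y => decide (S.getD (prevPos S y) 0 = c ∧ S.drop y < S.drop x)) = 0 := by
    rw [List.countP_eq_zero]
    intro y hy
    obtain ⟨i, hi, rfl⟩ := List.getElem_of_mem hy
    simp only [List.length_drop, sa_length] at hi
    simp only [List.getElem_drop, decide_eq_true_eq, not_and]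
    intro _ h
    have hpi : p + i < (sa S).length := by rw [sa_length]; omega
    rw [← List.getD_eq_getElem _ 0 hpi, hx, sa_drop_lt (by omega) hp] at h
    omega
  rw [h5, add_zero]
  apply List.countP_congr
  intro y hy
  obtain ⟨i, hi, rfl⟩ := List.getElem_of_mem hy
  simp only [List.length_take, sa_length, lt_min_iff] at hi
  have hi' : i < (sa S).length := by rw [sa_length]; omega
  have : S.drop ((sa S)[i]) < S.drop x := by
    rw [← List.getD_eq_getElem _ 0 hi', hx, sa_drop_lt hi.2 hp]
    exact hi.1
  simp [this]

/-- The insertion position of the special character, as a function of the BWT. -/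
def insPos (L : List ℕ) (c : ℕ) : ℕ :=
  L.countP (fun x => decide (x < c)) + (L.take (L.idxOf dollar + 1)).count c

lemma ins_eq (D : DBWT) (c : ℕ) : ins D c = insPos (expand D) c := rfl

/-- The position of the special character in the BWT. -/
def rep (S : List ℕ) : ℕ := (bwt S).idxOf dollar

lemma dollar_mem_bwt {S : List ℕ} (hS : IsText S) : dollar ∈ bwt S := by
  rw [(bwt_perm S).mem_iff]
  obtain ⟨s, rfl, -⟩ := hS; simp

lemma rep_lt {S : List ℕ} (hS : IsText S) : rep S < S.length := by
  rw [← bwt_length S]; exact List.idxOf_lt_length_iff.2 (dollar_mem_bwt hS)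

lemma bwt_eq_dollar {S : List ℕ} (hS : IsText S) {p : ℕ} (hp : p < S.length) :
    (bwt S).getD p 0 = dollar ↔ (sa S).getD p 0 = 0 := by
  rw [bwt_getD hp, hS.getD_eq_dollar (prevPos_lt (sa_lt hp))]
  have := sa_lt hp
  grind [prevPos]

lemma bwt_rep {S : List ℕ} (hS : IsText S) : (bwt S).getD (rep S) 0 = dollar := by
  grind [rep, bwt, bwt_length, rep_lt, List.getD_eq_getElem]

lemma sa_rep {S : List ℕ} (hS : IsText S) : (sa S).getD (rep S) 0 = 0 :=
  (bwt_eq_dollar hS (rep_lt hS)).1 (bwt_rep hS)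

lemma rep_eq_rk {S : List ℕ} (hS : IsText S) : rep S = rk S 0 := by
  rw [← rk_sa (rep_lt hS), sa_rep hS]

lemma bwt_eq_dollar_iff {S : List ℕ} (hS : IsText S) {p : ℕ} (hp : p < S.length) :
    (bwt S).getD p 0 = dollar ↔ p = rep S := by grind [bwt_eq_dollar, rep_eq_rk, rk_sa, sa_rep]

lemma bwt_one_le {S : List ℕ} (hS : IsText S) {x : ℕ} (hx : x ∈ bwt S) : dollar ≤ x :=
  hS.one_le ((bwt_perm S).mem_iff.1 hx)

lemma sa_pos {S : List ℕ} (hS : IsText S) {p : ℕ} (hp : p < S.length) (h : p ≠ rep S) :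
    0 < (sa S).getD p 0 := by
  have := (bwt_eq_dollar_iff hS hp).not.2 h
  grind [bwt_eq_dollar]

/-- The LF mapping is given by counting characters. -/
lemma lf_eq_count {S : List ℕ} (hS : IsText S) {p : ℕ} (hp : p < S.length) :
    lf S p = (bwt S).countP (fun x => decide (x < (bwt S).getD p 0)) +
      ((bwt S).take p).count ((bwt S).getD p 0) := by
  by_cases h : p = rep S
  · subst h
    rw [bwt_rep hS, lf_eq_rk, sa_rep hS]
    have hn := hS.length_pos
    have h1 : prevPos S 0 = S.length - 1 := by simp [prevPos]
    have h2 : (bwt S).countP (fun x => decide (x < dollar)) = 0 := by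
      rw [List.countP_eq_zero]
      intro x hx
      have := bwt_one_le hS hx
      simp; omega
    have h3 : ((bwt S).take (rep S)).count dollar = 0 := by
      rw [List.count_eq_zero]
      intro hm
      obtain ⟨i, hi, h⟩ := List.getElem_of_mem hm
      simp only [List.length_take, lt_min_iff] at hi
      rw [List.getElem_take, ← List.getD_eq_getElem _ 0,
        bwt_eq_dollar_iff hS (by grind)] at h
      omega
    rw [h2, h3, h1, rk_eq_below (by omega)]
    by_contra h4
    have h5 : 0 < below S (S.drop (S.length - 1)) := by omega
    rw [lt_below_iff hn, drop_eq_getD_cons (y := S.length - 1) (by omega),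
      (hS.getD_eq_dollar (by omega)).2 rfl, List.drop_of_length_le (i := S.length - 1 + 1)
      (by omega),
      drop_eq_getD_cons (sa_lt hn), List.cons_lt_cons_iff] at h5
    have h6 : dollar ≤ S.getD ((sa S).getD 0 0) 0 := by
      apply hS.one_le
      grind [List.getD_eq_getElem, sa_lt, List.getElem_mem]
    grind [List.not_lt_nil]
  grind [sa_pos, sa_lt, below_cons, bwt_eq_dollar_iff, lf_eq_rk, prevPos, sa, bwt_getD,
    rk_eq_below, drop_eq_getD_cons]

lemma lf_lt {S : List ℕ} {p : ℕ} (hp : p < S.length) : lf S p < S.length :=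
  rk_lt (prevPos_lt (sa_lt hp))

lemma lf_inj {S : List ℕ} {p q : ℕ} (hp : p < S.length) (hq : q < S.length)
    (h : lf S p = lf S q) : p = q := by
  have h1 := rk_inj (prevPos_lt (sa_lt hp)) (prevPos_lt (sa_lt hq)) h
  have h2 := prevPos_inj (sa_lt hp) (sa_lt hq) h1
  grind [rk_sa]

lemma count_take_succ (L : List ℕ) (c p : ℕ) (hp : p < L.length) :
    (L.take (p + 1)).count c = (L.take p).count c + if L.getD p 0 = c then 1 else 0 := by
  grind [List.take_succ_eq_append_getElem, List.getD_eq_getElem, List.count_singleton]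

lemma lf_succ {S : List ℕ} (hS : IsText S) {p : ℕ} (hp : p + 1 < S.length)
    (h : (bwt S).getD p 0 = (bwt S).getD (p + 1) 0) : lf S (p + 1) = lf S p + 1 := by
  grind [lf_eq_count, count_take_succ, bwt_length, add_assoc]

lemma lf_rep {S : List ℕ} (hS : IsText S) : lf S (rep S) = 0 := by
  rw [lf_eq_count hS (rep_lt hS), bwt_rep hS]
  have h2 : (bwt S).countP (fun x => decide (x < dollar)) = 0 := by
    rw [List.countP_eq_zero]
    intro x hx
    have := bwt_one_le hS hx
    simp; omega
  have h3 : ((bwt S).take (rep S)).count dollar = 0 := by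
    rw [List.count_eq_zero]
    intro hm
    obtain ⟨i, hi, h⟩ := List.getElem_of_mem hm
    simp only [List.length_take, lt_min_iff] at hi
    rw [List.getElem_take, ← List.getD_eq_getElem _ 0,
      bwt_eq_dollar_iff hS (by grind [bwt_length])] at h
    omega
  rw [h2, h3]

lemma lf_ne_self {S : List ℕ} {p : ℕ} (hp : p < S.length) (hn : 2 ≤ S.length) :
    lf S p ≠ p := by
  intro h
  have h1 : rk S (prevPos S ((sa S).getD p 0)) = rk S ((sa S).getD p 0) := by
    rw [rk_sa hp]; exact h
  have h2 := rk_inj (prevPos_lt (sa_lt hp)) (sa_lt hp) h1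
  grind [prevPos]

lemma fcol_lf {S : List ℕ} {p : ℕ} (hp : p < S.length) :
    (fcol S).getD (lf S p) 0 = (bwt S).getD p 0 := by
  rw [fcol_getD (lf_lt hp), bwt_getD hp, lf_eq_rk, sa_rk (prevPos_lt (sa_lt hp))]

/-! ### Prepending a character -/

lemma insPos_eq_below {S : List ℕ} (hS : IsText S) {c : ℕ} (hc : dollar < c) :
    insPos (bwt S) c = below S (c :: S) := by
  have h := below_cons hS (rep_lt hS) hc.ne'
  grind [sa_rep, insPos, rep, count_take_succ, bwt_length, rep_lt, bwt_rep, add_zero]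

lemma insPos_le {S : List ℕ} (hS : IsText S) {c : ℕ} (hc : dollar < c) :
    insPos (bwt S) c ≤ S.length := by grind [insPos_eq_below, below_le]

lemma insPos_pos {S : List ℕ} (hS : IsText S) {c : ℕ} (hc : dollar < c) :
    0 < insPos (bwt S) c := by grind [bwt, List.countP_pos_iff, dollar, dollar_mem_bwt, insPos]

/-- The position of an old suffix after an insertion at position `i`. -/
def shift (i p : ℕ) : ℕ := if p < i then p else p + 1

lemma shift_inj {i p q : ℕ} (h : shift i p = shift i q) : p = q := by grind [shift]

lemma shift_ne (i p : ℕ) : shift i p ≠ i := by unfold shift; split <;> omega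

lemma sa_cons_length (c : ℕ) (S : List ℕ) : (c :: S).length = S.length + 1 := rfl

lemma below_cons_left {S w : List ℕ} {c : ℕ} :
    below (c :: S) w = below S w + if c :: S < w then 1 else 0 := by
  rw [below, below, (sa_perm _).countP_eq, (sa_perm _).countP_eq, sa_cons_length,
    List.range_succ_eq_map, List.countP_cons, List.countP_map]
  simp only [Function.comp_def, Nat.succ_eq_add_one, List.drop_succ_cons, List.drop_zero,
    decide_eq_true_eq]

lemma rk_cons_zero {S : List ℕ} (hS : IsText S) {c : ℕ} (hc : dollar < c) :
    rk (c :: S) 0 = insPos (bwt S) c := by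
  grind [rk_eq_below, below_cons_left, lt_irrefl, add_zero, insPos_eq_below]

lemma rk_cons_succ {S : List ℕ} (hS : IsText S) {c : ℕ} (hc : dollar < c) {x : ℕ}
    (hx : x < S.length) : rk (c :: S) (x + 1) = shift (insPos (bwt S) c) (rk S x) := by
  rw [rk_eq_below (by simpa using hx), List.drop_succ_cons, below_cons_left,
    ← rk_eq_below hx, insPos_eq_below hS hc, shift]
  grind [lt_below_iff, rk_lt, sa_rk, not_lt, add_zero, lt_of_le_of_ne, List.length_cons,
    List.length_drop]

lemma sa_cons_shift {S : List ℕ} (hS : IsText S) {c : ℕ} (hc : dollar < c) {p : ℕ}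
    (hp : p < S.length) :
    (sa (c :: S)).getD (shift (insPos (bwt S) c) p) 0 = (sa S).getD p 0 + 1 := by
  have := sa_lt hp
  rw [← sa_rk (S := c :: S) (x := (sa S).getD p 0 + 1) (by simpa using this),
    rk_cons_succ hS hc this, rk_sa hp]

lemma rep_cons {S : List ℕ} (hS : IsText S) {c : ℕ} (hc : dollar < c) :
    rep (c :: S) = insPos (bwt S) c := by
  rw [rep_eq_rk (hS.cons hc), rk_cons_zero hS hc]

lemma lf_cons_ins {S : List ℕ} (hS : IsText S) {c : ℕ} (hc : dollar < c) :
    lf (c :: S) (insPos (bwt S) c) = 0 := by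
  rw [← rep_cons hS hc, lf_rep (hS.cons hc)]

lemma lf_cons_rep {S : List ℕ} (hS : IsText S) {c : ℕ} (hc : dollar < c) :
    lf (c :: S) (shift (insPos (bwt S) c) (rep S)) = insPos (bwt S) c := by
  grind [lf_eq_rk, sa_cons_shift, rep_lt, sa_rep, rk_cons_zero, prevPos]

lemma lf_cons_shift {S : List ℕ} (hS : IsText S) {c : ℕ} (hc : dollar < c) {p : ℕ}
    (hp : p < S.length) (h : p ≠ rep S) :
    lf (c :: S) (shift (insPos (bwt S) c) p) = shift (insPos (bwt S) c) (lf S p) := by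
  have h1 := sa_pos hS hp h
  have h2 := sa_lt hp
  rw [lf_eq_rk, sa_cons_shift hS hc hp, lf_eq_rk, ← rk_cons_succ hS hc (prevPos_lt h2)]
  grind [prevPos]

lemma bwt_cons_ins {S : List ℕ} (hS : IsText S) {c : ℕ} (hc : dollar < c) :
    (bwt (c :: S)).getD (insPos (bwt S) c) 0 = dollar := by
  rw [← rep_cons hS hc, bwt_rep (hS.cons hc)]

lemma bwt_cons_shift {S : List ℕ} (hS : IsText S) {c : ℕ} (hc : dollar < c) {p : ℕ}
    (hp : p < S.length) :
    (bwt (c :: S)).getD (shift (insPos (bwt S) c) p) 0 =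
      if p = rep S then c else (bwt S).getD p 0 := by
      grind [insPos_le, bwt_getD, shift, List.length_cons, sa_cons_shift, sa_rep, prevPos, sa_pos,
        Nat.add_eq_zero_iff, one_ne_zero, Nat.add_sub_cancel, sa]

lemma bwt_cons {S : List ℕ} (hS : IsText S) {c : ℕ} (hc : dollar < c) :
    bwt (c :: S) = ((bwt S).set (rep S) c).take (insPos (bwt S) c) ++
      dollar :: ((bwt S).set (rep S) c).drop (insPos (bwt S) c) := by
  have hi := insPos_le hS hc
  set L := (bwt S).set (rep S) c with hL
  have hLl : L.length = S.length := by simp [hL, bwt_length]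
  have hLg : ∀ p < S.length, L.getD p 0 = if p = rep S then c else (bwt S).getD p 0 := by
    grind
  set i := insPos (bwt S) c with hi'
  apply List.ext_getElem
  · simp [bwt_length, hLl]; omega
  intro q h1 h2
  rw [bwt_length, List.length_cons] at h1
  rw [← List.getD_eq_getElem _ 0, ← List.getD_eq_getElem _ 0]
  have htl : (L.take i).length = i := by simp [hLl, hi]
  rcases lt_trichotomy q i with h | h | h
  · have h3 := bwt_cons_shift hS hc (p := q) (by omega)
    grind [shift, List.getD_append, List.getD_eq_getElem]
  · grind [bwt_cons_ins, List.getD_append_right]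
  · have h3 := bwt_cons_shift hS hc (p := q - 1) (by omega)
    grind [shift, List.getD_append_right, List.getD_cons_succ, List.getD_eq_getElem]

/-! ### Neighbours of the special character -/

lemma lf_rep_pred {S : List ℕ} (hS : IsText S) {c : ℕ} (hc : dollar < c) {p : ℕ}
    (hp : p + 1 = rep S) (h : (bwt S).getD p 0 = c) : insPos (bwt S) c = lf S p + 1 := by
  grind [rep_lt, lf_eq_count, insPos, rep, count_take_succ, bwt_length, bwt_rep]

lemma lf_rep_succ {S : List ℕ} (hS : IsText S) {c : ℕ} (hn : rep S + 1 < S.length)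
    (h : (bwt S).getD (rep S + 1) 0 = c) : insPos (bwt S) c = lf S (rep S + 1) := by
  rw [lf_eq_count hS hn, insPos, h]; rfl

lemma insPos_ne_rep {S : List ℕ} (hS : IsText S) {c : ℕ} (hc : dollar < c) {p : ℕ}
    (hp : p + 1 = rep S) (h : (bwt S).getD p 0 = c) : insPos (bwt S) c ≠ rep S := by
  grind [rep_lt, lf_rep_pred, lf_ne_self]

lemma insPos_ne_rep_succ {S : List ℕ} (hS : IsText S) {c : ℕ}
    (hn : rep S + 1 < S.length) (h : (bwt S).getD (rep S + 1) 0 = c) :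
    insPos (bwt S) c ≠ rep S + 1 := by grind [lf_rep_succ, lf_ne_self]

lemma rep_pos {S : List ℕ} (hS : IsText S) (hn : 2 ≤ S.length) : 0 < rep S := by
  grind [Nat.eq_zero_or_pos, rep, lf_ne_self, rep_lt, lf_rep]

end RComp


namespace RComp

/-! ### Lists of repetitions -/

@[simp, grind =] lemma width_nil : width [] = 0 := rfl
@[simp, grind =] lemma width_cons (p : ℕ × ℕ) (D : DBWT) : width (p :: D) = p.2 + width D := by
  simp [width]
@[simp, grind =] lemma width_append (D E : DBWT) : width (D ++ E) = width D + width E := by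
  simp [width]
@[simp] lemma expand_nil : expand [] = [] := rfl
@[simp] lemma expand_cons (p : ℕ × ℕ) (D : DBWT) :
    expand (p :: D) = List.replicate p.2 p.1 ++ expand D := by simp [expand]
@[simp] lemma expand_append (D E : DBWT) : expand (D ++ E) = expand D ++ expand E := by
  simp [expand]
@[simp] lemma expand_length (D : DBWT) : (expand D).length = width D := by
  induction D with
  | nil => rfl
  | cons p D ih => simp [ih]

/-- The repetitions with their starting positions, from position `s` on. -/
def ent : ℕ → List (ℕ × ℕ) → List (ℕ × ℕ × ℕ)
  | _, [] => []
  | s, (x, l) :: T => (s, x, l) :: ent (s + l) T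

@[simp] lemma ent_nil (s : ℕ) : ent s [] = [] := rfl
@[simp] lemma ent_cons (s : ℕ) (p : ℕ × ℕ) (T : List (ℕ × ℕ)) :
    ent s (p :: T) = (s, p.1, p.2) :: ent (s + p.2) T := rfl
@[simp] lemma ent_append (s : ℕ) (T U : List (ℕ × ℕ)) :
    ent s (T ++ U) = ent s T ++ ent (s + width T) U := by
  induction T generalizing s with
  | nil => simp
  | cons p T ih => simp [ih, add_assoc]

lemma mem_ent {s : ℕ} {T : List (ℕ × ℕ)} {e : ℕ × ℕ × ℕ} :
    e ∈ ent s T ↔ ∃ X Y, T = X ++ (e.2.1, e.2.2) :: Y ∧ e.1 = s + width X := by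
  constructor
  · intro h
    induction T generalizing s with
    | nil => simp at h
    | cons p T ih => grind [ent_cons, width_cons]
  · rintro ⟨X, Y, rfl, h⟩
    obtain ⟨a, b, c⟩ := e
    simp only at h
    simp [h]

lemma ent_le {s : ℕ} {T : List (ℕ × ℕ)} {e : ℕ × ℕ × ℕ} (h : e ∈ ent s T) :
    s ≤ e.1 ∧ e.1 + e.2.2 ≤ s + width T := by grind [mem_ent]

lemma ent_map_snd (s : ℕ) (T : List (ℕ × ℕ)) : (ent s T).map Prod.snd = T := by
  induction T generalizing s with
  | nil => rfl
  | cons p T ih => simp [ih]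

lemma ent_length (s : ℕ) (T : List (ℕ × ℕ)) : (ent s T).length = T.length := by grind [ent_map_snd]

lemma ent_add (s k : ℕ) (T : List (ℕ × ℕ)) :
    ent (s + k) T = (ent s T).map (fun e => (e.1 + k, e.2)) := by
  induction T generalizing s with
  | nil => rfl
  | cons p T ih => grind [ent_cons]

lemma ent_pairwise (s : ℕ) (T : List (ℕ × ℕ)) :
    (ent s T).Pairwise (fun e e' => e.1 + e.2.2 ≤ e'.1) := by
  induction T generalizing s with
  | nil => simp
  | cons p T ih =>
    rw [ent_cons, List.pairwise_cons]
    exact ⟨fun e he => (ent_le he).1, ih _⟩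

lemma ent_disjoint {s : ℕ} {T : List (ℕ × ℕ)} {e e' : ℕ × ℕ × ℕ} (h : e ∈ ent s T)
    (h' : e' ∈ ent s T) : e = e' ∨ e.1 + e.2.2 ≤ e'.1 ∨ e'.1 + e'.2.2 ≤ e.1 := by
  have : Std.Symm (fun e e' : ℕ × ℕ × ℕ =>
      e = e' ∨ e.1 + e.2.2 ≤ e'.1 ∨ e'.1 + e'.2.2 ≤ e.1) :=
    ⟨fun _ _ h => by grind⟩
  exact List.Pairwise.forall_of_forall
    (R := fun e e' : ℕ × ℕ × ℕ => e = e' ∨ e.1 + e.2.2 ≤ e'.1 ∨ e'.1 + e'.2.2 ≤ e.1)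
    (fun _ _ => Or.inl rfl) ((ent_pairwise s T).imp fun h => Or.inr (Or.inl h)) h h'

lemma exists_ent {s : ℕ} {T : List (ℕ × ℕ)} {p : ℕ} (h : s ≤ p) (h' : p < s + width T) :
    ∃ e ∈ ent s T, e.1 ≤ p ∧ p < e.1 + e.2.2 := by
  induction T generalizing s with
  | nil => simp at h'; omega
  | cons q T ih =>
    rcases Nat.lt_or_ge p (s + q.2) with h1 | h1
    · simp_all
    · obtain ⟨e, he, h2⟩ := ih h1 (by rw [width_cons] at h'; omega)
      exact ⟨e, by simp [he], h2⟩

lemma start_succ {D : DBWT} {i : ℕ} (hi : i < D.length) :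
    start D (i + 1) = start D i + (D.getD i (0, 0)).2 := by
    grind [start, List.take_succ_eq_append_getElem]

lemma start_length_left (X Y : DBWT) : start (X ++ Y) X.length = width X := by
  simp [start]

lemma getD_append_cons (X Y : DBWT) (p : ℕ × ℕ) : (X ++ p :: Y).getD X.length (0, 0) = p := by
  simp

/-- The `i`-th entry. -/
def nth (D : DBWT) (i : ℕ) : ℕ × ℕ × ℕ := (start D i, D.getD i (0, 0))

lemma mem_ent_iff {D : DBWT} {e : ℕ × ℕ × ℕ} :
    e ∈ ent 0 D ↔ ∃ i < D.length, e = nth D i := by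
  rw [mem_ent]
  constructor
  · grind [nth, start_length_left, getD_append_cons]
  · rintro ⟨i, hi, rfl⟩
    refine ⟨D.take i, D.drop (i + 1), ?_, by simp [nth, start]⟩
    simp [nth, hi]

lemma nth_mem {D : DBWT} {i : ℕ} (hi : i < D.length) : nth D i ∈ ent 0 D :=
  mem_ent_iff.2 ⟨i, hi, rfl⟩

lemma expand_getD {D : DBWT} {e : ℕ × ℕ × ℕ} (he : e ∈ ent 0 D) {q : ℕ} (hq : q < e.2.2) :
    (expand D).getD (e.1 + q) 0 = e.2.1 := by
  obtain ⟨X, Y, rfl, h⟩ := mem_ent.1 he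
  rw [h, zero_add, expand_append, List.getD_append_right _ _ _ _ (by simp), expand_cons,
    List.getD_append _ _ _ _ (by simp; omega)]
  simp [hq]

/-! ### DBWTs of a BWT -/

section

variable {S : List ℕ} {D : DBWT}

lemma IsDBWT.width_eq (hD : IsDBWT D (bwt S)) : width D = S.length := by
  rw [← expand_length, hD.2, bwt_length]

lemma IsDBWT.len_pos (hD : IsDBWT D (bwt S)) {e : ℕ × ℕ × ℕ} (he : e ∈ ent 0 D) : 0 < e.2.2 := by
  obtain ⟨X, Y, rfl, -⟩ := mem_ent.1 he
  exact hD.1 (e.2.1, e.2.2) (by simp)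

lemma IsDBWT.ent_le (hD : IsDBWT D (bwt S)) {e : ℕ × ℕ × ℕ} (he : e ∈ ent 0 D) :
    e.1 + e.2.2 ≤ S.length := by
  have := (RComp.ent_le he).2
  rw [hD.width_eq] at this
  omega

lemma IsDBWT.ent_lt (hD : IsDBWT D (bwt S)) {e : ℕ × ℕ × ℕ} (he : e ∈ ent 0 D) :
    e.1 < S.length := by
  have := hD.ent_le he
  have := hD.len_pos he
  omega

lemma IsDBWT.getD (hD : IsDBWT D (bwt S)) {e : ℕ × ℕ × ℕ} (he : e ∈ ent 0 D) {q : ℕ}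
    (hq : q < e.2.2) : (bwt S).getD (e.1 + q) 0 = e.2.1 := by
  rw [← hD.2]; exact expand_getD he hq

lemma IsDBWT.lf_add (hS : IsText S) (hD : IsDBWT D (bwt S)) {e : ℕ × ℕ × ℕ}
    (he : e ∈ ent 0 D) {q : ℕ} (hq : q < e.2.2) : lf S (e.1 + q) = lf S e.1 + q := by
  induction q with
  | zero => rfl
  | succ q ih =>
    have := hD.ent_le he
    rw [← add_assoc, lf_succ hS (by omega), ih (by omega), add_assoc]
    rw [hD.getD he (by omega), add_assoc, hD.getD he (by omega)]

lemma IsDBWT.exists_ent (hD : IsDBWT D (bwt S)) {p : ℕ} (hp : p < S.length) :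
    ∃ e ∈ ent 0 D, e.1 ≤ p ∧ p < e.1 + e.2.2 :=
  RComp.exists_ent (Nat.zero_le _) (by rw [hD.width_eq]; omega)

lemma IsDBWT.exists_decomp (hS : IsText S) (hD : IsDBWT D (bwt S)) :
    ∃ A B, D = A ++ (dollar, 1) :: B ∧ width A = rep S ∧ (∀ p ∈ A, p.1 ≠ dollar) ∧
      (∀ p ∈ B, p.1 ≠ dollar) := by
  obtain ⟨e, he, h1, h2⟩ := hD.exists_ent (rep_lt hS)
  have hl := hD.ent_le he
  have hc := hD.getD he (q := rep S - e.1) (by omega)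
  rw [show e.1 + (rep S - e.1) = rep S by omega, bwt_rep hS] at hc
  have key : ∀ e' ∈ ent 0 D, e'.2.1 = dollar → e'.1 = rep S := by
    intro e' he' h
    have := hD.getD he' (hD.len_pos he')
    rw [h, add_zero, bwt_eq_dollar_iff hS (hD.ent_lt he')] at this
    exact this
  have h3 := key e he hc.symm
  have h4 : e.2.2 = 1 := by
    have := hD.len_pos he
    by_contra h
    have h5 := hD.getD he (q := 1) (by omega)
    grind [bwt_eq_dollar_iff]
  obtain ⟨A, B, hAB, hA⟩ := mem_ent.1 he
  rw [← hc, h4] at hAB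
  have hA' : width A = rep S := by omega
  refine ⟨A, B, hAB, hA', ?_, ?_⟩
  · intro p hp hpd
    obtain ⟨X, Y, rfl⟩ := List.append_of_mem hp
    have h5 : (width X, p.1, p.2) ∈ ent 0 D := by rw [hAB]; simp
    have h6 := key _ h5 hpd
    have h7 := hD.len_pos h5
    grind
  · intro p hp hpd
    obtain ⟨X, Y, rfl⟩ := List.append_of_mem hp
    have h5 : (width A + 1 + width X, p.1, p.2) ∈ ent 0 D := by rw [hAB]; simp
    grind

lemma dollarIdx_eq {A B : DBWT} (hA : ∀ p ∈ A, p.1 ≠ dollar) :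
    dollarIdx (A ++ (dollar, 1) :: B) = A.length := by grind [dollarIdx]

end

lemma lastHas_iff {c : ℕ} {A : DBWT} : lastHas c A ↔ ∃ A' l, A = A' ++ [(c, l)] := by
  grind [lastHas, List.getLast?_eq_some_iff]

lemma headHas_iff {c : ℕ} {B : DBWT} : headHas c B ↔ ∃ l B', B = (c, l) :: B' := by
  grind [headHas, Option.map_eq_some_iff, List.head?_eq_some_iff]

lemma mergeLeft_eq (A B : DBWT) (c l : ℕ) :
    mergeLeft (A ++ [(c, l)]) c B = A ++ (c, l + 1) :: B := by simp [mergeLeft]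

lemma mergeRight_eq (A B : DBWT) (c l : ℕ) :
    mergeRight A c ((c, l) :: B) = A ++ (c, 1 + l) :: B := by simp [mergeRight]

lemma mergeBoth_eq (A B : DBWT) (c l l' : ℕ) :
    mergeBoth (A ++ [(c, l)]) c ((c, l') :: B) = A ++ (c, l + 1 + l') :: B := by simp [mergeBoth]

/-! ### The insertion of the special character -/

lemma insertDollar_form {A : DBWT} (hA : ∀ p ∈ A, 0 < p.2) {i : ℕ} (hi : i ≤ width A) :
    (∃ X Y, A = X ++ Y ∧ width X = i ∧ insertDollar i A = X ++ (dollar, 1) :: Y) ∨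
    (∃ X x l₁ l₂ Y, A = X ++ (x, l₁ + l₂) :: Y ∧ 0 < l₁ ∧ 0 < l₂ ∧ width X + l₁ = i ∧
      insertDollar i A = X ++ (x, l₁) :: (dollar, 1) :: (x, l₂) :: Y) := by
  induction A generalizing i with
  | nil =>
    left
    have : i = 0 := by simpa using hi
    subst this
    exact ⟨[], [], rfl, rfl, rfl⟩
  | cons q A ih =>
    obtain ⟨x, l⟩ := q
    cases i with
    | zero => left; exact ⟨[], (x, l) :: A, rfl, rfl, rfl⟩
    | succ i =>
      by_cases h : i + 1 < l
      · right
        refine ⟨[], x, i + 1, l - (i + 1), A, ?_, by omega, by omega, by simp, ?_⟩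
        · simp; omega
        · simp [insertDollar, h]
      · have hl : l ≤ i + 1 := by omega
        have e : insertDollar (i + 1) ((x, l) :: A) = (x, l) :: insertDollar (i + 1 - l) A := by
          simp [insertDollar, h]
        rcases ih (fun p hp => hA p (by simp [hp])) (i := i + 1 - l)
          (by grind) with
          ⟨X, Y, rfl, h1, h2⟩ | ⟨X, y, l₁, l₂, Y, rfl, h1, h2, h3, h4⟩
        · grind
        grind

lemma splits_iff {D : DBWT} {c : ℕ} :
    Splits D c ↔ ∃ e ∈ ent 0 D, e.1 < ins D c ∧ ins D c < e.1 + e.2.2 := by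
  constructor
  · rintro ⟨j, hj, h1, h2⟩
    rw [start_succ hj] at h2
    exact ⟨nth D j, nth_mem hj, h1, h2⟩
  · rintro ⟨e, he, h1, h2⟩
    obtain ⟨j, hj, rfl⟩ := mem_ent_iff.1 he
    exact ⟨j, hj, h1, by rw [start_succ hj]; exact h2⟩

lemma not_splits_of_start {D : DBWT} {c : ℕ} {X Y : DBWT} (h : D = X ++ Y)
    (hX : width X = ins D c) : ¬ Splits D c := by
  rw [splits_iff]
  rintro ⟨e, he, h1, h2⟩
  rw [h, ent_append] at he
  rcases List.mem_append.1 he with he | he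
  · have := (RComp.ent_le he).2; omega
  · have := (RComp.ent_le he).1; omega

/-- The DBWT after the split-node step. -/
structure Refines (D : DBWT) (c : ℕ) (A B A₁ B₁ : DBWT) : Prop where
  cases : (¬ Splits D c ∧ A₁ = A ∧ B₁ = B) ∨
    (Splits D c ∧ ∃ X x l₁ l₂ Y, 0 < l₁ ∧ 0 < l₂ ∧ x ≠ dollar ∧ D = X ++ (x, l₁ + l₂) :: Y ∧
      width X + l₁ = ins D c ∧ A₁ ++ (dollar, 1) :: B₁ = X ++ (x, l₁) :: (x, l₂) :: Y)
  last : ∀ x, lastHas x A₁ ↔ lastHas x A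
  head : ∀ x, headHas x B₁ ↔ headHas x B
  widthA : width A₁ = width A
  widthB : width B₁ = width B
  pos : ∀ p ∈ A₁ ++ B₁, 0 < p.2
  ne : ∀ p ∈ A₁ ++ B₁, p.1 ≠ dollar
  expandA : expand A₁ = expand A
  expandB : expand B₁ = expand B
  parts : (∃ X Y, A₁ = X ++ Y ∧ width X = ins D c ∧
      updateParts D c = (X ++ (dollar, 1) :: Y, B₁)) ∨
    (∃ X Y, B₁ = X ++ Y ∧ width A₁ + 1 + width X = ins D c ∧
      updateParts D c = (A₁, X ++ (dollar, 1) :: Y))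

lemma updateParts_eq {D A B : DBWT} (c : ℕ) (hD : D = A ++ (dollar, 1) :: B)
    (hA : ∀ p ∈ A, p.1 ≠ dollar) : updateParts D c =
      if ins D c ≤ width A then (insertDollar (ins D c) A, B)
      else (A, insertDollar (ins D c - width A - 1) B) := by
  have h := dollarIdx_eq (B := B) hA
  rw [← hD] at h
  have h1 : D.take A.length = A := by rw [hD]; simp
  have h2 : D.drop (A.length + 1) = B := by rw [hD]; simp
  grind [updateParts]

lemma exists_refines {D A B : DBWT} {c : ℕ} (hD : D = A ++ (dollar, 1) :: B)
    (hpos : ∀ p ∈ D, 0 < p.2) (hA : ∀ p ∈ A, p.1 ≠ dollar) (hB : ∀ p ∈ B, p.1 ≠ dollar)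
    (hi : ins D c ≤ width D) : ∃ A₁ B₁, Refines D c A B A₁ B₁ := by
  have hw : width D = width A + 1 + width B := by rw [hD]; simp; omega
  have hne : ∀ p ∈ A ++ B, p.1 ≠ dollar := by grind
  have hpos' : ∀ p ∈ A ++ B, 0 < p.2 := by
    intro p hp
    grind
  have hup := updateParts_eq c hD hA
  by_cases hc : ins D c ≤ width A
  · rw [if_pos hc] at hup
    rcases insertDollar_form (fun p hp => hpos' p (by simp [hp])) hc with
      ⟨X, Y, h1, h2, h3⟩ | ⟨X, x, l₁, l₂, Y, h1, h2, h3, h4, h5⟩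
    · refine ⟨A, B, ⟨Or.inl ⟨?_, rfl, rfl⟩, fun _ => Iff.rfl, fun _ => Iff.rfl, rfl, rfl, hpos',
        hne, rfl, rfl, Or.inl ⟨X, Y, h1, h2, by rw [hup, h3]⟩⟩⟩
      grind [not_splits_of_start]
    · refine ⟨X ++ (x, l₁) :: (x, l₂) :: Y, B, ⟨Or.inr ⟨?_, X, x, l₁, l₂, Y ++ (dollar, 1) :: B,
        h2, h3, ?_, ?_, h4, by simp⟩, ?_, fun _ => Iff.rfl, ?_, rfl, ?_, ?_, ?_, rfl,
        Or.inl ⟨X ++ [(x, l₁)], (x, l₂) :: Y, by simp, by simpa using h4, by rw [hup, h5]; simp⟩⟩⟩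
      · rw [splits_iff]
        refine ⟨(width X, x, l₁ + l₂), ?_, ?_, ?_⟩
        · rw [hD, h1]; simp
        all_goals simp only; omega
      · exact hA (x, l₁ + l₂) (by rw [h1]; simp)
      · rw [hD, h1]; simp
      · grind [lastHas]
      · rw [h1]; simp; omega
      · intro p hp
        grind
      · intro p hp
        simp only [List.mem_append, List.mem_cons] at hp
        have := hne p
        rw [h1] at this
        simp only [List.mem_append, List.mem_cons] at this
        rcases hp with (hp | rfl | rfl | hp) | hp
        · exact this (by tauto)
        · exact hA (x, l₁ + l₂) (by rw [h1]; simp)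
        · exact hA (x, l₁ + l₂) (by rw [h1]; simp)
        · exact this (by tauto)
        · exact this (by tauto)
      · rw [h1]; simp [List.replicate_add, -List.replicate_append_replicate]
  · rw [if_neg hc] at hup
    rcases insertDollar_form (A := B) (i := ins D c - width A - 1)
      (fun p hp => hpos' p (by simp [hp])) (by omega) with
      ⟨X, Y, h1, h2, h3⟩ | ⟨X, x, l₁, l₂, Y, h1, h2, h3, h4, h5⟩
    · refine ⟨A, B, ⟨Or.inl ⟨?_, rfl, rfl⟩, fun _ => Iff.rfl, fun _ => Iff.rfl, rfl, rfl, hpos',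
        hne, rfl, rfl, Or.inr ⟨X, Y, h1, by omega, by rw [hup, h3]⟩⟩⟩
      grind [not_splits_of_start]
    · refine ⟨A, X ++ (x, l₁) :: (x, l₂) :: Y, ⟨Or.inr ⟨?_, A ++ (dollar, 1) :: X, x, l₁, l₂, Y,
        h2, h3, ?_, ?_, by simp; omega, by simp⟩, fun _ => Iff.rfl, ?_, rfl, ?_, ?_, ?_, rfl, ?_,
        Or.inr ⟨X ++ [(x, l₁)], (x, l₂) :: Y, by simp, by simp; omega, by rw [hup, h5]; simp⟩⟩⟩
      · rw [splits_iff]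
        refine ⟨(width A + 1 + width X, x, l₁ + l₂), ?_, ?_, ?_⟩
        · rw [hD, h1]; simp [add_assoc]
        all_goals simp only; omega
      · exact hB (x, l₁ + l₂) (by rw [h1]; simp)
      · rw [hD, h1]; simp
      · grind [headHas]
      · rw [h1]; simp; omega
      · intro p hp
        grind
      · intro p hp
        simp only [List.mem_append, List.mem_cons] at hp
        have := hne p
        rw [h1] at this
        simp only [List.mem_append, List.mem_cons] at this
        rcases hp with hp | hp | rfl | rfl | hp
        · exact this (by tauto)
        · exact this (by tauto)
        · exact hB (x, l₁ + l₂) (by rw [h1]; simp)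
        · exact hB (x, l₁ + l₂) (by rw [h1]; simp)
        · exact this (by tauto)
      · rw [h1]; simp [List.replicate_add, -List.replicate_append_replicate]

end RComp


namespace RComp

/-! ### The update operations produce DBWTs -/

section

variable {S : List ℕ} {D : DBWT} {c : ℕ}

lemma IsDBWT.ins_eq (hD : IsDBWT D (bwt S)) : ins D c = insPos (bwt S) c := by
  rw [RComp.ins_eq, hD.2]

/-- A DBWT decomposed at the special character, before and after the split-node step. -/
structure Setup (S : List ℕ) (D : DBWT) (c : ℕ) (A B A₁ B₁ : DBWT) : Prop where
  eq : D = A ++ (dollar, 1) :: B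
  widthA : width A = rep S
  neA : ∀ p ∈ A, p.1 ≠ dollar
  neB : ∀ p ∈ B, p.1 ≠ dollar
  ref : Refines D c A B A₁ B₁

lemma exists_setup (hS : IsText S) (hc : dollar < c) (hD : IsDBWT D (bwt S)) :
    ∃ A B A₁ B₁, Setup S D c A B A₁ B₁ := by
  obtain ⟨A, B, h1, h2, h3, h4⟩ := hD.exists_decomp hS
  obtain ⟨A₁, B₁, h5⟩ := exists_refines (c := c) h1 hD.1 h3 h4 (by
    rw [hD.width_eq, hD.ins_eq]; exact insPos_le hS hc)
  exact ⟨A, B, A₁, B₁, h1, h2, h3, h4, h5⟩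

variable {A B A₁ B₁ : DBWT}

lemma Setup.fastApplies_iff (h : Setup S D c A B A₁ B₁) :
    FastApplies D c ↔ lastHas c A ∨ headHas c B := by
  have h1 := dollarIdx_eq (B := B) h.neA
  rw [← h.eq] at h1
  rw [FastApplies, h1]
  have h2 : D.take A.length = A := by rw [h.eq]; simp
  have h3 : D.drop (A.length + 1) = B := by rw [h.eq]; simp
  rw [h2, h3]

lemma Setup.getD_pred (h : Setup S D c A B A₁ B₁) (hD : IsDBWT D (bwt S)) {x : ℕ}
    (hx : lastHas x A) : ∃ p, p + 1 = rep S ∧ (bwt S).getD p 0 = x := by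
  obtain ⟨A', l, rfl⟩ := lastHas_iff.1 hx
  have he : (width A', x, l) ∈ ent 0 D := by rw [h.eq]; simp
  have h1 := hD.len_pos he
  have h2 := hD.getD he (q := l - 1) (by simp only at *; omega)
  have h3 := h.widthA
  grind

lemma Setup.getD_succ (h : Setup S D c A B A₁ B₁) (hD : IsDBWT D (bwt S)) {x : ℕ}
    (hx : headHas x B) : rep S + 1 < S.length ∧ (bwt S).getD (rep S + 1) 0 = x := by
  obtain ⟨l, B', rfl⟩ := headHas_iff.1 hx
  have he : (rep S + 1, x, l) ∈ ent 0 D := by rw [h.eq, ← h.widthA]; simp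
  exact ⟨hD.ent_lt he, hD.getD he (hD.len_pos he)⟩

lemma Setup.lastHas_of_getD (h : Setup S D c A B A₁ B₁) (hS : IsText S) (hn : 2 ≤ S.length) :
    ∃ x, lastHas x A := by
  have h1 := rep_pos hS hn
  rw [← h.widthA] at h1
  rcases List.eq_nil_or_concat A with rfl | ⟨A', p, rfl⟩
  · simp at h1
  · exact ⟨p.1, lastHas_iff.2 ⟨A', p.2, by simp⟩⟩

lemma Setup.ins_ne_rep (h : Setup S D c A B A₁ B₁) (hS : IsText S) (hc : dollar < c)
    (hD : IsDBWT D (bwt S)) (hx : lastHas c A) : ins D c ≠ rep S := by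
  obtain ⟨p, h1, h2⟩ := h.getD_pred hD hx
  rw [hD.ins_eq]
  exact insPos_ne_rep hS hc h1 h2

lemma Setup.ins_ne_rep_succ (h : Setup S D c A B A₁ B₁) (hS : IsText S)
    (hD : IsDBWT D (bwt S)) (hx : headHas c B) : ins D c ≠ rep S + 1 := by
  obtain ⟨h1, h2⟩ := h.getD_succ hD hx
  rw [hD.ins_eq]
  exact insPos_ne_rep_succ hS h1 h2

/-- The new character keeps its neighbours of the same character. -/
lemma Setup.lastHas_iff (h : Setup S D c A B A₁ B₁) (hS : IsText S) (hc : dollar < c)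
    (hD : IsDBWT D (bwt S)) : lastHas c (updateParts D c).1 ↔ lastHas c A₁ := by
  rcases h.ref.parts with ⟨X, Y, h1, h2, h3⟩ | ⟨X, Y, h1, h2, h3⟩
  · rw [h3, h1]
    rcases List.eq_nil_or_concat Y with rfl | ⟨Y', p, rfl⟩
    · constructor
      · grind [lastHas]
      · intro hl
        exfalso
        rw [← h1, h.ref.last] at hl
        apply h.ins_ne_rep hS hc hD hl
        rw [← h2, ← h.widthA, ← h.ref.widthA, h1]
        simp
    grind [lastHas]
  · rw [h3]

lemma Setup.headHas_iff (h : Setup S D c A B A₁ B₁) (hS : IsText S) (hc : dollar < c)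
    (hD : IsDBWT D (bwt S)) : headHas c (updateParts D c).2 ↔ headHas c B₁ := by
  rcases h.ref.parts with ⟨X, Y, h1, h2, h3⟩ | ⟨X, Y, h1, h2, h3⟩
  · rw [h3]
  · rw [h3, h1]
    cases X with
    | nil =>
      constructor
      · grind [headHas]
      · intro hl
        exfalso
        rw [← h1, h.ref.head] at hl
        apply h.ins_ne_rep_succ hS hD hl
        rw [← h2, ← h.widthA, ← h.ref.widthA]
        simp
    | cons p X => simp [headHas]

lemma Setup.cut (h : Setup S D c A B A₁ B₁) :
    ∃ P Q, A₁ ++ (c, 1) :: B₁ = P ++ Q ∧ width P = ins D c ∧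
      slowUpdate D c = P ++ (dollar, 1) :: Q := by
  rcases h.ref.parts with ⟨X, Y, h1, h2, h3⟩ | ⟨X, Y, h1, h2, h3⟩
  · grind [slowUpdate]
  grind [slowUpdate]

lemma Setup.expand_eq (h : Setup S D c A B A₁ B₁) (hD : IsDBWT D (bwt S)) :
    bwt S = expand A ++ dollar :: expand B := by
  rw [← hD.2, h.eq]; simp

lemma Setup.expand_set (h : Setup S D c A B A₁ B₁) (hD : IsDBWT D (bwt S)) :
    (bwt S).set (rep S) c = expand (A₁ ++ (c, 1) :: B₁) := by
  rw [h.expand_eq hD, ← h.widthA, ← expand_length]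
  simp [h.ref.expandA, h.ref.expandB]

lemma Setup.slow_isDBWT (h : Setup S D c A B A₁ B₁) (hS : IsText S) (hc : dollar < c)
    (hD : IsDBWT D (bwt S)) : IsDBWT (slowUpdate D c) (bwt (c :: S)) := by
  obtain ⟨P, Q, h1, h2, h3⟩ := h.cut
  constructor
  · rw [h3]
    intro p hp
    have hp' : p ∈ P ++ Q ∨ p = (dollar, 1) := by grind
    rcases hp' with hp' | rfl
    · rw [← h1] at hp'
      have hp'' : p ∈ A₁ ++ B₁ ∨ p = (c, 1) := by grind
      rcases hp'' with hp'' | rfl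
      · exact h.ref.pos p hp''
      · simp
    · simp
  · rw [bwt_cons hS hc, h.expand_set hD, h1, h3, ← hD.ins_eq, ← h2, ← expand_length]
    simp

lemma Setup.width_parts (h : Setup S D c A B A₁ B₁) (hD : IsDBWT D (bwt S)) :
    width (updateParts D c).1 = shift (insPos (bwt S) c) (rep S) := by
  rw [← hD.ins_eq, ← h.widthA, ← h.ref.widthA, shift]
  rcases h.ref.parts with ⟨X, Y, h1, h2, h3⟩ | ⟨X, Y, h1, h2, h3⟩
  · grind
  · rw [h3, if_pos (by omega)]

lemma Setup.slow_length (h : Setup S D c A B A₁ B₁) :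
    (slowUpdate D c).length = D.length + 1 + if Splits D c then 1 else 0 := by
  obtain ⟨P, Q, h1, h2, h3⟩ := h.cut
  have h4 := congrArg List.length h1
  rw [h3]
  simp only [List.length_append, List.length_cons] at *
  rcases h.ref.cases with ⟨h5, rfl, rfl⟩ | ⟨h5, X, x, l₁, l₂, Y, -, -, -, h6, -, h7⟩
  · rw [if_neg h5, h.eq]
    grind
  grind [List.length_append]

lemma isDBWT_mergeLeft {P Q : DBWT} {L : List ℕ} (h : IsDBWT (P ++ (c, 1) :: Q) L)
    (hl : lastHas c P) : IsDBWT (mergeLeft P c Q) L := by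
  obtain ⟨P', l, rfl⟩ := RComp.lastHas_iff.1 hl
  rw [mergeLeft_eq]
  constructor
  · intro p hp
    simp only [List.mem_append, List.mem_cons] at hp
    rcases hp with hp | rfl | hp
    · exact h.1 p (by simp [hp])
    · simp
    · exact h.1 p (by simp [hp])
  · rw [← h.2]; simp [List.replicate_add, -List.replicate_append_replicate]

lemma isDBWT_mergeRight {P Q : DBWT} {L : List ℕ} (h : IsDBWT (P ++ (c, 1) :: Q) L)
    (hl : headHas c Q) : IsDBWT (mergeRight P c Q) L := by
  obtain ⟨l, Q', rfl⟩ := RComp.headHas_iff.1 hl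
  rw [mergeRight_eq]
  constructor
  · intro p hp
    simp only [List.mem_append, List.mem_cons] at hp
    rcases hp with hp | rfl | hp
    · exact h.1 p (by simp [hp])
    · simp
    · exact h.1 p (by simp [hp])
  · rw [← h.2]; simp [List.replicate_add, -List.replicate_append_replicate]

lemma isDBWT_mergeBoth {P Q : DBWT} {L : List ℕ} (h : IsDBWT (P ++ (c, 1) :: Q) L)
    (hl : lastHas c P) (hh : headHas c Q) : IsDBWT (mergeBoth P c Q) L := by
  obtain ⟨P', l, rfl⟩ := RComp.lastHas_iff.1 hl
  obtain ⟨l', Q', rfl⟩ := RComp.headHas_iff.1 hh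
  rw [mergeBoth_eq]
  constructor
  · intro p hp
    simp only [List.mem_append, List.mem_cons] at hp
    rcases hp with hp | rfl | hp
    · exact h.1 p (by simp [hp])
    · simp
    · exact h.1 p (by simp [hp])
  · rw [← h.2]; simp [List.replicate_add, -List.replicate_append_replicate]

/-- The possible outcomes of the modified fast update. -/
lemma Setup.fast_cases (h : Setup S D c A B A₁ B₁) (hS : IsText S) (hc : dollar < c)
    (hD : IsDBWT D (bwt S)) (hf : FastApplies D c) (b : Bool) :
    (lastHas c A ∧ (¬ headHas c B ∨ b = false) ∧
      fastUpdate D c b = some (mergeLeft (updateParts D c).1 c (updateParts D c).2)) ∨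
    (¬ lastHas c A ∧ headHas c B ∧
      fastUpdate D c b = some (mergeRight (updateParts D c).1 c (updateParts D c).2)) ∨
    (lastHas c A ∧ headHas c B ∧ b = true ∧
      fastUpdate D c b = some (mergeBoth (updateParts D c).1 c (updateParts D c).2)) := by
  rw [h.fastApplies_iff] at hf
  have h1 := (h.lastHas_iff hS hc hD).trans (h.ref.last c)
  have h2 := (h.headHas_iff hS hc hD).trans (h.ref.head c)
  grind [CaseA, CaseB, CaseC, fastUpdate]

lemma Setup.fast_isDBWT (h : Setup S D c A B A₁ B₁) (hS : IsText S) (hc : dollar < c)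
    (hD : IsDBWT D (bwt S)) (hf : FastApplies D c) {b : Bool} {D' : DBWT}
    (hu : fastUpdate D c b = some D') : IsDBWT D' (bwt (c :: S)) := by
  have h0 := h.slow_isDBWT hS hc hD
  have h1 := (h.lastHas_iff hS hc hD).trans (h.ref.last c)
  have h2 := (h.headHas_iff hS hc hD).trans (h.ref.head c)
  rcases h.fast_cases hS hc hD hf b with ⟨h3, -, h4⟩ | ⟨-, h3, h4⟩ | ⟨h3, h3', -, h4⟩
  all_goals rw [hu, Option.some_inj] at h4; subst h4
  · exact isDBWT_mergeLeft h0 (h1.2 h3)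
  · exact isDBWT_mergeRight h0 (h2.2 h3)
  · exact isDBWT_mergeBoth h0 (h1.2 h3) (h2.2 h3')

lemma exists_fastUpdate (hS : IsText S) (hc : dollar < c) (hD : IsDBWT D (bwt S))
    (hf : FastApplies D c) (b : Bool) : ∃ D', fastUpdate D c b = some D' := by
  obtain ⟨A, B, A₁, B₁, h⟩ := exists_setup hS hc hD
  rcases h.fast_cases hS hc hD hf b with ⟨-, -, h4⟩ | ⟨-, -, h4⟩ | ⟨-, -, -, h4⟩
  exacts [⟨_, h4⟩, ⟨_, h4⟩, ⟨_, h4⟩]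

/-- If a node is split, then the special character is inserted between equal characters. -/
lemma splits_getD (hS : IsText S) (hc : dollar < c) (hD : IsDBWT D (bwt S))
    (h : Splits D c) : ∃ x, x ≠ dollar ∧ insPos (bwt S) c < S.length ∧
      (bwt (c :: S)).getD (insPos (bwt S) c - 1) 0 = x ∧
      (bwt (c :: S)).getD (insPos (bwt S) c + 1) 0 = x := by
  obtain ⟨e, he, h1, h2⟩ := splits_iff.1 h
  rw [hD.ins_eq] at h1 h2
  have hl := hD.ent_le he
  set i := insPos (bwt S) c with hi
  have h3 := hD.getD he (q := i - 1 - e.1) (by omega)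
  have h4 := hD.getD he (q := i - e.1) (by omega)
  rw [show e.1 + (i - 1 - e.1) = i - 1 by omega] at h3
  rw [show e.1 + (i - e.1) = i by omega] at h4
  have hne : e.2.1 ≠ dollar := by grind [bwt_eq_dollar_iff]
  have h5 := bwt_cons_shift hS hc (p := i - 1) (by omega)
  have h6 := bwt_cons_shift hS hc (p := i) (by omega)
  rw [← hi, shift, if_pos (by omega), if_neg, h3] at h5
  · rw [← hi, shift, if_neg (by omega), if_neg, h4] at h6
    · exact ⟨_, hne, by omega, h5, h6⟩
    grind [bwt_eq_dollar_iff]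
  grind [bwt_eq_dollar_iff]

end

end RComp


namespace RComp

/-! ### Runs -/

lemma numRuns_nil : numRuns [] = 0 := rfl

lemma numRuns_cons (x : ℕ) (L : List ℕ) :
    numRuns (x :: L) = numRuns L + if L.head? = some x then 0 else 1 := by
  have key : ∀ (x : ℕ) (L : List ℕ), numRuns (x :: L) = 1 + (List.range L.length).countP
      (fun i => decide ((x :: L).getD i 0 ≠ L.getD i 0)) := by
    intro x L
    rw [numRuns, ← List.countP_eq_length_filter, List.length_cons, List.range_succ_eq_map,
      List.countP_cons, List.countP_map, add_comm]
    grind [List.countP_congr]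
  rw [key]
  cases L with
  | nil => simp [numRuns_nil]
  | cons y L =>
    rw [key, List.length_cons, List.range_succ_eq_map, List.countP_cons, List.countP_map]
    have : (fun i => decide ((x :: y :: L).getD i 0 ≠ (y :: L).getD i 0)) ∘ Nat.succ =
        fun i => decide ((y :: L).getD i 0 ≠ L.getD i 0) := by
      funext i; simp
    grind

/-- Two strings join in a run. -/
def Joins (A B : List ℕ) : Prop := ∃ x, A.getLast? = some x ∧ B.head? = some x

open Classical in
lemma numRuns_append (A B : List ℕ) :
    numRuns (A ++ B) + (if Joins A B then 1 else 0) = numRuns A + numRuns B := by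
  induction A with
  | nil => simp [Joins, numRuns_nil]
  | cons y A ih =>
    rw [List.cons_append, numRuns_cons, numRuns_cons]
    cases A with
    | nil => grind [Joins]
    | cons z A => grind [Joins]

lemma expand_getLast? {A : DBWT} (hA : ∀ p ∈ A, 0 < p.2) :
    (expand A).getLast? = A.getLast?.map Prod.fst := by
  rcases List.eq_nil_or_concat A with rfl | ⟨A', p, rfl⟩
  · rfl
  · have := hA p (by simp)
    rw [List.concat_eq_append, expand_append, List.getLast?_append]
    simp [List.getLast?_replicate, this.ne']

lemma expand_head? {B : DBWT} (hB : ∀ p ∈ B, 0 < p.2) :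
    (expand B).head? = B.head?.map Prod.fst := by
  cases B with
  | nil => rfl
  | cons p B => grind [expand_cons]

lemma drop_append_cons {X Y : List ℕ} {d k : ℕ} (h : X.length = k) :
    (X ++ d :: Y).drop (k + 1) = Y := by
  subst h
  rw [List.drop_append]
  simp

/-- The BWT before and after the special character. -/
def bwtL (S : List ℕ) : List ℕ := (bwt S).take (rep S)
def bwtR (S : List ℕ) : List ℕ := (bwt S).drop (rep S + 1)

lemma bwt_eq_append {S : List ℕ} (hS : IsText S) : bwt S = bwtL S ++ dollar :: bwtR S := by
  grind [bwt_length, rep_lt, List.take_append_drop, bwtL, bwtR, List.drop_eq_getElem_cons, bwt_rep]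

lemma dollar_notMem_bwtL {S : List ℕ} : dollar ∉ bwtL S := by
  intro h
  obtain ⟨i, hi, h⟩ := List.getElem_of_mem h
  simp only [bwtL, List.getElem_take] at h
  simp only [bwtL, List.length_take, lt_min_iff] at hi
  have := List.not_of_lt_findIdx (p := (· == dollar)) (xs := bwt S) (i := i) hi.1
  simp [h] at this

lemma dollar_notMem_bwtR {S : List ℕ} (hS : IsText S) : dollar ∉ bwtR S := by
  intro h
  obtain ⟨i, hi, h⟩ := List.getElem_of_mem h
  simp only [bwtR, List.getElem_drop] at h
  simp only [bwtR, List.length_drop, bwt_length] at hi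
  rw [← List.getD_eq_getElem _ 0, bwt_eq_dollar_iff hS (by omega)] at h
  omega

lemma numRuns_bwt {S : List ℕ} (hS : IsText S) :
    numRuns (bwt S) = numRuns (bwtL S) + numRuns (bwtR S) + 1 := by
  rw [bwt_eq_append hS]
  have h := numRuns_append (bwtL S) (dollar :: bwtR S)
  rw [if_neg, numRuns_cons, if_neg] at h
  · omega
  · grind [dollar_notMem_bwtR, List.mem_of_head?]
  · rintro ⟨x, h1, h2⟩
    grind [dollar_notMem_bwtL]

open Classical in
/-- The invariant that bounds the number of repetitions. -/
def CountInv (S : List ℕ) (D : DBWT) (b : Bool) (m : ℕ) : Prop :=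
  D.length + (if Joins (bwtL S) (bwtR S) then 1 else 0) ≤
    numRuns (bwtL S) + numRuns (bwtR S) + 1 + m +
      if b = true ∧ Joins (bwtL S) (bwtR S) then 1 else 0

lemma CountInv.length_le {S : List ℕ} (hS : IsText S) {D : DBWT} {b : Bool} {m : ℕ}
    (h : CountInv S D b m) : D.length ≤ numRuns (bwt S) + m := by grind [numRuns_bwt, CountInv]

section

variable {S : List ℕ} {D : DBWT} {c : ℕ} {A B A₁ B₁ : DBWT}

lemma Setup.bwtL_eq (h : Setup S D c A B A₁ B₁) (hD : IsDBWT D (bwt S)) :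
    bwtL S = expand A := by
  rw [bwtL, h.expand_eq hD, ← h.widthA, ← expand_length]; simp

lemma Setup.bwtR_eq (h : Setup S D c A B A₁ B₁) (hD : IsDBWT D (bwt S)) :
    bwtR S = expand B := by
  rw [bwtR, h.expand_eq hD, ← h.widthA, drop_append_cons (by simp)]

lemma Setup.last_iff (h : Setup S D c A B A₁ B₁) (hD : IsDBWT D (bwt S)) {x : ℕ} :
    (bwtL S).getLast? = some x ↔ lastHas x A := by
  rw [h.bwtL_eq hD, expand_getLast?, lastHas]
  intro p hp
  exact hD.1 p (by rw [h.eq]; simp [hp])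

lemma Setup.head_iff (h : Setup S D c A B A₁ B₁) (hD : IsDBWT D (bwt S)) {x : ℕ} :
    (bwtR S).head? = some x ↔ headHas x B := by
  rw [h.bwtR_eq hD, expand_head?, headHas]
  intro p hp
  exact hD.1 p (by rw [h.eq]; simp [hp])

lemma bwtL_cons (hS : IsText S) (hc : dollar < c) :
    bwtL (c :: S) = (bwtL S ++ c :: bwtR S).take (insPos (bwt S) c) ∧
    bwtR (c :: S) = (bwtL S ++ c :: bwtR S).drop (insPos (bwt S) c) := by
  have h1 : (bwt S).set (rep S) c = bwtL S ++ c :: bwtR S := by grind [bwtL, rep, bwt_eq_append]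
  grind [bwt_cons, insPos_le, bwtL, bwtR, bwt_length, rep_cons, drop_append_cons]

open Classical in
/-- The invariant after an update, in terms of the new number of repetitions. -/
lemma countInv_cons (hS : IsText S) (hc : dollar < c) (hD : IsDBWT D (bwt S)) {D' : DBWT} {m : ℕ}
    (h : D'.length + (if (bwtL S).getLast? = some c then 1 else 0) +
        (if (bwtR S).head? = some c then 1 else 0) ≤
      numRuns (bwtL S) + numRuns (bwtR S) + 2 + m + if Splits D c then 1 else 0) :
    CountInv (c :: S) D' (decide (Splits D c)) m := by
  obtain ⟨h1, h2⟩ := bwtL_cons hS hc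
  have h3 := numRuns_append (bwtL (c :: S)) (bwtR (c :: S))
  have h4 : bwtL (c :: S) ++ bwtR (c :: S) = bwtL S ++ c :: bwtR S := by simp_all
  have h5 := numRuns_append (bwtL S) (c :: bwtR S)
  have h6 : Joins (bwtL S) (c :: bwtR S) ↔ (bwtL S).getLast? = some c := by simp [Joins]
  rw [numRuns_cons] at h5
  simp only [h6] at h5
  have h7 : Splits D c → Joins (bwtL (c :: S)) (bwtR (c :: S)) := by
    intro hs
    obtain ⟨x, hx, hl, hx1, hx2⟩ := splits_getD hS hc hD hs
    have hi := insPos_pos hS hc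
    rw [← rep_cons hS hc] at *
    have hlen : (bwt (c :: S)).length = S.length + 1 := by rw [bwt_length]; rfl
    refine ⟨x, ?_, ?_⟩
    · grind [bwtL]
    grind [List.head?_eq_getElem?, bwtR]
  grind [CountInv]

lemma countInv_slow (hS : IsText S) (hc : dollar < c) (hD : IsDBWT D (bwt S)) {b : Bool} {m : ℕ}
    (h : CountInv S D b m) (hf : ¬ FastApplies D c) :
    CountInv (c :: S) (slowUpdate D c) (decide (Splits D c)) m := by
  obtain ⟨A, B, A₁, B₁, hs⟩ := exists_setup hS hc hD
  rw [hs.fastApplies_iff, not_or, ← hs.last_iff hD, ← hs.head_iff hD] at hf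
  apply countInv_cons hS hc hD
  rw [if_neg hf.1, if_neg hf.2, hs.slow_length]
  have := h.length_le hS
  grind [numRuns_bwt]

lemma Setup.parts_length (h : Setup S D c A B A₁ B₁) :
    (updateParts D c).1.length + (updateParts D c).2.length =
      D.length + if Splits D c then 1 else 0 := by
  have := h.slow_length
  grind [slowUpdate]

lemma countInv_fast (hS : IsText S) (hc : dollar < c) (hD : IsDBWT D (bwt S)) {b : Bool} {m : ℕ}
    (h : CountInv S D b m) (hf : FastApplies D c) {D' : DBWT}
    (hu : fastUpdate D c b = some D') :
    CountInv (c :: S) D' (decide (Splits D c)) m := by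
  obtain ⟨A, B, A₁, B₁, hs⟩ := exists_setup hS hc hD
  apply countInv_cons hS hc hD
  have h1 := (hs.lastHas_iff hS hc hD).trans (hs.ref.last c)
  have h2 := (hs.headHas_iff hS hc hD).trans (hs.ref.head c)
  have hp := hs.parts_length
  have hl := h.length_le hS
  rw [numRuns_bwt hS] at hl
  unfold CountInv at h
  rcases hs.fast_cases hS hc hD hf b with ⟨h3, h3', h4⟩ | ⟨h3', h3, h4⟩ | ⟨h3, h3', hb, h4⟩
  all_goals rw [hu, Option.some_inj] at h4; subst h4
  · rw [if_pos ((hs.last_iff hD).2 h3)]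
    obtain ⟨P', l, hP⟩ := RComp.lastHas_iff.1 (h1.2 h3)
    rw [hP] at hp ⊢
    rw [mergeLeft_eq]
    simp only [List.length_append, List.length_cons, List.length_nil] at *
    by_cases h5 : headHas c B
    · have hb : b = false := by tauto
      have hJ : Joins (bwtL S) (bwtR S) := ⟨c, (hs.last_iff hD).2 h3, (hs.head_iff hD).2 h5⟩
      grind
    · rw [if_neg ((hs.head_iff hD).not.2 h5)]
      omega
  · rw [if_neg ((hs.last_iff hD).not.2 h3'), if_pos ((hs.head_iff hD).2 h3)]
    grind [RComp.headHas_iff, mergeRight_eq]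
  grind [RComp.lastHas_iff, RComp.headHas_iff, mergeBoth_eq]

/-! ### Covered starting positions -/

/-- Starting positions of the repetitions. -/
def bd (D : DBWT) : Finset ℕ := ((ent 0 D).map Prod.fst).toFinset

lemma mem_bd {D : DBWT} {p : ℕ} : p ∈ bd D ↔ ∃ e ∈ ent 0 D, e.1 = p := by simp [bd]

lemma mem_bd_iff {D : DBWT} {p : ℕ} : p ∈ bd D ↔ ∃ j, j < D.length ∧ start D j = p := by
  rw [mem_bd]
  constructor
  · rintro ⟨e, he, rfl⟩
    obtain ⟨j, hj, rfl⟩ := mem_ent_iff.1 he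
    exact ⟨j, hj, rfl⟩
  · rintro ⟨j, hj, rfl⟩
    exact ⟨nth D j, nth_mem hj, rfl⟩

lemma IsDBWT.bd_lt (hD : IsDBWT D (bwt S)) {p : ℕ} (hp : p ∈ bd D) : p < S.length := by
  obtain ⟨e, he, rfl⟩ := mem_bd.1 hp
  exact hD.ent_lt he

lemma IsDBWT.ent_starts_nodup (hD : IsDBWT D (bwt S)) : ((ent 0 D).map Prod.fst).Nodup := by
  rw [List.Nodup, List.pairwise_map]
  refine (ent_pairwise 0 D).imp_of_mem ?_
  intro e e' he _ h
  have := hD.len_pos he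
  omega

lemma IsDBWT.bd_card (hD : IsDBWT D (bwt S)) : (bd D).card = D.length := by
  rw [bd, List.toFinset_card_of_nodup hD.ent_starts_nodup, List.length_map, ent_length]

lemma fFirst_eq {D : DBWT} {i : ℕ} : fFirst S D i = lf S (nth D i).1 := rfl

lemma IsDBWT.fLast_eq (hS : IsText S) (hD : IsDBWT D (bwt S)) {i : ℕ} (hi : i < D.length) :
    fLast S D i + 1 = lf S (nth D i).1 + (nth D i).2.2 := by
  have he := nth_mem hi
  have hl := hD.len_pos he
  have := hD.lf_add hS he (q := (nth D i).2.2 - 1) (by omega)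
  grind [fLast, start_succ, nth]

lemma IsDBWT.mem_coveredByL (hD : IsDBWT D (bwt S)) {i x : ℕ} (hi : i < D.length) :
    x ∈ coveredByL S D i ↔ (∃ s ∈ bd D, lf S s = x) ∧ (nth D i).1 ≤ x ∧
      x < (nth D i).1 + (nth D i).2.2 := by
  have hl := hD.len_pos (nth_mem hi)
  simp only [coveredByL, List.mem_filter, List.mem_range, decide_eq_true_eq, start_succ hi]
  change _ ∧ _ ∧ (nth D i).1 ≤ x ∧ x ≤ (nth D i).1 + (nth D i).2.2 - 1 ↔ _
  constructor
  · rintro ⟨h1, ⟨j, hj, h2⟩, h3, h4⟩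
    exact ⟨⟨_, mem_bd_iff.2 ⟨j, hj, rfl⟩, h2⟩, h3, by omega⟩
  · rintro ⟨⟨s, hs, h2⟩, h3, h4⟩
    obtain ⟨j, hj, rfl⟩ := mem_bd_iff.1 hs
    refine ⟨?_, ⟨j, hj, h2⟩, h3, by omega⟩
    rw [← h2]; exact lf_lt (hD.bd_lt hs)

lemma IsDBWT.mem_coveredByF (hS : IsText S) (hD : IsDBWT D (bwt S)) {i x : ℕ}
    (hi : i < D.length) : x ∈ coveredByF S D i ↔ x ∈ bd D ∧ lf S (nth D i).1 ≤ x ∧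
      x < lf S (nth D i).1 + (nth D i).2.2 := by
  have hl := hD.len_pos (nth_mem hi)
  have hf := hD.fLast_eq hS hi
  simp only [coveredByF, List.mem_filter, List.mem_range, decide_eq_true_eq, ← mem_bd_iff,
    fFirst_eq]
  constructor
  · grind
  · rintro ⟨h2, h3, h4⟩
    exact ⟨hD.bd_lt h2, h2, h3, by omega⟩

lemma filter_range_pairwise (p : ℕ → Bool) (n : ℕ) :
    ((List.range n).filter p).Pairwise (· < ·) :=
  List.Pairwise.filter _ (List.pairwise_lt_range)

lemma coveredByL_pairwise (S : List ℕ) (D : DBWT) (i : ℕ) :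
    (coveredByL S D i).Pairwise (· < ·) := filter_range_pairwise _ _

lemma coveredByF_pairwise (S : List ℕ) (D : DBWT) (i : ℕ) :
    (coveredByF S D i).Pairwise (· < ·) := filter_range_pairwise _ _

/-- The median of a strictly increasing list of at least two elements. -/
lemma median_spec {l : List ℕ} (hl : l.Pairwise (· < ·)) (h2 : 2 ≤ l.length) :
    l.getD ((l.length + 1) / 2) 0 ∈ l ∧
    (∃ x ∈ l, x < l.getD ((l.length + 1) / 2) 0) ∧
    l.length / 2 ≤ (l.filter (fun x => x < l.getD ((l.length + 1) / 2) 0)).length ∧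
    l.length / 2 ≤ (l.filter (fun x => l.getD ((l.length + 1) / 2) 0 ≤ x)).length := by
  have hk : (l.length + 1) / 2 < l.length := by omega
  set k := (l.length + 1) / 2 with hk'
  rw [List.getD_eq_getElem _ _ hk]
  have hl' := List.pairwise_iff_getElem.1 hl
  refine ⟨List.getElem_mem hk, ⟨l[0], List.getElem_mem _, hl' 0 k (by omega) hk (by omega)⟩,
    ?_, ?_⟩
  · have h1 : (l.take k).Sublist (l.filter (fun x => x < l[k])) := by
      have : (l.take k).filter (fun x => x < l[k]) = l.take k := by
        grind [List.filter_eq_self, List.getElem_of_mem, lt_min_iff]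
      grind
    grind
  · have h1 : (l.drop k).Sublist (l.filter (fun x => l[k] ≤ x)) := by
      have : (l.drop k).filter (fun x => l[k] ≤ x) = l.drop k := by
        rw [List.filter_eq_self]
        intro x hx
        obtain ⟨i, hi, rfl⟩ := List.getElem_of_mem hx
        simp only [List.length_drop] at hi
        rcases Nat.eq_zero_or_pos i with rfl | h
        · simp
        · simpa using (hl' k (k + i) hk (by omega) (by omega)).le
      grind
    grind

/-! ### The balancing operation -/

lemma splitNode_eq {D : DBWT} {i ℓ : ℕ} (hi : i < D.length) (h1 : ℓ ≤ (nth D i).2.2) :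
    ∃ X x l₂ Y, D = X ++ (x, ℓ + l₂) :: Y ∧ splitNode D i ℓ = X ++ (x, ℓ) :: (x, l₂) :: Y ∧
      width X = (nth D i).1 ∧ ℓ + l₂ = (nth D i).2.2 ∧ x = (nth D i).2.1 := by
  refine ⟨D.take i, (nth D i).2.1, (nth D i).2.2 - ℓ, D.drop (i + 1), ?_, rfl, rfl, by omega, rfl⟩
  rw [show ℓ + ((nth D i).2.2 - ℓ) = (nth D i).2.2 by omega]
  simp [nth, hi]

lemma splitNode_isDBWT {L : List ℕ} {i ℓ : ℕ} (hD : IsDBWT D L) (hi : i < D.length)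
    (h0 : 0 < ℓ) (h1 : ℓ < (nth D i).2.2) : IsDBWT (splitNode D i ℓ) L := by
  obtain ⟨X, x, l₂, Y, h2, h3, -, h4, -⟩ := splitNode_eq hi h1.le
  rw [h3]
  rw [h2] at hD
  constructor
  · intro p hp
    simp only [List.mem_append, List.mem_cons] at hp
    rcases hp with hp | rfl | rfl | hp
    · exact hD.1 p (by simp [hp])
    · exact h0
    · simp only; omega
    · exact hD.1 p (by simp [hp])
  · rw [← hD.2]; simp [List.replicate_add, -List.replicate_append_replicate]

lemma splitNode_length {i ℓ : ℕ} (hi : i < D.length) :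
    (splitNode D i ℓ).length = D.length + 1 := by
  simp [splitNode]; omega

/-- A balancing step splits a repetition properly, at a median. -/
lemma BalanceStep.cases (hS : IsText S) (hD : IsDBWT D (bwt S)) {α : ℕ} (hα : 2 ≤ α)
    {D' : DBWT} (h : BalanceStep S α D D') :
    ∃ i ℓ, i < D.length ∧ 0 < ℓ ∧ ℓ < (nth D i).2.2 ∧ D' = splitNode D i ℓ ∧
      ((α / 2 ≤ ((coveredByL S D i).filter (fun x => x < (nth D i).1 + ℓ)).length ∧
        α / 2 ≤ ((coveredByL S D i).filter (fun x => (nth D i).1 + ℓ ≤ x)).length ∧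
        (nth D i).1 + ℓ ∈ coveredByL S D i) ∨
       (α / 2 ≤ ((coveredByF S D i).filter (fun x => x < lf S (nth D i).1 + ℓ)).length ∧
        α / 2 ≤ ((coveredByF S D i).filter (fun x => lf S (nth D i).1 + ℓ ≤ x)).length ∧
        lf S (nth D i).1 + ℓ ∈ coveredByF S D i)) := by
  cases h with
  | case1 i hi h =>
    unfold HeavyL at h
    obtain ⟨h1, ⟨x, hx, h2⟩, h3, h4⟩ := median_spec (coveredByL_pairwise S D i) (by omega)
    set f := (coveredByL S D i).getD (((coveredByL S D i).length + 1) / 2) 0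
    have h5 := ((hD.mem_coveredByL hi).1 h1).2
    have h6 := ((hD.mem_coveredByL hi).1 hx).2
    have h7 : start D i = (nth D i).1 := rfl
    refine ⟨i, f - start D i, hi, by omega, by omega, rfl, Or.inl ?_⟩
    grind
  | case2 i hi _ h =>
    unfold HeavyF at h
    obtain ⟨h1, ⟨x, hx, h2⟩, h3, h4⟩ := median_spec (coveredByF_pairwise S D i) (by omega)
    set f := (coveredByF S D i).getD (((coveredByF S D i).length + 1) / 2) 0
    have h5 := ((hD.mem_coveredByF hS hi).1 h1).2
    have h6 := ((hD.mem_coveredByF hS hi).1 hx).2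
    refine ⟨i, f - fFirst S D i, hi, by rw [fFirst_eq]; omega, by rw [fFirst_eq]; omega, rfl,
      Or.inr ?_⟩
    rw [fFirst_eq, show lf S (nth D i).1 + (f - lf S (nth D i).1) = f by omega]
    grind

lemma BalanceStep.isDBWT (hS : IsText S) (hD : IsDBWT D (bwt S)) {α : ℕ} (hα : 2 ≤ α)
    {D' : DBWT} (h : BalanceStep S α D D') :
    IsDBWT D' (bwt S) ∧ D'.length = D.length + 1 := by
  obtain ⟨i, ℓ, hi, h0, h1, rfl, -⟩ := h.cases hS hD hα
  grind [splitNode_isDBWT, splitNode_length]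

lemma IsDBWT.length_le (hD : IsDBWT D (bwt S)) : D.length ≤ S.length := by
  rw [← hD.bd_card]
  calc (bd D).card ≤ (Finset.range S.length).card :=
        Finset.card_le_card fun p hp => Finset.mem_range.2 (hD.bd_lt hp)
    _ = S.length := Finset.card_range _

lemma exists_balanceRun (hS : IsText S) {α : ℕ} (hα : 2 ≤ α) :
    ∀ (k : ℕ) (D : DBWT), IsDBWT D (bwt S) → S.length ≤ D.length + k →
      ∃ s D', BalanceRun S α D s D' := by
  intro k
  induction k with
  | zero =>
    intro D hD hk
    by_cases hb : Balanced S D α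
    · exact ⟨0, D, .done D hb⟩
    · obtain ⟨D', hs⟩ : ∃ D', BalanceStep S α D D' := by
        simp only [Balanced, not_forall] at hb
        obtain ⟨i, hi, h⟩ := hb
        by_cases hl : HeavyL S D α i
        · exact ⟨_, .case1 D i hi hl⟩
        · exact ⟨_, .case2 D i hi hl (by tauto)⟩
      have := hs.isDBWT hS hD hα
      have := this.1.length_le
      omega
  | succ k ih =>
    intro D hD hk
    by_cases hb : Balanced S D α
    · exact ⟨0, D, .done D hb⟩
    · obtain ⟨D', hs⟩ : ∃ D', BalanceStep S α D D' := by
        simp only [Balanced, not_forall] at hb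
        obtain ⟨i, hi, h⟩ := hb
        by_cases hl : HeavyL S D α i
        · exact ⟨_, .case1 D i hi hl⟩
        · exact ⟨_, .case2 D i hi hl (by tauto)⟩
      have h1 := hs.isDBWT hS hD hα
      obtain ⟨s, D'', h2⟩ := ih D' h1.1 (by omega)
      exact ⟨s + 1, D'', .step D D' D'' s hs h2⟩

lemma BalanceRun.balanced {α s : ℕ} {D' : DBWT} (h : BalanceRun S α D s D') :
    Balanced S D' α := by
  induction h with
  | done D h => exact h
  | step _ _ _ _ _ _ ih => exact ih

end

end RComp


namespace RComp

/-! ### Charging splits to cuts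

Cuts `C` divide the line into tiles; points of a set `P` are distributed over the tiles.  Positions
are doubled, so that a cut may also be located between two positions. -/

/-- The point `p` lies in the tile of the cut `c`, or at its boundary. -/
def InTile (C : Finset ℕ) (c p : ℕ) : Prop := c < p + 2 ∧ ∀ c' ∈ C, c < c' → p < c' + 2

instance (C : Finset ℕ) (c p : ℕ) : Decidable (InTile C c p) := by unfold InTile; infer_instance

/-- The point `p` lies in the tile of the cut `c` and not at its boundary. -/
def Inside (C : Finset ℕ) (c p : ℕ) : Prop := c + 2 ≤ p ∧ ∀ c' ∈ C, c < c' → p + 2 ≤ c'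

def load (C U : Finset ℕ) (c : ℕ) : ℕ := (U.filter (InTile C c)).card

/-- The cost of `m` splits is covered by a set of points of `P`, and so is the excess of all tiles
over the threshold `β`. -/
def Charged (β : ℕ) (C P : Finset ℕ) (m : ℕ) : Prop :=
  ∃ U ⊆ P, (β - 1) * m + ∑ c ∈ C, (load C U c - β) ≤ U.card

lemma charged_zero (β : ℕ) (C P : Finset ℕ) : Charged β C P 0 :=
  ⟨∅, by simp, by simp [load]⟩

lemma Charged.le_card {β : ℕ} {C P : Finset ℕ} {m : ℕ} (h : Charged β C P m) :
    (β - 1) * m ≤ P.card := by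
  obtain ⟨U, hU, h⟩ := h
  have := Finset.card_le_card hU
  omega

lemma Inside.eq_of_inTile {C : Finset ℕ} {c d p : ℕ} (hc : c ∈ C) (hd : d ∈ C)
    (h : Inside C c p) (h' : InTile C d p) : d = c := by
  rcases lt_trichotomy d c with h1 | h1 | h1
  · have := h'.2 c hc h1; have := h.1; omega
  · exact h1
  · have := h.2 d hd h1; have := h'.1; omega

lemma load_insert_le (C U : Finset ℕ) (c p : ℕ) :
    load C (insert p U) c ≤ load C U c + if InTile C c p then 1 else 0 := by
    grind [load, Finset.filter_insert]

/-- The points inside the tiles can be used. -/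
lemma Charged.exists_inside {β : ℕ} {C P : Finset ℕ} {m : ℕ} (h : Charged β C P m) :
    ∃ U ⊆ P, (∀ p ∈ P, ∀ c ∈ C, Inside C c p → p ∈ U) ∧
      (β - 1) * m + ∑ c ∈ C, (load C U c - β) ≤ U.card := by
  classical
  have key : ∀ Z : Finset ℕ, Z ⊆ P → (∀ p ∈ Z, ∃ c ∈ C, Inside C c p) →
      ∃ U ⊆ P, Z ⊆ U ∧ (β - 1) * m + ∑ c ∈ C, (load C U c - β) ≤ U.card := by
    intro Z
    induction Z using Finset.induction_on with
    | empty =>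
      intro _ _
      obtain ⟨U, hU, h⟩ := h
      exact ⟨U, hU, by simp, h⟩
    | insert p Z hp ih =>
      intro hZ hin
      obtain ⟨U, hU, hZU, h⟩ := ih (fun q hq => hZ (Finset.mem_insert_of_mem hq))
        (fun q hq => hin q (Finset.mem_insert_of_mem hq))
      by_cases hpU : p ∈ U
      · grind
      obtain ⟨c, hc, hcp⟩ := hin p (Finset.mem_insert_self _ _)
      refine ⟨insert p U, Finset.insert_subset (hZ (Finset.mem_insert_self _ _)) hU,
        Finset.insert_subset_insert _ hZU, ?_⟩
      rw [Finset.card_insert_of_notMem hpU]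
      have h1 : ∑ d ∈ C, (load C (insert p U) d - β) ≤
          ∑ d ∈ C, ((load C U d - β) + if d = c then 1 else 0) := by
        refine Finset.sum_le_sum fun d hd => ?_
        have h2 := load_insert_le C U d p
        by_cases h3 : InTile C d p
        · rw [if_pos (hcp.eq_of_inTile hc hd h3)]
          grind
        grind
      rw [Finset.sum_add_distrib, Finset.sum_ite_eq' C c, if_pos hc] at h1
      omega
  obtain ⟨U, hU, hZ, h⟩ := key (P.filter fun p => ∃ c ∈ C, Inside C c p) (Finset.filter_subset _ _)
    (fun p hp => (Finset.mem_filter.1 hp).2)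
  grind

/-- Monotone relabelling of cuts and points. -/
lemma Charged.relabel {β : ℕ} {C P C' P' : Finset ℕ} {m : ℕ} (h : Charged β C P m) {F G : ℕ → ℕ}
    (hC : C' = C.image F) (hP : P.image G ⊆ P')
    (hF : ∀ c ∈ C, ∀ d ∈ C, c < d → F c < F d) (hG : ∀ p ∈ P, ∀ q ∈ P, G p = G q → p = q)
    (h1 : ∀ c ∈ C, ∀ p ∈ P, c + 2 ≤ p → F c + 2 ≤ G p)
    (h2 : ∀ c ∈ C, ∀ p ∈ P, p + 2 ≤ c → G p + 2 ≤ F c) : Charged β C' P' m := by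
  obtain ⟨U, hU, h⟩ := h
  have hF' : Set.InjOn F C := by
    intro c hc d hd hcd
    grind
  have hG' : Set.InjOn G U := fun p hp q hq => hG p (hU hp) q (hU hq)
  refine ⟨U.image G, (Finset.image_subset_image hU).trans hP, ?_⟩
  rw [Finset.card_image_of_injOn hG', hC, Finset.sum_image hF']
  refine le_trans (Nat.add_le_add_left (Finset.sum_le_sum fun c hc => Nat.sub_le_sub_right
    ?_ β) _) h
  unfold load
  rw [Finset.filter_image]
  refine Finset.card_image_le.trans (Finset.card_le_card ?_)
  intro p hp
  rw [Finset.mem_filter] at hp ⊢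
  obtain ⟨hp, h3, h4⟩ := hp
  refine ⟨hp, ?_, ?_⟩
  · grind
  grind

lemma Charged.mono {β : ℕ} {C P P' : Finset ℕ} {m : ℕ} (h : Charged β C P m) (hP : P ⊆ P') :
    Charged β C P' m := by
  obtain ⟨U, hU, h⟩ := h
  exact ⟨U, hU.trans hP, h⟩

/-- No two points of `P` are next to `z`. -/
def Sparse (P : Finset ℕ) (z : ℕ) : Prop :=
  ∀ p ∈ P, ∀ q ∈ P, z < p + 2 → p < z + 2 → z < q + 2 → q < z + 2 → p = q

lemma load_insert_cut {C U : Finset ℕ} {x z : ℕ} (hxz : x < z) (hz : z ∉ C)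
    (hmax : ∀ c ∈ C, c < z → c ≤ x) (hs : Sparse U z) :
    load (insert z C) U x + load (insert z C) U z ≤ load C U x + 1 ∧
      load (insert z C) U x ≤ load C U x ∧ load (insert z C) U z ≤ load C U x := by
  have h1 : ∀ p, InTile (insert z C) x p → InTile C x p ∧ p < z + 2 := fun p h =>
    ⟨⟨h.1, fun c hc => h.2 c (Finset.mem_insert_of_mem hc)⟩,
      h.2 z (Finset.mem_insert_self _ _) hxz⟩
  have h2 : ∀ p, InTile (insert z C) z p → InTile C x p ∧ z < p + 2 := fun p h =>
    ⟨⟨hxz.trans h.1, fun c hc hxc => h.2 c (Finset.mem_insert_of_mem hc) (by grind)⟩, h.1⟩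
  unfold load
  refine ⟨?_, Finset.card_le_card fun p hp => ?_, Finset.card_le_card fun p hp => ?_⟩
  · rw [← Finset.card_union_add_card_inter]
    refine Nat.add_le_add (Finset.card_le_card fun p hp => ?_) ?_
    · grind
    · rw [Finset.card_le_one]
      intro p hp q hq
      simp only [Finset.mem_inter, Finset.mem_filter] at hp hq
      exact hs p hp.1.1 q hq.1.1 (h2 p hp.2.2).2 (h1 p hp.1.2).2 (h2 q hq.2.2).2 (h1 q hq.1.2).2
  · grind
  grind

lemma sum_load_insert_cut {β : ℕ} {C U : Finset ℕ} {x z e : ℕ} (hx : x ∈ C)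
    (hz : z ∉ C) (h : (load (insert z C) U x - β) + (load (insert z C) U z - β) + e ≤
      load C U x - β) :
    e + ∑ c ∈ insert z C, (load (insert z C) U c - β) ≤ ∑ c ∈ C, (load C U c - β) := by
  rw [Finset.sum_insert hz, ← Finset.add_sum_erase C _ hx, ← Finset.add_sum_erase C (fun c =>
    load C U c - β) hx]
  have : ∑ c ∈ C.erase x, (load (insert z C) U c - β) ≤ ∑ c ∈ C.erase x, (load C U c - β) := by
    refine Finset.sum_le_sum fun c _ => Nat.sub_le_sub_right (Finset.card_le_card ?_) β
    intro p hp
    rw [Finset.mem_filter] at hp ⊢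
    exact ⟨hp.1, hp.2.1, fun d hd => hp.2.2 d (Finset.mem_insert_of_mem hd)⟩
  omega

lemma exists_pred {C : Finset ℕ} {z : ℕ} (h : ∃ c ∈ C, c < z) :
    ∃ x ∈ C, x < z ∧ ∀ c ∈ C, c < z → c ≤ x := by
  obtain ⟨c, hc, hcz⟩ := h
  have hne : (C.filter (· < z)).Nonempty := ⟨c, Finset.mem_filter.2 ⟨hc, hcz⟩⟩
  have := Finset.mem_filter.1 (Finset.max'_mem _ hne)
  grind [Finset.le_max']

lemma Charged.insert_cut {β : ℕ} (hβ : 1 ≤ β) {C P : Finset ℕ} {m : ℕ} (h : Charged β C P m)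
    {z : ℕ} (hpred : ∃ c ∈ C, c < z) (hs : Sparse P z) : Charged β (insert z C) P m := by
  by_cases hz : z ∈ C
  · grind
  obtain ⟨x, hx, hxz, hmax⟩ := exists_pred hpred
  obtain ⟨U, hU, h⟩ := h
  have h1 := load_insert_cut hxz hz hmax (U := U)
    (fun p hp q hq => hs p (hU hp) q (hU hq))
  have h2 := sum_load_insert_cut (β := β) (e := 0) hx hz (U := U) (by omega)
  exact ⟨U, hU, by omega⟩

/-- A cut that leaves at least `β` used points on both sides pays for a split. -/
lemma Charged.split {β : ℕ} (hβ : 1 ≤ β) {C P : Finset ℕ} {m : ℕ} (h : Charged β C P m)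
    {a t e : ℕ} (hat : a < t) (hpred : ∃ c ∈ C, c < 2 * t) (hs : Sparse P (2 * t))
    (hl : ∀ c ∈ C, c < 2 * t → c ≤ 2 * a) (hr : ∀ c ∈ C, 2 * t ≤ c → 2 * e ≤ c) (hte : t < e)
    {Y Z : Finset ℕ} (hY : ∀ y ∈ Y, 2 * y ∈ P ∧ a < y ∧ y < t) (hY' : β ≤ Y.card)
    (hZ : ∀ y ∈ Z, 2 * y ∈ P ∧ t ≤ y ∧ y < e) (hZ' : β ≤ Z.card) :
    Charged β (insert (2 * t) C) P (m + 1) := by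
  have hz : 2 * t ∉ C := fun hz => by have := hr _ hz le_rfl; omega
  obtain ⟨x, hx, hxz, hmax⟩ := exists_pred hpred
  obtain ⟨U, hU, hin, h⟩ := h.exists_inside
  have h1 := load_insert_cut hxz hz hmax (U := U) (fun p hp q hq => hs p (hU hp) q (hU hq))
  have hxa := hl x hx hxz
  have hr' : ∀ c ∈ C, x < c → 2 * e ≤ c := fun c hc hxc => hr c hc (by grind)
  have h2 : β ≤ load (insert (2 * t) C) U x := by
    rw [← Finset.card_image_of_injective Y (f := (2 * ·)) (fun a b h => by simpa using h)] at hY'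
    refine hY'.trans (Finset.card_le_card fun p hp => ?_)
    obtain ⟨y, hy, rfl⟩ := Finset.mem_image.1 hp
    obtain ⟨h3, h4, h5⟩ := hY y hy
    refine Finset.mem_filter.2 ⟨hin _ h3 x hx ⟨by omega, fun c hc hxc => ?_⟩, by omega,
      fun c hc hxc => ?_⟩
    · have := hr' c hc hxc; omega
    grind
  have h3 : β ≤ load (insert (2 * t) C) U (2 * t) := by
    rw [← Finset.card_image_of_injective Z (f := (2 * ·)) (fun a b h => by simpa using h)] at hZ'
    refine hZ'.trans (Finset.card_le_card fun p hp => ?_)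
    obtain ⟨y, hy, rfl⟩ := Finset.mem_image.1 hp
    obtain ⟨h3, h4, h5⟩ := hZ y hy
    refine Finset.mem_filter.2 ⟨hin _ h3 x hx ⟨by omega, fun c hc hxc => ?_⟩, by omega,
      fun c hc hxc => ?_⟩
    · have := hr' c hc hxc; omega
    grind
  have h4 := sum_load_insert_cut (β := β) (e := β - 1) hx hz (U := U) (by omega)
  refine ⟨U, hU, ?_⟩
  rw [Nat.mul_succ]
  omega

end RComp


namespace RComp

/-! ### Starting positions of repetitions after the operations -/

section

variable {S : List ℕ} {D D' : DBWT} {c : ℕ}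

lemma bd_insert {P Q : DBWT} (hP : ∀ p ∈ P, 0 < p.2) (x : ℕ) :
    bd (P ++ (x, 1) :: Q) = insert (width P) ((bd (P ++ Q)).image (shift (width P))) := by
  have hlt : ∀ e ∈ ent 0 P, e.1 < width P := by
    intro e he
    grind [mem_ent]
  have hge : ∀ e ∈ ent (width P) Q, width P ≤ e.1 := fun e he => (ent_le he).1
  ext p
  simp only [mem_bd, ent_append, ent_cons, List.mem_append, List.mem_cons, zero_add,
    Finset.mem_insert, Finset.mem_image, ent_add (width P) 1, List.mem_map]
  grind [shift]

lemma bd_split (X Y : DBWT) (x y z l₁ l₂ : ℕ) :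
    bd (X ++ (x, l₁) :: (y, l₂) :: Y) = insert (width X + l₁) (bd (X ++ (z, l₁ + l₂) :: Y)) := by
  ext p
  simp only [mem_bd, ent_append, ent_cons, List.mem_append, List.mem_cons, zero_add,
    Finset.mem_insert, add_assoc]
  grind

lemma bd_congr_char (X Y : DBWT) (x y l : ℕ) : bd (X ++ (x, l) :: Y) = bd (X ++ (y, l) :: Y) := by
  ext p
  simp only [mem_bd, ent_append, ent_cons, List.mem_append, List.mem_cons, or_and_right,
    exists_or, exists_eq_left]

lemma IsDBWT.notMem_bd (hD : IsDBWT D (bwt S)) {e : ℕ × ℕ × ℕ} (he : e ∈ ent 0 D) {p : ℕ}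
    (h1 : e.1 < p) (h2 : p < e.1 + e.2.2) : p ∉ bd D := by
  intro hp
  obtain ⟨e', he', rfl⟩ := mem_bd.1 hp
  have := hD.len_pos he'
  rcases ent_disjoint he he' with rfl | h | h <;> omega

lemma IsDBWT.zero_mem_bd (hS : IsText S) (hD : IsDBWT D (bwt S)) : 0 ∈ bd D := by
  obtain ⟨e, he, h1, -⟩ := hD.exists_ent hS.length_pos
  grind [mem_bd]

lemma IsDBWT.rep_mem_bd (hS : IsText S) (hD : IsDBWT D (bwt S)) : rep S ∈ bd D := by
  obtain ⟨A, B, h1, h2, -⟩ := hD.exists_decomp hS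
  exact mem_bd.2 ⟨(rep S, dollar, 1), by rw [h1, ← h2]; simp, rfl⟩

lemma IsDBWT.rep_succ_mem_bd (hS : IsText S) (hD : IsDBWT D (bwt S))
    (hn : rep S + 1 < S.length) : rep S + 1 ∈ bd D := by
  obtain ⟨A, B, h1, h2, -⟩ := hD.exists_decomp hS
  obtain ⟨e, he, h3, h4⟩ := hD.exists_ent hn
  have h5 : (rep S, dollar, 1) ∈ ent 0 D := by rw [h1, ← h2]; simp
  rcases ent_disjoint he h5 with rfl | h | h
  · simp only at h4; omega
  · simp only at h; omega
  grind [mem_bd]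

variable {A B A₁ B₁ : DBWT}

/-- The position of the cut of the split-node step, if there is one. -/
def splitSet (D : DBWT) (c : ℕ) : Finset ℕ := if Splits D c then {ins D c} else ∅

lemma mem_splitSet {p : ℕ} : p ∈ splitSet D c ↔ Splits D c ∧ p = ins D c := by grind [splitSet]

lemma Setup.bd_slow (h : Setup S D c A B A₁ B₁) (hD : IsDBWT D (bwt S)) :
    bd (slowUpdate D c) =
      insert (insPos (bwt S) c) ((bd D ∪ splitSet D c).image (shift (insPos (bwt S) c))) := by
  obtain ⟨P, Q, h1, h2, h3⟩ := h.cut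
  have h4 : bd (A₁ ++ (c, 1) :: B₁) = bd D ∪ splitSet D c := by
    rw [bd_congr_char _ _ c dollar]
    rcases h.ref.cases with ⟨h5, h6, h7⟩ | ⟨h5, X, x, l₁, l₂, Y, -, -, -, h6, h7, h8⟩
    · rw [h6, h7, ← h.eq, splitSet, if_neg h5, Finset.union_empty]
    grind [bd_split, splitSet]
  have hP : ∀ p ∈ P, 0 < p.2 := by
    intro p hp
    have : p ∈ A₁ ++ (c, 1) :: B₁ := by rw [h1]; simp [hp]
    rcases List.mem_append.1 this with h' | h'
    · exact h.ref.pos p (by simp [h'])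
    · rcases List.mem_cons.1 h' with rfl | h'
      · simp
      · exact h.ref.pos p (by simp [h'])
  rw [h3, bd_insert hP, ← h1, h4, h2, hD.ins_eq]

/-- The starting positions after an update, where `X` collects those of `D` that are kept. -/
def Updated (S : List ℕ) (D : DBWT) (c : ℕ) (X : Finset ℕ) (D' : DBWT) : Prop :=
  bd D' = insert (insPos (bwt S) c) ((X ∪ splitSet D c).image (shift (insPos (bwt S) c)))

lemma Updated.erase {X : Finset ℕ} (h : Updated S D c X D') {p : ℕ} {D'' : DBWT}
    (hp : p ∉ splitSet D c) (h' : bd D' = insert (shift (insPos (bwt S) c) p) (bd D''))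
    (hn : shift (insPos (bwt S) c) p ∉ bd D'') : Updated S D c (X.erase p) D'' := by
  unfold Updated at *
  have h1 : bd D'' = (bd D').erase (shift (insPos (bwt S) c) p) := by grind
  grind [shift_ne, shift_inj]

lemma IsDBWT.notMem_splitSet (hD : IsDBWT D (bwt S)) {p : ℕ} (hp : p ∈ bd D) :
    p ∉ splitSet D c := by
  intro h
  obtain ⟨h1, rfl⟩ := mem_splitSet.1 h
  obtain ⟨e, he, h2, h3⟩ := splits_iff.1 h1
  exact hD.notMem_bd he h2 h3 hp

lemma bd_mergeLeft {A B : DBWT} (h : lastHas c A) :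
    bd (A ++ (c, 1) :: B) = insert (width A) (bd (mergeLeft A c B)) := by
    grind [RComp.lastHas_iff, bd_split, mergeLeft_eq]

lemma bd_mergeRight {A B : DBWT} (h : headHas c B) :
    bd (A ++ (c, 1) :: B) = insert (width A + 1) (bd (mergeRight A c B)) := by
  obtain ⟨l, B', rfl⟩ := RComp.headHas_iff.1 h
  rw [mergeRight_eq]
  exact bd_split A B' c c c 1 l

lemma bd_mergeBoth {A B : DBWT} (h : headHas c B) (h' : lastHas c A) :
    bd (mergeLeft A c B) = insert (width A + 1) (bd (mergeBoth A c B)) := by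
  obtain ⟨l, B', rfl⟩ := RComp.headHas_iff.1 h
  obtain ⟨A', l', rfl⟩ := RComp.lastHas_iff.1 h'
  rw [mergeBoth_eq, mergeLeft_eq, bd_split A' B' c c c]
  simp [add_assoc]

lemma Setup.updated_slow (h : Setup S D c A B A₁ B₁) (hD : IsDBWT D (bwt S)) :
    Updated S D c (bd D) (slowUpdate D c) := h.bd_slow hD

lemma notMem_bd_merge {X Y : DBWT} {x l l' : ℕ} (hD : IsDBWT (X ++ (x, l + l') :: Y) (bwt S))
    (hl : 0 < l) (hl' : 0 < l') : width X + l ∉ bd (X ++ (x, l + l') :: Y) :=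
  hD.notMem_bd (e := (width X, x, l + l')) (by simp) (by simp; omega) (by simp; omega)

lemma Setup.updated_left (h : Setup S D c A B A₁ B₁) (hS : IsText S) (hc : dollar < c)
    (hD : IsDBWT D (bwt S)) (hl : lastHas c A) :
    Updated S D c ((bd D).erase (rep S))
      (mergeLeft (updateParts D c).1 c (updateParts D c).2) := by
  have h1 := ((h.lastHas_iff hS hc hD).trans (h.ref.last c)).2 hl
  have h2 := isDBWT_mergeLeft (h.slow_isDBWT hS hc hD) h1
  refine (h.updated_slow hD).erase (hD.notMem_splitSet (hD.rep_mem_bd hS)) ?_ ?_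
  · rw [← h.width_parts hD]; exact bd_mergeLeft h1
  · rw [← h.width_parts hD]
    have h3 := (h.slow_isDBWT hS hc hD).1
    rw [slowUpdate] at h3
    obtain ⟨A', l, h4⟩ := RComp.lastHas_iff.1 h1
    rw [h4, mergeLeft_eq] at h2 ⊢
    have := notMem_bd_merge h2 (h3 (c, l) (by simp [h4])) one_pos
    simpa using this

lemma Setup.shift_rep_succ (h : Setup S D c A B A₁ B₁) (hS : IsText S)
    (hD : IsDBWT D (bwt S)) (hr : headHas c B) :
    width (updateParts D c).1 + 1 = shift (insPos (bwt S) c) (rep S + 1) := by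
  have h1 := h.ins_ne_rep_succ hS hD hr
  rw [hD.ins_eq] at h1
  rw [h.width_parts hD]
  grind [shift]

lemma Setup.updated_right (h : Setup S D c A B A₁ B₁) (hS : IsText S) (hc : dollar < c)
    (hD : IsDBWT D (bwt S)) (hr : headHas c B) :
    Updated S D c ((bd D).erase (rep S + 1))
      (mergeRight (updateParts D c).1 c (updateParts D c).2) := by
  have h1 := ((h.headHas_iff hS hc hD).trans (h.ref.head c)).2 hr
  have h2 := isDBWT_mergeRight (h.slow_isDBWT hS hc hD) h1
  refine (h.updated_slow hD).erase (hD.notMem_splitSet (hD.rep_succ_mem_bd hS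
    (h.getD_succ hD hr).1)) ?_ ?_
  · rw [← h.shift_rep_succ hS hD hr]; exact bd_mergeRight h1
  · rw [← h.shift_rep_succ hS hD hr]
    have h3 := (h.slow_isDBWT hS hc hD).1
    rw [slowUpdate] at h3
    obtain ⟨l, B', h4⟩ := RComp.headHas_iff.1 h1
    rw [h4, mergeRight_eq] at h2 ⊢
    exact notMem_bd_merge h2 one_pos (h3 (c, l) (by simp [h4]))

lemma Setup.updated_both (h : Setup S D c A B A₁ B₁) (hS : IsText S) (hc : dollar < c)
    (hD : IsDBWT D (bwt S)) (hl : lastHas c A) (hr : headHas c B) :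
    Updated S D c (((bd D).erase (rep S)).erase (rep S + 1))
      (mergeBoth (updateParts D c).1 c (updateParts D c).2) := by
  have h1 := ((h.headHas_iff hS hc hD).trans (h.ref.head c)).2 hr
  have h1' := ((h.lastHas_iff hS hc hD).trans (h.ref.last c)).2 hl
  have h2 := isDBWT_mergeBoth (h.slow_isDBWT hS hc hD) h1' h1
  refine (h.updated_left hS hc hD hl).erase (hD.notMem_splitSet (hD.rep_succ_mem_bd hS
    (h.getD_succ hD hr).1)) ?_ ?_
  · rw [← h.shift_rep_succ hS hD hr]; exact bd_mergeBoth h1 h1'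
  · rw [← h.shift_rep_succ hS hD hr]
    have h3 := (h.slow_isDBWT hS hc hD).1
    rw [slowUpdate] at h3
    obtain ⟨l, B', h4⟩ := RComp.headHas_iff.1 h1
    obtain ⟨A', l', h5⟩ := RComp.lastHas_iff.1 h1'
    rw [h4, h5, mergeBoth_eq] at h2 ⊢
    have := notMem_bd_merge h2 (Nat.succ_pos _) (h3 (c, l) (by simp [h4]))
    simpa [add_assoc] using this

end

/-! ### The potential -/

section

variable {S : List ℕ} {D D' : DBWT} {c : ℕ} {b : Bool} {β m : ℕ}

/-- The cuts of the repetitions.  Those next to the special character are replaced by one cut at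
its place, or by none if the special character was inserted into a repetition. -/
def cutsU (S : List ℕ) (D : DBWT) (b : Bool) : Finset ℕ :=
  ((bd D).filter (fun s => s ≠ rep S ∧ s ≠ rep S + 1)).image (fun s => 2 * s) ∪
    if b = false ∧ rep S + 1 < S.length then {2 * rep S + 1} else ∅

/-- The cuts of the F-intervals. -/
def cutsV (S : List ℕ) (D : DBWT) (b : Bool) : Finset ℕ :=
  ((bd D).filter (fun s => b = true → s ≠ rep S + 1)).image (fun s => 2 * lf S s)

lemma mem_cutsU {p : ℕ} : p ∈ cutsU S D b ↔
    (∃ s ∈ bd D, s ≠ rep S ∧ s ≠ rep S + 1 ∧ 2 * s = p) ∨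
      (b = false ∧ rep S + 1 < S.length ∧ p = 2 * rep S + 1) := by
  unfold cutsU
  split <;> simp_all [and_assoc, or_comm]

lemma mem_cutsV {p : ℕ} : p ∈ cutsV S D b ↔
    ∃ s ∈ bd D, (b = true → s ≠ rep S + 1) ∧ 2 * lf S s = p := by
  simp [cutsV, and_assoc]

/-- The splits of the balancing operations are charged to the cuts. -/
def Potential (β : ℕ) (S : List ℕ) (D : DBWT) (b : Bool) (m : ℕ) : Prop :=
  ∃ mU mV, m = mU + mV ∧ Charged β (cutsU S D b) (cutsV S D b) mU ∧
    Charged β (cutsV S D b) (cutsU S D b) mV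

lemma potential_zero : Potential β S D b 0 := ⟨0, 0, rfl, charged_zero _ _ _, charged_zero _ _ _⟩

lemma Potential.le (hS : IsText S) (hD : IsDBWT D (bwt S)) (h : Potential β S D b m) :
    (β - 1) * m ≤ 2 * D.length := by
  obtain ⟨mU, mV, rfl, h1, h2⟩ := h
  have h3 : (cutsV S D b).card ≤ D.length := by
    rw [← hD.bd_card]
    exact Finset.card_image_le.trans (Finset.card_le_card (Finset.filter_subset _ _))
  have h4 : (cutsU S D b).card ≤ D.length := by
    rw [← hD.bd_card]
    have h5 : ((bd D).filter (fun s => s ≠ rep S ∧ s ≠ rep S + 1)).card + 1 ≤ (bd D).card := by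
      rw [← Finset.card_insert_of_notMem (a := rep S) (by simp)]
      exact Finset.card_le_card (Finset.insert_subset (hD.rep_mem_bd hS) (Finset.filter_subset _ _))
    refine (Finset.card_union_le _ _).trans (le_trans (Nat.add_le_add Finset.card_image_le ?_) h5)
    split <;> simp
  have h5 := h1.le_card
  have h6 := h2.le_card
  rw [Nat.mul_add]
  omega

lemma sparse_of_even {P : Finset ℕ} (h : ∀ p ∈ P, p % 2 = 0) {z : ℕ} (hz : z % 2 = 0) :
    Sparse P z := by
  intro p hp q hq
  grind

lemma sparse_cutsV {z : ℕ} (hz : z % 2 = 0) : Sparse (cutsV S D b) z := by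
  grind [sparse_of_even, mem_cutsV]

lemma sparse_cutsU {z : ℕ} (hz : z % 2 = 0) : Sparse (cutsU S D b) z := by
  intro p hp q hq
  grind [mem_cutsU]

lemma zero_mem_cutsV (hS : IsText S) (hD : IsDBWT D (bwt S)) : 0 ∈ cutsV S D b :=
  mem_cutsV.2 ⟨rep S, hD.rep_mem_bd hS, by omega, by rw [lf_rep hS]⟩

lemma zero_mem_cutsU (hS : IsText S) (hD : IsDBWT D (bwt S)) (hn : 2 ≤ S.length) :
    0 ∈ cutsU S D b :=
  mem_cutsU.2 (Or.inl ⟨0, hD.zero_mem_bd hS, (rep_pos hS hn).ne, by omega, rfl⟩)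

/-! #### Balancing -/

lemma bd_splitNode {i ℓ : ℕ} (hi : i < D.length) (h1 : ℓ ≤ (nth D i).2.2) :
    bd (splitNode D i ℓ) = insert ((nth D i).1 + ℓ) (bd D) := by grind [splitNode_eq, bd_split]

lemma card_filter_of_sorted {l : List ℕ} (hl : l.Pairwise (· < ·)) (p : ℕ → Bool) :
    (l.toFinset.filter (fun x => p x = true)).card = (l.filter p).length := by
  rw [← List.toFinset_filter, List.toFinset_card_of_nodup]
  exact (hl.imp fun h => h.ne).filter _

/-- Two positions within an F-interval of length at least two belong to one repetition. -/
lemma IsDBWT.lf_bd (hS : IsText S) (hD : IsDBWT D (bwt S)) {e : ℕ × ℕ × ℕ} (he : e ∈ ent 0 D)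
    {s : ℕ} (hs : s ∈ bd D) : lf S s ≤ lf S e.1 ∨ lf S e.1 + e.2.2 ≤ lf S s := by
  by_contra! h
  have hl := hD.ent_le he
  have h1 := hD.lf_add hS he (q := lf S s - lf S e.1) (by omega)
  rw [Nat.add_sub_cancel' h.1.le] at h1
  have h2 := lf_inj (by omega) (hD.bd_lt hs) h1
  exact hD.notMem_bd he (p := s) (by omega) (by omega) hs

lemma IsDBWT.bd_le (hD : IsDBWT D (bwt S)) {e : ℕ × ℕ × ℕ} (he : e ∈ ent 0 D)
    {s : ℕ} (hs : s ∈ bd D) : s ≤ e.1 ∨ e.1 + e.2.2 ≤ s := by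
  by_contra! h
  exact hD.notMem_bd he h.1 h.2 hs

end

end RComp


namespace RComp

section

variable {S : List ℕ} {D D' : DBWT} {c : ℕ} {b : Bool} {β m : ℕ}

lemma cutsU_splitNode (hS : IsText S) (hD : IsDBWT D (bwt S)) {i ℓ : ℕ} (hi : i < D.length)
    (h0 : 0 < ℓ) (h1 : ℓ < (nth D i).2.2) :
    (nth D i).1 + ℓ ≠ rep S ∧ (nth D i).1 + ℓ ≠ rep S + 1 ∧
    cutsU S (splitNode D i ℓ) b = insert (2 * ((nth D i).1 + ℓ)) (cutsU S D b) := by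
  have he := nth_mem hi
  have hl := hD.ent_le he
  have h2 := hD.notMem_bd he (p := (nth D i).1 + ℓ) (by omega) (by omega)
  have h3 : (nth D i).1 + ℓ ≠ rep S := fun h => h2 (h ▸ hD.rep_mem_bd hS)
  have h4 : (nth D i).1 + ℓ ≠ rep S + 1 := fun h => h2 (h ▸ hD.rep_succ_mem_bd hS (by omega))
  refine ⟨h3, h4, ?_⟩
  ext p
  rw [Finset.mem_insert, mem_cutsU, mem_cutsU, bd_splitNode hi h1.le]
  simp only [Finset.mem_insert]
  grind

lemma cutsV_splitNode {i ℓ : ℕ} (hi : i < D.length) (h1 : ℓ < (nth D i).2.2)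
    (h4 : (nth D i).1 + ℓ ≠ rep S + 1) :
    cutsV S (splitNode D i ℓ) b = insert (2 * lf S ((nth D i).1 + ℓ)) (cutsV S D b) := by
  grind [mem_cutsV, bd_splitNode]

lemma Potential.balance {α : ℕ} (hα : 16 ≤ α) (hS : IsText S) (hD : IsDBWT D (bwt S))
    (h : Potential ((α + 1) / 2 - 4) S D b m) (hb : BalanceStep S α D D') :
    Potential ((α + 1) / 2 - 4) S D' b (m + 1) := by
  obtain ⟨i, ℓ, hi, h0, h1, rfl, hcov⟩ := hb.cases hS hD (by omega)
  obtain ⟨h3, h4, hU⟩ := cutsU_splitNode (b := b) hS hD hi h0 h1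
  have hV := cutsV_splitNode (b := b) hi h1 h4
  have he := nth_mem hi
  have hl := hD.ent_le he
  have hβ : 1 ≤ (α + 1) / 2 - 4 := by omega
  have hft := hD.lf_add hS he h1
  set e := nth D i with hedef
  set t := e.1 + ℓ with ht
  have hn : 2 ≤ S.length := by omega
  have hpU : ∃ z ∈ cutsU S D b, z < 2 * t := ⟨0, zero_mem_cutsU hS hD hn, by omega⟩
  have hlf : 0 < lf S t := by grind
  have hpV : ∃ z ∈ cutsV S D b, z < 2 * lf S t := ⟨0, zero_mem_cutsV hS hD, by omega⟩
  have hrep : rep S ≠ e.1 := by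
    intro h5
    obtain ⟨X, Y, h6, h7, -⟩ := hD.exists_decomp hS
    have h8 : (rep S, dollar, 1) ∈ ent 0 D := by rw [h6, ← h7]; simp
    rcases ent_disjoint he h8 with h | h | h
    · grind
    · simp only at h; omega
    · simp only at h; omega
  have hcard : ∀ (Q : Finset ℕ) (x y z : ℕ), α / 2 ≤ Q.card →
      (α + 1) / 2 - 4 ≤ (Q \ {x, y, z}).card := by grind
  obtain ⟨mU, mV, rfl, hcU, hcV⟩ := h
  have sU := sparse_cutsU (S := S) (D := splitNode D i ℓ) (b := b) (z := 2 * lf S t) (by omega)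
  have sV := sparse_cutsV (S := S) (D := splitNode D i ℓ) (b := b) (z := 2 * t) (by omega)
  have hcU' := hcU.mono (P' := cutsV S (splitNode D i ℓ) b) (by grind)
  have hcV' := hcV.mono (P' := cutsU S (splitNode D i ℓ) b) (by grind)
  rcases hcov with ⟨hc1, hc2, -⟩ | ⟨hc1, hc2, -⟩
  · refine ⟨mU + 1, mV, by omega, ?_, ?_⟩
    · rw [← card_filter_of_sorted (coveredByL_pairwise S D i)] at hc1 hc2
      simp only [decide_eq_true_eq] at hc1 hc2
      have key : ∀ y ∈ (coveredByL S D i).toFinset, y ≠ lf S (rep S + 1) →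
          2 * y ∈ cutsV S (splitNode D i ℓ) b ∧ e.1 ≤ y ∧ y < e.1 + e.2.2 := by
        intro y hy hy'
        rw [List.mem_toFinset, hD.mem_coveredByL hi] at hy
        grind [mem_cutsV]
      have hs := hcU'.split hβ (a := e.1) (t := t) (e := e.1 + e.2.2) (by omega) hpU sV
        (fun z hz hzt => by
          rcases mem_cutsU.1 hz with ⟨s, hs, -, -, rfl⟩ | ⟨-, -, rfl⟩
          · rcases hD.bd_le he hs with h | h <;> omega
          · rcases hD.bd_le he (hD.rep_mem_bd hS) with h | h <;> omega)
        (fun z hz hzt => by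
          rcases mem_cutsU.1 hz with ⟨s, hs, -, -, rfl⟩ | ⟨-, -, rfl⟩
          · rcases hD.bd_le he hs with h | h <;> omega
          · rcases hD.bd_le he (hD.rep_mem_bd hS) with h | h <;> omega) (by omega)
        (Y := _ \ {lf S (rep S + 1), e.1, e.1}) (fun y hy => by grind) (hcard _ _ _ _ hc1)
        (Z := _ \ {lf S (rep S + 1), e.1, e.1}) (fun y hy => by grind) (hcard _ _ _ _ hc2)
      rwa [← hU] at hs
    · have hs := hcV'.insert_cut hβ hpV sU
      rwa [← hV] at hs
  · refine ⟨mU, mV + 1, by omega, ?_, ?_⟩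
    · have hs := hcU'.insert_cut hβ hpU sV
      rwa [← hU] at hs
    · rw [← card_filter_of_sorted (coveredByF_pairwise S D i)] at hc1 hc2
      simp only [decide_eq_true_eq, ← hft] at hc1 hc2
      have key : ∀ y ∈ (coveredByF S D i).toFinset, y ≠ rep S → y ≠ rep S + 1 →
          2 * y ∈ cutsU S (splitNode D i ℓ) b ∧ lf S e.1 ≤ y ∧ y < lf S e.1 + e.2.2 := by
        intro y hy h5 h6
        rw [List.mem_toFinset, hD.mem_coveredByF hS hi] at hy
        grind [mem_cutsU]
      have hs := hcV'.split hβ (a := lf S e.1) (t := lf S t) (e := lf S e.1 + e.2.2) (by omega)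
        hpV sU
        (fun z hz hzt => by
          obtain ⟨s, hs, -, rfl⟩ := mem_cutsV.1 hz
          rcases hD.lf_bd hS he hs with h | h <;> omega)
        (fun z hz hzt => by
          obtain ⟨s, hs, -, rfl⟩ := mem_cutsV.1 hz
          rcases hD.lf_bd hS he hs with h | h <;> omega) (by omega)
        (Y := _ \ {rep S, rep S + 1, lf S e.1}) (fun y hy => by grind) (hcard _ _ _ _ hc1)
        (Z := _ \ {rep S, rep S + 1, lf S e.1}) (fun y hy => by grind) (hcard _ _ _ _ hc2)
      rwa [← hV] at hs

lemma Potential.balanceRun {α s : ℕ} (hα : 16 ≤ α) (hS : IsText S) (hD : IsDBWT D (bwt S))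
    (h : Potential ((α + 1) / 2 - 4) S D b m) (hb : BalanceRun S α D s D') :
    Potential ((α + 1) / 2 - 4) S D' b (m + s) := by
  induction hb generalizing m with
  | done D _ => exact h
  | step D D' D'' s h1 _ ih =>
    have := ih (h1.isDBWT hS hD (by omega)).1 (h.balance hα hS hD h1)
    grind

/-! #### Updates -/

/-- The images of doubled starting positions of repetitions and F-intervals under the insertion
of the special character at position `i`. -/
def moveU (i u : ℕ) : ℕ := if u = 2 * i then 2 * i + 1 else 2 * shift i (u / 2)
def moveV (i : ℕ) (g : Bool) (v : ℕ) : ℕ :=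
  if v = 2 * i ∧ g = true then 2 * i else 2 * shift i (v / 2)

lemma moveU_lt {i u u' : ℕ} (h : u % 2 = 0) (h' : u' % 2 = 0) (hu : u < u') :
    moveU i u < moveU i u' := by grind [moveU, shift]

lemma moveV_lt {i v v' : ℕ} {g : Bool} (h : v % 2 = 0) (h' : v' % 2 = 0) (hv : v < v') :
    moveV i g v < moveV i g v' := by grind [moveV, shift]

lemma moveU_moveV {i u v : ℕ} {g : Bool} (h : u % 2 = 0) (h' : v % 2 = 0) (hu : u + 2 ≤ v) :
    moveU i u + 2 ≤ moveV i g v := by grind [moveU, moveV, shift]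

lemma moveV_moveU {i u v : ℕ} {g : Bool} (h : u % 2 = 0) (h' : v % 2 = 0) (hu : v + 2 ≤ u) :
    moveV i g v + 2 ≤ moveU i u := by grind [moveU, moveV, shift]

lemma eq_of_lt_imp_lt {P : Finset ℕ} {F : ℕ → ℕ} (h : ∀ p ∈ P, ∀ q ∈ P, p < q → F p < F q) :
    ∀ p ∈ P, ∀ q ∈ P, F p = F q → p = q := by grind

/-- Cuts and points may change their roles. -/
lemma charged_relabel_both {C P C' P' : Finset ℕ} {m m' : ℕ} {F G : ℕ → ℕ}
    (h : Charged β C P m ∧ Charged β P C m')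
    (hC : C' = C.image F) (hP : P' = P.image G)
    (hF : ∀ c ∈ C, ∀ d ∈ C, c < d → F c < F d) (hG : ∀ p ∈ P, ∀ q ∈ P, p < q → G p < G q)
    (h1 : ∀ c ∈ C, ∀ p ∈ P, c + 2 ≤ p → F c + 2 ≤ G p)
    (h2 : ∀ c ∈ C, ∀ p ∈ P, p + 2 ≤ c → G p + 2 ≤ F c) :
    Charged β C' P' m ∧ Charged β P' C' m' :=
  ⟨h.1.relabel hC hP.symm.subset hF (eq_of_lt_imp_lt hG) h1 h2,
    h.2.relabel hP hC.symm.subset hG (eq_of_lt_imp_lt hF) (fun p hp c hc => h2 c hc p hp)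
      (fun p hp c hc => h1 c hc p hp)⟩

lemma charged_move {X Y : Finset ℕ} {mU mV : ℕ} (i : ℕ) (g : Bool)
    (h : Charged β (X.image (2 * ·)) (Y.image (2 * ·)) mU ∧
      Charged β (Y.image (2 * ·)) (X.image (2 * ·)) mV) :
    Charged β ((X.image (2 * ·)).image (moveU i)) ((Y.image (2 * ·)).image (moveV i g)) mU ∧
      Charged β ((Y.image (2 * ·)).image (moveV i g)) ((X.image (2 * ·)).image (moveU i)) mV := by
  grind [charged_relabel_both, moveU_lt, moveV_lt, moveU_moveV, moveV_moveU]

lemma cutsU_updated (hS : IsText S) (hc : dollar < c) (hD : IsDBWT D (bwt S)) {X : Finset ℕ}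
    (h : Updated S D c X D') (hX : X ⊆ bd D)
    (hi : insPos (bwt S) c ∈ bd D → insPos (bwt S) c ∈ X) :
    cutsU (c :: S) D' (decide (Splits D c)) =
      (X.image (2 * ·)).image (moveU (insPos (bwt S) c)) := by
  ext p
  rw [mem_cutsU, rep_cons hS hc, Finset.image_image, Finset.mem_image, h]
  have hsp : insPos (bwt S) c ∈ X → ¬ Splits D c := fun h1 h2 =>
    hD.notMem_splitSet (c := c) (hX h1) (mem_splitSet.2 ⟨h2, (hD.ins_eq).symm⟩)
  simp only [Finset.mem_insert, Finset.mem_image, Finset.mem_union, mem_splitSet, hD.ins_eq,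
    Function.comp, List.length_cons, decide_eq_false_iff_not]
  set i := insPos (bwt S) c
  constructor
  · rintro (⟨s, rfl | ⟨q, hq | ⟨-, rfl⟩, rfl⟩, h1, h2, rfl⟩ | ⟨h1, h2, rfl⟩)
    · exact absurd rfl h1
    · grind [shift, moveU]
    · grind [shift]
    · refine ⟨i, hi ?_, by simp [moveU]⟩
      obtain ⟨e, he, h3, h4⟩ := hD.exists_ent (p := i) (by omega)
      rw [splits_iff] at h1
      push Not at h1
      have h5 := h1 e he
      rw [hD.ins_eq] at h5
      grind [mem_bd]
  · rintro ⟨q, hq, rfl⟩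
    by_cases hqi : q = i
    · subst hqi
      have := hD.bd_lt (hX hq)
      grind [moveU]
    grind [shift, moveU]

lemma cutsV_updated (hS : IsText S) (hc : dollar < c) (hD : IsDBWT D (bwt S)) {X : Finset ℕ}
    (h : Updated S D c X D') (hX : X ⊆ bd D) :
    cutsV (c :: S) D' (decide (Splits D c)) =
      insert 0 (X.image (fun s => if s = rep S then 2 * insPos (bwt S) c
        else 2 * shift (insPos (bwt S) c) (lf S s))) := by
  ext p
  rw [mem_cutsV, rep_cons hS hc, Finset.mem_insert, Finset.mem_image, h]
  have hsp : insPos (bwt S) c ∈ X → ¬ Splits D c := fun h1 h2 =>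
    hD.notMem_splitSet (c := c) (hX h1) (mem_splitSet.2 ⟨h2, (hD.ins_eq).symm⟩)
  simp only [Finset.mem_insert, Finset.mem_image, Finset.mem_union, mem_splitSet, hD.ins_eq,
    decide_eq_true_eq]
  have key : ∀ q ∈ X, 2 * lf (c :: S) (shift (insPos (bwt S) c) q) =
      if q = rep S then 2 * insPos (bwt S) c else 2 * shift (insPos (bwt S) c) (lf S q) := by
    intro q hq
    split
    · grind [lf_cons_rep]
    · rename_i h; rw [lf_cons_shift hS hc (hD.bd_lt (hX hq)) h]
  grind [lf_cons_ins, shift]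

end

end RComp


namespace RComp

section

variable {S : List ℕ} {D D' : DBWT} {c : ℕ} {b : Bool} {β m mU mV : ℕ}

/-- If the previous update split a node, then the special character has equal neighbours. -/
def FlagOk (S : List ℕ) (b : Bool) : Prop :=
  b = true → rep S + 1 < S.length ∧ (bwt S).getD (rep S - 1) 0 = (bwt S).getD (rep S + 1) 0

lemma flagOk_cons (hS : IsText S) (hc : dollar < c) (hD : IsDBWT D (bwt S)) :
    FlagOk (c :: S) (decide (Splits D c)) := by
  intro h
  grind [splits_getD, rep_cons]

lemma FlagOk.iff {A B A₁ B₁ : DBWT} (hb : FlagOk S true) (h : Setup S D c A B A₁ B₁)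
    (hS : IsText S) (hD : IsDBWT D (bwt S)) : lastHas c A ↔ headHas c B := by
  obtain ⟨h1, h2⟩ := hb rfl
  obtain ⟨x, hx⟩ := h.lastHas_of_getD hS (by omega)
  have hB : ∃ y, headHas y B := by
    cases hB : B with
    | nil =>
      have := hD.width_eq
      rw [h.eq, hB, width_append, h.widthA] at this
      simp at this
      omega
    | cons p B' => exact ⟨p.1, RComp.headHas_iff.2 ⟨p.2, B', rfl⟩⟩
  obtain ⟨y, hy⟩ := hB
  obtain ⟨p, h3, h4⟩ := h.getD_pred hD hx
  have h5 := (h.getD_succ hD hy).2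
  grind [Nat.add_sub_cancel, lastHas, headHas]

/-- Charges for the repetitions and for the F-intervals. -/
def ChargedBoth (β : ℕ) (C P : Finset ℕ) (mU mV : ℕ) : Prop :=
  Charged β C P mU ∧ Charged β P C mV

lemma ChargedBoth.insert_left (hβ : 1 ≤ β) {C P : Finset ℕ} (h : ChargedBoth β C P mU mV)
    {z : ℕ} (hpred : ∃ c ∈ C, c < z) (hs : Sparse P z) : ChargedBoth β (insert z C) P mU mV :=
  ⟨h.1.insert_cut hβ hpred hs, h.2.mono (Finset.subset_insert _ _)⟩

lemma ChargedBoth.symm {C P : Finset ℕ} (h : ChargedBoth β C P mU mV) :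
    ChargedBoth β P C mV mU := ⟨h.2, h.1⟩

lemma cutsV_false : cutsV S D false = ((bd D).image (lf S)).image (2 * ·) := by
  ext p
  simp [mem_cutsV]

lemma even_image (X : Finset ℕ) : ∀ u ∈ X.image (2 * ·), u % 2 = 0 := by grind

lemma chargedBoth_left (hS : IsText S) (hD : IsDBWT D (bwt S))
    (h : ChargedBoth β (cutsU S D false) (cutsV S D false) mU mV) :
    ChargedBoth β (((bd D).erase (rep S)).image (2 * ·)) (((bd D).image (lf S)).image (2 * ·))
      mU mV := by
  rw [cutsV_false] at h
  refine charged_relabel_both h (F := fun u => if u = 2 * rep S + 1 then 2 * rep S + 2 else u)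
    (G := id) ?_ Finset.image_id.symm ?_ (fun _ _ _ _ h => h) ?_ ?_
  · ext p
    simp only [Finset.mem_image, mem_cutsU, Finset.mem_erase]
    constructor
    · rintro ⟨s, ⟨h1, h2⟩, rfl⟩
      by_cases h3 : s = rep S + 1
      · have := hD.bd_lt h2
        grind
      · exact ⟨2 * s, Or.inl ⟨s, h2, h1, h3, rfl⟩, if_neg (by omega)⟩
    · rintro ⟨u, ⟨s, h1, h2, h3, rfl⟩ | ⟨-, h1, rfl⟩, rfl⟩
      · grind
      · exact ⟨rep S + 1, ⟨by omega, hD.rep_succ_mem_bd hS h1⟩, by rw [if_pos rfl]; omega⟩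
  · grind [mem_cutsU]
  · grind
  grind

lemma chargedBoth_right (hD : IsDBWT D (bwt S)) (hS : IsText S)
    (hn : rep S + 1 < S.length)
    (h : ChargedBoth β (cutsU S D false) (cutsV S D false) mU mV) :
    ChargedBoth β (((bd D).erase (rep S + 1)).image (2 * ·)) (((bd D).image (lf S)).image (2 * ·))
      mU mV := by
  rw [cutsV_false] at h
  refine charged_relabel_both h (F := fun u => if u = 2 * rep S + 1 then 2 * rep S else u)
    (G := id) ?_ Finset.image_id.symm ?_ (fun _ _ _ _ h => h) ?_ ?_
  · ext p
    simp only [Finset.mem_image, mem_cutsU, Finset.mem_erase]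
    constructor
    · rintro ⟨s, ⟨h1, h2⟩, rfl⟩
      by_cases h3 : s = rep S
      · grind
      · exact ⟨2 * s, Or.inl ⟨s, h2, h3, h1, rfl⟩, if_neg (by omega)⟩
    · rintro ⟨u, ⟨s, h1, h2, h3, rfl⟩ | ⟨-, h1, rfl⟩, rfl⟩
      · grind
      · exact ⟨rep S, ⟨by omega, hD.rep_mem_bd hS⟩, by rw [if_pos rfl]⟩
  · grind [mem_cutsU]
  · grind
  grind

lemma cuts_true : cutsU S D true = (((bd D).erase (rep S)).erase (rep S + 1)).image (2 * ·) ∧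
    cutsV S D true = (((bd D).erase (rep S + 1)).image (lf S)).image (2 * ·) := by
  constructor
  · ext p
    simp only [mem_cutsU, Finset.mem_image, Finset.mem_erase]
    grind
  · ext p
    simp [mem_cutsV, and_assoc, and_left_comm]

lemma chargedBoth_slow (hβ : 1 ≤ β) (hS : IsText S) (hD : IsDBWT D (bwt S)) (hn : 2 ≤ S.length)
    (hb : FlagOk S b) (h : ChargedBoth β (cutsU S D b) (cutsV S D b) mU mV) :
    ChargedBoth β ((bd D).image (2 * ·)) (((bd D).image (lf S)).image (2 * ·)) mU mV := by
  have hrep := rep_pos hS hn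
  have h0 := hD.zero_mem_bd hS
  have hr := hD.rep_mem_bd hS
  cases b with
  | false =>
    have h1 := (chargedBoth_left hS hD h).insert_left hβ (z := 2 * rep S)
      ⟨0, Finset.mem_image.2 ⟨0, Finset.mem_erase.2 ⟨hrep.ne, h0⟩, rfl⟩, by omega⟩
      (sparse_of_even (even_image _) (by omega))
    grind [Finset.image_insert, rep, bd, Finset.insert_erase]
  | true =>
    obtain ⟨hn', -⟩ := hb rfl
    have hr' := hD.rep_succ_mem_bd hS hn'
    have hlf : 0 < lf S (rep S + 1) := by
      grind [Nat.eq_zero_or_pos, lf, rep, lf_rep, lf_inj, rep_lt]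
    rw [cuts_true.1, cuts_true.2] at h
    have h0' : 0 ∈ ((bd D).erase (rep S)).erase (rep S + 1) := by grind
    have h1 := h.symm.insert_left hβ (z := 2 * lf S (rep S + 1))
      ⟨0, Finset.mem_image.2 ⟨0, Finset.mem_image.2 ⟨rep S, Finset.mem_erase.2 ⟨by omega, hr⟩,
        lf_rep hS⟩, rfl⟩, by omega⟩ (sparse_of_even (even_image _) (by omega))
    rw [← Finset.image_insert (2 * ·), ← Finset.image_insert (lf S), Finset.insert_erase hr'] at h1
    have h2 := h1.symm.insert_left hβ (z := 2 * (rep S + 1))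
      ⟨0, Finset.mem_image.2 ⟨0, h0', rfl⟩, by omega⟩ (sparse_of_even (even_image _) (by omega))
    rw [← Finset.image_insert (2 * ·), Finset.insert_erase
      (Finset.mem_erase.2 ⟨by omega, hr'⟩)] at h2
    have h3 := h2.insert_left hβ (z := 2 * rep S)
      ⟨0, Finset.mem_image.2 ⟨0, Finset.mem_erase.2 ⟨hrep.ne, h0⟩, rfl⟩, by omega⟩
      (sparse_of_even (even_image _) (by omega))
    grind [Finset.image_insert, Finset.insert_erase]

lemma shift_zero (hS : IsText S) (hc : dollar < c) : shift (insPos (bwt S) c) 0 = 0 := by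
  simp [shift, insPos_pos hS hc]

lemma moveV_false (i q : ℕ) : moveV i false (2 * q) = 2 * shift i q := by simp [moveV]

lemma image_moveV {Y : Finset ℕ} (i : ℕ) (g : Bool) :
    ((Y.image (lf S)).image (2 * ·)).image (moveV i g) = Y.image (fun s => moveV i g
    (2 * lf S s)) := by
  grind

lemma Potential.update {A B A₁ B₁ : DBWT} (hβ : 1 ≤ β) (hS : IsText S) (hc : dollar < c)
    (hD : IsDBWT D (bwt S)) (hs : Setup S D c A B A₁ B₁) (hn : 2 ≤ S.length) (hb : FlagOk S b)
    (h : Potential β S D b m) :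
    Potential β (c :: S) (slowUpdate D c) (decide (Splits D c)) m ∧
    ∀ D', FastApplies D c → fastUpdate D c b = some D' →
      Potential β (c :: S) D' (decide (Splits D c)) m := by
  obtain ⟨mU, mV, rfl, h⟩ := h
  have hi := insPos_pos hS hc
  have hr := hD.rep_mem_bd hS
  have ex : ∀ D', ChargedBoth β (cutsU (c :: S) D' (decide (Splits D c)))
      (cutsV (c :: S) D' (decide (Splits D c))) mU mV →
      Potential β (c :: S) D' (decide (Splits D c)) (mU + mV) := fun D' h => ⟨mU, mV, rfl, h⟩
  constructor
  · apply ex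
    have h1 := charged_move (insPos (bwt S) c) false (chargedBoth_slow hβ hS hD hn hb h)
    have hU := cutsU_updated hS hc hD (hs.updated_slow hD) subset_rfl id
    have hV := cutsV_updated hS hc hD (hs.updated_slow hD) subset_rfl
    rw [← hU] at h1
    have hV' : cutsV (c :: S) (slowUpdate D c) (decide (Splits D c)) =
        insert (2 * insPos (bwt S) c)
          ((((bd D).image (lf S)).image (2 * ·)).image (moveV (insPos (bwt S) c) false)) := by
          grind [image_moveV, moveV_false, rep, lf_rep, shift_zero]
    rw [hV']
    refine (ChargedBoth.insert_left hβ (ChargedBoth.symm h1) ⟨0, ?_, by omega⟩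
      (sparse_cutsU (by omega))).symm
    grind [image_moveV, rep, moveV_false, lf_rep, shift_zero]
  · intro D' hf hu
    apply ex
    rcases hs.fast_cases hS hc hD hf b with ⟨h1, h2, h3⟩ | ⟨h1, h2, h3⟩ | ⟨h1, h2, rfl, h3⟩ <;>
      obtain rfl := Option.some.inj (h3.symm.trans hu)
    · have : b = false := by
        cases b with
        | false => rfl
        | true =>
          have := (hb.iff hs hS hD).1 h1
          simp_all
      subst this
      have h4 := charged_move (insPos (bwt S) c) false (chargedBoth_left hS hD h)
      have hin := hs.ins_ne_rep hS hc hD h1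
      rw [hD.ins_eq] at hin
      have hU := cutsU_updated hS hc hD (hs.updated_left hS hc hD h1) (Finset.erase_subset _ _)
        (fun h => Finset.mem_erase.2 ⟨hin, h⟩)
      have hV := cutsV_updated hS hc hD (hs.updated_left hS hc hD h1) (Finset.erase_subset _ _)
      rw [← hU] at h4
      refine Eq.mp (congrArg (ChargedBoth β _ · mU mV) ?_) h4
      grind [image_moveV, moveV_false, rep, lf_rep, shift_zero]
    · have : b = false := by
        cases b with
        | false => rfl
        | true => exact absurd ((hb.iff hs hS hD).2 h2) h1
      subst this
      obtain ⟨hn', hc'⟩ := hs.getD_succ hD h2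
      have h4 := charged_move (insPos (bwt S) c) true (chargedBoth_right hD hS hn' h)
      have hin := hs.ins_ne_rep_succ hS hD h2
      rw [hD.ins_eq] at hin
      have hins := lf_rep_succ hS hn' hc'
      have hU := cutsU_updated hS hc hD (hs.updated_right hS hc hD h2) (Finset.erase_subset _ _)
        (fun h => Finset.mem_erase.2 ⟨hin, h⟩)
      have hV := cutsV_updated hS hc hD (hs.updated_right hS hc hD h2) (Finset.erase_subset _ _)
      rw [← hU] at h4
      refine Eq.mp (congrArg (ChargedBoth β _ · mU mV) ?_) h4
      symm
      rw [hV, image_moveV]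
      have hmv : ∀ s ∈ bd D, s ≠ rep S + 1 → moveV (insPos (bwt S) c) true (2 * lf S s) =
          2 * shift (insPos (bwt S) c) (lf S s) := by
        intro s hs hne
        have : lf S s ≠ insPos (bwt S) c := by
          rw [hins]
          exact fun h => hne (lf_inj (hD.bd_lt hs) hn' h)
        unfold moveV
        simp_all
      ext p
      simp only [Finset.mem_insert, Finset.mem_image, Finset.mem_erase]
      constructor
      · rintro (rfl | ⟨s, ⟨h5, h6⟩, rfl⟩)
        · grind [rep, lf_rep, shift_zero]
        · split
          · exact ⟨rep S + 1, hD.rep_succ_mem_bd hS hn', by rw [← hins]; simp [moveV]⟩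
          grind
      grind [rep, lf_rep, shift_zero, moveV]
    · rw [cuts_true.1, cuts_true.2] at h
      have h4 := charged_move (insPos (bwt S) c) false h
      have hin := hs.ins_ne_rep hS hc hD h1
      have hin' := hs.ins_ne_rep_succ hS hD h2
      rw [hD.ins_eq] at hin hin'
      have hsub : ((bd D).erase (rep S)).erase (rep S + 1) ⊆ bd D :=
        (Finset.erase_subset _ _).trans (Finset.erase_subset _ _)
      have hU := cutsU_updated hS hc hD (hs.updated_both hS hc hD h1 h2) hsub
        (fun h => Finset.mem_erase.2 ⟨hin', Finset.mem_erase.2 ⟨hin, h⟩⟩)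
      have hV := cutsV_updated hS hc hD (hs.updated_both hS hc hD h1 h2) hsub
      rw [← hU] at h4
      refine Eq.mp (congrArg (ChargedBoth β _ · mU mV) ?_) h4
      grind [image_moveV, moveV_false, rep, lf_rep, shift_zero]

end

/-! ### Executions of r-comp -/

section

variable {T : List ℕ} {α : ℕ}

lemma isText_suffix (hT : IsText T) {δ : ℕ} (h1 : 1 ≤ δ) (h2 : δ ≤ T.length) :
    IsText (suffix T δ) := by
  obtain ⟨s, rfl, hs⟩ := hT
  simp only [List.length_append, List.length_singleton] at h2
  refine ⟨s.drop (s.length + 1 - δ), ?_, fun c hc => hs c (List.mem_of_mem_drop hc)⟩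
  grind [suffix]

lemma suffix_length {δ : ℕ} (h : δ ≤ T.length) : (suffix T δ).length = δ := by
  simp [suffix]; omega

lemma suffix_succ {δ : ℕ} (h : δ < T.length) :
    suffix T (δ + 1) = T.getD (T.length - δ - 1) 0 :: suffix T δ := by
    grind [suffix, drop_eq_getD_cons, Nat.sub_sub]

lemma dollar_lt_getD (hT : IsText T) {δ : ℕ} (h1 : 1 ≤ δ) (h2 : δ < T.length) :
    dollar < T.getD (T.length - δ - 1) 0 := by
  have h3 : T.length - δ - 1 < T.length := by omega
  have h4 := (hT.getD_eq_dollar h3).not.2 (by omega)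
  have h5 := hT.one_le (List.getElem_mem h3)
  grind

lemma suffix_one (hT : IsText T) : suffix T 1 = [dollar] := by
  obtain ⟨s, rfl, -⟩ := hT
  simp [suffix]

lemma bwt_dollar : bwt [dollar] = [dollar] :=
  List.perm_singleton.1 (bwt_perm [dollar])

/-- What holds throughout an execution. -/
structure RunInv (T : List ℕ) (α δ : ℕ) (D : DBWT) (b : Bool) (m : ℕ) : Prop where
  one_le : 1 ≤ δ
  le : δ ≤ T.length
  isDBWT : IsDBWT D (bwt (suffix T δ))
  balanced : Balanced (suffix T δ) D α
  count : CountInv (suffix T δ) D b m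
  flag : FlagOk (suffix T δ) b
  zero : δ = 1 → m = 0
  pot : 16 ≤ α → Potential ((α + 1) / 2 - 4) (suffix T δ) D b m

lemma CountInv.balanceRun {S : List ℕ} {D D' : DBWT} {b : Bool} {m s : ℕ} (hα : 2 ≤ α)
    (hS : IsText S) (hD : IsDBWT D (bwt S)) (h : CountInv S D b m) (hb : BalanceRun S α D s D') :
    IsDBWT D' (bwt S) ∧ CountInv S D' b (m + s) := by
  induction hb generalizing m with
  | done D _ => exact ⟨hD, h⟩
  | step D D' D'' s h1 _ ih =>
    obtain ⟨h2, h3⟩ := h1.isDBWT hS hD hα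
    have := ih h2 (m := m + 1) (by unfold CountInv at *; omega)
    grind

lemma length_le_of_balanced_one {S : List ℕ} (h : S.length ≤ 1) (D : DBWT) (hα : 2 ≤ α) :
    Balanced S D α := by
  intro i _
  have h1 : ∀ p : ℕ → Bool, ((List.range S.length).filter p).length < α := by grind
  exact ⟨not_le.2 (h1 _), not_le.2 (h1 _)⟩

lemma runInv_init (hT : IsText T) (hα : 2 ≤ α) : RunInv T α 1 [(dollar, 1)] false 0 where
  one_le := le_rfl
  le := hT.length_pos
  isDBWT := by
    rw [suffix_one hT, bwt_dollar]
    exact ⟨by simp, by simp⟩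
  balanced := by grind [suffix_one, length_le_of_balanced_one]
  count := by grind [suffix_one, bwtL, dollar, rep, bwt_dollar, Joins, bwtR, CountInv]
  flag := by simp [FlagOk]
  zero := fun _ => rfl
  pot := fun _ => potential_zero

lemma RunInv.next {δ : ℕ} {D D₁ D' : DBWT} {b : Bool} {m s : ℕ} (hT : IsText T) (hα : 2 ≤ α)
    (h : RunInv T α δ D b m) (hδ : δ < T.length)
    (hu : (¬ FastApplies D (T.getD (T.length - δ - 1) 0) ∧
        D₁ = slowUpdate D (T.getD (T.length - δ - 1) 0)) ∨
      (FastApplies D (T.getD (T.length - δ - 1) 0) ∧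
        fastUpdate D (T.getD (T.length - δ - 1) 0) b = some D₁))
    (hb : BalanceRun (suffix T (δ + 1)) α D₁ s D') :
    RunInv T α (δ + 1) D' (decide (Splits D (T.getD (T.length - δ - 1) 0))) (m + s) := by
  have hS := isText_suffix hT h.one_le h.le
  have hc := dollar_lt_getD hT h.one_le hδ
  have hS' := isText_suffix hT (by omega : 1 ≤ δ + 1) hδ
  have hcount := h.count
  have hpot := h.pot
  have hlen := suffix_length h.le
  have hflag := flagOk_cons hS hc h.isDBWT
  obtain ⟨A, B, A₁, B₁, hs⟩ := exists_setup hS hc h.isDBWT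
  rw [suffix_succ hδ] at hb hS'
  set c := T.getD (T.length - δ - 1) 0
  set S := suffix T δ
  have h1 : IsDBWT D₁ (bwt (c :: S)) ∧ CountInv (c :: S) D₁ (decide (Splits D c)) m ∧
      (16 ≤ α → Potential ((α + 1) / 2 - 4) (c :: S) D₁ (decide (Splits D c)) m) := by
    have hp : δ = 1 → Potential ((α + 1) / 2 - 4) (c :: S) D₁ (decide (Splits D c)) m := by
      intro h1
      rw [h.zero h1]
      exact potential_zero
    rcases hu with ⟨hf, rfl⟩ | ⟨hf, hu⟩
    · refine ⟨hs.slow_isDBWT hS hc h.isDBWT, countInv_slow hS hc h.isDBWT hcount hf, fun h16 => ?_⟩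
      by_cases h2 : δ = 1
      · exact hp h2
      · exact ((hpot h16).update (by omega) hS hc h.isDBWT hs (by have := h.one_le; omega)
          h.flag).1
    · refine ⟨hs.fast_isDBWT hS hc h.isDBWT hf hu, countInv_fast hS hc h.isDBWT hcount hf hu,
        fun h16 => ?_⟩
      by_cases h2 : δ = 1
      · exact hp h2
      · exact ((hpot h16).update (by omega) hS hc h.isDBWT hs (by have := h.one_le; omega)
          h.flag).2 D₁ hf hu
  obtain ⟨h2, h3⟩ := h1.2.1.balanceRun hα hS' h1.1 hb
  have h5 := suffix_succ hδ
  constructor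
  · omega
  · exact hδ
  · rw [h5]; exact h2
  · rw [h5]; exact hb.balanced
  · rw [h5]; exact h3
  · rw [h5]; exact hflag
  · have := h.one_le; omega
  · rw [h5]; exact fun h16 => (h1.2.2 h16).balanceRun h16 hS' h1.1 hb

lemma Run.inv (hT : IsText T) (hα : 2 ≤ α) {δ : ℕ} {D : DBWT} {b : Bool} {m : ℕ}
    (h : Run T α δ D b m) : RunInv T α δ D b m := by
  induction h with
  | init => exact runInv_init hT hα
  | slow δ D b m c s D' _ hδ hc hf hb ih =>
    subst hc
    exact ih.next hT hα hδ (Or.inl ⟨hf, rfl⟩) hb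
  | fast δ D b m c s D₁ D' _ hδ hc hf hu hb ih =>
    subst hc
    exact ih.next hT hα hδ (Or.inr ⟨hf, hu⟩) hb

lemma exists_run (hT : IsText T) (hα : 2 ≤ α) {δ : ℕ} (h1 : 1 ≤ δ) (h2 : δ ≤ T.length) :
    ∃ D b m, Run T α δ D b m := by
  induction δ, h1 using Nat.le_induction with
  | base => exact ⟨_, _, _, Run.init⟩
  | succ δ h1 ih =>
    obtain ⟨D, b, m, h⟩ := ih (by omega)
    have hi := h.inv hT hα
    have hS := isText_suffix hT h1 hi.le
    have hc := dollar_lt_getD hT h1 h2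
    have hS' := isText_suffix hT (by omega : 1 ≤ δ + 1) h2
    have h5 := suffix_succ h2
    have ex : ∀ D₁, IsDBWT D₁ (bwt (suffix T (δ + 1))) →
        ∃ s D', BalanceRun (suffix T (δ + 1)) α D₁ s D' := fun D₁ h =>
      exists_balanceRun hS' hα _ D₁ h (Nat.le_add_left _ _)
    obtain ⟨A, B, A₁, B₁, hs⟩ := exists_setup hS hc hi.isDBWT
    by_cases hf : FastApplies D (T.getD (T.length - δ - 1) 0)
    · obtain ⟨D₁, hu⟩ := exists_fastUpdate hS hc hi.isDBWT hf b
      obtain ⟨s, D', hb⟩ := ex D₁ (by rw [h5]; exact hs.fast_isDBWT hS hc hi.isDBWT hf hu)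
      exact ⟨_, _, _, Run.fast δ D b m _ s D₁ D' h h2 rfl hf hu hb⟩
    · obtain ⟨s, D', hb⟩ := ex (slowUpdate D _) (by
        rw [h5]; exact hs.slow_isDBWT hS hc hi.isDBWT)
      exact ⟨_, _, _, Run.slow δ D b m _ s D' h h2 rfl hf hb⟩

lemma suffix_self : suffix T T.length = T := by simp [suffix]

/-- The bounds on the number of repetitions and on the number of splits. -/
lemma run_bounds (hT : IsText T) (hα : 2 ≤ α) {D : DBWT} {b : Bool} {m : ℕ}
    (h : Run T α T.length D b m) :
    IsDBWT D (bwt T) ∧ Balanced T D α ∧ D.length ≤ numRuns (bwt T) + m ∧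
    (16 ≤ α → (m : ℚ) ≤ 2 * (numRuns (bwt T) : ℚ) / (((⌈(α : ℚ) / 2⌉ : ℤ) : ℚ) - 7)) := by
  have hi := h.inv hT hα
  have h1 := hi.isDBWT
  have h2 := hi.balanced
  have h3 := hi.count
  have h4 := hi.pot
  rw [suffix_self] at h1 h2 h3 h4
  refine ⟨h1, h2, h3.length_le hT, fun h16 => ?_⟩
  have h5 := (h4 h16).le hT h1
  have h6 := h3.length_le hT
  have h7 : (⌈(α : ℚ) / 2⌉ : ℤ) = (((α + 1) / 2 : ℕ) : ℤ) := by
    rw [Int.ceil_eq_iff]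
    have e1 : 2 * ((α + 1) / 2) ≤ α + 1 := by omega
    have e2 : α ≤ 2 * ((α + 1) / 2) := by omega
    have e1' : (2 : ℚ) * ((α + 1) / 2 : ℕ) ≤ α + 1 := by exact_mod_cast e1
    have e2' : (α : ℚ) ≤ 2 * ((α + 1) / 2 : ℕ) := by exact_mod_cast e2
    constructor
    · push_cast only [Int.cast_natCast]
      linarith
    · push_cast only [Int.cast_natCast]
      linarith
  obtain ⟨H, hH⟩ : ∃ H, (α + 1) / 2 = H + 8 := ⟨(α + 1) / 2 - 8, by omega⟩
  rw [h7, hH]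
  rw [hH] at h5
  have h8 : (H + 1) * m ≤ 2 * numRuns (bwt T) := by grind
  rw [le_div_iff₀ (by push_cast; grind)]
  have h9 : ((H + 1) * m : ℚ) ≤ 2 * numRuns (bwt T) := by exact_mod_cast h8
  push_cast
  linarith

end

end RComp


namespace RComp

/-! ### Programs -/

section

variable {W : ℕ} {P P' : Program} {σ : State} {n n' : ℕ} {Q R : State → Prop}

/-- The program halts after at most `n` steps in a state that satisfies `Q`. -/
def Runs (W : ℕ) (P : Program) (σ : State) (n : ℕ) (Q : State → Prop) : Prop :=
  ∃ t σ', Exec W P σ t σ' ∧ t ≤ n ∧ Q σ'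

lemma Runs.mono (h : Runs W P σ n Q) (hn : n ≤ n') (hQ : ∀ σ', Q σ' → R σ') :
    Runs W P σ n' R := by
  obtain ⟨t, σ', h1, h2, h3⟩ := h
  exact ⟨t, σ', h1, h2.trans hn, hQ σ' h3⟩

lemma Runs.le (h : Runs W P σ n Q) (hn : n ≤ n' := by omega) : Runs W P σ n' Q :=
  h.mono hn fun _ h => h

lemma Runs.seq (h : Runs W P σ n R) (h' : ∀ σ', R σ' → Runs W P' σ' n' Q) :
    Runs W (.seq P P') σ (n + n') Q := by
  obtain ⟨t, σ', h1, h2, h3⟩ := h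
  obtain ⟨t', σ'', h4, h5, h6⟩ := h' σ' h3
  exact ⟨t + t', σ'', .seq _ _ _ _ _ _ _ h1 h4, by omega, h6⟩

lemma Runs.ite {b : Test} (h : b.Holds σ → Runs W P σ n Q) (h' : ¬ b.Holds σ → Runs W P' σ n Q) :
    Runs W (.ite b P P') σ (n + 1) Q := by
  by_cases hb : b.Holds σ
  · obtain ⟨t, σ', h1, h2, h3⟩ := h hb
    exact ⟨t + 1, σ', .iteTrue _ _ _ _ _ _ hb h1, by omega, h3⟩
  · obtain ⟨t, σ', h1, h2, h3⟩ := h' hb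
    exact ⟨t + 1, σ', .iteFalse _ _ _ _ _ _ hb h1, by omega, h3⟩

lemma Runs.skip (h : Q σ) : Runs W .skip σ 0 Q := ⟨0, σ, .skip σ, le_rfl, h⟩

lemma Runs.loopDone {b : Test} (hb : ¬ b.Holds σ) (h : Q σ) : Runs W (.loop b P) σ 1 Q :=
  ⟨1, σ, .loopDone _ _ _ hb, le_rfl, h⟩

lemma Runs.loopStep {b : Test} (hb : b.Holds σ) (h : Runs W P σ n R)
    (h' : ∀ σ', R σ' → Runs W (.loop b P) σ' n' Q) : Runs W (.loop b P) σ (n + n' + 1) Q := by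
  obtain ⟨t, σ', h1, h2, h3⟩ := h
  obtain ⟨t', σ'', h4, h5, h6⟩ := h' σ' h3
  exact ⟨t + t' + 1, σ'', .loopStep _ _ _ _ _ _ _ hb h1 h4, by omega, h6⟩

/-- A sequence of instructions. -/
def blk : List Instr → Program
  | [] => .skip
  | i :: l => .seq (.instr i) (blk l)

def runAll (W : ℕ) : List Instr → State → State
  | [], σ => σ
  | i :: l, σ => runAll W l (i.run W σ)

attribute [simp] runAll Instr.run State.setReg

/-- The instruction changes no register below `N`. -/
def Instr.above (N : ℕ) : Instr → Bool
  | .const d _ | .copy d _ | .add d _ _ | .sub d _ _ | .load d _ _ | .omLess d _ _ | .btMem d _ =>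
    N ≤ d
  | _ => true

lemma runAll_reg {l : List Instr} {N r : ℕ} (hr : r < N)
    (h : l.all (Instr.above N) = true := by rfl) : (runAll W l σ).reg r = σ.reg r := by
  induction l generalizing σ with
  | nil => rfl
  | cons i l ih =>
    rw [List.all_cons, Bool.and_eq_true] at h
    rw [runAll, ih h.2]
    cases i <;> simp_all [Instr.above, Function.update_apply] <;> omega

lemma runs_blk {l : List Instr} (h : Q (runAll W l σ)) : Runs W (blk l) σ l.length Q := by
  induction l generalizing σ with
  | nil => exact Runs.skip h
  | cons i l ih =>
    rw [List.length_cons, add_comm]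
    exact Runs.seq (R := fun σ' => σ' = i.run W σ) ⟨1, _, .instr i σ, le_rfl, rfl⟩
      (fun σ' h' => by subst h'; exact ih h)

end

/-! ### Memory -/

/-- The memory after a write access. -/
def upd (h : ℕ → ℕ → ℕ) (a f v : ℕ) : ℕ → ℕ → ℕ := fun p q => if p = a ∧ q = f then v else h p q

lemma run_store (W x f y : ℕ) (σ : State) :
    (Instr.store x f y).run W σ = { σ with heap := upd σ.heap (σ.reg x) f (σ.reg y) } := rfl

@[grind =] lemma upd_apply (h : ℕ → ℕ → ℕ) (a f v p q : ℕ) :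
    upd h a f v p q = if p = a ∧ q = f then v else h p q := rfl

@[simp] lemma upd_same (h : ℕ → ℕ → ℕ) (a f v : ℕ) : upd h a f v a f = v := by simp [upd]

lemma upd_addr (h : ℕ → ℕ → ℕ) {a p : ℕ} (f v q : ℕ) (hp : p ≠ a) :
    upd h a f v p q = h p q := by simp [upd, hp]

lemma upd_field (h : ℕ → ℕ → ℕ) {f q : ℕ} (a v p : ℕ) (hq : q ≠ f) :
    upd h a f v p q = h p q := by simp [upd, hq]

attribute [grind =] fChar fLen fPrevU fNextU fPrevV fNextV fEL fBL fEF fBF fArrU fArrV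

/-- Fields of a record, for `U` (`false`) and for `V` (`true`). -/
@[grind =] def fn (s : Bool) : ℕ := bif s then fNextV else fNextU
@[grind =] def fp (s : Bool) : ℕ := bif s then fPrevV else fPrevU
@[grind =] def fe (s : Bool) : ℕ := bif s then fEF else fEL
@[grind =] def fb (s : Bool) : ℕ := bif s then fBF else fBL

/-- Registers that are not used for temporary values, order and B-tree are unchanged. -/
def Frame (σ σ' : State) : Prop :=
  (∀ r < 40, σ'.reg r = σ.reg r) ∧ σ'.order = σ.order ∧ σ'.btree = σ.btree

lemma Frame.reg {σ σ' : State} (h : Frame σ σ') (r : ℕ) (hr : r < 40 := by decide) :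
    σ'.reg r = σ.reg r := h.1 r hr

lemma Frame.trans {σ σ' σ'' : State} (h : Frame σ σ') (h' : Frame σ' σ'') : Frame σ σ'' :=
  ⟨fun r hr => (h'.1 r hr).trans (h.1 r hr), h'.2.1.trans h.2.1, h'.2.2.trans h.2.2⟩

lemma Frame.refl (σ : State) : Frame σ σ := ⟨fun _ _ => rfl, rfl, rfl⟩

/-! ### Linked lists

The record `0` closes the lists to cycles. -/

/-- The list with its sentinels is doubly linked. -/
def Links (h : ℕ → ℕ → ℕ) (s : Bool) (l : List ℕ) : Prop :=
  List.IsChain (fun x y => h x (fn s) = y ∧ h y (fp s) = x) (0 :: (l ++ [0]))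

lemma chain_congr {h h' : ℕ → ℕ → ℕ} {s : Bool} {L : List ℕ}
    (hL : List.IsChain (fun x y => h x (fn s) = y ∧ h y (fp s) = x) L)
    (h1 : ∀ a ∈ L.dropLast, h' a (fn s) = h a (fn s))
    (h2 : ∀ b ∈ L.tail, h' b (fp s) = h b (fp s)) :
    List.IsChain (fun x y => h' x (fn s) = y ∧ h' y (fp s) = x) L := by
  induction L with
  | nil => exact List.isChain_nil
  | cons a L ih =>
    cases L with
    | nil => exact List.isChain_singleton _
    | cons b L =>
      rw [List.isChain_cons_cons] at hL ⊢
      refine ⟨⟨?_, ?_⟩, ih hL.2 (fun a ha => h1 a ?_) (fun b hb => h2 b ?_)⟩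
      · rw [h1 a (by simp)]; exact hL.1.1
      · rw [h2 b (by simp)]; exact hL.1.2
      · rw [List.dropLast_cons_of_ne_nil (by simp)]; exact List.mem_cons_of_mem _ ha
      · exact List.mem_of_mem_tail hb

lemma Links.congr {h h' : ℕ → ℕ → ℕ} {s : Bool} {l : List ℕ} (hl : Links h s l)
    (h1 : ∀ a, h' a (fn s) = h a (fn s)) (h2 : ∀ a, h' a (fp s) = h a (fp s)) : Links h' s l :=
  chain_congr hl (fun a _ => h1 a) (fun a _ => h2 a)

lemma Links.append_iff {h : ℕ → ℕ → ℕ} {s : Bool} {X Y A B : List ℕ} {x y : ℕ}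
    (hX : 0 :: X = A ++ [x]) (hY : Y ++ [0] = y :: B) :
    Links h s (X ++ Y) ↔ List.IsChain (fun x y => h x (fn s) = y ∧ h y (fp s) = x) (0 :: X) ∧
      (h x (fn s) = y ∧ h y (fp s) = x) ∧
      List.IsChain (fun x y => h x (fn s) = y ∧ h y (fp s) = x) (Y ++ [0]) := by
  rw [Links, List.append_assoc, ← List.cons_append, hX, hY, List.append_assoc,
    List.singleton_append, List.isChain_append_cons_cons]

/-- Links between consecutive records. -/
lemma Links.next {h : ℕ → ℕ → ℕ} {s : Bool} {X Y A B : List ℕ} {x y : ℕ} (hl : Links h s (X ++ Y))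
    (hX : 0 :: X = A ++ [x]) (hY : Y ++ [0] = y :: B) : h x (fn s) = y ∧ h y (fp s) = x :=
  ((Links.append_iff hX hY).1 hl).2.1

/-- The memory after the insertion of `x` behind `u`. -/
def linkAfter (h : ℕ → ℕ → ℕ) (s : Bool) (u x : ℕ) : ℕ → ℕ → ℕ :=
  upd (upd (upd (upd h u (fn s) x) x (fp s) u) x (fn s) (h u (fn s))) (h u (fn s)) (fp s) x

/-- The memory after the deletion of `y`. -/
def unlink (h : ℕ → ℕ → ℕ) (s : Bool) (y : ℕ) : ℕ → ℕ → ℕ :=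
  upd (upd h (h y (fp s)) (fn s) (h y (fn s))) (h y (fn s)) (fp s) (h y (fp s))

@[grind =]
lemma linkAfter_field {h : ℕ → ℕ → ℕ} {s : Bool} {u x a f : ℕ} (h1 : f ≠ fn s) (h2 : f ≠ fp s) :
    linkAfter h s u x a f = h a f := by
  simp [linkAfter, upd_field _ _ _ _ h1, upd_field _ _ _ _ h2]

@[grind =]
lemma unlink_field {h : ℕ → ℕ → ℕ} {s : Bool} {y a f : ℕ} (h1 : f ≠ fn s) (h2 : f ≠ fp s) :
    unlink h s y a f = h a f := by
  simp [unlink, upd_field _ _ _ _ h1, upd_field _ _ _ _ h2]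

lemma fn_ne_fp (s : Bool) : fn s ≠ fp s := by cases s <;> decide

lemma exists_concat_zero (X : List ℕ) : ∃ A x, 0 :: X = A ++ [x] := by
  rcases List.eq_nil_or_concat (0 :: X) with h | ⟨A, x, h⟩
  · simp at h
  · exact ⟨A, x, by simpa using h⟩

lemma exists_cons_zero (Y : List ℕ) : ∃ B y, Y ++ [0] = y :: B := by
  cases Y with
  | nil => exact ⟨[], 0, rfl⟩
  | cons y Y => exact ⟨Y ++ [0], y, rfl⟩

lemma ends_unique {X Y A B : List ℕ} {x y : ℕ} (hX : 0 :: X = A ++ [x]) (hY : Y ++ [0] = y :: B)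
    (hn : (X ++ Y).Nodup) (h0 : 0 ∉ X ++ Y) :
    (∀ a ∈ (0 :: X).dropLast, a ≠ x) ∧ (∀ a ∈ (Y ++ [0]).tail, a ≠ y) ∧ (∀ a ∈ X, a ≠ y) ∧
      (∀ a ∈ Y, a ≠ x) ∧ x ∈ 0 :: X ∧ y ∈ Y ++ [0] := by
  rw [hX, hY]
  have h1 : (A ++ [x]).Nodup := by grind
  have h2 : (y :: B).Nodup := by grind
  have h3 : ∀ a, a ∈ A ++ [x] ↔ a ∈ 0 :: X := by grind
  have h4 : ∀ a, a ∈ y :: B ↔ a ∈ Y ++ [0] := by grind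
  grind

lemma Links.insert {h : ℕ → ℕ → ℕ} {s : Bool} {X Y A : List ℕ} {u x : ℕ}
    (hl : Links h s (X ++ Y)) (hX : 0 :: X = A ++ [u]) (hx : x ∉ X ++ Y) (hx0 : x ≠ 0)
    (hn : (X ++ Y).Nodup) (h0 : 0 ∉ X ++ Y) : Links (linkAfter h s u x) s (X ++ x :: Y) := by
  obtain ⟨B, n, hY⟩ := exists_cons_zero Y
  obtain ⟨g1, g2, g3, g4, g5, g6⟩ := ends_unique hX hY hn h0
  have hf := fn_ne_fp s
  obtain ⟨l1, ⟨l2, -⟩, l3⟩ := (Links.append_iff hX hY).1 hl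
  refine (Links.append_iff hX (List.cons_append ..)).2 ⟨chain_congr l1 ?_ ?_, ?_, ?_⟩
  · intro a ha
    have := List.mem_of_mem_dropLast ha
    simp only [linkAfter, upd]; grind
  · intro a ha
    have := List.mem_of_mem_tail ha
    simp only [linkAfter, upd]; grind
  · simp only [linkAfter, upd]; grind
  · rw [List.cons_append, hY, List.isChain_cons_cons, ← hY]
    refine ⟨?_, chain_congr l3 ?_ ?_⟩
    · simp only [linkAfter, upd]; grind
    · rw [List.dropLast_concat]
      simp only [linkAfter, upd]; grind
    · intro a ha
      have := List.mem_of_mem_tail ha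
      simp only [linkAfter, upd]; grind

lemma Links.erase {h : ℕ → ℕ → ℕ} {s : Bool} {X Y : List ℕ} {y : ℕ}
    (hl : Links h s (X ++ y :: Y)) (hn : (X ++ y :: Y).Nodup) (h0 : 0 ∉ X ++ y :: Y) :
    Links (unlink h s y) s (X ++ Y) := by
  obtain ⟨A, p, hX⟩ := exists_concat_zero X
  obtain ⟨B, n, hY⟩ := exists_cons_zero Y
  obtain ⟨g1, g2, g3, g4, g5, g6⟩ := ends_unique hX hY (by grind) (by grind)
  have hf := fn_ne_fp s
  obtain ⟨l1, ⟨-, l2⟩, l3⟩ := (Links.append_iff hX (List.cons_append ..)).1 hl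
  rw [List.cons_append, hY, List.isChain_cons_cons, ← hY] at l3
  refine (Links.append_iff hX hY).2 ⟨chain_congr l1 ?_ ?_, ?_, chain_congr l3.2 ?_ ?_⟩ <;>
    simp only [unlink, upd] <;> grind

/-! ### Subprograms

Arguments are passed in the registers from 30 on, the registers from 40 on hold temporary values.
The registers 11 and 12 hold the constants 0 and 1. -/

section

variable {W : ℕ} {σ : State} {s : Bool}

def linkProg (s : Bool) : Program :=
  blk [.load 40 30 (fn s), .store 30 (fn s) 31, .store 31 (fp s) 30, .store 31 (fn s) 40,
    .store 40 (fp s) 31]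

lemma runs_link : Runs W (linkProg s) σ 5 (fun σ' => Frame σ σ' ∧
    σ'.heap = linkAfter σ.heap s (σ.reg 30) (σ.reg 31)) := by
  refine runs_blk ⟨⟨fun r hr => runAll_reg hr, rfl, rfl⟩, ?_⟩
  · simp [linkAfter]; rfl

def unlinkProg (s : Bool) : Program :=
  blk [.load 40 30 (fp s), .load 41 30 (fn s), .store 40 (fn s) 41, .store 41 (fp s) 40]

lemma runs_unlink : Runs W (unlinkProg s) σ 4 (fun σ' => Frame σ σ' ∧
    σ'.heap = unlink σ.heap s (σ.reg 30)) := by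
  refine runs_blk ⟨⟨fun r hr => runAll_reg hr, rfl, rfl⟩, ?_⟩
  · simp [unlink]; rfl

/-- The first node of the other list that starts in the interval of the node in register 48, and
its edge. -/
def firstProg (s : Bool) : Program :=
  .seq (blk [.load 40 48 (fe s), .load 43 48 (fb s)])
    (.seq (.ite (.eq 43 11) .skip (blk [.load 40 40 (fn !s)])) (blk [.load 41 40 (fe !s)]))

lemma runs_first (h0 : σ.reg 11 = 0) : Runs W (firstProg s) σ 5 (fun σ' => Frame σ σ' ∧
    σ'.heap = σ.heap ∧ σ'.reg 40 = (if σ.heap (σ.reg 48) (fb s) = 0 then σ.heap (σ.reg 48) (fe s)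
      else σ.heap (σ.heap (σ.reg 48) (fe s)) (fn !s)) ∧
    σ'.reg 41 = σ.heap (σ'.reg 40) (fe !s) ∧ σ'.reg 46 = σ.reg 46) := by
  refine Runs.seq (n := 2) (n' := 3) (R := fun σ' => Frame σ σ' ∧ σ'.heap = σ.heap ∧
    σ'.reg 40 = σ.heap (σ.reg 48) (fe s) ∧ σ'.reg 43 = σ.heap (σ.reg 48) (fb s) ∧
    σ'.reg 46 = σ.reg 46)
    (runs_blk ?_) ?_
  · refine ⟨⟨fun r hr => ?_, rfl, rfl⟩, rfl, ?_, ?_, ?_⟩ <;>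
      simp [Function.update_apply]
    simp [(show r ≠ 40 by omega), (show r ≠ 43 by omega)]
  · rintro σ₁ ⟨hf, hh, h1, h2, h3⟩
    refine Runs.seq (n := 2) (n' := 1) (R := fun σ' => Frame σ σ' ∧ σ'.heap = σ.heap ∧
      σ'.reg 40 = (if σ.heap (σ.reg 48) (fb s) = 0 then σ.heap (σ.reg 48) (fe s)
      else σ.heap (σ.heap (σ.reg 48) (fe s)) (fn !s)) ∧ σ'.reg 46 = σ.reg 46)
      (Runs.ite (n := 1) ?_ ?_) ?_
    · intro hb
      simp only [Test.Holds] at hb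
      rw [hf.reg 11, h0, h2] at hb
      exact (Runs.skip ⟨hf, hh, by rw [h1, if_pos hb], h3⟩).le
    · intro hb
      simp only [Test.Holds] at hb
      rw [hf.reg 11, h0, h2] at hb
      refine runs_blk ⟨hf.trans ⟨fun r hr => runAll_reg hr, rfl, rfl⟩, hh, ?_, ?_⟩
      · simp [hh, h1, hb]
      · simp [h3]
    · rintro σ₂ ⟨hf, hh, h1, h3⟩
      refine runs_blk ⟨hf.trans ⟨fun r hr => ?_, rfl, rfl⟩, hh, ?_, ?_, ?_⟩ <;>
        simp [Function.update_apply, h1, h3, hh]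
      omega

/-- The memory after the edges of the nodes of `M` have been changed. -/
def redir (h : ℕ → ℕ → ℕ) (s : Bool) (M : List ℕ) (x ra rs : ℕ) : ℕ → ℕ → ℕ := fun p q =>
  if p ∈ M ∧ q = fe s then x else if p ∈ M ∧ q = fb s then h p (fb s) + ra - rs else h p q

lemma redir_field {h : ℕ → ℕ → ℕ} {M : List ℕ} {x ra rs a f : ℕ} (h1 : f ≠ fe s)
    (h2 : f ≠ fb s) : redir h s M x ra rs a f = h a f := by simp [redir, h1, h2]

lemma redir_addr {h : ℕ → ℕ → ℕ} {M : List ℕ} {x ra rs a f : ℕ} (h1 : a ∉ M) :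
    redir h s M x ra rs a f = h a f := by simp [redir, h1]

lemma fe_ne_fb (s : Bool) : fe s ≠ fb s := by cases s <;> decide
lemma fn_ne_fe (s t : Bool) : fn s ≠ fe t := by cases s <;> cases t <;> decide
lemma fn_ne_fb (s t : Bool) : fn s ≠ fb t := by cases s <;> cases t <;> decide

def redirectProg (s : Bool) : Program :=
  .loop (.eq 41 30) (blk [.store 40 (fe s) 31, .load 42 40 (fb s), .add 42 42 32, .sub 42 42 33,
    .store 40 (fb s) 42, .load 40 40 (fn s), .load 41 40 (fe s)])

lemma runs_redirect {M B : List ℕ} {v w : ℕ}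
    (hM : M.Nodup) (hB : M ++ [w] = v :: B)
    (hch : List.IsChain (fun x y => σ.heap x (fn s) = y) (M ++ [w]))
    (h40 : σ.reg 40 = v) (h41 : σ.reg 41 = σ.heap v (fe s))
    (hin : ∀ p ∈ M, σ.heap p (fe s) = σ.reg 30) (hout : σ.heap w (fe s) ≠ σ.reg 30)
    (hW : ∀ p ∈ M, σ.heap p (fb s) + σ.reg 32 < W) :
    Runs W (redirectProg s) σ (8 * M.length + 1) (fun σ' => Frame σ σ' ∧
      σ'.heap = redir σ.heap s M (σ.reg 31) (σ.reg 32) (σ.reg 33)) := by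
  induction M generalizing σ v B with
  | nil =>
    obtain ⟨rfl, rfl⟩ : w = v ∧ [] = B := by simpa using hB
    refine Runs.loopDone ?_ ⟨Frame.refl σ, ?_⟩
    · simp only [Test.Holds]; rw [h41]; exact hout
    · funext p q; simp [redir]
  | cons p M ih =>
    obtain ⟨rfl, rfl⟩ : p = v ∧ M ++ [w] = B := by simpa using hB
    obtain ⟨B', v', hB'⟩ : ∃ B' v', M ++ [w] = v' :: B' := by
      cases M with
      | nil => exact ⟨[], w, rfl⟩
      | cons a M => exact ⟨M ++ [w], a, rfl⟩
    have hpM := (List.nodup_cons.1 hM).1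
    have hwp : w ≠ p := by
      rintro rfl
      exact hout (hin w (by simp))
    have hnext : σ.heap p (fn s) = v' := by
      rw [List.cons_append, hB', List.isChain_cons_cons] at hch
      exact hch.1
    have e1 := fe_ne_fb s
    have e2 := fn_ne_fe s s
    have e3 := fn_ne_fb s s
    have hv'p : v' ≠ p := by
      have : v' ∈ M ++ [w] := by rw [hB']; simp
      rcases List.mem_append.1 this with h | h
      · exact fun h' => hpM (h' ▸ h)
      · simp at h; rw [h]; exact hwp
    have hWp := hW p (by simp)
    refine (Runs.loopStep (n := 7) (n' := 8 * M.length + 1)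
      (R := fun σ' => Frame σ σ' ∧ σ'.heap = redir σ.heap s [p] (σ.reg 31) (σ.reg 32) (σ.reg 33) ∧
        σ'.reg 40 = v' ∧ σ'.reg 41 = σ.heap v' (fe s)) ?_ (runs_blk ?_) ?_).le (by simp; omega)
    · simp only [Test.Holds]; rw [h41]; exact hin p (by simp)
    · refine ⟨⟨fun r hr => runAll_reg hr, rfl, rfl⟩, ?_, ?_, ?_⟩
      · funext a f
        simp only [runAll, Instr.run, State.setReg, Function.update_apply, redir, h40]
        by_cases ha : a = p <;> by_cases hf : f = fe s <;> by_cases hf' : f = fb s <;>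
          simp_all [Nat.mod_eq_of_lt hWp, e1.symm]
      · simp [h40, e2, e3, hnext]
      · simp [h40, e2, e3, hnext, hv'p]
    · rintro σ₁ ⟨hf, hh, h1, h2⟩
      have hfr : ∀ a ∈ M ++ [w], ∀ f, σ₁.heap a f = σ.heap a f := by
        intro a ha f
        rw [hh]
        apply redir_addr
        rcases List.mem_append.1 ha with h | h
        · rw [List.mem_singleton]; rintro rfl; exact hpM h
        · simp at h ⊢; rw [h]; exact hwp
      refine (ih (List.nodup_cons.1 hM).2 hB' ?_ h1 ?_ ?_ ?_ ?_).mono le_rfl ?_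
      · rw [List.cons_append, hB', List.isChain_cons_cons] at hch
        rw [hB']
        refine hch.2.imp_of_mem_imp fun x y hx _ h => ?_
        rw [hfr x (hB' ▸ hx), h]
      · rw [h2, hfr v' (by rw [hB']; simp)]
      · intro q hq
        rw [hfr q (by simp [hq]), hf.reg 30, hin q (by simp [hq])]
      · rw [hfr w (by simp), hf.reg 30]; exact hout
      · intro q hq
        rw [hfr q (by simp [hq]), hf.reg 32]
        exact hW q (by simp [hq])
      · rintro σ₂ ⟨hf', hh'⟩
        refine ⟨hf.trans hf', ?_⟩
        rw [hh', hf.reg 31, hf.reg 32, hf.reg 33]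
        funext a f
        rw [hh]
        by_cases ha : a = p
        · subst ha
          simp only [redir]
          simp [hpM]
        · simp only [redir]
          simp [ha]

def countProg (s : Bool) : Program :=
  .loop (.eq 41 30) (blk [.add 46 46 12, .load 40 40 (fn s), .load 41 40 (fe s)])

lemma runs_count {M B : List ℕ} {v w : ℕ} (hB : M ++ [w] = v :: B)
    (hch : List.IsChain (fun x y => σ.heap x (fn s) = y) (M ++ [w]))
    (h40 : σ.reg 40 = v) (h41 : σ.reg 41 = σ.heap v (fe s)) (h12 : σ.reg 12 = 1)
    (hin : ∀ p ∈ M, σ.heap p (fe s) = σ.reg 30) (hout : σ.heap w (fe s) ≠ σ.reg 30)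
    (hW : σ.reg 46 + M.length < W) :
    Runs W (countProg s) σ (4 * M.length + 1) (fun σ' => Frame σ σ' ∧
      σ'.heap = σ.heap ∧ σ'.reg 46 = σ.reg 46 + M.length) := by
  induction M generalizing σ v B with
  | nil =>
    obtain ⟨rfl, rfl⟩ : w = v ∧ [] = B := by simpa using hB
    refine Runs.loopDone ?_ ⟨Frame.refl σ, rfl, rfl⟩
    simp only [Test.Holds]; rw [h41]; exact hout
  | cons p M ih =>
    obtain ⟨rfl, rfl⟩ : p = v ∧ M ++ [w] = B := by simpa using hB
    obtain ⟨B', v', hB'⟩ : ∃ B' v', M ++ [w] = v' :: B' := by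
      cases M with
      | nil => exact ⟨[], w, rfl⟩
      | cons a M => exact ⟨M ++ [w], a, rfl⟩
    rw [List.cons_append, hB', List.isChain_cons_cons] at hch
    simp only [List.length_cons] at hW
    refine (Runs.loopStep (n := 3) (n' := 4 * M.length + 1)
      (R := fun σ' => Frame σ σ' ∧ σ'.heap = σ.heap ∧
        σ'.reg 40 = v' ∧ σ'.reg 41 = σ.heap v' (fe s) ∧ σ'.reg 46 = σ.reg 46 + 1)
      ?_ (runs_blk ?_) ?_).le (by simp; omega)
    · simp only [Test.Holds]; rw [h41]; exact hin p (by simp)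
    · refine ⟨⟨fun r hr => runAll_reg hr, rfl, rfl⟩, rfl, ?_, ?_, ?_⟩ <;>
        simp [h40, hch.1, h12]
      · exact Nat.mod_eq_of_lt (by omega)
    · rintro σ₁ ⟨hf, hh, h1, h2, h3⟩
      refine (ih hB' ?_ h1 ?_ ?_ ?_ ?_ ?_).mono le_rfl ?_
      · rw [hh, hB']; exact hch.2
      · rw [h2, hh]
      · rw [hf.reg 12, h12]
      · intro q hq
        rw [hh, hf.reg 30, hin q (by simp [hq])]
      · rw [hh, hf.reg 30]; exact hout
      · omega
      · rintro σ₂ ⟨hf', hh', h4⟩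
        exact ⟨hf.trans hf', by rw [hh', hh], by rw [h4, h3, List.length_cons]; omega⟩

/-- Walks to the node that contains a given offset, increased by one in register 44. -/
def findProg (s : Bool) : Program :=
  .loop (.lt 45 44) (blk [.sub 44 44 45, .load 40 40 (fn s), .load 45 40 fLen])

lemma runs_find {M : List (ℕ × ℕ)} {B : List ℕ} {v w o : ℕ} (hB : M.map Prod.fst ++ [w] = v :: B)
    (hch : List.IsChain (fun x y => σ.heap x (fn s) = y) (M.map Prod.fst ++ [w]))
    (h40 : σ.reg 40 = v) (h45 : σ.reg 45 = σ.heap v fLen) (h44 : σ.reg 44 = width M + o + 1)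
    (hlen : ∀ p ∈ M, σ.heap p.1 fLen = p.2) (ho : o < σ.heap w fLen) :
    Runs W (findProg s) σ (4 * M.length + 1) (fun σ' => Frame σ σ' ∧
      σ'.heap = σ.heap ∧ σ'.reg 40 = w ∧ σ'.reg 44 = o + 1) := by
  induction M generalizing σ v B with
  | nil =>
    obtain ⟨rfl, rfl⟩ : w = v ∧ [] = B := by simpa using hB
    refine Runs.loopDone ?_ ⟨Frame.refl σ, rfl, h40, by simpa using h44⟩
    simp only [Test.Holds]; rw [h45, h44]; simp; omega
  | cons p M ih =>
    obtain ⟨rfl, rfl⟩ : p.1 = v ∧ M.map Prod.fst ++ [w] = B := by simpa using hB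
    obtain ⟨B', v', hB'⟩ : ∃ B' v', M.map Prod.fst ++ [w] = v' :: B' := by
      cases M with
      | nil => exact ⟨[], w, rfl⟩
      | cons a M => exact ⟨M.map Prod.fst ++ [w], a.1, rfl⟩
    rw [List.map_cons, List.cons_append, hB', List.isChain_cons_cons] at hch
    have hp := hlen p (by simp)
    rw [width_cons] at h44
    refine (Runs.loopStep (n := 3) (n' := 4 * M.length + 1)
      (R := fun σ' => Frame σ σ' ∧ σ'.heap = σ.heap ∧
        σ'.reg 40 = v' ∧ σ'.reg 45 = σ.heap v' fLen ∧ σ'.reg 44 = width M + o + 1)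
      ?_ (runs_blk ?_) ?_).le (by simp; omega)
    · simp only [Test.Holds]; rw [h45, h44, hp]; omega
    · refine ⟨⟨fun r hr => runAll_reg hr, rfl, rfl⟩, rfl, ?_, ?_, ?_⟩ <;>
        simp [h40, hch.1, h44, h45, hp]
      · omega
    · rintro σ₁ ⟨hf, hh, h1, h2, h3⟩
      refine (ih hB' ?_ h1 ?_ h3 ?_ ?_).mono le_rfl ?_
      · rw [hh, hB']; exact hch.2
      · rw [h2, hh]
      · intro q hq
        rw [hh, hlen q (by simp [hq])]
      · rw [hh]; exact ho
      · rintro σ₂ ⟨hf', hh', h4⟩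
        exact ⟨hf.trans hf', by rw [hh', hh], h4⟩

end

end RComp


namespace RComp

/-! ### Edges between two tilings -/

/-- Every tile of `T` stores the tile of `T'` that contains its starting position, and the
offset. -/
def Edges (h : ℕ → ℕ → ℕ) (e b : ℕ) (T T' : List (ℕ × ℕ)) : Prop :=
  ∀ p ∈ ent 0 T, ∀ q ∈ ent 0 T', q.1 ≤ p.1 → p.1 < q.1 + q.2.2 →
    h p.2.1 e = q.2.1 ∧ h p.2.1 b = p.1 - q.1

/-- The records of a tiling. -/
def recs (T : List (ℕ × ℕ)) : List ℕ := T.map Prod.fst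

@[simp] lemma recs_nil : recs [] = [] := rfl
@[simp] lemma recs_cons (p : ℕ × ℕ) (T : List (ℕ × ℕ)) : recs (p :: T) = p.1 :: recs T := rfl
@[simp] lemma recs_append (T T' : List (ℕ × ℕ)) : recs (T ++ T') = recs T ++ recs T' := by
  simp [recs]

lemma mem_recs_of_ent {s : ℕ} {T : List (ℕ × ℕ)} {e : ℕ × ℕ × ℕ} (h : e ∈ ent s T) :
    e.2.1 ∈ recs T := by
  obtain ⟨X, Y, rfl, -⟩ := mem_ent.1 h
  simp

lemma exists_ent_of_mem_recs {s x : ℕ} {T : List (ℕ × ℕ)} (h : x ∈ recs T) :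
    ∃ e ∈ ent s T, e.2.1 = x := by
  obtain ⟨p, hp, rfl⟩ := List.mem_map.1 h
  grind [ent_map_snd]

lemma ent_eq_of_rec {s : ℕ} {T : List (ℕ × ℕ)} (hn : (recs T).Nodup) {e e' : ℕ × ℕ × ℕ}
    (he : e ∈ ent s T) (he' : e' ∈ ent s T) (h : e.2.1 = e'.2.1) : e = e' := by
    grind [recs, ent_map_snd, List.inj_on_of_nodup_map]

lemma ent_pos {s : ℕ} {T : List (ℕ × ℕ)} (hpos : ∀ p ∈ T, 0 < p.2) {e : ℕ × ℕ × ℕ}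
    (he : e ∈ ent s T) : 0 < e.2.2 := by grind [mem_ent]

/-- A tiling is divided by a position. -/
lemma exists_parts (T : List (ℕ × ℕ)) (s p : ℕ) :
    ∃ P R, T = P ++ R ∧ (∀ e ∈ ent s P, e.1 < p) ∧ ∀ e ∈ ent (s + width P) R, p ≤ e.1 := by
  induction T generalizing s with
  | nil => simp_all
  | cons q T ih =>
    by_cases h : s < p
    · obtain ⟨P, R, h1, h2, h3⟩ := ih (s + q.2)
      refine ⟨q :: P, R, by rw [h1]; rfl, ?_, ?_⟩
      · intro e he
        rcases List.mem_cons.1 he with rfl | he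
        · exact h
        · exact h2 e he
      grind
    · refine ⟨[], q :: T, rfl, by simp, fun e he => ?_⟩
      have := (ent_le he).1
      grind

section

variable {h h' : ℕ → ℕ → ℕ} {s : Bool} {T T' X Y P M Q R : List (ℕ × ℕ)} {x y u l l₁ l₂ e b : ℕ}

lemma Edges.congr (hE : Edges h e b T T') (h1 : ∀ a ∈ recs T, h' a e = h a e)
    (h2 : ∀ a ∈ recs T, h' a b = h a b) : Edges h' e b T T' := by
  intro p hp q hq h3 h4
  rw [h1 _ (mem_recs_of_ent hp), h2 _ (mem_recs_of_ent hp)]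
  exact hE p hp q hq h3 h4

lemma Links.chain {X M Y B : List ℕ} {w : ℕ} (hl : Links h s (X ++ (M ++ Y)))
    (hY : Y ++ [0] = w :: B) : List.IsChain (fun x y => h x (fn s) = y) (M ++ [w]) := by
  have h1 : (M ++ [w]) <:+: 0 :: (X ++ (M ++ Y) ++ [0]) := by
    refine ⟨0 :: X, B, ?_⟩
    simp [hY]
  exact (List.IsChain.infix hl h1).imp fun _ _ h => h.1

/-- The first node that starts in or behind the interval of `y`. -/
lemma first_eq {B : List ℕ} {v : ℕ} (hT : T = X ++ (y, l) :: Y) (hT' : T' = P ++ R)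
    (hE : Edges h (fe s) (fb s) T T') (hl : Links h (!s) (recs T'))
    (hpos : ∀ p ∈ T', 0 < p.2) (hw : width X < width T')
    (hP : ∀ e ∈ ent 0 P, e.1 < width X) (hR : ∀ e ∈ ent (width P) R, width X ≤ e.1)
    (hv : recs R ++ [0] = v :: B) :
    (if h y (fb s) = 0 then h y (fe s) else h (h y (fe s)) (fn !s)) = v := by
  obtain ⟨q, hq, h1, h2⟩ := exists_ent (s := 0) (T := T') (Nat.zero_le (width X)) (by omega)
  obtain ⟨h3, h4⟩ := hE (width X, y, l) (by rw [hT]; simp) q hq h1 h2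
  simp only at h3 h4
  rw [h3, h4]
  have hq' := hq
  rw [hT', ent_append, List.mem_append, zero_add] at hq'
  split
  · rename_i h5
    rcases hq' with h6 | h6
    · have := hP q h6; omega
    · cases R with
      | nil => simp at h6
      | cons r R =>
        rw [ent_cons, List.mem_cons] at h6
        rcases h6 with rfl | h6
        · simp at hv; simp [hv.1]
        · have h7 := (ent_le h6).1
          have h8 := hR (width P, r) (by simp)
          grind
  · rename_i h5
    rcases hq' with h6 | h6
    · rcases List.eq_nil_or_concat P with rfl | ⟨P', r, rfl⟩
      · simp at h6
      · rw [List.concat_eq_append, ent_append, List.mem_append] at h6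
        rcases h6 with h6 | h6
        · have h7 := (ent_le h6).2
          have h8 := hP (width P', r) (by simp)
          grind
        · simp at h6
          rw [h6]
          rw [hT', recs_append] at hl
          exact (hl.next (A := 0 :: recs P') (x := r.1) (by simp) hv).1
    · have := hR q h6; omega

/-- A node that starts behind the interval of `u` is not connected with `u`. -/
lemma edge_out {B : List ℕ} {w : ℕ} (hT : T = X ++ (u, l) :: Y) (hT' : T' = P ++ Q)
    (hE : Edges h e b T' T) (hn : (recs T).Nodup) (h0 : 0 ∉ recs T) (hz : h 0 e = 0)
    (hw : width T' = width T) (hpos : ∀ p ∈ T', 0 < p.2)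
    (hQ : ∀ e ∈ ent (width P) Q, width X + l ≤ e.1) (hw' : recs Q ++ [0] = w :: B) : h w e ≠ u := by
  have hu : (width X, u, l) ∈ ent 0 T := by rw [hT]; simp
  cases Q with
  | nil => simp_all
  | cons r Q =>
    obtain rfl : r.1 = w := by simp_all
    have hr : (width P, r) ∈ ent 0 T' := by rw [hT']; simp
    have h1 := hQ (width P, r) (by simp)
    have h2 := (ent_le hr).2
    have h3 := hpos r (by rw [hT']; simp)
    obtain ⟨q, hq, h4, h5⟩ := exists_ent (s := 0) (T := T) (Nat.zero_le (width P)) (by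
      simp only at h2; omega)
    rw [(hE _ hr q hq h4 h5).1]
    grind [ent_eq_of_rec]

lemma ent_append_append {s : ℕ} (P M Q : List (ℕ × ℕ)) : ent s (P ++ (M ++ Q)) =
    ent s P ++ (ent (s + width P) M ++ ent (s + width P + width M) Q) := by
  rw [ent_append, ent_append]

lemma notMem_mid (hn : (recs (P ++ (M ++ Q))).Nodup) {p : ℕ}
    (hp : p ∈ recs P ∨ p ∈ recs Q) : p ∉ recs M := by grind [recs_append]

/-- Splitting a tile to which edges point. -/
lemma Edges.target_split (hE : Edges h (fe s) (fb s) T' (X ++ (u, l₁ + l₂) :: Y))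
    (hT' : T' = P ++ (M ++ Q)) (hn : (recs T').Nodup)
    (hP : ∀ e ∈ ent 0 P, e.1 < width X + l₁)
    (hM : ∀ e ∈ ent (width P) M, width X + l₁ ≤ e.1 ∧ e.1 < width X + l₁ + l₂)
    (hQ : ∀ e ∈ ent (width P + width M) Q, width X + l₁ + l₂ ≤ e.1) :
    Edges (redir h s (recs M) x 0 l₁) (fe s) (fb s) T' (X ++ (u, l₁) :: (x, l₂) :: Y) := by
  have e1 := fe_ne_fb s
  subst hT'
  intro p hp q hq h1 h2
  have hp' := hp
  rw [ent_append_append, List.mem_append, List.mem_append, zero_add] at hp'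
  have hu := hE p hp (width X, u, l₁ + l₂) (by simp)
  simp only at hu
  have hout : p.2.1 ∉ recs M → (q ∈ ent 0 X ∨ q = (width X, u, l₁) ∨
      q ∈ ent (width X + (l₁ + l₂)) Y) →
      redir h s (recs M) x 0 l₁ p.2.1 (fe s) = q.2.1 ∧
        redir h s (recs M) x 0 l₁ p.2.1 (fb s) = p.1 - q.1 := by
    intro h3 h4
    rw [redir_addr h3, redir_addr h3]
    rcases h4 with h4 | rfl | h4
    · exact hE p hp q (by simp [h4]) h1 h2
    · grind
    · exact hE p hp q (by simp [h4]) h1 h2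
  rw [ent_append, List.mem_append, ent_cons, List.mem_cons, ent_cons, List.mem_cons, zero_add] at hq
  simp only [add_assoc] at hq
  rcases hp' with h3 | h3 | h3
  · grind [notMem_mid, mem_recs_of_ent]
  · have h4 := hM p h3
    have h5 := mem_recs_of_ent h3
    have h6 : q = (width X + l₁, x, l₂) := by
      rcases hq with hq | rfl | hq | hq
      · have := (ent_le hq).2; omega
      · simp only at h2; omega
      · exact hq
      · have := (ent_le hq).1; omega
    grind [redir]
  grind [notMem_mid, mem_recs_of_ent]

/-- Merging two tiles to which edges point. -/
lemma Edges.target_merge (hE : Edges h (fe s) (fb s) T' (X ++ (x, l₁) :: (y, l₂) :: Y))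
    (hT' : T' = P ++ (M ++ Q)) (hn : (recs T').Nodup)
    (hP : ∀ e ∈ ent 0 P, e.1 < width X + l₁)
    (hM : ∀ e ∈ ent (width P) M, width X + l₁ ≤ e.1 ∧ e.1 < width X + l₁ + l₂)
    (hQ : ∀ e ∈ ent (width P + width M) Q, width X + l₁ + l₂ ≤ e.1) :
    Edges (redir h s (recs M) x l₁ 0) (fe s) (fb s) T' (X ++ (x, l₁ + l₂) :: Y) := by
  have e1 := fe_ne_fb s
  subst hT'
  intro p hp q hq h1 h2
  have hp' := hp
  rw [ent_append_append, List.mem_append, List.mem_append, zero_add] at hp'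
  have hx := hE p hp (width X, x, l₁) (by simp)
  have hy := hE p hp (width X + l₁, y, l₂) (by simp)
  simp only at hx hy
  rw [ent_append, List.mem_append, ent_cons, List.mem_cons, zero_add] at hq
  have hout : p.2.1 ∉ recs M → (p.1 < width X + l₁ ∨ width X + l₁ + l₂ ≤ p.1) →
      redir h s (recs M) x l₁ 0 p.2.1 (fe s) = q.2.1 ∧
        redir h s (recs M) x l₁ 0 p.2.1 (fb s) = p.1 - q.1 := by
    intro h3 h4
    rw [redir_addr h3, redir_addr h3]
    rcases hq with hq | rfl | hq
    · exact hE p hp q (by simp [hq]) h1 h2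
    · grind
    · exact hE p hp q (by simp [add_assoc] at hq ⊢; simp [hq]) h1 h2
  rcases hp' with h3 | h3 | h3
  · grind [notMem_mid, mem_recs_of_ent]
  · have h4 := hM p h3
    have h5 := mem_recs_of_ent h3
    have h6 : q = (width X, x, l₁ + l₂) := by
      rcases hq with hq | hq | hq
      · have := (ent_le hq).2; omega
      · exact hq
      · have := (ent_le hq).1; omega
    grind [redir]
  grind [notMem_mid, mem_recs_of_ent]

/-- Splitting a tile from which edges start. -/
lemma Edges.source_split (hE : Edges h e b (X ++ (u, l₁ + l₂) :: Y) T')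
    (hx : ∀ q ∈ ent 0 T', q.1 ≤ width X + l₁ → width X + l₁ < q.1 + q.2.2 →
      h x e = q.2.1 ∧ h x b = width X + l₁ - q.1) :
    Edges h e b (X ++ (u, l₁) :: (x, l₂) :: Y) T' := by
  intro p hp q hq h1 h2
  rw [ent_append, List.mem_append, ent_cons, List.mem_cons, ent_cons, List.mem_cons, zero_add] at hp
  simp only [add_assoc] at hp
  rcases hp with hp | rfl | rfl | hp
  · exact hE p (by simp [hp]) q hq h1 h2
  · exact hE (width X, u, l₁ + l₂) (by simp) q hq h1 h2
  · exact hx q hq h1 h2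
  · exact hE p (by simp [hp]) q hq h1 h2

/-- Merging two tiles from which edges start. -/
lemma Edges.source_merge (hE : Edges h e b (X ++ (x, l₁) :: (y, l₂) :: Y) T') :
    Edges h e b (X ++ (x, l₁ + l₂) :: Y) T' := by
  intro p hp q hq h1 h2
  rw [ent_append, List.mem_append, ent_cons, List.mem_cons, zero_add] at hp
  rcases hp with hp | rfl | hp
  · exact hE p (by simp [hp]) q hq h1 h2
  · exact hE (width X, x, l₁) (by simp) q hq h1 h2
  · exact hE p (by simp [add_assoc] at hp ⊢; simp [hp]) q hq h1 h2

/-- Inserting tiles of length 1 at the same position of both tilings. -/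
lemma Edges.insert {P' Q' : List (ℕ × ℕ)} {x' : ℕ} (hE : Edges h e b (P ++ Q) (P' ++ Q'))
    (hw : width P = width P') (hQ : ∀ p ∈ P ++ Q, 0 < p.2)
    (h1 : h x e = x') (h2 : h x b = 0) :
    Edges h e b (P ++ (x, 1) :: Q) (P' ++ (x', 1) :: Q') := by
  intro p hp q hq h3 h4
  simp only [ent_append, ent_cons, List.mem_append, List.mem_cons, zero_add, ← hw] at hp hq
  have hadd := ent_add (width P) 1
  rw [hadd] at hp hq
  rcases hp with hp | rfl | hp <;> rcases hq with hq | rfl | hq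
  · exact hE p (by simp [hp]) q (by simp [hq]) h3 h4
  · have := (ent_le hp).2
    have := ent_pos (fun r hr => hQ r (by simp [hr])) hp
    simp only at h3; omega
  · obtain ⟨q, hq', rfl⟩ := List.mem_map.1 hq
    have := (ent_le hp).2
    have := ent_pos (fun r hr => hQ r (by simp [hr])) hp
    have := (ent_le hq').1
    simp only at h3; omega
  · have := (ent_le hq).2
    simp only at h4; omega
  · grind
  · obtain ⟨q, hq', rfl⟩ := List.mem_map.1 hq
    have := (ent_le hq').1
    simp only at h3; omega
  · obtain ⟨p, hp', rfl⟩ := List.mem_map.1 hp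
    have := (ent_le hp').1
    have := (ent_le hq).2
    simp only at h4; omega
  · obtain ⟨p, hp', rfl⟩ := List.mem_map.1 hp
    have := (ent_le hp').1
    simp only at h4; omega
  · obtain ⟨p, hp', rfl⟩ := List.mem_map.1 hp
    obtain ⟨q, hq', rfl⟩ := List.mem_map.1 hq
    simp only at h3 h4 ⊢
    obtain ⟨h5, h6⟩ := hE p (by simp [hp']) q (by simp [← hw, hq']) (by omega) (by omega)
    exact ⟨h5, by omega⟩

/-- Replacing the record of a tile from which an edge starts. -/
lemma Edges.source_rename (hE : Edges h e b (X ++ (u, l) :: Y) T')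
    (h1 : h x e = h u e) (h2 : h x b = h u b) : Edges h e b (X ++ (x, l) :: Y) T' := by
  intro p hp q hq h3 h4
  rw [ent_append, List.mem_append, ent_cons, List.mem_cons] at hp
  rcases hp with hp | rfl | hp
  · exact hE p (by simp [hp]) q hq h3 h4
  · obtain ⟨h5, h6⟩ := hE (0 + width X, u, l) (by simp) q hq h3 h4
    grind
  · exact hE p (by simp at hp ⊢; simp [hp]) q hq h3 h4

/-- Replacing the record of a tile of length 1 to which edges point. -/
lemma Edges.target_rename (hE : Edges h e b T' (X ++ (u, 1) :: Y))
    (h1 : ∀ p ∈ ent 0 T', p.1 = width X → h' p.2.1 e = x)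
    (h2 : ∀ p ∈ ent 0 T', p.1 ≠ width X → h' p.2.1 e = h p.2.1 e)
    (h3 : ∀ p ∈ ent 0 T', h' p.2.1 b = h p.2.1 b) : Edges h' e b T' (X ++ (x, 1) :: Y) := by
  intro p hp q hq h4 h5
  rw [ent_append, List.mem_append, ent_cons, List.mem_cons, zero_add] at hq
  by_cases h6 : p.1 = width X
  · rw [h3 p hp, h1 p hp h6]
    have h7 := hE p hp (width X, u, 1) (by simp) (by simp [h6]) (by simp [h6])
    rcases hq with hq | rfl | hq
    · have := (ent_le hq).2; omega
    · exact ⟨rfl, h7.2⟩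
    · have := (ent_le hq).1; omega
  · rw [h3 p hp, h2 p hp h6]
    rcases hq with hq | rfl | hq
    · exact hE p hp q (by simp [hq]) h4 h5
    · simp only at h4 h5; omega
    · exact hE p hp q (by simp [hq]) h4 h5

end

end RComp


namespace RComp

/-! ### Operations on one of the two lists -/

/-- The two tilings with their lists and edges in memory; `s` tells the side of `T`. -/
structure Mesh (h : ℕ → ℕ → ℕ) (s : Bool) (T T' : List (ℕ × ℕ)) : Prop where
  pos : ∀ p ∈ T, 0 < p.2
  pos' : ∀ p ∈ T', 0 < p.2
  nodup : (recs T).Nodup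
  nodup' : (recs T').Nodup
  zero : 0 ∉ recs T
  zero' : 0 ∉ recs T'
  width_eq : width T' = width T
  links : Links h s (recs T)
  links' : Links h (!s) (recs T')
  edges : Edges h (fe s) (fb s) T T'
  edges' : Edges h (fe !s) (fb !s) T' T
  null : h 0 (fe s) = 0
  null' : h 0 (fe !s) = 0

lemma Mesh.symm {h : ℕ → ℕ → ℕ} {s : Bool} {T T' : List (ℕ × ℕ)} (m : Mesh h s T T') :
    Mesh h (!s) T' T where
  pos := m.pos'
  pos' := m.pos
  nodup := m.nodup'
  nodup' := m.nodup
  zero := m.zero'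
  zero' := m.zero
  width_eq := m.width_eq.symm
  links := m.links'
  links' := by rw [Bool.not_not]; exact m.links
  edges := m.edges'
  edges' := by rw [Bool.not_not]; exact m.edges
  null := m.null'
  null' := by rw [Bool.not_not]; exact m.null

/-- Fields that are not changed by operations on the list `s`. -/
def Kept (s : Bool) (f : ℕ) : Prop := f = fn (!s) ∨ f = fp (!s) ∨ f < 2 ∨ 10 ≤ f

lemma Kept.ne {s : Bool} {f : ℕ} (hf : Kept s f) (t : Bool) :
    f ≠ fn s ∧ f ≠ fp s ∧ f ≠ fe t ∧ f ≠ fb t := by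
  unfold Kept at hf
  cases s <;> cases t <;>
    simp [fn, fp, fe, fb, fNextU, fNextV, fPrevU, fPrevV, fEL, fEF, fBL, fBF] at hf ⊢ <;> omega

/-- The values of these fields, and the edges of the sentinel, are preserved. -/
def Keeps (s : Bool) (h h' : ℕ → ℕ → ℕ) : Prop := ∀ a f, Kept s f → h' a f = h a f

section

variable {W : ℕ} {σ : State} {s : Bool} {T T' X Y : List (ℕ × ℕ)} {x y u l l₁ l₂ N : ℕ}

/-- At most `N` tiles of `T` start in the interval `[a, b)`. -/
def StartsLe (T : List (ℕ × ℕ)) (a b N : ℕ) : Prop :=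
  ∀ P M Q, T = P ++ (M ++ Q) → (∀ e ∈ ent (width P) M, a ≤ e.1 ∧ e.1 < b) → M.length ≤ N

/-- A tiling is divided by an interval. -/
lemma exists_parts_interval (T : List (ℕ × ℕ)) (a b : ℕ) :
    ∃ P M Q, T = P ++ (M ++ Q) ∧ (∀ e ∈ ent 0 P, e.1 < a) ∧
      (∀ e ∈ ent (width P) M, a ≤ e.1 ∧ e.1 < b) ∧
      (∀ e ∈ ent (width P + width M) Q, b ≤ e.1) ∧ ∀ e ∈ ent (width P) (M ++ Q), a ≤ e.1 := by
  obtain ⟨P, R, rfl, h1, h2⟩ := exists_parts T 0 a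
  obtain ⟨M, Q, rfl, h3, h4⟩ := exists_parts R (width P) b
  rw [zero_add] at h2
  refine ⟨P, M, Q, rfl, h1, fun e he => ⟨h2 e ?_, h3 e he⟩, h4, h2⟩
  simp_all

lemma recs_append_zero (R : List (ℕ × ℕ)) : ∃ B v, recs R ++ [0] = v :: B := exists_cons_zero _

/-- The edges of the tiles that start in an interval are redirected. -/
lemma Edges.redirect {P M Q : List (ℕ × ℕ)} {a b z : ℕ}
    (hE : Edges σ.heap (fe !s) (fb !s) T' T) (hl : Links σ.heap (!s) (recs T'))
    (hn' : (recs T').Nodup) (hn : (recs T).Nodup) (h0 : 0 ∉ recs T) (hz : σ.heap 0 (fe !s) = 0)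
    (hw' : width T' = width T) (hpos : ∀ p ∈ T', 0 < p.2)
    (hT : T = X ++ (u, l) :: Y) (hT' : T' = P ++ (M ++ Q))
    (ha : width X ≤ a) (hb : b = width X + l)
    (hM : ∀ e ∈ ent (width P) M, a ≤ e.1 ∧ e.1 < b)
    (hQ : ∀ e ∈ ent (width P + width M) Q, b ≤ e.1)
    {v : ℕ} {B : List ℕ} (hv : recs (M ++ Q) ++ [0] = v :: B)
    (h40 : σ.reg 40 = v) (h41 : σ.reg 41 = σ.heap v (fe !s)) (h30 : σ.reg 30 = u)
    (h31 : σ.reg 31 = z) (hW : width T + σ.reg 32 < W) :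
    Runs W (redirectProg !s) σ (8 * M.length + 1) (fun σ' => Frame σ σ' ∧
      σ'.heap = redir σ.heap (!s) (recs M) z (σ.reg 32) (σ.reg 33)) := by
  obtain ⟨C, w, hw⟩ := recs_append_zero Q
  have hu : (width X, u, l) ∈ ent 0 T := by rw [hT]; simp
  have hMT : ∀ e ∈ ent (width P) M, e ∈ ent 0 T' := by simp_all
  have hedge : ∀ p ∈ recs M, σ.heap p (fe !s) = u ∧ σ.heap p (fb !s) < width T + 1 := by
    intro p hp
    obtain ⟨e, he, rfl⟩ := exists_ent_of_mem_recs (s := width P) hp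
    have h1 := hM e he
    obtain ⟨h2, h3⟩ := hE e (hMT e he) _ hu (by simp only; omega) (by simp only; omega)
    refine ⟨h2, ?_⟩
    have := (ent_le (hMT e he)).2
    grind
  have hMw : ∃ v' B', recs M ++ [w] = v' :: B' ∧ v' = v := by
    rw [recs_append, List.append_assoc, hw] at hv
    cases hM' : recs M with
    | nil => grind
    | cons p R => grind
  obtain ⟨v', B', h1, rfl⟩ := hMw
  refine (runs_redirect (M := recs M) (w := w) (v := v') ?_ h1 ?_ h40 h41 ?_ ?_ ?_).mono
    (by simp [recs]) ?_
  · have := hn'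
    rw [hT', recs_append, recs_append] at this
    grind
  · have := hl
    rw [hT', recs_append, recs_append] at this
    exact this.chain hw
  · grind
  · rw [h30]
    refine edge_out hT (P := P ++ M) (Q := Q) (by rw [hT', List.append_assoc]) hE hn
      h0 hz hw' hpos ?_ hw
    rw [width_append, ← hb]
    exact hQ
  · grind
  · rw [h31]; exact fun _ h => h

/-- Splits the node in register 30 at the offset in register 33; the record of the second part
is in register 31. -/
def splitSideProg (s : Bool) : Program :=
  .seq (blk [.load 40 30 (fe s), .load 44 30 (fb s), .add 44 44 33, .add 44 44 12,
      .load 45 40 fLen])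
    (.seq (findProg !s)
      (.seq (blk [.sub 44 44 12, .store 31 (fe s) 40, .store 31 (fb s) 44])
        (.seq (linkProg s)
          (.seq (blk [.copy 48 31]) (.seq (firstProg s) (redirectProg !s))))))

lemma runs_splitSide (m : Mesh σ.heap s T T') (hT : T = X ++ (u, l₁ + l₂) :: Y)
    (hl₁ : 0 < l₁) (hl₂ : 0 < l₂) (hx : x ∉ recs T) (hx0 : x ≠ 0)
    (hlen : ∀ p ∈ T', σ.heap p.1 fLen = p.2)
    (hN : StartsLe T' (width X) (width X + l₁ + l₂) N)
    (hW : width T + 1 < W) (h11 : σ.reg 11 = 0) (h12 : σ.reg 12 = 1) (h30 : σ.reg 30 = u)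
    (h31 : σ.reg 31 = x) (h32 : σ.reg 32 = 0) (h33 : σ.reg 33 = l₁) :
    Runs W (splitSideProg s) σ (12 * N + 25) (fun σ' => Frame σ σ' ∧
      Mesh σ'.heap s (X ++ (u, l₁) :: (x, l₂) :: Y) T' ∧ Keeps s σ.heap σ'.heap) := by
  have hwT : width T = width X + (l₁ + l₂) + width Y := by rw [hT]; simp; omega
  have hwT' := m.width_eq
  obtain ⟨q₀, hq₀, hq₁, hq₂⟩ := exists_ent (s := 0) (T := T') (Nat.zero_le (width X)) (by omega)
  obtain ⟨e1, e2⟩ := m.edges (width X, u, l₁ + l₂) (by rw [hT]; simp) q₀ hq₀ hq₁ hq₂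
  simp only at e1 e2
  obtain ⟨P₀, R₀, hP₀, hqP⟩ := mem_ent.1 hq₀
  rw [zero_add] at hqP
  obtain ⟨q, hq, hq3, hq4⟩ := exists_ent (s := width P₀) (T := (q₀.2.1, q₀.2.2) :: R₀)
    (p := width X + l₁) (by omega) (by
      have := congrArg width hP₀
      rw [width_append] at this
      omega)
  obtain ⟨M₀, Q₀, hM₀, hqM⟩ := mem_ent.1 hq
  have hqT : (q.2.1, q.2.2) ∈ T' := by rw [hP₀, hM₀]; simp
  have hM₀N : M₀.length ≤ N + 1 := by
    cases M₀ with
    | nil => simp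
    | cons r M₀ =>
      obtain ⟨hr, hR₀⟩ : (q₀.2.1, q₀.2.2) = r ∧ R₀ = M₀ ++ (q.2.1, q.2.2) :: Q₀ := by
        simpa using hM₀
      have := hN (P₀ ++ [r]) M₀ ((q.2.1, q.2.2) :: Q₀) (by rw [hP₀, hR₀, hr]; simp) (by
        intro e he
        have h1 := ent_le he
        rw [width_cons] at hqM
        rw [← hr] at h1 hqM
        simp only [width_append, width_cons, width_nil] at h1 hqM
        omega)
      simp; omega
  have k1 := fe_ne_fb s
  have k2 : fLen ≠ fe s := by cases s <;> decide
  have k3 : fLen ≠ fb s := by cases s <;> decide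
  refine (Runs.seq (n := 5) (n' := 12 * N + 20) (R := fun σ' => Frame σ σ' ∧ σ'.heap = σ.heap ∧
    σ'.reg 40 = q₀.2.1 ∧ σ'.reg 44 = width M₀ + (width X + l₁ - q.1) + 1 ∧
    σ'.reg 45 = σ.heap q₀.2.1 fLen) (runs_blk ?_) ?_).le
  · refine ⟨⟨fun r hr => ?_, rfl, rfl⟩, rfl, ?_, ?_, ?_⟩ <;>
      simp [h30, e1, e2, h33, h12]
    · grind
    · rw [Nat.mod_eq_of_lt (by omega)]; omega
  rintro σ₁ ⟨f1, hh1, r40, r44, r45⟩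
  refine (Runs.seq (n := 4 * M₀.length + 1) (n' := 8 * N + 15) (R := fun σ' => Frame σ σ' ∧
    σ'.heap = σ.heap ∧ σ'.reg 40 = q.2.1 ∧ σ'.reg 44 = width X + l₁ - q.1 + 1)
    ((runs_find (M := M₀) (w := q.2.1) (v := q₀.2.1)
      (B := (recs (M₀ ++ [(q.2.1, q.2.2)])).tail) ?_ ?_ r40 ?_ r44 ?_ ?_).mono le_rfl ?_) ?_).le
  · cases M₀ with
    | nil => simp at hM₀ ⊢; simp [hM₀]
    | cons r M₀ => simp at hM₀ ⊢; simp [recs, ← hM₀.1]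
  · have := m.links'
    rw [hP₀, hM₀, recs_append, recs_append] at this
    rw [hh1]
    exact this.chain (B := recs Q₀ ++ [0]) rfl
  · rw [r45, hh1]
  · intro p hp
    grind
  · grind
  · rintro σ₂ ⟨f2, hh2, h⟩
    exact ⟨f1.trans f2, hh2.trans hh1, h⟩
  rintro σ₂ ⟨f2, hh2, r40, r44⟩
  obtain ⟨P, M, Q, hPMQ, p1, p2, p3, p4⟩ := exists_parts_interval T' (width X + l₁)
    (width X + l₁ + l₂)
  have hMN : M.length ≤ N := hN P M Q hPMQ fun e he => by have := p2 e he; omega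
  -- the new node and its edge
  refine (Runs.seq (n := 3) (n' := 8 * N + 12) (R := fun σ' => Frame σ σ' ∧
    σ'.heap = upd (upd σ.heap x (fe s) q.2.1) x (fb s) (width X + l₁ - q.1))
    (runs_blk ?_) ?_).le
  · refine ⟨f2.trans ⟨fun r hr => runAll_reg hr, rfl, rfl⟩, ?_⟩
    · have := f2.reg 12
      have := f2.reg 31
      simp [*]
      rfl
  rintro σ₃ ⟨f3, hh3⟩
  refine (Runs.seq (n := 5) (n' := 8 * N + 7) (R := fun σ' => Frame σ σ' ∧
    σ'.heap = linkAfter σ₃.heap s u x) (runs_link.mono le_rfl ?_) ?_).le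
  · rintro σ₄ ⟨f4, hh4⟩
    exact ⟨f3.trans f4, by rw [hh4, f3.reg 30, f3.reg 31, h30, h31]⟩
  rintro σ₄ ⟨f4, hh4⟩
  have hxe : ∀ t, t = fe (!s) ∨ t = fb (!s) ∨ t = fn (!s) ∨ t = fp (!s) →
      ∀ a, σ₄.heap a t = σ.heap a t := by
    intro t ht a
    have k4 : t ≠ fn s ∧ t ≠ fp s ∧ t ≠ fe s ∧ t ≠ fb s := by
      rcases ht with rfl | rfl | rfl | rfl <;> cases s <;> decide
    rw [hh4, linkAfter_field k4.1 k4.2.1, hh3, upd_field _ _ _ _ k4.2.2.2,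
      upd_field _ _ _ _ k4.2.2.1]
  have hxs : ∀ a, a ≠ x → ∀ t, t = fe s ∨ t = fb s → σ₄.heap a t = σ.heap a t := by
    intro a ha t ht
    have k4 : t ≠ fn s ∧ t ≠ fp s := by rcases ht with rfl | rfl <;> cases s <;> decide
    rw [hh4, linkAfter_field k4.1 k4.2, hh3, upd_addr _ _ _ _ ha, upd_addr _ _ _ _ ha]
  have hxx : σ₄.heap x (fe s) = q.2.1 ∧ σ₄.heap x (fb s) = width X + l₁ - q.1 := by
    have k4 : fe s ≠ fn s ∧ fe s ≠ fp s ∧ fb s ≠ fn s ∧ fb s ≠ fp s := by cases s <;> decide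
    rw [hh4, linkAfter_field k4.1 k4.2.1, linkAfter_field k4.2.2.1 k4.2.2.2, hh3]
    simp [upd_field _ _ _ _ k1]
  have hxu : u ≠ x := by rintro rfl; exact hx (by rw [hT]; simp)
  have hqT' : q ∈ ent 0 T' := by
    rw [hP₀, ent_append, zero_add]; grind
  have edges4 : Edges σ₄.heap (fe s) (fb s) (X ++ (u, l₁) :: (x, l₂) :: Y) T' := by
    refine Edges.source_split ?_ ?_
    · rw [← hT]
      exact m.edges.congr (fun a ha => hxs a (fun h => hx (h ▸ ha)) _ (Or.inl rfl))
        (fun a ha => hxs a (fun h => hx (h ▸ ha)) _ (Or.inr rfl))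
    · intro q' hq' h1 h2
      have : q' = q := by
        rcases ent_disjoint hq' hqT' with h | h | h
        · exact h
        · omega
        · omega
      subst this
      exact hxx
  have nodup4 : (recs (X ++ (u, l₁) :: (x, l₂) :: Y)).Nodup := by
    have h1 := m.nodup
    rw [hT] at h1 hx
    simp only [recs_append, recs_cons, List.nodup_append, List.nodup_cons, List.mem_cons,
      List.mem_append, not_or] at h1 hx ⊢
    grind
  have zero4 : 0 ∉ recs (X ++ (u, l₁) :: (x, l₂) :: Y) := by
    have h1 := m.zero
    rw [hT] at h1
    simp only [recs_append, recs_cons, List.mem_cons, List.mem_append, not_or] at h1 ⊢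
    grind
  have links4 : Links σ₄.heap s (recs (X ++ (u, l₁) :: (x, l₂) :: Y)) := by
    have h1 := m.links
    have h2 := m.nodup
    have h3 := m.zero
    have e : recs T = (recs X ++ [u]) ++ recs Y := by rw [hT]; simp
    rw [e] at h1 h2 h3 hx
    have := (Links.congr (h' := σ₃.heap) h1 (fun a => ?_) (fun a => ?_)).insert (A := 0 :: recs X)
      (u := u) (by simp) hx hx0 h2 h3
    · rw [hh4]; simpa using this
    · rw [hh3, upd_field _ _ _ _ (fn_ne_fb s s), upd_field _ _ _ _ (fn_ne_fe s s)]
    · have k4 : fp s ≠ fe s ∧ fp s ≠ fb s := by cases s <;> decide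
      rw [hh3, upd_field _ _ _ _ k4.2, upd_field _ _ _ _ k4.1]
  have links4' : Links σ₄.heap (!s) (recs T') :=
    m.links'.congr (hxe _ (Or.inr (Or.inr (Or.inl rfl)))) (hxe _ (Or.inr (Or.inr (Or.inr rfl))))
  obtain ⟨B, v, hv⟩ := recs_append_zero (M ++ Q)
  -- redirection of edges
  refine (Runs.seq (n := 1) (n' := 8 * N + 6) (R := fun σ' => Frame σ σ' ∧
    σ'.heap = σ₄.heap ∧ σ'.reg 48 = x) (runs_blk ?_) ?_).le
  · refine ⟨f4.trans ⟨fun r hr => runAll_reg hr, rfl, rfl⟩, rfl, ?_⟩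
    · simp [f4.reg 31, h31]
  rintro σ₅ ⟨f5, hh5, r48⟩
  refine (Runs.seq (n := 5) (n' := 8 * M.length + 1) (R := fun σ' => Frame σ σ' ∧
    σ'.heap = σ₄.heap ∧ σ'.reg 40 = v ∧ σ'.reg 41 = σ'.heap v (fe !s))
    ((runs_first (s := s) (by rw [f5.reg 11, h11])).mono le_rfl ?_) ?_).le
  · rintro σ₆ ⟨f6, hh6, r40, r41, -⟩
    rw [hh5] at hh6
    have : σ₆.reg 40 = v := by
      rw [r40, r48, hh5]
      refine first_eq (T := X ++ (u, l₁) :: (x, l₂) :: Y) (X := X ++ [(u, l₁)]) (Y := Y) (l := l₂)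
        (by simp) hPMQ edges4 links4' m.pos' (by simp; omega) (by simpa using p1)
        (by simpa using p4) hv
    exact ⟨f5.trans f6, hh6, this, by rw [r41, this, hh5, hh6]⟩
  rintro σ₆ ⟨f6, hh6, r40, r41⟩
  have key : ∀ a f, σ₆.heap a f = σ₄.heap a f := fun a f => by rw [hh6]
  have links6 : Links σ₆.heap (!s) (recs T') := by rw [hh6]; exact links4'
  -- the edges of the other list are not yet changed
  have edges6 : Edges σ₆.heap (fe !s) (fb !s) T' T := by
    rw [hh6]
    exact m.edges'.congr (fun a _ => hxe _ (Or.inl rfl) a) (fun a _ => hxe _ (Or.inr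
      (Or.inl rfl)) a)
  have null6 : ∀ t, σ₆.heap 0 (fe t) = 0 := by
    intro t
    rw [hh6]
    by_cases ht : t = s
    · subst ht; rw [hxs 0 hx0.symm _ (Or.inl rfl)]; exact m.null
    · have : t = !s := by cases t <;> cases s <;> simp_all
      subst this; rw [hxe _ (Or.inl rfl)]; exact m.null'
  have f33 := f6.reg 33
  have f32 := f6.reg 32
  refine (Edges.redirect (z := x) (a := width X + l₁)
    (b := width X + l₁ + l₂) edges6 links6 m.nodup'
    m.nodup m.zero (null6 _) m.width_eq m.pos' hT hPMQ (by omega) (by omega) p2 p3 hv r40 r41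
    (by rw [f6.reg 30, h30]) (by rw [f6.reg 31, h31])
    (by rw [f32, h32]; omega)).mono le_rfl ?_
  rintro σ₇ ⟨f7, hh7⟩
  rw [f32, f33, h32, h33] at hh7
  have hfield : ∀ a f, f ≠ fe (!s) → f ≠ fb (!s) → σ₇.heap a f = σ₄.heap a f := by
    intro a f h1 h2
    rw [hh7, redir_field h1 h2, hh6]
  have h0M : 0 ∉ recs M := fun h => m.zero' (by rw [hPMQ]; simp [h])
  have k5 : ∀ t, fn t ≠ fe (!s) ∧ fn t ≠ fb (!s) ∧ fp t ≠ fe (!s) ∧ fp t ≠ fb (!s) := by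
    intro t; cases s <;> cases t <;> decide
  have k6 : fe s ≠ fe (!s) ∧ fe s ≠ fb (!s) ∧ fb s ≠ fe (!s) ∧ fb s ≠ fb (!s) := by
    cases s <;> decide
  refine ⟨f6.trans f7, ⟨?_, m.pos', nodup4, m.nodup', zero4, m.zero', ?_, ?_, ?_, ?_, ?_, ?_, ?_⟩,
    ?_⟩
  · have := m.pos
    rw [hT] at this
    intro p hp
    simp only [List.mem_append, List.mem_cons] at hp this
    grind
  · rw [hwT', hwT]; simp; omega
  · exact links4.congr (fun a => hfield a _ (k5 s).1 (k5 s).2.1)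
      (fun a => hfield a _ (k5 s).2.2.1 (k5 s).2.2.2)
  · exact links4'.congr (fun a => hfield a _ (k5 _).1 (k5 _).2.1)
      (fun a => hfield a _ (k5 _).2.2.1 (k5 _).2.2.2)
  · exact edges4.congr (fun a _ => hfield a _ k6.1 k6.2.1) (fun a _ => hfield a _ k6.2.2.1 k6.2.2.2)
  · rw [hh7]
    exact Edges.target_split (by rw [← hT]; exact edges6) hPMQ m.nodup' p1 p2 p3
  · grind
  · rw [hh7, redir_addr h0M]; exact null6 _
  · intro a f hf
    have h1 := hf.ne s
    have h2 := hf.ne (!s)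
    rw [hfield a f h2.2.2.1 h2.2.2.2, hh4, linkAfter_field h1.1 h1.2.1, hh3,
      upd_field _ _ _ _ h1.2.2.2, upd_field _ _ _ _ h1.2.2.1]

/-- Merges the node in register 30 into its predecessor in register 31, whose length is in
register 32. -/
def mergeSideProg (s : Bool) : Program :=
  .seq (blk [.copy 48 30]) (.seq (firstProg s) (.seq (redirectProg !s) (unlinkProg s)))

lemma runs_mergeSide (m : Mesh σ.heap s T T') (hT : T = X ++ (x, l₁) :: (y, l₂) :: Y)
    (hN : StartsLe T' (width X + l₁) (width X + l₁ + l₂) N)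
    (hW : 2 * width T < W) (h11 : σ.reg 11 = 0) (h30 : σ.reg 30 = y)
    (h31 : σ.reg 31 = x) (h32 : σ.reg 32 = l₁) (h33 : σ.reg 33 = 0) :
    Runs W (mergeSideProg s) σ (8 * N + 11) (fun σ' => Frame σ σ' ∧
      Mesh σ'.heap s (X ++ (x, l₁ + l₂) :: Y) T' ∧ Keeps s σ.heap σ'.heap) := by
  have hwT : width T = width X + l₁ + l₂ + width Y := by rw [hT]; simp; omega
  have hwT' := m.width_eq
  have hposT := m.pos
  rw [hT] at hposT
  have hl₂ : 0 < l₂ := hposT (y, l₂) (by simp)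
  obtain ⟨P, M, Q, hPMQ, p1, p2, p3, p4⟩ := exists_parts_interval T' (width X + l₁)
    (width X + l₁ + l₂)
  have hMN : M.length ≤ N := hN P M Q hPMQ p2
  obtain ⟨B, v, hv⟩ := recs_append_zero (M ++ Q)
  refine (Runs.seq (n := 1) (n' := 8 * N + 10) (R := fun σ' => Frame σ σ' ∧
    σ'.heap = σ.heap ∧ σ'.reg 48 = y) (runs_blk ?_) ?_).le
  · refine ⟨⟨fun r hr => runAll_reg hr, rfl, rfl⟩, rfl, ?_⟩
    · simp [h30]
  rintro σ₁ ⟨f1, hh1, r48⟩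
  refine (Runs.seq (n := 5) (n' := 8 * N + 5) (R := fun σ' => Frame σ σ' ∧
    σ'.heap = σ.heap ∧ σ'.reg 40 = v ∧ σ'.reg 41 = σ'.heap v (fe !s))
    ((runs_first (s := s) (by rw [f1.reg 11, h11])).mono le_rfl ?_) ?_).le
  · rintro σ₂ ⟨f2, hh2, r40, r41, -⟩
    rw [hh1] at hh2
    have : σ₂.reg 40 = v := by
      rw [r40, r48, hh1]
      exact first_eq (T := T) (X := X ++ [(x, l₁)]) (Y := Y) (l := l₂)
        (by simp [hT]) hPMQ m.edges m.links' m.pos' (by simp; omega) (by simpa using p1)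
        (by simpa using p4) hv
    exact ⟨f1.trans f2, hh2, this, by rw [r41, this, hh1, hh2]⟩
  rintro σ₂ ⟨f2, hh2, r40, r41⟩
  have g30 := f2.reg 30
  have g31 := f2.reg 31
  have g32 := f2.reg 32
  have g33 := f2.reg 33
  refine (Runs.seq (n := 8 * N + 1) (n' := 4) (R := fun σ' => Frame σ σ' ∧
    σ'.heap = redir σ.heap (!s) (recs M) x l₁ 0)
    ((Edges.redirect (s := s) (T := T) (X := X ++ [(x, l₁)]) (u := y) (l := l₂) (Y := Y) (z := x)
      (a := width X + l₁) (b := width X + l₁ + l₂) (by rw [hh2]; exact m.edges')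
      (by rw [hh2]; exact m.links') m.nodup' m.nodup m.zero (by rw [hh2]; exact m.null') m.width_eq
      m.pos' (by simp [hT]) hPMQ (by simp) (by simp) p2 p3 hv r40 r41 (by rw [g30, h30])
      (by rw [g31, h31]) (by rw [g32, h32]; omega)).mono (by omega) ?_) ?_).le
  · rintro σ₃ ⟨f3, hh3⟩
    refine ⟨f2.trans f3, ?_⟩
    grind
  rintro σ₃ ⟨f3, hh3⟩
  refine runs_unlink.mono le_rfl ?_
  rintro σ₄ ⟨f4, hh4⟩
  rw [f3.reg 30, h30] at hh4
  have hfield : ∀ a f, f ≠ fe (!s) → f ≠ fb (!s) → f ≠ fn s → f ≠ fp s →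
      σ₄.heap a f = σ.heap a f := by
    intro a f h1 h2 h3 h4
    rw [hh4, unlink_field h3 h4, hh3, redir_field h1 h2]
  have h0M : 0 ∉ recs M := fun h => m.zero' (by rw [hPMQ]; simp [h])
  have k6 : fe s ≠ fe (!s) ∧ fe s ≠ fb (!s) ∧ fb s ≠ fe (!s) ∧ fb s ≠ fb (!s) := by
    cases s <;> decide
  have k7 : ∀ t, fe t ≠ fn s ∧ fe t ≠ fp s ∧ fb t ≠ fn s ∧ fb t ≠ fp s := by
    intro t; cases s <;> cases t <;> decide
  have k8 : fn (!s) ≠ fn s ∧ fn (!s) ≠ fp s ∧ fp (!s) ≠ fn s ∧ fp (!s) ≠ fp s := by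
    cases s <;> decide
  have k9 : ∀ t, fn t ≠ fe (!s) ∧ fn t ≠ fb (!s) ∧ fp t ≠ fe (!s) ∧ fp t ≠ fb (!s) := by
    intro t; cases s <;> cases t <;> decide
  have hsub : List.Sublist (recs (X ++ (x, l₁ + l₂) :: Y)) (recs T) := by
    rw [hT]; simp [recs]
  refine ⟨f3.trans f4, ⟨?_, m.pos', m.nodup.sublist hsub, m.nodup', fun h => m.zero (hsub.subset h),
    m.zero', ?_, ?_, ?_, ?_, ?_, ?_, ?_⟩, ?_⟩
  · grind
  · rw [hwT', hwT]; simp; omega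
  · have h1 := m.links
    have h2 := m.nodup
    have h3 := m.zero
    have e : recs T = (recs X ++ [x]) ++ y :: recs Y := by rw [hT]; simp
    rw [e] at h1 h2 h3
    have := (Links.congr (h' := σ₃.heap) h1
      (fun a => by rw [hh3, redir_field (k9 s).1 (k9 s).2.1])
      (fun a => by rw [hh3, redir_field (k9 s).2.2.1 (k9 s).2.2.2])).erase h2 h3
    rw [hh4]; simpa using this
  · exact m.links'.congr (fun a => hfield a _ (k9 _).1 (k9 _).2.1 k8.1 k8.2.1)
      (fun a => hfield a _ (k9 _).2.2.1 (k9 _).2.2.2 k8.2.2.1 k8.2.2.2)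
  · refine Edges.source_merge ?_ (y := y)
    rw [← hT]
    exact m.edges.congr (fun a _ => hfield a _ k6.1 k6.2.1 (k7 s).1 (k7 s).2.1)
      (fun a _ => hfield a _ k6.2.2.1 k6.2.2.2 (k7 s).2.2.1 (k7 s).2.2.2)
  · refine Edges.congr (h := redir σ.heap (!s) (recs M) x l₁ 0)
      (Edges.target_merge (by rw [← hT]; exact m.edges') hPMQ m.nodup' p1 p2 p3)
      (fun a _ => ?_) (fun a _ => ?_)
    · rw [hh4, unlink_field (k7 _).1 (k7 _).2.1, hh3]
    · rw [hh4, unlink_field (k7 _).2.2.1 (k7 _).2.2.2, hh3]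
  · rw [hfield _ _ k6.1 k6.2.1 (k7 s).1 (k7 s).2.1]; exact m.null
  · rw [hh4, unlink_field (k7 _).1 (k7 _).2.1, hh3, redir_addr h0M]; exact m.null'
  · intro a f hf
    have h1 := hf.ne (!s)
    grind

/-- Counts the nodes of the other list that start in the interval of the node in register 30. -/
def countNodeProg (s : Bool) : Program :=
  .seq (blk [.copy 48 30, .copy 46 11]) (.seq (firstProg s) (countProg !s))

lemma runs_countNode (m : Mesh σ.heap s T T') (hT : T = X ++ (u, l) :: Y)
    {P M Q : List (ℕ × ℕ)} (hT' : T' = P ++ (M ++ Q))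
    (hP : ∀ e ∈ ent 0 P, e.1 < width X)
    (hM : ∀ e ∈ ent (width P) M, width X ≤ e.1 ∧ e.1 < width X + l)
    (hQ : ∀ e ∈ ent (width P + width M) Q, width X + l ≤ e.1)
    (hMN : M.length ≤ N) (hW : N < W) (h11 : σ.reg 11 = 0) (h12 : σ.reg 12 = 1)
    (h30 : σ.reg 30 = u) :
    Runs W (countNodeProg s) σ (4 * N + 8) (fun σ' => Frame σ σ' ∧
      σ'.heap = σ.heap ∧ σ'.reg 46 = M.length) := by
  have hl : 0 < l := m.pos (u, l) (by rw [hT]; simp)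
  have hwT : width T = width X + l + width Y := by rw [hT]; simp; omega
  have hwT' := m.width_eq
  have hR : ∀ e ∈ ent (width P) (M ++ Q), width X ≤ e.1 := by
    intro e he
    rw [ent_append, List.mem_append] at he
    grind
  obtain ⟨B, v, hv⟩ := recs_append_zero (M ++ Q)
  obtain ⟨C, w, hw⟩ := recs_append_zero Q
  refine (Runs.seq (n := 2) (n' := 4 * N + 6) (R := fun σ' => Frame σ σ' ∧
    σ'.heap = σ.heap ∧ σ'.reg 48 = u ∧ σ'.reg 46 = 0) (runs_blk ?_) ?_).le
  · refine ⟨⟨fun r hr => runAll_reg hr, rfl, rfl⟩, rfl, ?_, ?_⟩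
    · simp [h30]
    · simp [h11]
  rintro σ₁ ⟨f1, hh1, r48, r46⟩
  refine (Runs.seq (n := 5) (n' := 4 * N + 1) (R := fun σ' => Frame σ σ' ∧
    σ'.heap = σ.heap ∧ σ'.reg 40 = v ∧ σ'.reg 41 = σ'.heap v (fe !s) ∧ σ'.reg 46 = 0)
    ((runs_first (s := s) (by rw [f1.reg 11, h11])).mono le_rfl ?_) ?_).le
  · rintro σ₂ ⟨f2, hh2, r40, r41, r46'⟩
    rw [hh1] at hh2
    have : σ₂.reg 40 = v := by
      rw [r40, r48, hh1]
      exact first_eq hT hT' m.edges m.links' m.pos' (by omega) hP hR hv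
    exact ⟨f1.trans f2, hh2, this, by rw [r41, this, hh1, hh2], by rw [r46', r46]⟩
  rintro σ₂ ⟨f2, hh2, r40, r41, r46⟩
  have hu : (width X, u, l) ∈ ent 0 T := by rw [hT]; simp
  have hMw : ∃ B', recs M ++ [w] = v :: B' := by
    rw [recs_append, List.append_assoc, hw] at hv
    cases hM' : recs M with
    | nil => grind
    | cons p R => grind
  obtain ⟨B', hB'⟩ := hMw
  have hlen : (recs M).length = M.length := by simp [recs]
  refine (runs_count hB' ?_ r40 r41 (by rw [f2.reg 12, h12]) ?_ ?_ ?_).mono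
    (by omega) ?_
  · have := m.links'
    rw [hT', recs_append, recs_append] at this
    rw [hh2]; exact this.chain hw
  · intro p hp
    obtain ⟨e, he, rfl⟩ := exists_ent_of_mem_recs (s := width P) hp
    rw [hh2, f2.reg 30, h30]
    have h1 := hM e he
    refine (m.edges' e ?_ _ hu h1.1 h1.2).1
    simp_all
  · rw [hh2, f2.reg 30, h30]
    refine edge_out hT (P := P ++ M) (Q := Q) (by rw [hT', List.append_assoc]) m.edges' m.nodup
      m.zero m.null' m.width_eq m.pos' ?_ hw
    rw [width_append]
    exact hQ
  · omega
  · rintro σ₃ ⟨f3, hh3, h⟩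
    exact ⟨f2.trans f3, hh3.trans hh2, by rw [h, r46, zero_add, hlen]⟩

end

end RComp


namespace RComp

/-! ### Heavy nodes after an update -/

/-- The number of elements of `Y` in the interval `[a, b)`. -/
def cnt (Y : Finset ℕ) (a b : ℕ) : ℕ := (Y.filter (fun x => a ≤ x ∧ x < b)).card

section

variable {S : List ℕ} {D D' : DBWT} {c α : ℕ} {X : Finset ℕ}

lemma cnt_le_len (Y : Finset ℕ) (a l : ℕ) : cnt Y a (a + l) ≤ l := by
  have : Y.filter (fun x => a ≤ x ∧ x < a + l) ⊆ Finset.Ico a (a + l) := by grind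
  simpa [cnt] using Finset.card_le_card this

lemma cnt_mono {Y Z : Finset ℕ} (h : Y ⊆ Z) (a b : ℕ) : cnt Y a b ≤ cnt Z a b :=
  Finset.card_le_card (Finset.filter_subset_filter _ h)

lemma cnt_insert_le (Y : Finset ℕ) (t a b : ℕ) : cnt (insert t Y) a b ≤ cnt Y a b + 1 := by
  grind [cnt, Finset.filter_insert]

lemma IsDBWT.coveredByL_length (hD : IsDBWT D (bwt S)) {i : ℕ} (hi : i < D.length) :
    (coveredByL S D i).length =
      cnt ((bd D).image (lf S)) (nth D i).1 ((nth D i).1 + (nth D i).2.2) := by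
  have h1 : (coveredByL S D i).Nodup := (coveredByL_pairwise S D i).imp fun h => h.ne
  rw [← List.toFinset_card_of_nodup h1, cnt]
  congr 1
  ext x
  rw [List.mem_toFinset, hD.mem_coveredByL hi]
  simp

lemma IsDBWT.coveredByF_length (hS : IsText S) (hD : IsDBWT D (bwt S)) {i : ℕ}
    (hi : i < D.length) : (coveredByF S D i).length =
      cnt (bd D) (lf S (nth D i).1) (lf S (nth D i).1 + (nth D i).2.2) := by
  have h1 : (coveredByF S D i).Nodup := (coveredByF_pairwise S D i).imp fun h => h.ne
  rw [← List.toFinset_card_of_nodup h1, cnt]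
  congr 1
  ext x
  rw [List.mem_toFinset, hD.mem_coveredByF hS hi]
  simp

lemma Balanced.cnt_lt (hS : IsText S) (hD : IsDBWT D (bwt S)) (hb : Balanced S D α)
    {e : ℕ × ℕ × ℕ} (he : e ∈ ent 0 D) :
    cnt ((bd D).image (lf S)) e.1 (e.1 + e.2.2) < α ∧
      cnt (bd D) (lf S e.1) (lf S e.1 + e.2.2) < α := by
  obtain ⟨i, hi, rfl⟩ := mem_ent_iff.1 he
  have h := hb i hi
  rw [HeavyL, HeavyF, hD.coveredByL_length hi, hD.coveredByF_length hS hi] at h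
  omega

/-- An interval without starting positions in its interior is part of a repetition. -/
lemma IsDBWT.exists_cover (hD : IsDBWT D (bwt S)) {a b : ℕ} (hab : a < b) (hb : b ≤ S.length)
    (h : ∀ t ∈ bd D, a < t → b ≤ t) : ∃ e ∈ ent 0 D, e.1 ≤ a ∧ b ≤ e.1 + e.2.2 := by
  obtain ⟨e, he, h1, h2⟩ := hD.exists_ent (p := a) (by omega)
  refine ⟨e, he, h1, ?_⟩
  by_contra h3
  obtain ⟨e', he', h4, h5⟩ := hD.exists_ent (p := e.1 + e.2.2) (by omega)
  have h6 := hD.len_pos he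
  have h7 : e'.1 = e.1 + e.2.2 := by
    rcases ent_disjoint he he' with rfl | h | h <;> omega
  grind [mem_bd]

lemma Balanced.cntV_gap (hS : IsText S) (hD : IsDBWT D (bwt S)) (hα : 0 < α)
    (hb : Balanced S D α) {p q : ℕ}
    (hq : q ≤ S.length) (h : ∀ t ∈ bd D, p < t → q ≤ t) :
    cnt ((bd D).image (lf S)) p q < α := by
  by_cases hpq : p < q
  · obtain ⟨e, he, h1, h2⟩ := hD.exists_cover hpq hq h
    refine lt_of_le_of_lt (Finset.card_le_card ?_) (hb.cnt_lt hS hD he).1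
    grind
  grind [cnt, Finset.filter_eq_empty_iff]

lemma Balanced.cntU_gap (hS : IsText S) (hD : IsDBWT D (bwt S)) (hα : 0 < α)
    (hb : Balanced S D α) {p q : ℕ}
    (hq : q ≤ S.length) (h : ∀ t ∈ bd D, p < t → q ≤ t) :
    (bd D ∩ (Finset.Ico p q).image (lf S)).card < α := by
  by_cases hpq : p < q
  · obtain ⟨e, he, h1, h2⟩ := hD.exists_cover hpq hq h
    refine lt_of_le_of_lt (Finset.card_le_card ?_) (hb.cnt_lt hS hD he).2
    intro x hx
    simp only [Finset.mem_inter, Finset.mem_image, Finset.mem_Ico] at hx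
    obtain ⟨h3, y, ⟨h4, h5⟩, rfl⟩ := hx
    have := hD.lf_add hS he (q := y - e.1) (by omega)
    grind
  simp_all

/-- The set of starting positions after an update, possibly with merging. -/
structure Step (S : List ℕ) (D : DBWT) (c : ℕ) (X : Finset ℕ) (D' : DBWT) : Prop where
  updated : Updated S D c X D'
  isDBWT : IsDBWT D' (bwt (c :: S))
  subset : X ⊆ bd D
  mem : ∀ p ∈ bd D, p ≠ rep S → p ≠ rep S + 1 → p ∈ X
  ins_mem : insPos (bwt S) c ∈ bd D → insPos (bwt S) c ∈ X

lemma shift_le_iff {i p q : ℕ} : shift i p ≤ shift i q ↔ p ≤ q := by grind [shift]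

lemma Step.mem_bd_iff (h : Step S D c X D') {t : ℕ} : t ∈ bd D' ↔ t = insPos (bwt S) c ∨
    ∃ s, (s ∈ X ∨ s ∈ splitSet D c) ∧ shift (insPos (bwt S) c) s = t := by
  rw [h.updated]; simp

lemma Step.ins_mem_cut (h : Step S D c X D') (hD : IsDBWT D (bwt S))
    (hi : insPos (bwt S) c < S.length) :
    insPos (bwt S) c ∈ X ∨ insPos (bwt S) c ∈ splitSet D c := by
  by_cases h1 : insPos (bwt S) c ∈ bd D
  · exact Or.inl (h.ins_mem h1)
  · right
    rw [mem_splitSet, hD.ins_eq, splits_iff, hD.ins_eq]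
    refine ⟨?_, rfl⟩
    obtain ⟨e, he, h2, h3⟩ := hD.exists_ent hi
    grind [mem_bd]

/-- A repetition after the update is that of the special character or the image of an interval. -/
lemma Step.tile_cases (h : Step S D c X D') (hS : IsText S) (hc : dollar < c)
    (hD : IsDBWT D (bwt S)) {e : ℕ × ℕ × ℕ} (he : e ∈ ent 0 D') :
    (e.1 = insPos (bwt S) c ∧ e.2.2 = 1) ∨
    ∃ s, s + e.2.2 ≤ S.length ∧ (∀ q < e.2.2, e.1 + q = shift (insPos (bwt S) c) (s + q)) ∧
      (s ∈ X ∨ s ∈ splitSet D c) ∧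
      ∀ t, t ∈ X ∨ t ∈ splitSet D c → s < t → s + e.2.2 ≤ t := by
  have hpos := h.isDBWT.len_pos he
  have hle := h.isDBWT.ent_le he
  have hi := insPos_le hS hc
  rw [List.length_cons] at hle
  have hbd := fun t ht => h.isDBWT.bd_le he (s := t) ht
  rcases h.mem_bd_iff.1 (mem_bd.2 ⟨e, he, rfl⟩) with h1 | ⟨s, hs, h1⟩
  · left
    refine ⟨h1, ?_⟩
    by_cases h2 : insPos (bwt S) c = S.length
    · omega
    · have := hbd _ (h.mem_bd_iff.2 (Or.inr ⟨_, h.ins_mem_cut hD (by omega), rfl⟩))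
      grind [shift]
  · right
    refine ⟨s, ?_⟩
    have h2 := hbd _ (h.mem_bd_iff.2 (Or.inl rfl))
    have h3 : ∀ q < e.2.2, e.1 + q = shift (insPos (bwt S) c) (s + q) := by grind [shift]
    have h4 := h3 (e.2.2 - 1) (by omega)
    refine ⟨?_, h3, hs, fun t ht hst => ?_⟩
    · grind [shift]
    · have h5 := hbd _ (h.mem_bd_iff.2 (Or.inr ⟨t, ht, rfl⟩))
      by_contra h6
      have h7 := h3 (t - s) (by omega)
      grind

lemma Step.mem_image_lf (h : Step S D c X D') (hS : IsText S) (hc : dollar < c)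
    (hD : IsDBWT D (bwt S)) {y : ℕ} (hy : y ∈ (bd D').image (lf (c :: S))) :
    y = insPos (bwt S) c ∨ (∃ t ∈ (bd D).image (lf S), shift (insPos (bwt S) c) t = y) ∨
      Splits D c ∧ y = shift (insPos (bwt S) c) (lf S (insPos (bwt S) c)) := by
  obtain ⟨t, ht, rfl⟩ := Finset.mem_image.1 hy
  rcases h.mem_bd_iff.1 ht with rfl | ⟨s, hs, rfl⟩
  · refine Or.inr (Or.inl ⟨0, Finset.mem_image.2 ⟨rep S, hD.rep_mem_bd hS, lf_rep hS⟩, ?_⟩)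
    rw [shift_zero hS hc, lf_cons_ins hS hc]
  · rcases hs with hs | hs
    · by_cases h1 : s = rep S
      · grind [lf_cons_rep]
      · refine Or.inr (Or.inl ⟨lf S s, Finset.mem_image_of_mem _ (h.subset hs), ?_⟩)
        rw [lf_cons_shift hS hc (hD.bd_lt (h.subset hs)) h1]
    · have h2 := hs
      rw [mem_splitSet, hD.ins_eq] at h2
      obtain ⟨e, he, h3, h4⟩ := splits_iff.1 h2.1
      rw [hD.ins_eq] at h3 h4
      have h5 := hD.ent_le he
      refine Or.inr (Or.inr ⟨h2.1, ?_⟩)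
      rw [h2.2, lf_cons_shift hS hc (by omega)]
      intro h6
      rw [h6] at h3 h4
      exact hD.notMem_bd he h3 h4 (hD.rep_mem_bd hS)

lemma card_le_of_cover {Y E F : Finset ℕ} {f : ℕ → ℕ}
    (h : ∀ y ∈ Y, y ∈ E ∨ ∃ t ∈ F, f t = y) : Y.card ≤ E.card + F.card := by
  have : Y ⊆ E ∪ F.image f := by grind
  calc Y.card ≤ (E ∪ F.image f).card := Finset.card_le_card this
    _ ≤ E.card + (F.image f).card := Finset.card_union_le _ _
    _ ≤ E.card + F.card := Nat.add_le_add_left Finset.card_image_le _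

lemma Step.gap (h : Step S D c X D') {s l : ℕ}
    (hs : ∀ t, t ∈ X ∨ t ∈ splitSet D c → s < t → s + l ≤ t) {t : ℕ} (ht : t ∈ bd D) (hst : s < t) :
    s + l ≤ t ∨ t = rep S ∨ t = rep S + 1 := by
  by_cases h1 : t = rep S
  · exact Or.inr (Or.inl h1)
  by_cases h2 : t = rep S + 1
  · exact Or.inr (Or.inr h2)
  exact Or.inl (hs t (Or.inl (h.mem t ht h1 h2)) hst)

/-- Bound on the number of F-intervals that start in a repetition. -/
lemma Step.cntV_le (h : Step S D c X D') (hS : IsText S) (hc : dollar < c)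
    (hD : IsDBWT D (bwt S)) (hα : 2 ≤ α) (hb : Balanced S D α) {e : ℕ × ℕ × ℕ}
    (he : e ∈ ent 0 D') :
    cnt ((bd D').image (lf (c :: S))) e.1 (e.1 + e.2.2) ≤ 2 * α ∧
    (α ≤ cnt ((bd D').image (lf (c :: S))) e.1 (e.1 + e.2.2) →
      (e.1 ≤ shift (insPos (bwt S) c) (rep S) ∧
        shift (insPos (bwt S) c) (rep S) < e.1 + e.2.2) ∨
      Splits D c ∧ e.1 ≤ shift (insPos (bwt S) c) (lf S (insPos (bwt S) c)) ∧
        shift (insPos (bwt S) c) (lf S (insPos (bwt S) c)) < e.1 + e.2.2) := by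
  rcases h.tile_cases hS hc hD he with ⟨h1, h2⟩ | ⟨s, hn, hq, hs, hs'⟩
  · grind [cnt_le_len]
  set i := insPos (bwt S) c with hi
  set sp := shift i (lf S i) with hsp
  have hin : ∀ t, (e.1 ≤ shift i t ∧ shift i t < e.1 + e.2.2) ↔ (s ≤ t ∧ t < s + e.2.2) := by
    intro t
    have hpos := h.isDBWT.len_pos he
    have h0 := hq 0 hpos
    have h1 := hq (e.2.2 - 1) (by omega)
    rw [show e.1 + (e.2.2 - 1) = e.1 + e.2.2 - 1 by omega] at h1
    have h2 := shift_le_iff (i := i) (p := s + 0) (q := t)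
    have h3 := shift_le_iff (i := i) (p := t) (q := s + (e.2.2 - 1))
    grind
  have hcover : cnt ((bd D').image (lf (c :: S))) e.1 (e.1 + e.2.2) ≤
      (if Splits D c ∧ e.1 ≤ sp ∧ sp < e.1 + e.2.2 then 1 else 0) +
        cnt ((bd D).image (lf S)) s (s + e.2.2) := by
    refine (card_le_of_cover (f := shift i)
      (E := if Splits D c ∧ e.1 ≤ sp ∧ sp < e.1 + e.2.2 then {sp} else ∅)
      (F := ((bd D).image (lf S)).filter fun x => s ≤ x ∧ x < s + e.2.2) ?_).trans ?_
    · intro y hy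
      obtain ⟨hy, h1, h2⟩ := Finset.mem_filter.1 hy
      rcases h.mem_image_lf hS hc hD hy with h3 | ⟨t, ht, rfl⟩ | ⟨h3, h4⟩
      · have := hq (y - e.1) (by omega)
        grind [shift_ne]
      · grind
      grind
    grind [cnt]
  have hsplit : (if Splits D c ∧ e.1 ≤ sp ∧ sp < e.1 + e.2.2 then 1 else 0) ≤ 1 := by
    split <;> omega
  by_cases hr : s ≤ rep S ∧ rep S < s + e.2.2
  · refine ⟨?_, fun _ => Or.inl ((hin _).2 hr)⟩
    have hA := hb.cntV_gap hS hD (by omega) (p := s) (q := rep S) (by omega) fun t ht hst => by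
      rcases h.gap hs' ht hst with h1 | h1 | h1 <;> omega
    have hB := hb.cntV_gap hS hD (by omega) (p := rep S + 1) (q := s + e.2.2) hn fun t ht hst => by
      rcases h.gap hs' ht (by omega) with h1 | h1 | h1 <;> omega
    have hC : cnt ((bd D).image (lf S)) s (s + e.2.2) ≤ cnt ((bd D).image (lf S)) s (rep S) + 1 +
        cnt ((bd D).image (lf S)) (rep S + 1) (s + e.2.2) := by
      have hC' : ((bd D).image (lf S)).filter (fun x => s ≤ x ∧ x < s + e.2.2) ⊆
          (((bd D).image (lf S)).filter (fun x => s ≤ x ∧ x < rep S) ∪ {rep S}) ∪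
            ((bd D).image (lf S)).filter (fun x => rep S + 1 ≤ x ∧ x < s + e.2.2) := by grind
      refine (Finset.card_le_card hC').trans ((Finset.card_union_le _ _).trans ?_)
      refine Nat.add_le_add_right ((Finset.card_union_le _ _).trans ?_) _
      rfl
    omega
  · have hA := hb.cntV_gap hS hD (by omega) (p := s) (q := s + e.2.2) hn fun t ht hst => by
      rcases h.gap hs' ht hst with h1 | h1 | h1 <;> omega
    grind

/-- Bound on the number of repetitions that start in an F-interval. -/
lemma Step.cntU_le (h : Step S D c X D') (hS : IsText S) (hc : dollar < c)
    (hD : IsDBWT D (bwt S)) (hα : 2 ≤ α) (hb : Balanced S D α) {e : ℕ × ℕ × ℕ}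
    (he : e ∈ ent 0 D') :
    cnt (bd D') (lf (c :: S) e.1) (lf (c :: S) e.1 + e.2.2) ≤ 2 * α ∧
    (α ≤ cnt (bd D') (lf (c :: S) e.1) (lf (c :: S) e.1 + e.2.2) →
      (e.1 ≤ shift (insPos (bwt S) c) (rep S) ∧
        shift (insPos (bwt S) c) (rep S) < e.1 + e.2.2) ∨
      lf (c :: S) e.1 ≤ insPos (bwt S) c + 1 ∧
        insPos (bwt S) c + 1 < lf (c :: S) e.1 + e.2.2) := by
  have hS' := hS.cons hc
  rcases h.tile_cases hS hc hD he with ⟨h1, h2⟩ | ⟨s, hn, hq, hs, hs'⟩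
  · grind [cnt_le_len]
  have hlf : ∀ q < e.2.2, lf (c :: S) e.1 + q =
      if s + q = rep S then insPos (bwt S) c else shift (insPos (bwt S) c) (lf S (s + q)) := by
    intro q hq'
    rw [← h.isDBWT.lf_add hS' he hq', hq q hq']
    grind [lf_cons_rep, lf_cons_shift]
  set i := insPos (bwt S) c with hi
  set v := lf (c :: S) e.1 with hv
  have hcover : ∀ {E F : Finset ℕ}, (v ≤ i ∧ i < v + e.2.2 → i ∈ E) →
      (v ≤ i + 1 ∧ i + 1 < v + e.2.2 → i + 1 ∈ E) →
      (∀ y ∈ bd D, ∀ q < e.2.2, s + q ≠ rep S → lf S (s + q) = y → y ∈ F) →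
      cnt (bd D') v (v + e.2.2) ≤ E.card + F.card := by
    intro E F hE1 hE2 hF
    refine card_le_of_cover (f := shift i) fun y hy => ?_
    obtain ⟨hy, h1, h2⟩ := Finset.mem_filter.1 hy
    rcases h.mem_bd_iff.1 hy with h3 | ⟨t, ht | ht, h3⟩
    · grind
    · have h4 := hlf (y - v) (by omega)
      rw [show v + (y - v) = y by omega] at h4
      split at h4
      · grind
      · rename_i h5
        rw [h4] at h3
        have h6 := shift_inj h3
        exact Or.inr ⟨t, hF t (h.subset ht) _ (by omega) h5 h6.symm, by rw [h6]; exact h4.symm⟩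
    · rw [mem_splitSet, hD.ins_eq, ← hi] at ht
      grind [shift]
  have hpos := h.isDBWT.len_pos he
  by_cases hr : s ≤ rep S ∧ rep S < s + e.2.2
  · refine ⟨?_, fun _ => Or.inl ?_⟩
    · have hA := hb.cntU_gap hS hD (by omega) (p := s) (q := rep S) (by omega) fun t ht hst => by
        rcases h.gap hs' ht hst with h1 | h1 | h1 <;> omega
      have hB := hb.cntU_gap hS hD (by omega) (p := rep S + 1) (q := s + e.2.2) hn
        fun t ht hst => by
          rcases h.gap hs' ht (by omega) with h1 | h1 | h1 <;> omega
      have hC := hcover (E := {i, i + 1})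
        (F := bd D ∩ (Finset.Ico s (rep S)).image (lf S) ∪
          bd D ∩ (Finset.Ico (rep S + 1) (s + e.2.2)).image (lf S))
        (by simp) (by simp) (by grind)
      grind
    · have h1 := hq (rep S - s) (by omega)
      grind
  · have hA := hb.cntU_gap hS hD (by omega) (p := s) (q := s + e.2.2) hn fun t ht hst => by
      rcases h.gap hs' ht hst with h1 | h1 | h1 <;> omega
    have hni : ¬ (v ≤ i ∧ i < v + e.2.2) := by
      intro h1
      have h2 := hlf (i - v) (by omega)
      grind [shift_ne]
    have hF : ∀ y ∈ bd D, ∀ q < e.2.2, s + q ≠ rep S → lf S (s + q) = y →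
        y ∈ bd D ∩ (Finset.Ico s (s + e.2.2)).image (lf S) := by grind
    have hC := hcover (E := {i + 1}) (fun h => absurd h hni) (by simp) hF
    rw [Finset.card_singleton] at hC
    refine ⟨by omega, fun hge => Or.inr ?_⟩
    by_contra hsp'
    have hC := hcover (E := ∅) (fun h => absurd h hni) (fun h => absurd h hsp') hF
    grind

lemma Step.balanced (h : Step S D c X D') (hS : IsText S) (hc : dollar < c)
    (hD : IsDBWT D (bwt S)) (hα : 2 ≤ α) (hb : Balanced S D α) :
    Balanced (c :: S) D' (2 * α + 1) := by
  intro i hi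
  rw [HeavyL, HeavyF, h.isDBWT.coveredByL_length hi, h.isDBWT.coveredByF_length (hS.cons hc) hi]
  have h1 := (h.cntV_le hS hc hD hα hb (nth_mem hi)).1
  have h2 := (h.cntU_le hS hc hD hα hb (nth_mem hi)).1
  omega

end

section

variable {S : List ℕ} {D : DBWT} {c : ℕ} {A B A₁ B₁ : DBWT}

lemma Setup.step_slow (h : Setup S D c A B A₁ B₁) (hS : IsText S) (hc : dollar < c)
    (hD : IsDBWT D (bwt S)) : Step S D c (bd D) (slowUpdate D c) :=
  ⟨h.updated_slow hD, h.slow_isDBWT hS hc hD, subset_rfl, fun _ h _ _ => h, fun h => h⟩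

lemma Setup.step_left (h : Setup S D c A B A₁ B₁) (hS : IsText S) (hc : dollar < c)
    (hD : IsDBWT D (bwt S)) (hl : lastHas c A) : Step S D c ((bd D).erase (rep S))
      (mergeLeft (updateParts D c).1 c (updateParts D c).2) := by
  have h1 := h.ins_ne_rep hS hc hD hl
  rw [hD.ins_eq] at h1
  refine ⟨h.updated_left hS hc hD hl, ?_, Finset.erase_subset _ _, ?_, ?_⟩
  · refine isDBWT_mergeLeft (h.slow_isDBWT hS hc hD) ?_
    rw [h.lastHas_iff hS hc hD, h.ref.last]; exact hl
  · grind
  grind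

lemma Setup.step_right (h : Setup S D c A B A₁ B₁) (hS : IsText S) (hc : dollar < c)
    (hD : IsDBWT D (bwt S)) (hr : headHas c B) : Step S D c ((bd D).erase (rep S + 1))
      (mergeRight (updateParts D c).1 c (updateParts D c).2) := by
  have h1 := h.ins_ne_rep_succ hS hD hr
  rw [hD.ins_eq] at h1
  refine ⟨h.updated_right hS hc hD hr, ?_, Finset.erase_subset _ _, ?_, ?_⟩
  · refine isDBWT_mergeRight (h.slow_isDBWT hS hc hD) ?_
    rw [h.headHas_iff hS hc hD, h.ref.head]; exact hr
  · grind
  grind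

lemma Setup.step_both (h : Setup S D c A B A₁ B₁) (hS : IsText S) (hc : dollar < c)
    (hD : IsDBWT D (bwt S)) (hl : lastHas c A) (hr : headHas c B) :
    Step S D c (((bd D).erase (rep S)).erase (rep S + 1))
      (mergeBoth (updateParts D c).1 c (updateParts D c).2) := by
  have h1 := h.ins_ne_rep_succ hS hD hr
  have h2 := h.ins_ne_rep hS hc hD hl
  rw [hD.ins_eq] at h1 h2
  refine ⟨h.updated_both hS hc hD hl hr, ?_,
    (Finset.erase_subset _ _).trans (Finset.erase_subset _ _), ?_, ?_⟩
  · refine isDBWT_mergeBoth (h.slow_isDBWT hS hc hD) ?_ ?_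
    · rw [h.lastHas_iff hS hc hD, h.ref.last]; exact hl
    · rw [h.headHas_iff hS hc hD, h.ref.head]; exact hr
  · grind
  grind

end

end RComp


namespace RComp

/-! ### The two tilings of the positions -/

lemma ent_getElem {s : ℕ} {T : List (ℕ × ℕ)} {i : ℕ} (hi : i < (ent s T).length) :
    (ent s T)[i] = (s + start T i, T[i]'(by rwa [ent_length] at hi)) := by
  induction T generalizing s i with
  | nil => simp [ent] at hi
  | cons p T ih =>
    cases i with
    | zero => simp [ent, start]
    | succ i => grind [ent, start]

lemma ent_insert {P Q : List (ℕ × ℕ)} (hP : ∀ p ∈ P, 0 < p.2) {x : ℕ} {e : ℕ × ℕ × ℕ} :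
    e ∈ ent 0 (P ++ (x, 1) :: Q) ↔
      e = (width P, x, 1) ∨ ∃ e₀ ∈ ent 0 (P ++ Q), e = (shift (width P) e₀.1, e₀.2) := by
  simp only [ent_append, ent_cons, List.mem_append, List.mem_cons, zero_add]
  rw [ent_add]
  have h1 : ∀ e ∈ ent 0 P, shift (width P) e.1 = e.1 := by
    intro e he
    have := (ent_le he).2
    grind [ent_pos, shift]
  have h2 : ∀ e ∈ ent (width P) Q, shift (width P) e.1 = e.1 + 1 := by
    intro e he
    have := (ent_le he).1
    simp [shift]; omega
  grind

/-- The tiles of `TV` are the tiles of `TU`, moved by the LF function. -/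
structure Geo (S : List ℕ) (TU TV : List (ℕ × ℕ)) : Prop where
  perm : TV.Perm TU
  compat : ∀ e ∈ ent 0 TU, (lf S e.1, e.2) ∈ ent 0 TV

section

variable {S : List ℕ} {TU TV X Y X' Y' : List (ℕ × ℕ)} {x y u z c l₁ l₂ : ℕ}

lemma Geo.perm_recs (g : Geo S TU TV) : (recs TV).Perm (recs TU) := g.perm.map _

lemma Geo.mem_ent (g : Geo S TU TV) (hn : (recs TU).Nodup) {e' : ℕ × ℕ × ℕ} :
    e' ∈ ent 0 TV ↔ ∃ e ∈ ent 0 TU, (lf S e.1, e.2) = e' := by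
  constructor
  · intro h
    have h1 := g.perm_recs.mem_iff.1 (mem_recs_of_ent h)
    obtain ⟨e, he, h2⟩ := exists_ent_of_mem_recs (s := 0) h1
    exact ⟨e, he, ent_eq_of_rec (g.perm_recs.nodup_iff.2 hn) (g.compat e he) h h2⟩
  · rintro ⟨e, he, rfl⟩; exact g.compat e he

lemma Geo.bd_eq (g : Geo S TU TV) (hn : (recs TU).Nodup) : bd TV = (bd TU).image (lf S) := by
  ext p
  rw [mem_bd, Finset.mem_image]
  constructor
  · rintro ⟨e', he', rfl⟩
    obtain ⟨e, he, rfl⟩ := (g.mem_ent hn).1 he'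
    grind [mem_bd]
  · rintro ⟨t, ht, rfl⟩
    obtain ⟨e, he, rfl⟩ := mem_bd.1 ht
    exact ⟨_, g.compat e he, rfl⟩

/-- The tile of `TV` with a given record. -/
lemma Geo.exists_parts (g : Geo S TU TV) (hT : TU = X ++ (x, l₁) :: Y) :
    ∃ X' Y', TV = X' ++ (x, l₁) :: Y' ∧ width X' = lf S (width X) := by
  have h1 := g.compat (width X, x, l₁) (by rw [hT]; simp)
  grind [RComp.mem_ent]

lemma ent_replace {M M' : List (ℕ × ℕ)} (hw : width M = width M') {e : ℕ × ℕ × ℕ}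
    (he : e ∈ ent 0 (X ++ (M ++ Y))) (hM : e.2.1 ∉ recs M) : e ∈ ent 0 (X ++ (M' ++ Y)) := by
  grind [ent_append_append, mem_recs_of_ent]

/-- Exchanging corresponding parts of the tilings. -/
lemma Geo.replace {M M' N N' : List (ℕ × ℕ)} (g : Geo S (X ++ (M ++ Y)) (X' ++ (M' ++ Y')))
    (hn : (recs (X ++ (M ++ Y))).Nodup) (h1 : M'.Perm M) (h2 : N'.Perm N)
    (hw : width M = width N) (hw' : width M' = width N')
    (hN : ∀ e ∈ ent (width X) N, (lf S e.1, e.2) ∈ ent (width X') N') :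
    Geo S (X ++ (N ++ Y)) (X' ++ (N' ++ Y')) := by
  refine ⟨?_, ?_⟩
  · have h3 : (M' ++ (X' ++ Y')).Perm (M' ++ (X ++ Y)) := by
      have e1 : (X' ++ (M' ++ Y')).Perm (M' ++ (X' ++ Y')) := List.perm_append_comm_assoc _ _ _
      have e2 : (X ++ (M ++ Y)).Perm (M ++ (X ++ Y)) := List.perm_append_comm_assoc _ _ _
      exact e1.symm.trans (g.perm.trans (e2.trans (h1.symm.append_right _)))
    grind [List.perm_append_left_iff, List.perm_append_comm_assoc]
  · intro e he
    have hout : e ∈ ent 0 (X ++ (M ++ Y)) → e.2.1 ∉ recs M →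
        (lf S e.1, e.2) ∈ ent 0 (X' ++ (N' ++ Y')) := by
      intro h3 h4
      refine ent_replace hw' (g.compat e h3) ?_
      grind [recs]
    grind [ent_append, notMem_mid, mem_recs_of_ent]

lemma Geo.split (g : Geo S (X ++ (u, l₁ + l₂) :: Y) (X' ++ (u, l₁ + l₂) :: Y'))
    (hX : width X' = lf S (width X)) (hl : lf S (width X + l₁) = lf S (width X) + l₁)
    (hn : (recs (X ++ (u, l₁ + l₂) :: Y)).Nodup) (x : ℕ) :
    Geo S (X ++ (u, l₁) :: (x, l₂) :: Y) (X' ++ (u, l₁) :: (x, l₂) :: Y') := by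
  refine Geo.replace (M := [(u, l₁ + l₂)]) (M' := [(u, l₁ + l₂)]) (N := [(u, l₁), (x, l₂)])
    (N' := [(u, l₁), (x, l₂)]) g hn (.refl _) (.refl _) (by simp) (by simp) ?_
  simp [hX, hl]

lemma adjacent_of_ent {T : List (ℕ × ℕ)} (hpos : ∀ p ∈ T, 0 < p.2) {p : ℕ}
    (h1 : (p, x, l₁) ∈ ent 0 T) (h2 : (p + l₁, y, l₂) ∈ ent 0 T) :
    ∃ X' Y', T = X' ++ (x, l₁) :: (y, l₂) :: Y' ∧ width X' = p := by
  obtain ⟨X', R, rfl, h3⟩ := RComp.mem_ent.1 h1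
  simp only [zero_add] at h3
  rw [ent_append, List.mem_append, ent_cons, List.mem_cons, zero_add, ← h3] at h2
  have hl := hpos (x, l₁) (by simp)
  simp only at hl
  rcases h2 with h | h | h
  · have := (ent_le h).2
    simp only at this; omega
  · simp at h; omega
  · cases R with
    | nil => simp at h
    | cons r R =>
      have hr := hpos r (by simp)
      rw [ent_cons, List.mem_cons] at h
      rcases h with h | h
      · grind
      · have := (ent_le h).1
        simp only at this; omega

lemma Geo.merge (g : Geo S (X ++ (x, l₁) :: (y, l₂) :: Y) TV) (hpos : ∀ p ∈ TV, 0 < p.2)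
    (hl : lf S (width X + l₁) = lf S (width X) + l₁)
    (hn : (recs (X ++ (x, l₁) :: (y, l₂) :: Y)).Nodup) :
    ∃ X' Y', TV = X' ++ (x, l₁) :: (y, l₂) :: Y' ∧ width X' = lf S (width X) ∧
      Geo S (X ++ (x, l₁ + l₂) :: Y) (X' ++ (x, l₁ + l₂) :: Y') := by
  have h1 := g.compat (width X, x, l₁) (by simp)
  have h2 := g.compat (width X + l₁, y, l₂) (by simp)
  simp only [hl] at h1 h2
  obtain ⟨X', Y', rfl, h3⟩ := adjacent_of_ent hpos h1 h2
  refine ⟨X', Y', rfl, h3, ?_⟩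
  refine Geo.replace (M := [(x, l₁), (y, l₂)]) (M' := [(x, l₁), (y, l₂)]) (N := [(x, l₁ + l₂)])
    (N' := [(x, l₁ + l₂)]) g hn (.refl _) (.refl _) (by simp) (by simp) ?_
  simp [h3]

lemma Geo.insert {A B PU QU PV QV : List (ℕ × ℕ)} {d : ℕ} (g : Geo S TU TV) (hS : IsText S)
    (hc : dollar < c)
    (hT : TU = A ++ (d, 1) :: B) (hA : width A = rep S) (hV : TV = PV ++ QV)
    (hU : A ++ (z, 1) :: B = PU ++ QU) (hPU : width PU = insPos (bwt S) c)
    (hPV : width PV = insPos (bwt S) c) (hpos : ∀ p ∈ TU, 0 < p.2) (hw : width TU = S.length) :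
    Geo (c :: S) (PU ++ (d, 1) :: QU) (PV ++ (z, 1) :: QV) := by
  have hposV : ∀ p ∈ TV, 0 < p.2 := fun p hp => hpos p (g.perm.mem_iff.1 hp)
  have hposU : ∀ p ∈ PU, 0 < p.2 := by
    intro p hp
    have h1 : p ∈ A ++ (z, 1) :: B := by rw [hU]; simp [hp]
    grind
  subst hV
  have hVm : ∀ e ∈ ent 0 (PV ++ QV),
      (shift (insPos (bwt S) c) e.1, e.2) ∈ ent 0 (PV ++ (z, 1) :: QV) := by
    intro e he
    exact (ent_insert (fun p hp => hposV p (by simp [hp]))).2 (Or.inr ⟨e, he, by rw [hPV]⟩)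
  refine ⟨?_, ?_⟩
  · refine List.perm_middle.trans (.trans ?_ List.perm_middle.symm)
    rw [← hU]
    refine ((g.perm.trans (hT ▸ List.perm_middle)).cons _).trans ?_
    grind
  · intro e he
    rcases (ent_insert hposU).1 he with rfl | ⟨e₀, he₀, rfl⟩
    · have h1 := hVm _ (g.compat (rep S, d, 1) (by rw [hT, ← hA]; simp))
      grind [lf_rep, shift_zero, lf_cons_ins]
    · rw [← hU] at he₀
      simp only [hPU]
      by_cases h2 : e₀ = (rep S, z, 1)
      · rw [h2]
        simp only [lf_cons_rep hS hc]
        rw [← hPV]; simp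
      · have h3 : e₀ ∈ ent 0 TU ∧ e₀.1 ≠ rep S := by
          rw [hT] at hpos ⊢
          simp only [ent_append, ent_cons, List.mem_append, List.mem_cons, zero_add, hA] at he₀ ⊢
          rcases he₀ with h | h | h
          · have h4 := (ent_le h).2
            have h5 := ent_pos (fun p hp => hpos p (by simp [hp])) h
            grind
          · exact absurd h h2
          · have h4 := (ent_le h).1
            grind
        have h4 := (ent_le h3.1).2
        have h5 := ent_pos hpos h3.1
        rw [lf_cons_shift hS hc (by omega) h3.2]
        exact hVm _ (g.compat e₀ h3.1)

end

end RComp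


namespace RComp

/-! ### The stored graph and its tilings -/

lemma links_iff {h : ℕ → ℕ → ℕ} {s : Bool} {l : List ℕ} : Links h s l ↔
    IsLinkedList h (fp s) (fn s) l (h 0 (fn s)) (h 0 (fp s)) := by
  have e1 : ∀ i (hi : i + 1 < (0 :: (l ++ [0])).length),
      (0 :: (l ++ [0]))[i + 1] = l.getD i 0 := by grind
  have e2 : ∀ i (hi : i < (0 :: (l ++ [0])).length),
      (0 :: (l ++ [0]))[i] = if i = 0 then 0 else l.getD (i - 1) 0 := by grind
  have e3 : l.headD 0 = l.getD 0 0 := by cases l <;> rfl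
  have e4 : l.getLastD 0 = if l.length = 0 then 0 else l.getD (l.length - 1) 0 := by grind
  have e5 : l.getD l.length 0 = 0 := by simp
  unfold Links IsLinkedList
  rw [List.isChain_iff_getElem, e3, e4]
  constructor
  · grind
  grind

section

variable {S : List ℕ} {D : DBWT}

/-- The order of F-intervals is the order by character and position. -/
lemma lf_lt_of_key (hS : IsText S) {p q : ℕ} (hp : p < S.length) (hq : q < S.length)
    (h : (bwt S).getD p 0 < (bwt S).getD q 0 ∨ ((bwt S).getD p 0 = (bwt S).getD q 0 ∧ p < q)) :
    lf S p < lf S q := by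
  rw [lf_eq_count hS hp, lf_eq_count hS hq]
  have hp' : p < (bwt S).length := by rwa [bwt_length]
  have h0 := count_take_succ (bwt S) ((bwt S).getD p 0) p hp'
  rw [if_pos rfl] at h0
  rcases h with h | ⟨h, hpq⟩
  · have h1 : ((bwt S).take (p + 1)).count ((bwt S).getD p 0) ≤ (bwt S).count ((bwt S).getD p 0) :=
      (List.take_sublist _ _).count_le _
    have h2 : (bwt S).countP (fun x => decide (x < (bwt S).getD p 0)) +
        (bwt S).count ((bwt S).getD p 0) ≤
        (bwt S).countP (fun x => decide (x < (bwt S).getD q 0)) := by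
      generalize (bwt S).getD p 0 = x at h
      generalize (bwt S).getD q 0 = y at h
      induction bwt S with
      | nil => simp
      | cons a L ih => grind
    omega
  · rw [← h]
    have h1 : ((bwt S).take (p + 1)).count ((bwt S).getD p 0) ≤
        ((bwt S).take q).count ((bwt S).getD p 0) :=
      (List.take_sublist_take_left hpq).count_le _
    omega

lemma IsDBWT.chr_eq (hD : IsDBWT D (bwt S)) {i : ℕ} (hi : i < D.length) :
    (bwt S).getD (start D i) 0 = chr D i := by
  simpa [nth, chr] using hD.getD (nth_mem hi) (q := 0) (hD.len_pos (nth_mem hi))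

lemma start_lt {D : DBWT} (hpos : ∀ p ∈ D, 0 < p.2) {i j : ℕ} (hij : i < j) (hj : j ≤ D.length) :
    start D i < start D j := by
  induction j, hij using Nat.le_induction with
  | base => grind [start_succ]
  | succ j hij ih => grind [start_succ]

lemma IsDBWT.keyLt_iff (hS : IsText S) (hD : IsDBWT D (bwt S)) {i j : ℕ} (hi : i < D.length)
    (hj : j < D.length) : keyLt D i j ↔ fFirst S D i < fFirst S D j := by
  have hi' := hD.ent_lt (nth_mem hi)
  have hj' := hD.ent_lt (nth_mem hj)
  have key : ∀ {i j}, i < D.length → j < D.length → keyLt D i j →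
      fFirst S D i < fFirst S D j := by
    intro i j hi hj h
    refine lf_lt_of_key hS (hD.ent_lt (nth_mem hi)) (hD.ent_lt (nth_mem hj)) ?_
    rw [hD.chr_eq hi, hD.chr_eq hj]
    rcases h with h | ⟨h, h'⟩
    · exact Or.inl h
    · exact Or.inr ⟨h, start_lt hD.1 h' hj.le⟩
  grind [keyLt]

lemma vOrder_perm (S : List ℕ) (D : DBWT) : (vOrder S D).Perm (List.range D.length) :=
  List.mergeSort_perm _ _

lemma mem_vOrder {i : ℕ} : i ∈ vOrder S D ↔ i < D.length := by grind [vOrder_perm]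

lemma IsDBWT.vOrder_sorted (hD : IsDBWT D (bwt S)) :
    (vOrder S D).Pairwise (fun i j => fFirst S D i < fFirst S D j) := by
  have h1 : (vOrder S D).Pairwise (fun i j => fFirst S D i ≤ fFirst S D j) := by
    grind [List.pairwise_mergeSort, vOrder]
  have h2 : (vOrder S D).Nodup := (vOrder_perm S D).nodup_iff.2 List.nodup_range
  rw [List.Nodup] at h2
  refine (h1.and h2).imp_of_mem ?_
  rintro a b ha hb ⟨h, h'⟩
  refine lt_of_le_of_ne h fun h'' => h' ?_
  have ha' := mem_vOrder.1 ha
  have hb' := mem_vOrder.1 hb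
  have h3 := lf_inj (hD.ent_lt (nth_mem ha')) (hD.ent_lt (nth_mem hb')) h''
  simp only [nth] at h3
  rcases lt_trichotomy a b with h4 | h4 | h4
  · have := start_lt hD.1 h4 hb'.le; omega
  · exact h4
  · have := start_lt hD.1 h4 ha'.le; omega

/-- Disjoint intervals fit into an interval that contains them. -/
lemma sum_le_of_disjoint {l : List (ℕ × ℕ × ℕ)} {a b : ℕ} (hab : a ≤ b)
    (hl : l.Pairwise (fun e e' => e.1 + e.2.2 ≤ e'.1)) (h1 : ∀ e ∈ l, a ≤ e.1)
    (h2 : ∀ e ∈ l, e.1 + e.2.2 ≤ b) : a + width (l.map Prod.snd) ≤ b := by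
  induction l generalizing a with
  | nil => simpa using hab
  | cons e l ih => grind [List.pairwise_cons]

/-- Intervals that fill an interval are the tiles of a tiling. -/
lemma ent_of_disjoint {l : List (ℕ × ℕ × ℕ)} {s : ℕ}
    (hl : l.Pairwise (fun e e' => e.1 + e.2.2 ≤ e'.1)) (h1 : ∀ e ∈ l, s ≤ e.1)
    (h2 : ∀ e ∈ l, e.1 + e.2.2 ≤ s + width (l.map Prod.snd)) : ent s (l.map Prod.snd) = l := by
  induction l generalizing s with
  | nil => rfl
  | cons e l ih =>
    rw [List.pairwise_cons] at hl
    have h3 := h2 e (by simp)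
    have h4 := h1 e (by simp)
    have h5 := sum_le_of_disjoint h3 hl.2 hl.1 fun e' he' => h2 e' (by simp [he'])
    grind [ent_cons]

/-- The stored tilings. -/
def tileU (D : DBWT) (a : ℕ → ℕ) : List (ℕ × ℕ) :=
  (List.range D.length).map fun i => (a i, (D.getD i (0, 0)).2)

def tileV (S : List ℕ) (D : DBWT) (a : ℕ → ℕ) : List (ℕ × ℕ) :=
  (vOrder S D).map fun i => (a i, (D.getD i (0, 0)).2)

lemma width_tileU (D : DBWT) (a : ℕ → ℕ) : width (tileU D a) = width D := by
  unfold width tileU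
  congr 1
  refine List.ext_getElem (by simp) fun i h1 h2 => ?_
  simp at h2
  simp [h2]

lemma start_tileU (D : DBWT) (a : ℕ → ℕ) (i : ℕ) : start (tileU D a) i = start D i := by
  unfold start width
  rw [List.map_take, List.map_take]
  congr 2
  refine List.ext_getElem (by simp [tileU]) fun i h1 h2 => ?_
  simp at h2
  simp [tileU, h2]

lemma ent_tileU (D : DBWT) (a : ℕ → ℕ) : ent 0 (tileU D a) =
    (List.range D.length).map fun i => (start D i, a i, (D.getD i (0, 0)).2) := by
  refine List.ext_getElem (by simp [ent_length, tileU]) fun i h1 h2 => ?_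
  rw [ent_getElem, start_tileU]
  simp [tileU]

lemma tileV_perm (S : List ℕ) (D : DBWT) (a : ℕ → ℕ) : (tileV S D a).Perm (tileU D a) :=
  (vOrder_perm S D).map _

lemma width_perm {T T' : List (ℕ × ℕ)} (h : T.Perm T') : width T = width T' :=
  (h.map _).sum_eq

lemma IsDBWT.lf_le (hS : IsText S) (hD : IsDBWT D (bwt S)) {e : ℕ × ℕ × ℕ}
    (he : e ∈ ent 0 D) : lf S e.1 + e.2.2 ≤ S.length := by
  have h1 := hD.len_pos he
  have h2 := hD.lf_add hS he (q := e.2.2 - 1) (by omega)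
  have h3 := hD.ent_le he
  have h4 := lf_lt (S := S) (p := e.1 + (e.2.2 - 1)) (by omega)
  omega

lemma IsDBWT.ent_tileV (hS : IsText S) (hD : IsDBWT D (bwt S)) (a : ℕ → ℕ) :
    ent 0 (tileV S D a) =
      (vOrder S D).map fun i => (fFirst S D i, a i, (D.getD i (0, 0)).2) := by
  have h := ent_of_disjoint (s := 0)
    (l := (vOrder S D).map fun i => (fFirst S D i, a i, (D.getD i (0, 0)).2)) ?_ (by simp) ?_
  · rw [← h]; simp [tileV, Function.comp_def]
  · rw [List.pairwise_map]
    refine hD.vOrder_sorted.imp_of_mem ?_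
    intro i j hi hj hij
    have hj' := mem_vOrder.1 hj
    have := hD.lf_bd hS (nth_mem (mem_vOrder.1 hi)) (mem_bd.2 ⟨_, nth_mem hj', rfl⟩)
    grind [fFirst, nth]
  · intro e he
    obtain ⟨i, hi, rfl⟩ := List.mem_map.1 he
    have h1 : width (((vOrder S D).map fun i => (fFirst S D i, a i, (D.getD i (0, 0)).2)).map
        Prod.snd) = S.length := by
      have := (width_perm (tileV_perm S D a)).trans (width_tileU D a)
      rw [hD.width_eq] at this
      rw [← this, tileV, List.map_map]; rfl
    rw [h1, zero_add]
    exact hD.lf_le hS (nth_mem (mem_vOrder.1 hi))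

lemma IsDBWT.geo_tile (hS : IsText S) (hD : IsDBWT D (bwt S)) (a : ℕ → ℕ) :
    Geo S (tileU D a) (tileV S D a) := by
  refine ⟨tileV_perm S D a, fun e he => ?_⟩
  rw [ent_tileU, List.mem_map] at he
  obtain ⟨i, hi, rfl⟩ := he
  rw [hD.ent_tileV hS, List.mem_map]
  exact ⟨i, mem_vOrder.2 (by simpa using hi), rfl⟩

/-- The memory contains the graph given by the two tilings. -/
structure Core (S : List ℕ) (D : DBWT) (h : ℕ → ℕ → ℕ) (TU TV : List (ℕ × ℕ)) : Prop where
  mesh : Mesh h false TU TV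
  geo : Geo S TU TV
  len : ∀ p ∈ TU, h p.1 fLen = p.2
  dbwt : TU.map (fun p => (h p.1 fChar, p.2)) = D

lemma mem_tileU {a : ℕ → ℕ} {p : ℕ × ℕ} : p ∈ tileU D a ↔
    ∃ i < D.length, p = (a i, (D.getD i (0, 0)).2) := by grind [tileU]

lemma recs_tileU (a : ℕ → ℕ) : recs (tileU D a) = (List.range D.length).map a := by
  simp [recs, tileU, Function.comp_def]

lemma recs_tileV (a : ℕ → ℕ) : recs (tileV S D a) = (vOrder S D).map a := by
  simp [recs, tileV, Function.comp_def]

variable {α : ℕ} {σ : State} {a : ℕ → ℕ}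

lemma Stores.label (st : Stores S D α σ a) (hD : IsDBWT D (bwt S)) {i : ℕ} (hi : i < D.length) :
    σ.heap (a i) fChar = chr D i ∧ σ.heap (a i) fLen = (D.getD i (0, 0)).2 := by
  have h1 := st.labelU i hi
  simp only [grp, Prod.mk.injEq] at h1
  rw [← h1.1, ← h1.2, hD.chr_eq hi, start_succ hi]
  exact ⟨rfl, by omega⟩

lemma Stores.core (st : Stores S D α σ a) (hS : IsText S) (hD : IsDBWT D (bwt S))
    {h : ℕ → ℕ → ℕ} (hh : ∀ x, x ≠ 0 → ∀ f, h x f = σ.heap x f)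
    (hE : ∀ s, h 0 (fe s) = 0) (h1 : h 0 fNextU = σ.reg rHeadU) (h2 : h 0 fPrevU = σ.reg rTailU)
    (h3 : h 0 fNextV = σ.reg rHeadV) (h4 : h 0 fPrevV = σ.reg rTailV) :
    Core S D h (tileU D a) (tileV S D a) := by
  have hg := hD.geo_tile hS a
  have hinj : (recs (tileU D a)).Nodup := by
    rw [recs_tileU]
    refine List.Nodup.map_on (fun i hi j hj hij => ?_) List.nodup_range
    exact st.addr_inj i (by simpa using hi) j (by simpa using hj) hij
  have hz : ∀ i < D.length, a i ≠ 0 := fun i hi => (st.addr_pos i hi).ne'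
  have hz0 : 0 ∉ recs (tileU D a) := by grind [recs_tileU]
  have hpos : ∀ p ∈ tileU D a, 0 < p.2 := by
    intro p hp
    obtain ⟨i, hi, rfl⟩ := mem_tileU.1 hp
    exact hD.len_pos (nth_mem hi)
  have hlist : ∀ {l : List ℕ} {fp fn hd tl : ℕ}, (∀ x ∈ l, x ≠ 0) →
      IsLinkedList σ.heap fp fn l hd tl → IsLinkedList h fp fn l hd tl := by
    intro l fp fn hd tl hl hL
    refine ⟨hL.1, hL.2.1, fun t ht => ?_⟩
    have : l.getD t 0 ≠ 0 := hl _ (by grind)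
    rw [hh _ this, hh _ this]
    exact hL.2.2 t ht
  refine ⟨⟨hpos, fun p hp => hpos p ((tileV_perm S D a).mem_iff.1 hp), hinj,
    hg.perm_recs.nodup_iff.2 hinj, hz0, fun h => hz0 (hg.perm_recs.mem_iff.1 h),
    width_perm (tileV_perm S D a), ?_, ?_, ?_, ?_, hE _, hE _⟩, hg, ?_, ?_⟩
  · rw [links_iff, recs_tileU]
    refine hlist ?_ (by
      rw [show fn false = fNextU from rfl, show fp false = fPrevU from rfl, h1, h2]
      exact st.listU)
    grind
  · rw [links_iff, recs_tileV]
    refine hlist ?_ (by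
      rw [show fn (!false) = fNextV from rfl, show fp (!false) = fPrevV from rfl, h3, h4]
      exact st.listV)
    grind [mem_vOrder]
  · intro p hp q hq h5 h6
    rw [ent_tileU, List.mem_map] at hp
    rw [hD.ent_tileV hS, List.mem_map] at hq
    obtain ⟨i, hi, rfl⟩ := hp
    obtain ⟨j, hj, rfl⟩ := hq
    have hi' : i < D.length := by simpa using hi
    have hj' := mem_vOrder.1 hj
    simp only at h5 h6 ⊢
    rw [hh _ (hz i hi'), hh _ (hz i hi')]
    have h7 := hD.fLast_eq hS hj'
    refine st.edgeL i j ⟨hi', hj', h5, ?_⟩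
    grind [nth, fFirst]
  · intro p hp q hq h5 h6
    rw [ent_tileU, List.mem_map] at hq
    rw [hD.ent_tileV hS, List.mem_map] at hp
    obtain ⟨i, hi, rfl⟩ := hq
    obtain ⟨j, hj, rfl⟩ := hp
    have hi' : i < D.length := by simpa using hi
    have hj' := mem_vOrder.1 hj
    simp only at h5 h6 ⊢
    rw [hh _ (hz j hj'), hh _ (hz j hj')]
    refine st.edgeF j i ⟨hi', hj', h5, ?_⟩
    rw [start_succ hi']
    omega
  · intro p hp
    obtain ⟨i, hi, rfl⟩ := mem_tileU.1 hp
    simp only [hh _ (hz i hi)]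
    exact (st.label hD hi).2
  · refine List.ext_getElem (by simp [tileU]) fun i h5 h6 => ?_
    simp only [tileU, List.map_map, List.getElem_map, List.getElem_range, Function.comp]
    rw [hh _ (hz i h6), (st.label hD h6).1, chr, List.getD_eq_getElem _ _ h6]

lemma Stores.inorder_sublist (st : Stores S D α σ a) (hS : IsText S) (hD : IsDBWT D (bwt S)) :
    σ.btree.inorder.Sublist (recs (tileV S D a)) := by
  obtain ⟨js, h1, h2, h3⟩ := st.btreeSorted
  rw [h1, recs_tileV]
  refine List.Sublist.map _ ?_
  have h4 : js.Pairwise (fun i j => fFirst S D i < fFirst S D j) :=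
    h3.imp_of_mem fun hi hj h => (hD.keyLt_iff hS (h2 _ hi) (h2 _ hj)).1 h
  have h5 : js.Subperm (vOrder S D) := by
    refine List.subperm_of_subset (h4.imp fun h => ?_) fun i hi => mem_vOrder.2 (h2 i hi)
    grind
  obtain ⟨l, h6, h7⟩ := h5
  have := h6.eq_of_pairwise (le := fun i j => fFirst S D i < fFirst S D j)
    (fun _ _ _ _ h h' => absurd h (not_lt_of_gt h')) (hD.vOrder_sorted.sublist h7) h4
  rw [← this]; exact h7

end

end RComp


namespace RComp

section

variable {S : List ℕ} {D : DBWT} {h : ℕ → ℕ → ℕ} {TU TV : List (ℕ × ℕ)} {α : ℕ} {σ : State}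

/-- A tiling can be divided at a position in at most one way. -/
lemma append_inj_of_width {P Q P' Q' : List (ℕ × ℕ)} (he : P ++ Q = P' ++ Q')
    (hpos : ∀ p ∈ P ++ Q, 0 < p.2) (hw : width P = width P') : P = P' ∧ Q = Q' := by
  induction P generalizing P' with
  | nil =>
    cases P' with
    | nil => exact ⟨rfl, he⟩
    | cons p P' =>
      have := hpos p (by rw [he]; simp)
      simp only [width_nil, width_cons] at hw
      omega
  | cons p P ih =>
    cases P' with
    | nil =>
      have := hpos p (by simp)
      simp only [width_nil, width_cons] at hw
      omega
    | cons p' P' =>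
      simp only [List.cons_append, List.cons.injEq] at he
      obtain ⟨rfl, he⟩ := he
      simp only [width_cons] at hw
      obtain ⟨h1, h2⟩ := ih he (fun q hq => hpos q (by simp at hq ⊢; simp [hq])) (by omega)
      exact ⟨by rw [h1], h2⟩

/-- The addresses of the records of a tiling. -/
def addr (TU : List (ℕ × ℕ)) (i : ℕ) : ℕ := (TU.getD i (0, 0)).1

lemma Core.length_eq (co : Core S D h TU TV) : D.length = TU.length := by
  rw [← co.dbwt]; simp

lemma Core.getD_eq (co : Core S D h TU TV) {i : ℕ} (hi : i < D.length) :
    D.getD i (0, 0) = (h (addr TU i) fChar, (TU.getD i (0, 0)).2) := by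
  have hi' : i < TU.length := by rwa [← co.length_eq]
  rw [← co.dbwt]
  simp [addr, hi']

lemma Core.tileU_eq (co : Core S D h TU TV) : tileU D (addr TU) = TU := by
  have hl := co.length_eq
  refine List.ext_getElem (by simp [tileU, hl]) fun i h1 h2 => ?_
  simp only [tileU, List.getElem_map, List.getElem_range]
  rw [co.getD_eq (by omega)]
  simp [addr, h2]

lemma Core.tileV_eq (co : Core S D h TU TV) (hS : IsText S) (hD : IsDBWT D (bwt S)) :
    tileV S D (addr TU) = TV := by
  have h1 := hD.geo_tile hS (addr TU)
  rw [co.tileU_eq] at h1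
  have hn := co.mesh.nodup
  have hnd : ∀ {T}, (recs T).Nodup → (ent 0 T).Nodup := by
    intro T hT
    have h3 : (ent 0 T).map (fun e => e.2.1) = recs T := by
      rw [recs]
      conv_rhs => rw [← ent_map_snd 0 T]
      rw [List.map_map]; rfl
    exact List.Nodup.of_map _ (h3 ▸ hT)
  have h2 : (ent 0 (tileV S D (addr TU))).Perm (ent 0 TV) := by
    refine (List.perm_ext_iff_of_nodup (hnd (h1.perm_recs.nodup_iff.2 hn))
      (hnd co.mesh.nodup')).2 fun e => ?_
    rw [h1.mem_ent hn, co.geo.mem_ent hn]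
  have hlt : ∀ {T}, (∀ p ∈ T, 0 < p.2) → (ent 0 T).Pairwise (fun e e' => e.1 < e'.1) := by
    intro T hT
    refine (ent_pairwise 0 T).imp_of_mem fun he _ h => ?_
    have := ent_pos hT he
    omega
  have h3 := h2.eq_of_pairwise (le := fun e e' => e.1 < e'.1)
    (fun _ _ _ _ h h' => absurd h (not_lt_of_gt h'))
    (hlt fun p hp => co.mesh.pos p (h1.perm.mem_iff.1 hp)) (hlt co.mesh.pos')
  rw [← ent_map_snd 0 (tileV S D (addr TU)), h3, ent_map_snd]

lemma Core.recs_eq (co : Core S D h TU TV) : recs TU = (List.range D.length).map (addr TU) := by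
  rw [← recs_tileU, co.tileU_eq]

lemma Core.addr_mem (co : Core S D h TU TV) {i : ℕ} (hi : i < D.length) :
    (start D i, addr TU i, (D.getD i (0, 0)).2) ∈ ent 0 TU := by
  have h1 : (start D i, addr TU i, (D.getD i (0, 0)).2) ∈ ent 0 (tileU D (addr TU)) := by
    rw [ent_tileU, List.mem_map]
    exact ⟨i, by simpa using hi, rfl⟩
  rwa [co.tileU_eq] at h1

lemma Core.exists_parts (co : Core S D h TU TV) {i : ℕ} (hi : i < D.length) :
    ∃ X Y, TU = X ++ (addr TU i, (D.getD i (0, 0)).2) :: Y ∧ width X = start D i := by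
  have h1 := co.addr_mem hi
  obtain ⟨X, Y, h2, h3⟩ := mem_ent.1 h1
  exact ⟨X, Y, h2, by simpa using h3.symm⟩

lemma Core.dollar_parts (co : Core S D h TU TV) (hS : IsText S) (hD : IsDBWT D (bwt S)) :
    ∃ A B, TU = A ++ (addr TU (dollarIdx D), 1) :: B ∧ width A = rep S ∧
      h (addr TU (dollarIdx D)) fChar = dollar ∧ dollarIdx D = A.length ∧
      ∀ p ∈ A ++ B, h p.1 fChar ≠ dollar := by
  obtain ⟨A', B', h1, h2, h3, h4⟩ := hD.exists_decomp hS
  have h5 : dollarIdx D = A'.length := by rw [h1]; exact dollarIdx_eq h3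
  have h6 : dollarIdx D < D.length := by rw [h5, h1]; simp
  have h7 : D.getD (dollarIdx D) (0, 0) = (dollar, 1) := by
    rw [h5, h1]; exact getD_append_cons _ _ _
  obtain ⟨X, Y, h8, h9⟩ := co.exists_parts h6
  rw [h7] at h8
  have h10 : width X = rep S := by rw [h9, h5, h1, start_length_left, h2]
  have h11 := co.dbwt
  generalize addr TU (dollarIdx D) = d at h8 ⊢
  rw [h8, List.map_append, List.map_cons] at h11
  replace h11 := h11.trans h1
  have hw : ∀ T : List (ℕ × ℕ), width (T.map fun p => (h p.1 fChar, p.2)) = width T := by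
    intro T; simp [width, Function.comp_def]
  have h12 := append_inj_of_width h11 (by rw [h11, ← h1]; exact hD.1) (by rw [hw, h10, h2])
  simp only [List.cons.injEq, Prod.mk.injEq] at h12
  refine ⟨X, Y, h8, h10, h12.2.1.1, ?_, ?_⟩
  · rw [h5, ← h12.1]; simp
  · intro p hp
    rcases List.mem_append.1 hp with hp | hp
    · exact h3 (h p.1 fChar, p.2) (by rw [← h12.1]; exact List.mem_map.2 ⟨p, hp, rfl⟩)
    · exact h4 (h p.1 fChar, p.2) (by rw [← h12.2.2]; exact List.mem_map.2 ⟨p, hp, rfl⟩)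

lemma Core.stores (co : Core S D σ.heap TU TV) (hS : IsText S) (hD : IsDBWT D (bwt S))
    (hα : σ.reg rAlpha = α) (hf : ∀ x ∈ recs TU, x < σ.reg rFresh)
    (h1 : σ.reg rHeadU = σ.heap 0 fNextU) (h2 : σ.reg rTailU = σ.heap 0 fPrevU)
    (h3 : σ.reg rHeadV = σ.heap 0 fNextV) (h4 : σ.reg rTailV = σ.heap 0 fPrevV)
    {A B : List (ℕ × ℕ)} (hd : TU = A ++ (σ.reg rDollar, 1) :: B) (hA : width A = rep S)
    (ho : σ.order = recs TU)
    (hU : ((List.range (σ.reg rNumU)).map (fun q => σ.heap q fArrU)).Perm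
      ((heavyLs S D α).map (addr TU)))
    (hV : ((List.range (σ.reg rNumV)).map (fun q => σ.heap q fArrV)).Perm
      ((heavyFs S D α).map (addr TU)))
    (hb : ∃ h, σ.btree.HasHeight h) (hb' : σ.btree.inorder.Sublist (recs TV)) :
    Stores S D α σ (addr TU) := by
  have hTU := co.tileU_eq
  have hTV := co.tileV_eq hS hD
  have hmem : ∀ i < D.length, addr TU i ∈ recs TU := by
    intro i hi
    rw [co.recs_eq]; exact List.mem_map_of_mem (by simpa using hi)
  have hE : ∀ i < D.length, (start D i, addr TU i, (D.getD i (0, 0)).2) ∈ ent 0 TU :=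
    fun i hi => co.addr_mem hi
  have hE' : ∀ i < D.length, (fFirst S D i, addr TU i, (D.getD i (0, 0)).2) ∈ ent 0 TV := by
    intro i hi
    exact co.geo.compat _ (hE i hi)
  have hlen : ∀ i < D.length, σ.heap (addr TU i) fLen = (D.getD i (0, 0)).2 := by
    intro i hi
    refine co.len (addr TU i, (D.getD i (0, 0)).2) ?_
    have h5 : (addr TU i, (D.getD i (0, 0)).2) ∈ tileU D (addr TU) := mem_tileU.2 ⟨i, hi, rfl⟩
    rwa [hTU] at h5
  have hchr : ∀ i < D.length, σ.heap (addr TU i) fChar = chr D i := by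
    intro i hi; rw [chr, co.getD_eq hi]
  have hlast : ∀ i < D.length, fLast S D i + 1 = fFirst S D i + (D.getD i (0, 0)).2 :=
    fun i hi => hD.fLast_eq hS hi
  have hpos : ∀ i < D.length, 0 < (D.getD i (0, 0)).2 := fun i hi => hD.len_pos (nth_mem hi)
  refine ⟨hα, ?_, fun i hi => hf _ (hmem i hi), ?_, ?_, ?_, ?_, ?_, ?_, ?_, ?_, ?_, hU, hV, hb, ?_⟩
  · intro i hi
    exact Nat.pos_of_ne_zero fun h => co.mesh.zero (h ▸ hmem i hi)
  · intro i hi j hj hij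
    have := ent_eq_of_rec co.mesh.nodup (hE i hi) (hE j hj) hij
    have h5 := (Prod.ext_iff.1 this).1
    simp only at h5
    rcases lt_trichotomy i j with h | h | h
    · have := start_lt hD.1 h hj.le; omega
    · exact h
    · have := start_lt hD.1 h hi.le; omega
  · intro i hi
    simp only [grp]
    rw [hchr i hi, hlen i hi, hD.chr_eq hi, start_succ hi, Nat.add_sub_cancel_left]
  · intro i hi
    have h5 := hlast i hi
    have h6 := hpos i hi
    simp only [grp]
    rw [hchr i hi, hlen i hi, fFirst, fcol_lf (p := start D i) (hD.ent_lt (nth_mem hi)),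
      hD.chr_eq hi]
    rw [fFirst] at h5
    simp only [Prod.mk.injEq, true_and]
    omega
  · rw [← co.recs_eq, h1, h2]
    exact links_iff.1 co.mesh.links
  · rw [← recs_tileV, hTV, h3, h4]
    exact links_iff.1 co.mesh.links'
  · rintro i j ⟨hi, hj, h5, h6⟩
    have h7 := hlast j hj
    exact co.mesh.edges _ (hE i hi) _ (hE' j hj) h5 (by simp only; omega)
  · rintro j i ⟨hi, hj, h5, h6⟩
    have h7 := start_succ hi
    have h8 := hpos i hi
    exact co.mesh.edges' _ (hE' j hj) _ (hE i hi) h5 (by simp only; omega)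
  · obtain ⟨A', B', h5, h6, -⟩ := co.dollar_parts hS hD
    rw [h5] at hd
    have := append_inj_of_width hd (by rw [← h5]; exact co.mesh.pos) (by rw [h6, hA])
    simp only [List.cons.injEq, Prod.mk.injEq] at this
    exact this.2.1.1.symm
  · rw [ho, co.recs_eq]
  · rw [← hTV, recs_tileV, List.sublist_map_iff] at hb'
    obtain ⟨js, h5, h6⟩ := hb'
    have h7 : ∀ j ∈ js, j < D.length := fun j hj => mem_vOrder.1 (h5.subset hj)
    refine ⟨js, h6, h7, ?_⟩
    exact (hD.vOrder_sorted.sublist h5).imp_of_mem fun hi hj h =>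
      (hD.keyLt_iff hS (h7 _ hi) (h7 _ hj)).2 h

end

/-! ### The B-tree -/

lemma BTree.inorder_replace (a b : ℕ) (t : BTree) :
    (t.replace a b).inorder = t.inorder.map (fun x => if x = a then b else x) := by
  induction t with
  | nil => rfl
  | two l x r ihl ihr => simp [BTree.replace, BTree.inorder, ihl, ihr]
  | three l x m y r ihl ihm ihr => simp [BTree.replace, BTree.inorder, ihl, ihm, ihr]

lemma BTree.hasHeight_replace (a b : ℕ) {t : BTree} {n : ℕ} (ht : t.HasHeight n) :
    (t.replace a b).HasHeight n := by
  induction t generalizing n with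
  | nil => exact ht
  | two l x r ihl ihr =>
    obtain ⟨k, rfl, h1, h2⟩ := ht
    exact ⟨k, rfl, ihl h1, ihr h2⟩
  | three l x m y r ihl ihm ihr =>
    obtain ⟨k, rfl, h1, h2, h3⟩ := ht
    exact ⟨k, rfl, ihl h1, ihm h2, ihr h3⟩

/-- The record `x` is followed by a record with another character. -/
def Brk (ch : ℕ → ℕ) : List ℕ → ℕ → Prop
  | a :: b :: l, x => (x = a ∧ ch a ≠ ch b) ∨ Brk ch (b :: l) x
  | _, _ => False

section

variable {ch ch' : ℕ → ℕ} {N J X Y : List ℕ} {a b d x u : ℕ}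

lemma brk_cons_cons : Brk ch (a :: b :: N) x ↔ (x = a ∧ ch a ≠ ch b) ∨ Brk ch (b :: N) x :=
  Iff.rfl

lemma brk_append (X Y : List ℕ) (a : ℕ) :
    Brk ch (X ++ a :: Y) x ↔ Brk ch (X ++ [a]) x ∨ Brk ch (a :: Y) x := by
  induction X with
  | nil => simp [Brk]
  | cons b X ih =>
    cases X with
    | nil => simp [Brk]
    | cons b' X =>
      simp only [List.cons_append] at ih ⊢
      rw [brk_cons_cons, brk_cons_cons, ih, or_assoc]

lemma Brk.mem (h : Brk ch N x) : x ∈ N := by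
  induction N with
  | nil => exact h.elim
  | cons a N ih =>
    cases N with
    | nil => exact h.elim
    | cons b N =>
      rcases h with h | h
      · simp [h.1]
      · exact List.mem_cons_of_mem _ (ih h)

/-- Doubling a record does not matter. -/
lemma brk_double (h : ch a = ch b) :
    Brk ch (X ++ a :: b :: Y) x ↔ Brk ch (X ++ b :: Y) x := by
  rw [brk_append X (b :: Y) a, brk_append X Y b, brk_cons_cons]
  have : Brk ch (X ++ [a]) x ↔ Brk ch (X ++ [b]) x := by
    induction X with
    | nil => simp [Brk]
    | cons c X ih =>
      cases X with
      | nil => simp [Brk, h]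
      | cons c' X =>
        simp only [List.cons_append] at ih ⊢
        rw [brk_cons_cons, brk_cons_cons, ih]
  rw [this]
  simp [h]

lemma brk_map {f : ℕ → ℕ} (hch : ∀ a ∈ N, ch' (f a) = ch a)
    (hf : ∀ a ∈ N, ∀ b ∈ N, f a = f b → a = b) (hx : x ∈ N) :
    Brk ch' (N.map f) (f x) ↔ Brk ch N x := by
  have key : ∀ N' : List ℕ, (∀ a ∈ N', a ∈ N) → (Brk ch' (N'.map f) (f x) ↔ Brk ch N' x) := by
    intro N' hN'
    induction N' with
    | nil => simp [Brk]
    | cons a N' ih =>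
      cases N' with
      | nil => simp [Brk]
      | cons b N' =>
        have ha := hN' a (by simp)
        have hb := hN' b (by simp)
        have := ih fun c hc => hN' c (List.mem_cons_of_mem _ hc)
        rw [List.map_cons] at this
        rw [List.map_cons, List.map_cons, brk_cons_cons, brk_cons_cons, this, hch a ha, hch b hb]
        have : f x = f a ↔ x = a := ⟨hf x hx a ha, fun h => by rw [h]⟩
        rw [this]
  exact key N fun _ h => h

/-- The stored nodes satisfy the conditions. -/
def BOnly (ch : ℕ → ℕ) (N : List ℕ) (d : ℕ) (J : List ℕ) : Prop := ∀ x ∈ J, x = d ∨ Brk ch N x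

/-- The nodes that satisfy the conditions are stored. -/
def BAll (ch : ℕ → ℕ) (N : List ℕ) (d : ℕ) (J : List ℕ) : Prop :=
  d ∈ J ∧ ∀ x, Brk ch N x → x ∈ J

lemma BOnly.congr (h : BOnly ch N d J) (hch : ∀ a ∈ N, ch' a = ch a) : BOnly ch' N d J := by
  intro x hx
  refine (h x hx).imp id fun h' => ?_
  have := (brk_map (f := id) (ch' := ch') (ch := ch) hch (fun _ _ _ _ h => h) h'.mem).2 h'
  simpa using this

lemma BAll.congr (h : BAll ch N d J) (hch : ∀ a ∈ N, ch' a = ch a) : BAll ch' N d J := by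
  refine ⟨h.1, fun x hx => h.2 x ?_⟩
  have := (brk_map (f := id) (ch' := ch') (ch := ch) hch (fun _ _ _ _ h => h) hx.mem).1
    (by simpa using hx)
  exact this

/-- Renaming a record. -/
lemma rename_list (hn : (X ++ u :: Y).Nodup) :
    (X ++ u :: Y).map (fun a => if a = u then x else a) = X ++ x :: Y := by
  rw [List.nodup_append, List.nodup_cons] at hn
  rw [List.map_append, List.map_cons, if_pos rfl]
  congr 1
  · refine (List.map_congr_left fun a ha => ?_).trans (List.map_id _)
    rw [if_neg fun h => hn.2.2 a ha u (by simp) h]; rfl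
  · congr 1
    refine (List.map_congr_left fun a ha => ?_).trans (List.map_id _)
    rw [if_neg (by rintro rfl; exact hn.2.1.1 ha)]; rfl

lemma brk_rename (hn : (X ++ u :: Y).Nodup) (hx : x ∉ X ++ Y) (hch : ch x = ch u)
    {y : ℕ} (hy : y ∈ X ++ u :: Y) :
    Brk ch (X ++ x :: Y) (if y = u then x else y) ↔ Brk ch (X ++ u :: Y) y := by
  have hxx : ∀ a ∈ X ++ u :: Y, a ≠ u → a ≠ x := by
    intro a ha h1 h2
    subst h2
    refine hx ?_
    simp only [List.mem_append, List.mem_cons] at ha ⊢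
    tauto
  rw [← rename_list (x := x) hn]
  refine brk_map (f := fun a => if a = u then x else a) ?_ ?_ hy
  · intro a _
    split
    · rename_i h; rw [h, hch]
    · rfl
  · intro a ha b hb h
    by_cases h1 : a = u <;> by_cases h2 : b = u <;> simp only [h1, h2, if_true, if_false] at h
    · rw [h1, h2]
    · exact absurd h.symm (hxx b hb h2)
    · exact absurd h (hxx a ha h1)
    · exact h

lemma BOnly.rename (h : BOnly ch (X ++ u :: Y) d J) (hn : (X ++ u :: Y).Nodup)
    (hx : x ∉ X ++ Y) (hch : ch x = ch u) (hd : d ≠ u) :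
    BOnly ch (X ++ x :: Y) d (J.map fun a => if a = u then x else a) := by
  intro y hy
  obtain ⟨a, ha, rfl⟩ := List.mem_map.1 hy
  rcases h a ha with h1 | h1
  · left; simp only [h1, if_neg hd]
  · right; exact (brk_rename hn hx hch h1.mem).2 h1

lemma BAll.rename (h : BAll ch (X ++ u :: Y) d J) (hn : (X ++ u :: Y).Nodup)
    (hx : x ∉ X ++ Y) (hch : ch x = ch u) (hd : d ≠ u) :
    BAll ch (X ++ x :: Y) d (J.map fun a => if a = u then x else a) := by
  refine ⟨List.mem_map.2 ⟨d, h.1, if_neg hd⟩, fun y hy => ?_⟩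
  have h1 := hy.mem
  rw [← rename_list (x := x) hn] at h1
  obtain ⟨a, ha, rfl⟩ := List.mem_map.1 h1
  exact List.mem_map.2 ⟨a, h.2 a ((brk_rename hn hx hch ha).1 hy), rfl⟩

lemma BOnly.double (h : ch a = ch b) :
    BOnly ch (X ++ a :: b :: Y) d J ↔ BOnly ch (X ++ b :: Y) d J := by
  simp only [BOnly, brk_double h]

lemma BAll.double (h : ch a = ch b) :
    BAll ch (X ++ a :: b :: Y) d J ↔ BAll ch (X ++ b :: Y) d J := by
  simp only [BAll, brk_double h]

lemma brk_iff_getD (hn : N.Nodup) {i : ℕ} (hi : i < N.length) :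
    Brk ch N (N.getD i 0) ↔ i + 1 < N.length ∧ ch (N.getD i 0) ≠ ch (N.getD (i + 1) 0) := by
  induction N generalizing i with
  | nil => simp at hi
  | cons a N ih =>
    cases N with
    | nil => simp [Brk]
    | cons b N =>
      rw [brk_cons_cons]
      cases i with
      | zero =>
        have h1 : ¬ Brk ch (b :: N) a := fun h => (List.nodup_cons.1 hn).1 h.mem
        simp [h1]
      | succ i =>
        have h2 := ih (List.nodup_cons.1 hn).2 (i := i) (by simpa using hi)
        simp only [List.getD_cons_succ] at h2 ⊢
        have h3 : (b :: N).getD i 0 ≠ a := by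
          intro h
          refine (List.nodup_cons.1 hn).1 (h ▸ ?_)
          rw [List.getD_eq_getElem _ _ (by simpa using hi)]
          exact List.getElem_mem _
        rw [h2, List.length_cons (a := a), Nat.add_lt_add_iff_right]
        exact or_iff_right fun h => h3 h.1

end

section

variable {S : List ℕ} {D : DBWT} {h : ℕ → ℕ → ℕ} {TU TV A B : List (ℕ × ℕ)} {d : ℕ}

lemma Core.btreeCond_iff (co : Core S D h TU TV) (hd : TU = A ++ (d, 1) :: B)
    (hd' : h d fChar = dollar) (hne : ∀ p ∈ A ++ B, h p.1 fChar ≠ dollar) {g : ℕ}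
    (hg : g < D.length) : BTreeCond D g ↔
      addr TU g = d ∨ Brk (fun x => h x fChar) (recs A ++ recs B) (addr TU g) := by
  have hl := co.length_eq
  have hlT : TU.length = A.length + 1 + B.length := by rw [hd]; simp; omega
  have hchr : ∀ i < D.length, chr D i = h (addr TU i) fChar := by
    intro i hi; rw [chr, co.getD_eq hi]
  have hN : ∀ i, (recs A ++ recs B).getD i 0 =
      if i < A.length then addr TU i else addr TU (i + 1) := by
    intro i
    rw [hd]
    simp only [addr, recs, List.getD_eq_getElem?_getD, List.getElem?_append, List.length_map,
      List.getElem?_map]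
    split
    · rename_i h1; simp [h1]
    · rename_i h1
      rw [if_neg (by omega), show i + 1 - A.length = i - A.length + 1 by omega,
        List.getElem?_cons_succ]
      cases B[i - A.length]? <;> rfl
  have hk : addr TU A.length = d := by rw [hd, addr]; simp
  have hnd : (recs A ++ recs B).Nodup := by
    have := co.mesh.nodup
    rw [hd] at this
    refine this.sublist ?_
    simp [recs]
  have hlN : (recs A ++ recs B).length = A.length + B.length := by simp [recs]
  have hdol : ∀ i < D.length, chr D i = dollar ↔ i = A.length := by
    intro i hi
    rw [hchr i hi]
    refine ⟨fun h1 => ?_, fun h1 => by rw [h1, hk, hd']⟩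
    by_contra h2
    refine hne (TU.getD i (0, 0)) ?_ h1
    rw [hd]
    simp only [List.getD_eq_getElem?_getD, List.getElem?_append]
    split
    · rename_i h3
      simp [h3]
    · rename_i h3
      have h4 : i - A.length - 1 < B.length := by omega
      rw [show i - A.length = i - A.length - 1 + 1 by omega, List.getElem?_cons_succ]
      simp [h4]
  have hgd : addr TU g = d ↔ g = A.length := by
    rw [← hdol g hg, hchr g hg]
    constructor
    · intro h1; rw [h1, hd']
    · intro h1
      rw [(hdol g hg).1 (by rw [hchr g hg, h1]), hk]
  unfold BTreeCond
  rw [hgd, hdol g hg]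
  by_cases h1 : g < A.length
  · have h2 := hN g
    rw [if_pos h1] at h2
    rw [← h2, brk_iff_getD hnd (by omega), hlN, hN (g + 1), h2, hchr g hg]
    by_cases h3 : g + 1 < A.length
    · rw [if_pos h3]
      have h4 : g + 1 < D.length := by omega
      have h5 := hdol (g + 1) h4
      rw [← hchr (g + 1) h4]
      constructor
      · rintro (⟨-, h, -⟩ | ⟨-, -, h⟩ | h)
        · exact Or.inr ⟨by omega, h⟩
        · have := h5.1 h; omega
        · omega
      · rintro (h | ⟨-, h⟩)
        · omega
        · exact Or.inl ⟨h4, h, fun h' => by have := h5.1 h'; omega⟩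
    · rw [if_neg h3]
      have h4 : g + 1 < D.length := by omega
      have h5 := (hdol (g + 1) h4).2 (by omega)
      constructor
      · rintro (⟨-, -, h⟩ | ⟨h6, h, -⟩ | h)
        · exact absurd h5 h
        · rw [hchr (g + 2) h6] at h
          exact Or.inr ⟨by omega, h⟩
        · omega
      · rintro (h | ⟨h6, h⟩)
        · omega
        · have h7 : g + 2 < D.length := by omega
          exact Or.inr (Or.inl ⟨h7, by rw [hchr (g + 2) h7]; exact h, h5⟩)
  · by_cases h3 : g = A.length
    · simp [h3]
    · have h2 := hN (g - 1)
      rw [if_neg (by omega), show g - 1 + 1 = g by omega] at h2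
      rw [← h2, brk_iff_getD hnd (by omega), hlN, hN (g - 1 + 1), h2, hchr g hg, if_neg (by omega),
        show g - 1 + 1 = g by omega]
      constructor
      · rintro (⟨h4, h, -⟩ | ⟨h4, -, h⟩ | h)
        · rw [hchr (g + 1) h4] at h
          exact Or.inr ⟨by omega, h⟩
        · have := (hdol (g + 1) (by omega)).1 h; omega
        · exact Or.inl h
      · rintro (h | ⟨h6, h⟩)
        · exact absurd h h3
        · have h4 : g + 1 < D.length := by omega
          refine Or.inl ⟨h4, by rw [hchr (g + 1) h4]; exact h, fun h' => ?_⟩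
          have := (hdol (g + 1) h4).1 h'; omega

lemma Core.bOnly_iff (co : Core S D h TU TV) (hd : TU = A ++ (d, 1) :: B)
    (hd' : h d fChar = dollar) (hne : ∀ p ∈ A ++ B, h p.1 fChar ≠ dollar) {σ : State}
    (hJ : ∀ x ∈ σ.btree.inorder, x ∈ recs TU) : BTreeOnly D σ (addr TU) ↔
      BOnly (fun x => h x fChar) (recs A ++ recs B) d σ.btree.inorder := by
  constructor
  · intro H x hx
    have h1 := hJ x hx
    rw [co.recs_eq] at h1
    obtain ⟨g, hg, rfl⟩ := List.mem_map.1 h1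
    rw [List.mem_range] at hg
    exact (co.btreeCond_iff hd hd' hne hg).1 (H g hg hx)
  · intro H g hg hx
    exact (co.btreeCond_iff hd hd' hne hg).2 (H _ hx)

lemma Core.bAll_iff (co : Core S D h TU TV) (hd : TU = A ++ (d, 1) :: B)
    (hd' : h d fChar = dollar) (hne : ∀ p ∈ A ++ B, h p.1 fChar ≠ dollar) {σ : State} :
    BTreeAll D σ (addr TU) ↔
      BAll (fun x => h x fChar) (recs A ++ recs B) d σ.btree.inorder := by
  have hrec : ∀ x ∈ recs TU, ∃ g < D.length, x = addr TU g := by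
    intro x hx
    rw [co.recs_eq] at hx
    obtain ⟨g, hg, rfl⟩ := List.mem_map.1 hx
    exact ⟨g, by simpa using hg, rfl⟩
  constructor
  · intro H
    refine ⟨?_, fun x hx => ?_⟩
    · obtain ⟨g, hg, h1⟩ := hrec d (by rw [hd]; simp)
      rw [h1]
      exact H g hg ((co.btreeCond_iff hd hd' hne hg).2 (Or.inl h1.symm))
    · obtain ⟨g, hg, rfl⟩ := hrec x (by
        have := hx.mem
        rw [hd]; simp at this ⊢; tauto)
      exact H g hg ((co.btreeCond_iff hd hd' hne hg).2 (Or.inr hx))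
  · intro H g hg hx
    rcases (co.btreeCond_iff hd hd' hne hg).1 hx with h1 | h1
    · rw [h1]; exact H.1
    · exact H.2 _ h1

end

end RComp


namespace RComp

/-! ### Splitting and merging nodes -/

section

variable {T X Y : List (ℕ × ℕ)} {a b N : ℕ}

lemma startsLe_of_cnt (hpos : ∀ p ∈ T, 0 < p.2) (h : cnt (bd T) a b ≤ N) :
    StartsLe T a b N := by
  intro P M Q hT hM
  have h1 : ((ent (width P) M).map Prod.fst).Nodup := by
    have h2 : (ent (width P) M).Pairwise (fun e e' => e.1 < e'.1) := by
      refine (ent_pairwise _ _).imp_of_mem fun he _ h' => ?_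
      have := ent_pos (fun p hp => hpos p (by rw [hT]; simp [hp])) he
      omega
    exact List.pairwise_map.2 (h2.imp fun h => h.ne)
  have h3 : M.length = ((ent (width P) M).map Prod.fst).toFinset.card := by
    rw [List.toFinset_card_of_nodup h1, List.length_map, ent_length]
  rw [h3]
  refine (Finset.card_le_card fun p hp => ?_).trans h
  rw [List.mem_toFinset, List.mem_map] at hp
  obtain ⟨e, he, rfl⟩ := hp
  refine Finset.mem_filter.2 ⟨mem_bd.2 ⟨e, ?_, rfl⟩, hM e he⟩
  rw [hT, ent_append_append, zero_add]
  exact List.mem_append_right _ (List.mem_append_left _ he)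

/-- The tiles that start in an interval. -/
lemma length_eq_cnt {P M Q : List (ℕ × ℕ)} (hpos : ∀ p ∈ T, 0 < p.2) (hT : T = P ++ (M ++ Q))
    (hP : ∀ e ∈ ent 0 P, e.1 < a) (hM : ∀ e ∈ ent (width P) M, a ≤ e.1 ∧ e.1 < b)
    (hQ : ∀ e ∈ ent (width P + width M) Q, b ≤ e.1) : M.length = cnt (bd T) a b := by
  refine le_antisymm (startsLe_of_cnt hpos le_rfl P M Q hT hM) ?_
  have h1 : (bd T).filter (fun x => a ≤ x ∧ x < b) ⊆ ((ent (width P) M).map Prod.fst).toFinset := by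
    intro p hp
    obtain ⟨h1, h2, h3⟩ := Finset.mem_filter.1 hp
    obtain ⟨e, he, rfl⟩ := mem_bd.1 h1
    rw [hT, ent_append_append, List.mem_append, List.mem_append, zero_add] at he
    rcases he with he | he | he
    · have := hP e he; omega
    · rw [List.mem_toFinset]; exact List.mem_map_of_mem he
    · have := hQ e he; omega
  refine (Finset.card_le_card h1).trans ((List.toFinset_card_le _).trans ?_)
  rw [List.length_map, ent_length]

end

/-- Registers that are used for neither arguments nor temporary values are unchanged. -/
def Fixed (σ σ' : State) : Prop := ∀ r < 30, σ'.reg r = σ.reg r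

lemma Fixed.trans {σ σ' σ'' : State} (h : Fixed σ σ') (h' : Fixed σ' σ'') : Fixed σ σ'' :=
  fun r hr => (h' r hr).trans (h r hr)

lemma Frame.fixed {σ σ' : State} (h : Frame σ σ') : Fixed σ σ' := fun r hr => h.1 r (by omega)

/-- The characters of the records of a tiling. -/
def lab (h : ℕ → ℕ → ℕ) (T : List (ℕ × ℕ)) : DBWT := T.map fun p => (h p.1 fChar, p.2)

lemma lab_append (h : ℕ → ℕ → ℕ) (T T' : List (ℕ × ℕ)) :
    lab h (T ++ T') = lab h T ++ lab h T' := by simp [lab]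

lemma lab_cons (h : ℕ → ℕ → ℕ) (p : ℕ × ℕ) (T : List (ℕ × ℕ)) :
    lab h (p :: T) = (h p.1 fChar, p.2) :: lab h T := rfl

lemma lab_congr {h h' : ℕ → ℕ → ℕ} {T : List (ℕ × ℕ)}
    (hh : ∀ x ∈ recs T, h' x fChar = h x fChar) : lab h' T = lab h T := by
  refine List.map_congr_left fun p hp => ?_
  rw [hh p.1 (List.mem_map_of_mem hp)]

lemma width_lab (h : ℕ → ℕ → ℕ) (T : List (ℕ × ℕ)) : width (lab h T) = width T := by
  simp [lab, width, Function.comp_def]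

/-- The data structures for the graph given by the two tilings. -/
structure Inv (S : List ℕ) (σ : State) (TU TV : List (ℕ × ℕ)) : Prop where
  core : Core S (lab σ.heap TU) σ.heap TU TV
  order : σ.order = recs TU
  shape : ∃ n, σ.btree.HasHeight n
  sub : σ.btree.inorder.Sublist (recs TV)
  zero : σ.reg 11 = 0
  one : σ.reg 12 = 1

section

variable {S : List ℕ} {W : ℕ} {σ : State} {TU TV X Y : List (ℕ × ℕ)} {x y u l₁ l₂ N : ℕ}

lemma insertAfter_append {A B : List ℕ} {u z : ℕ} (h : u ∉ A) :
    insertAfter u z (A ++ u :: B) = A ++ u :: z :: B := by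
  induction A with
  | nil => simp [insertAfter]
  | cons a A ih =>
    simp only [List.mem_cons, not_or] at h
    simp only [List.cons_append, insertAfter]
    rw [if_neg (Ne.symm h.1), ih h.2]

def splitProg : Program :=
  .seq (splitSideProg false)
    (.seq (blk [.load 44 30 fLen, .sub 44 44 33, .store 31 fLen 44, .store 30 fLen 33,
        .load 44 30 fChar, .store 31 fChar 44])
      (.seq (splitSideProg true) (blk [.omAfter 30 31, .btReplace 30 31])))

lemma runs_split (inv : Inv S σ TU TV) (hT : TU = X ++ (u, l₁ + l₂) :: Y)
    (hlf : lf S (width X + l₁) = lf S (width X) + l₁)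
    (hl₁ : 0 < l₁) (hl₂ : 0 < l₂) (hx : x ∉ recs TU) (hx0 : x ≠ 0)
    (hN : cnt (bd TV) (width X) (width X + (l₁ + l₂)) ≤ N)
    (hN' : cnt (bd TU) (lf S (width X)) (lf S (width X) + (l₁ + l₂)) ≤ N)
    (hW : width TU + 1 < W) (h30 : σ.reg 30 = u)
    (h31 : σ.reg 31 = x) (h32 : σ.reg 32 = 0) (h33 : σ.reg 33 = l₁) :
    ∃ X' Y', TV = X' ++ (u, l₁ + l₂) :: Y' ∧
      Runs W splitProg σ (24 * N + 70) (fun σ' => Fixed σ σ' ∧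
      Inv S σ' (X ++ (u, l₁) :: (x, l₂) :: Y) (X' ++ (u, l₁) :: (x, l₂) :: Y') ∧
      (∀ a, σ'.heap a fChar = if a = x then σ.heap u fChar else σ.heap a fChar) ∧
      σ'.btree.inorder = σ.btree.inorder.map (fun a => if a = u then x else a)) := by
  have m := inv.core.mesh
  obtain ⟨X', Y', hT', hX'⟩ := inv.core.geo.exists_parts hT
  refine ⟨X', Y', hT', ?_⟩
  have hg : Geo S (X ++ (u, l₁) :: (x, l₂) :: Y) (X' ++ (u, l₁) :: (x, l₂) :: Y') := by
    have h1 := inv.core.geo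
    have h2 := m.nodup
    rw [hT] at h1 h2
    rw [hT'] at h1
    exact h1.split hX' hlf h2 x
  have hxu : u ≠ x := by rintro rfl; exact hx (by rw [hT]; simp)
  have hxV : x ∉ recs TV := fun h => hx (inv.core.geo.perm_recs.mem_iff.1 h)
  have hlenV : ∀ p ∈ TV, σ.heap p.1 fLen = p.2 := fun p hp =>
    inv.core.len p (inv.core.geo.perm.mem_iff.1 hp)
  have hlu : σ.heap u fLen = l₁ + l₂ := inv.core.len (u, l₁ + l₂) (by rw [hT]; simp)
  have kC : ∀ s, Kept s fChar := fun s => Or.inr (Or.inr (Or.inl (by decide)))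
  have kL : ∀ s, Kept s fLen := fun s => Or.inr (Or.inr (Or.inl (by decide)))
  refine (Runs.seq (n := 12 * N + 25) (n' := 12 * N + 45)
    (runs_splitSide m hT hl₁ hl₂ hx hx0 hlenV
      (startsLe_of_cnt m.pos' (by rw [add_assoc]; exact hN)) hW inv.zero inv.one h30 h31 h32 h33)
    ?_).le
  rintro σ₁ ⟨f1, m1, k1⟩
  have g30 : σ₁.reg 30 = u := by rw [f1.reg 30, h30]
  have g31 : σ₁.reg 31 = x := by rw [f1.reg 31, h31]
  have g33 : σ₁.reg 33 = l₁ := by rw [f1.reg 33, h33]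
  have hh1 : ∀ a, σ₁.heap a fLen = σ.heap a fLen := fun a => k1 a fLen (kL _)
  have hh1' : ∀ a, σ₁.heap a fChar = σ.heap a fChar := fun a => k1 a fChar (kC _)
  refine (Runs.seq (n := 6) (n' := 12 * N + 39) (R := fun σ' => Frame σ σ' ∧
    (∀ a f, 2 ≤ f → σ'.heap a f = σ₁.heap a f) ∧
    (∀ a, σ'.heap a fLen = if a = x then l₂ else if a = u then l₁ else σ.heap a fLen) ∧
    (∀ a, σ'.heap a fChar = if a = x then σ.heap u fChar else σ.heap a fChar))
    (runs_blk ?_) ?_).le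
  · refine ⟨f1.trans ⟨fun r hr => runAll_reg hr, rfl, rfl⟩, fun a f hf => ?_, fun a => ?_,
      fun a => ?_⟩
    · simp [fLen, fChar, (show f ≠ 0 by omega),
        (show f ≠ 1 by omega)]
    · simp [fLen, fChar, g30, g31, g33]
      have h1 := hh1 u
      have h2 := hh1 a
      simp only [fLen] at h1 h2 hlu
      rw [h1, h2, hlu]
      by_cases ha : a = x
      · simp [ha, hxu.symm]
      · simp [ha]
    · simp [fLen, fChar, g30, g31, g33]
      have h1 := hh1' u
      have h2 := hh1' a
      simp only [fChar] at h1 h2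
      rw [h1, h2]
  rintro σ₂ ⟨f2, k2, hlen2, hchr2⟩
  have m2 : Mesh σ₂.heap false (X ++ (u, l₁) :: (x, l₂) :: Y) TV := by
    have hf : ∀ (t : Bool) a, σ₂.heap a (fn t) = σ₁.heap a (fn t) ∧
        σ₂.heap a (fp t) = σ₁.heap a (fp t) ∧ σ₂.heap a (fe t) = σ₁.heap a (fe t) ∧
        σ₂.heap a (fb t) = σ₁.heap a (fb t) := by
      intro t a
      refine ⟨k2 _ _ ?_, k2 _ _ ?_, k2 _ _ ?_, k2 _ _ ?_⟩ <;> cases t <;> decide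
    exact ⟨m1.pos, m1.pos', m1.nodup, m1.nodup', m1.zero, m1.zero', m1.width_eq,
      m1.links.congr (fun a => (hf _ a).1) (fun a => (hf _ a).2.1),
      m1.links'.congr (fun a => (hf _ a).1) (fun a => (hf _ a).2.1),
      m1.edges.congr (fun a _ => (hf _ a).2.2.1) (fun a _ => (hf _ a).2.2.2),
      m1.edges'.congr (fun a _ => (hf _ a).2.2.1) (fun a _ => (hf _ a).2.2.2),
      (hf _ _).2.2.1.trans m1.null, (hf _ _).2.2.1.trans m1.null'⟩
  have hlenU : ∀ p ∈ X ++ (u, l₁) :: (x, l₂) :: Y, σ₂.heap p.1 fLen = p.2 := by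
    intro p hp
    rw [hlen2]
    have hn := m.nodup
    rw [hT] at hn hx
    have hlen := inv.core.len
    rw [hT] at hlen
    simp only [recs_append, recs_cons, List.nodup_append, List.nodup_cons, List.mem_append,
      List.mem_cons, not_or] at hp hn hx hlen
    rcases hp with hp | rfl | rfl | hp
    · have h1 : p.1 ∈ recs X := List.mem_map_of_mem hp
      rw [if_neg (show p.1 ≠ x from fun h => hx.1 (h ▸ h1)), if_neg fun h => hn.2.2 _ h1 u
        (Or.inl rfl) h]
      exact hlen p (Or.inl hp)
    · rw [if_neg hxu, if_pos rfl]
    · rw [if_pos rfl]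
    · have h1 : p.1 ∈ recs Y := List.mem_map_of_mem hp
      rw [if_neg (show p.1 ≠ x from fun h => hx.2.2 (h ▸ h1)),
        if_neg (show p.1 ≠ u from fun h => hn.2.1.1 (h ▸ h1))]
      exact hlen p (Or.inr (Or.inr hp))
  have hcnt : cnt (bd (X ++ (u, l₁) :: (x, l₂) :: Y)) (width X') (width X' + l₁ + l₂) ≤ N + 1 := by
    rw [bd_split X Y u x u l₁ l₂, ← hT, hX', add_assoc]
    exact (cnt_insert_le _ _ _ _).trans (by omega)
  have hw1 := m.width_eq
  refine (Runs.seq (n := 12 * (N + 1) + 25) (n' := 2)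
    (runs_splitSide (s := true) (T := TV) (X := X') (Y := Y') (N := N + 1) m2.symm hT' hl₁ hl₂ hxV
      hx0 hlenU
      (startsLe_of_cnt m2.pos hcnt) (by omega) (by rw [f2.reg 11, inv.zero])
      (by rw [f2.reg 12, inv.one]) (by rw [f2.reg 30, h30])
      (by rw [f2.reg 31, h31]) (by rw [f2.reg 32, h32])
      (by rw [f2.reg 33, h33])) ?_).le
  rintro σ₃ ⟨f3, m3, k3⟩
  have f3' := f2.trans f3
  have q30 : σ₃.reg 30 = u := by rw [f3'.reg 30, h30]
  have q31 : σ₃.reg 31 = x := by rw [f3'.reg 31, h31]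
  have hc3 : ∀ a, σ₃.heap a fChar = if a = x then σ.heap u fChar else σ.heap a fChar := by
    intro a; rw [k3 a fChar (kC _), hchr2]
  have hJ : σ₃.btree.inorder = σ.btree.inorder := by rw [f3'.2.2]
  refine runs_blk ?_
  simp only [runAll, Instr.run, q30, q31]
  refine ⟨f3'.fixed, ⟨⟨m3.symm, hg, fun p hp => ?_, rfl⟩, ?_, ?_, ?_, ?_, ?_⟩, hc3, ?_⟩
  · simp only [k3 _ fLen (kL _)]; exact hlenU p hp
  · have h1 := inv.order
    have h2 := m.nodup
    rw [hT] at h1 h2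
    simp only [recs_append, recs_cons] at h1 h2 ⊢
    rw [f3'.2.1, h1]
    exact insertAfter_append fun h => (List.nodup_append.1 h2).2.2 u h u (by simp) rfl
  · obtain ⟨n, hn⟩ := inv.shape
    exact ⟨n, BTree.hasHeight_replace _ _ (by rw [f3'.2.2]; exact hn)⟩
  · simp only [BTree.inorder_replace, hJ]
    have h1 := inv.sub
    have h2 := m.nodup'
    rw [hT'] at h1 h2
    have h3 := h1.map (fun a => if a = u then x else a)
    rw [recs_append, recs_cons] at h3 h2
    rw [rename_list h2] at h3
    refine h3.trans ?_
    simp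
  · rw [f3'.reg 11, inv.zero]
  · rw [f3'.reg 12, inv.one]
  · simp only [BTree.inorder_replace, hJ]

/-- Merges the node in register 30 into its predecessor in register 31. -/
def mergeProg : Program :=
  .seq (blk [.load 32 31 fLen, .copy 33 11])
    (.seq (mergeSideProg false) (.seq (mergeSideProg true)
      (blk [.load 44 30 fLen, .add 32 32 44, .store 31 fLen 32, .omDelete 30, .btReplace 30 31])))

lemma runs_merge (inv : Inv S σ TU TV) (hT : TU = X ++ (x, l₁) :: (y, l₂) :: Y)
    (hlf : lf S (width X + l₁) = lf S (width X) + l₁)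
    (hN : cnt (bd TV) (width X + l₁) (width X + l₁ + l₂) ≤ N)
    (hN' : cnt (bd TU) (lf S (width X + l₁)) (lf S (width X + l₁) + l₂) ≤ N)
    (hW : 2 * width TU < W) (h30 : σ.reg 30 = y) (h31 : σ.reg 31 = x)
    (hJ : x ∉ σ.btree.inorder ∨ y ∉ σ.btree.inorder) :
    ∃ X' Y', TV = X' ++ (x, l₁) :: (y, l₂) :: Y' ∧ width X' = lf S (width X) ∧
      Runs W mergeProg σ (16 * N + 30) (fun σ' => Fixed σ σ' ∧
      Inv S σ' (X ++ (x, l₁ + l₂) :: Y) (X' ++ (x, l₁ + l₂) :: Y') ∧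
      (∀ a, σ'.heap a fChar = σ.heap a fChar) ∧
      σ'.btree.inorder = σ.btree.inorder.map (fun a => if a = y then x else a)) := by
  have m := inv.core.mesh
  have hn := m.nodup
  rw [hT] at hn
  obtain ⟨X', Y', hT', hX', hg⟩ := (hT ▸ inv.core.geo).merge m.pos' hlf hn
  refine ⟨X', Y', hT', hX', ?_⟩
  have hlx : σ.heap x fLen = l₁ := inv.core.len (x, l₁) (by rw [hT]; simp)
  have hly : σ.heap y fLen = l₂ := inv.core.len (y, l₂) (by rw [hT]; simp)
  have kC : ∀ s, Kept s fChar := fun s => Or.inr (Or.inr (Or.inl (by decide)))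
  have kL : ∀ s, Kept s fLen := fun s => Or.inr (Or.inr (Or.inl (by decide)))
  have hwT : width TU = width X + l₁ + l₂ + width Y := by rw [hT]; simp; omega
  refine (Runs.seq (n := 2) (n' := 16 * N + 28) (R := fun σ' => Fixed σ σ' ∧ σ'.heap = σ.heap ∧
    σ'.order = σ.order ∧ σ'.btree = σ.btree ∧ σ'.reg 30 = y ∧ σ'.reg 31 = x ∧ σ'.reg 32 = l₁ ∧
    σ'.reg 33 = 0) (runs_blk ?_) ?_).le
  · refine ⟨fun r hr => ?_, rfl, rfl, rfl, ?_, ?_, ?_, ?_⟩ <;>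
      simp [Function.update_apply, h30, h31, hlx, inv.zero]
    rw [if_neg (by omega), if_neg (by omega)]
  rintro σ₁ ⟨f1, hh1, ho1, hb1, g30, g31, g32, g33⟩
  refine (Runs.seq (n := 8 * N + 11) (n' := 8 * N + 17)
    (runs_mergeSide (s := false) (T := TU) (T' := TV) (by rw [hh1]; exact m) hT
      (startsLe_of_cnt m.pos' hN) hW (by rw [f1 11 (by omega), inv.zero]) g30 g31 g32 g33)
    ?_).le
  rintro σ₂ ⟨f2, m2, k2⟩
  have hcnt : cnt (bd (X ++ (x, l₁ + l₂) :: Y)) (width X' + l₁) (width X' + l₁ + l₂) ≤ N := by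
    rw [hlf, ← hX', hT] at hN'
    refine (cnt_mono ?_ _ _).trans hN'
    rw [bd_split X Y x y x l₁ l₂]
    exact Finset.subset_insert _ _
  have hw1 := m.width_eq
  refine (Runs.seq (n := 8 * N + 11) (n' := 5)
    (runs_mergeSide (s := true) (T := TV) (T' := X ++ (x, l₁ + l₂) :: Y) m2.symm hT'
      (startsLe_of_cnt m2.pos hcnt) (by omega)
      (by rw [f2.reg 11, f1 11 (by omega), inv.zero])
      (by rw [f2.reg 30, g30]) (by rw [f2.reg 31, g31])
      (by rw [f2.reg 32, g32]) (by rw [f2.reg 33, g33]))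
    ?_).le
  rintro σ₃ ⟨f3, m3, k3⟩
  have f3' := f2.trans f3
  have q30 : σ₃.reg 30 = y := by rw [f3'.reg 30, g30]
  have q31 : σ₃.reg 31 = x := by rw [f3'.reg 31, g31]
  have q32 : σ₃.reg 32 = l₁ := by rw [f3'.reg 32, g32]
  have hc3 : ∀ a, σ₃.heap a fChar = σ.heap a fChar := by
    intro a; rw [k3 a fChar (kC _), k2 a fChar (kC _), hh1]
  have hl3 : ∀ a, σ₃.heap a fLen = σ.heap a fLen := by
    intro a; rw [k3 a fLen (kL _), k2 a fLen (kL _), hh1]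
  have hJ3 : σ₃.btree = σ.btree := by rw [f3'.2.2, hb1]
  have hmod : (l₁ + l₂) % W = l₁ + l₂ := Nat.mod_eq_of_lt (by omega)
  have hkey : ∀ a f, f ≠ fLen → upd σ₃.heap x fLen (l₁ + l₂) a f = σ₃.heap a f :=
    fun a f hf => upd_field _ _ _ _ hf
  refine runs_blk (Q := _) ?_
  have hrun : runAll W [.load 44 30 fLen, .add 32 32 44, .store 31 fLen 32, .omDelete 30,
      .btReplace 30 31] σ₃ = ⟨Function.update (Function.update σ₃.reg 44 l₂) 32 (l₁ + l₂),
        upd σ₃.heap x fLen (l₁ + l₂), σ₃.order.erase y, σ₃.btree.replace y x⟩ := by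
    simp [q30, q31, q32, hl3, hly, hmod]
    rfl
  rw [hrun]
  have m4 : Mesh (upd σ₃.heap x fLen (l₁ + l₂)) false (X ++ (x, l₁ + l₂) :: Y)
      (X' ++ (x, l₁ + l₂) :: Y') := by
    have m3 := m3.symm
    have hf : ∀ (t : Bool), fn t ≠ fLen ∧ fp t ≠ fLen ∧ fe t ≠ fLen ∧ fb t ≠ fLen := by
      intro t; cases t <;> decide
    exact ⟨m3.pos, m3.pos', m3.nodup, m3.nodup', m3.zero, m3.zero', m3.width_eq,
      m3.links.congr (fun a => hkey _ _ (hf _).1) (fun a => hkey _ _ (hf _).2.1),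
      m3.links'.congr (fun a => hkey _ _ (hf _).1) (fun a => hkey _ _ (hf _).2.1),
      m3.edges.congr (fun a _ => hkey _ _ (hf _).2.2.1) (fun a _ => hkey _ _ (hf _).2.2.2),
      m3.edges'.congr (fun a _ => hkey _ _ (hf _).2.2.1) (fun a _ => hkey _ _ (hf _).2.2.2),
      (hkey _ _ (hf _).2.2.1).trans m3.null, (hkey _ _ (hf _).2.2.1).trans m3.null'⟩
  have hreg : ∀ r < 30, Function.update (Function.update σ₃.reg 44 l₂) 32 (l₁ + l₂) r =
      σ.reg r := by
    intro r hr
    rw [Function.update_apply, if_neg (by omega), Function.update_apply, if_neg (by omega),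
      f3'.1 r (by omega), f1 r hr]
  refine ⟨hreg, ⟨⟨m4, hg, fun p hp => ?_, rfl⟩, ?_, ?_, ?_, ?_, ?_⟩, fun a => ?_, ?_⟩
  · have hlen := inv.core.len
    rw [hT] at hlen
    simp only [List.mem_append, List.mem_cons] at hp hlen
    have hout : p.1 ≠ x → upd σ₃.heap x fLen (l₁ + l₂) p.1 fLen = σ.heap p.1 fLen := by
      intro h; rw [upd_addr _ _ _ _ h, hl3]
    simp only [recs_append, recs_cons, List.nodup_append, List.nodup_cons, List.mem_cons,
      not_or] at hn
    rcases hp with hp | rfl | hp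
    · have h1 : p.1 ∈ recs X := List.mem_map_of_mem hp
      simp only [hout fun h => hn.2.2 _ h1 x (Or.inl rfl) h]
      exact hlen p (Or.inl hp)
    · simp
    · have h1 : p.1 ∈ recs Y := List.mem_map_of_mem hp
      simp only [hout fun h => hn.2.1.1.2 (h ▸ h1)]
      exact hlen p (Or.inr (Or.inr (Or.inr hp)))
  · have h1 := inv.order
    rw [hT] at h1
    simp only [recs_append, recs_cons] at h1 hn ⊢
    rw [f3'.2.1, ho1, h1]
    have h2 : y ∉ recs X := fun h => (List.nodup_append.1 hn).2.2 y h y (by simp) rfl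
    have h3 : x ≠ y := by
      rintro rfl
      have := (List.nodup_append.1 hn).2.1
      simp at this
    rw [List.erase_append_right _ h2, List.erase_cons, if_neg (by simpa using h3)]
    simp
  · obtain ⟨n, hn⟩ := inv.shape
    exact ⟨n, BTree.hasHeight_replace _ _ (by rw [hJ3]; exact hn)⟩
  · simp only [BTree.inorder_replace, hJ3]
    have h1 := inv.sub
    have h2 := m.nodup'
    rw [hT'] at h1 h2
    simp only [recs_append, recs_cons] at h1 h2 ⊢
    rcases hJ with h | h
    · have h3 : σ.btree.inorder.Sublist (recs X' ++ y :: recs Y') := by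
        have h4 := h1.filter (fun a => decide (a ≠ x))
        rw [List.filter_eq_self.2 (by
          intro a ha; simp only [decide_eq_true_eq]; rintro rfl; exact h ha)] at h4
        refine h4.trans ?_
        rw [List.filter_append, List.filter_cons_of_neg (by simp)]
        exact List.filter_sublist.append List.filter_sublist
      have h4 : (recs X' ++ y :: recs Y').Nodup := h2.sublist (by simp)
      have h5 := h3.map (fun a => if a = y then x else a)
      rwa [rename_list h4] at h5
    · have h3 : σ.btree.inorder.map (fun a => if a = y then x else a) = σ.btree.inorder := by
        refine (List.map_congr_left fun a ha => ?_).trans (List.map_id _)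
        rw [if_neg]; · rfl
        rintro rfl; exact h ha
      rw [h3]
      have h4 := h1.filter (fun a => decide (a ≠ y))
      rw [List.filter_eq_self.2 (by
        intro a ha; simp only [decide_eq_true_eq]; rintro rfl; exact h ha)] at h4
      refine h4.trans ?_
      rw [List.filter_append, List.filter_cons]
      refine List.filter_sublist.append ?_
      split
      · refine List.Sublist.cons_cons _ ?_
        rw [List.filter_cons_of_neg (by simp)]; exact List.filter_sublist
      · rw [List.filter_cons_of_neg (by simp)]
        exact List.filter_sublist.trans (List.sublist_cons_self _ _)
  · exact (hreg 11 (by omega)).trans inv.zero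
  · exact (hreg 12 (by omega)).trans inv.one
  · exact (hkey _ _ (by decide)).trans (hc3 a)
  · simp only [BTree.inorder_replace, hJ3]

end

end RComp


namespace RComp

/-! ### Inserting the new nodes -/

section

variable {S : List ℕ} {W : ℕ} {σ : State} {h h' : ℕ → ℕ → ℕ}
  {TU TV A B PU QU PV QV : List (ℕ × ℕ)} {d z c nv bu : ℕ}

/-- The record of a tile of length 1 is exchanged. -/
lemma Mesh.rename (m : Mesh h false (A ++ (d, 1) :: B) TV) (hz : z ∉ recs (A ++ (d, 1) :: B))
    (hz0 : z ≠ 0) (hl : Links h' false (recs A ++ z :: recs B))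
    (hn : ∀ a, h' a fNextV = h a fNextV) (hp : ∀ a, h' a fPrevV = h a fPrevV)
    (hE : h' z fEL = h d fEL) (hB : h' z fBL = h d fBL)
    (hE' : ∀ a, a ≠ z → h' a fEL = h a fEL) (hB' : ∀ a, a ≠ z → h' a fBL = h a fBL)
    (hF : ∀ a, h' a fEF = if h d fBL = 0 ∧ a = h d fEL then z else h a fEF)
    (hG : ∀ a, h' a fBF = h a fBF) : Mesh h' false (A ++ (z, 1) :: B) TV := by
  have hw : width TV = width A + 1 + width B := by rw [m.width_eq]; simp; omega
  obtain ⟨q, hq, h1, h2⟩ := exists_ent (s := 0) (T := TV) (Nat.zero_le (width A)) (by omega)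
  obtain ⟨h3, h4⟩ := m.edges (width A, d, 1) (by simp) q hq h1 h2
  simp only at h3 h4
  have hnd := m.nodup
  have hz1 := m.zero
  simp only [recs_append, recs_cons, List.mem_append, List.mem_cons, not_or, List.nodup_append,
    List.nodup_cons] at hz hnd hz1
  have hq0 : q.2.1 ≠ 0 := fun h => m.zero' (h ▸ mem_recs_of_ent hq)
  refine ⟨?_, m.pos', ?_, m.nodup', ?_, m.zero', by rw [hw]; simp; omega, by simpa using hl,
    m.links'.congr hn hp, ?_, ?_, ?_, ?_⟩
  · intro p hp
    have := m.pos
    simp only [List.mem_append, List.mem_cons] at hp this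
    rcases hp with h | rfl | h
    · exact this p (Or.inl h)
    · exact Nat.one_pos
    · exact this p (Or.inr (Or.inr h))
  · simp only [recs_append, recs_cons, List.mem_cons, List.nodup_append, List.nodup_cons]
    refine ⟨hnd.1, ⟨hz.2.2, hnd.2.1.2⟩, ?_⟩
    rintro a ha b (rfl | hb)
    · rintro rfl; exact hz.1 ha
    · exact hnd.2.2 a ha b (Or.inr hb)
  · simp only [recs_append, recs_cons, List.mem_append, List.mem_cons, not_or]
    exact ⟨hz1.1, hz0.symm, hz1.2.2⟩
  · refine Edges.source_rename (u := d) ?_ ?_ ?_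
    · refine m.edges.congr (fun a ha => hE' a ?_) (fun a ha => hB' a ?_) <;>
      · rintro rfl
        simp only [recs_append, recs_cons, List.mem_append, List.mem_cons] at ha
        tauto
    · exact hE.trans (hE' d (Ne.symm hz.2.1)).symm
    · exact hB.trans (hB' d (Ne.symm hz.2.1)).symm
  · refine Edges.target_rename m.edges' (fun p hp h5 => ?_) (fun p hp h5 => ?_) fun p _ => hG _
    · obtain ⟨h6, h7⟩ := m.edges (width A, d, 1) (by simp) p hp (by simp only; omega) (by
        have := ent_pos m.pos' hp
        simp only; omega)
      simp only at h6 h7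
      exact (hF _).trans (if_pos ⟨h7.trans (by omega), h6.symm⟩)
    · refine (hF _).trans (if_neg ?_)
      rintro ⟨h6, h7⟩
      have := ent_eq_of_rec m.nodup' hp hq (h7.trans h3)
      subst this
      have h8 : width A - p.1 = 0 := h4.symm.trans h6
      omega
  · exact (hE' 0 hz0.symm).trans m.null
  · refine (hF 0).trans ?_
    rw [if_neg fun h5 => hq0 (h3.symm.trans h5.2.symm)]
    exact m.null'

/-- Tiles of length 1 are inserted at the same position. -/
lemma Mesh.insert (m : Mesh h false (PU ++ QU) (PV ++ QV)) (hw : width PU = width PV)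
    (hd : d ∉ recs (PU ++ QU)) (hd0 : d ≠ 0) (hz : z ∉ recs (PV ++ QV)) (hz0 : z ≠ 0)
    (hl : Links h' false (recs PU ++ d :: recs QU)) (hl' : Links h' true (recs PV ++ z :: recs QV))
    (h1 : h' d fEL = z) (h2 : h' d fBL = 0) (h3 : h' z fEF = d) (h4 : h' z fBF = 0)
    (hE : ∀ a, a ≠ d → h' a fEL = h a fEL) (hB : ∀ a, a ≠ d → h' a fBL = h a fBL)
    (hF : ∀ a, a ≠ z → h' a fEF = h a fEF) (hG : ∀ a, a ≠ z → h' a fBF = h a fBF) :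
    Mesh h' false (PU ++ (d, 1) :: QU) (PV ++ (z, 1) :: QV) := by
  have hpos : ∀ {P Q : List (ℕ × ℕ)} {x : ℕ}, (∀ p ∈ P ++ Q, 0 < p.2) →
      ∀ p ∈ P ++ (x, 1) :: Q, 0 < p.2 := by
    intro P Q x hPQ p hp
    simp only [List.mem_append, List.mem_cons] at hp hPQ
    rcases hp with h | rfl | h
    · exact hPQ p (Or.inl h)
    · exact Nat.one_pos
    · exact hPQ p (Or.inr h)
  have hnd : ∀ {P Q : List (ℕ × ℕ)} {x : ℕ}, (recs (P ++ Q)).Nodup → x ∉ recs (P ++ Q) →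
      (recs (P ++ (x, 1) :: Q)).Nodup := by
    intro P Q x hPQ hx
    rw [recs_append] at hPQ hx
    rw [recs_append, recs_cons, List.nodup_middle, List.nodup_cons]
    exact ⟨hx, hPQ⟩
  have hze : ∀ {P Q : List (ℕ × ℕ)} {x : ℕ}, 0 ∉ recs (P ++ Q) → x ≠ 0 →
      0 ∉ recs (P ++ (x, 1) :: Q) := by
    intro P Q x hPQ hx
    simp only [recs_append, recs_cons, List.mem_append, List.mem_cons, not_or] at hPQ ⊢
    exact ⟨hPQ.1, hx.symm, hPQ.2⟩
  have hw1 := m.width_eq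
  refine ⟨hpos m.pos, hpos m.pos', hnd m.nodup hd, hnd m.nodup' hz, hze m.zero hd0, hze m.zero' hz0,
    by simp at hw1 ⊢; omega, by simpa using hl, by simpa using hl', ?_, ?_,
    (hE 0 hd0.symm).trans m.null, (hF 0 hz0.symm).trans m.null'⟩
  · refine Edges.insert ?_ hw m.pos h1 h2
    exact m.edges.congr (fun a ha => hE a fun h => hd (h ▸ ha)) (fun a ha => hB a fun h => hd
      (h ▸ ha))
  · refine Edges.insert ?_ hw.symm m.pos' h3 h4
    exact m.edges'.congr (fun a ha => hF a fun h => hz (h ▸ ha)) (fun a ha => hG a fun h => hz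
      (h ▸ ha))

/-- A division of a tiling, after the record of a tile was exchanged. -/
lemma rename_parts {P Q : List (ℕ × ℕ)} {C : List ℕ} (hT : A ++ (d, 1) :: B = P ++ Q)
    (hn : (recs (A ++ (d, 1) :: B)).Nodup) (h0 : 0 ∉ recs (A ++ (d, 1) :: B))
    (hv : recs Q ++ [0] = bu :: C) (z : ℕ) :
    ∃ P' Q' C', A ++ (z, 1) :: B = P' ++ Q' ∧ width P' = width P ∧
      recs Q' ++ [0] = (if bu = d then z else bu) :: C' := by
  have hd : ∀ {Y W : List (ℕ × ℕ)}, A ++ (d, 1) :: B = Y ++ (d,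
      1) :: W → d ∉ recs Y ∧ d ∉ recs W := by
    intro Y W h
    rw [h] at hn
    simp only [recs_append, recs_cons, List.nodup_append, List.nodup_cons] at hn
    exact ⟨fun h' => hn.2.2 d h' d (by simp) rfl, hn.2.1.1⟩
  have hd0 : d ≠ 0 := by rintro rfl; simp at h0
  rcases List.append_eq_append_iff.1 hT with ⟨Z, h1, h2⟩ | ⟨Z, h1, h2⟩
  · cases Z with
    | nil =>
      simp only [List.nil_append] at h2
      rw [← h2] at hv
      simp only [recs_cons, List.cons_append, List.cons.injEq] at hv
      refine ⟨A, (z, 1) :: B, recs B ++ [0], rfl, by rw [h1]; simp, ?_⟩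
      rw [if_pos hv.1.symm]; rfl
    | cons r Z =>
      simp only [List.cons_append, List.cons.injEq] at h2
      obtain ⟨rfl, rfl⟩ := h2
      refine ⟨A ++ (z, 1) :: Z, Q, C, by simp, by rw [h1]; simp, ?_⟩
      rw [if_neg, hv]
      rintro rfl
      have h3 := (hd rfl).2
      have h4 : bu ∈ recs Q ++ [0] := by rw [hv]; simp
      simp only [recs_append, List.mem_append, List.mem_singleton, not_or] at h3 h4
      rcases h4 with h4 | h4
      · exact h3.2 h4
      · exact hd0 h4
  · cases Z with
    | nil =>
      simp only [List.append_nil, List.nil_append] at h1 h2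
      rw [h2] at hv
      simp only [recs_cons, List.cons_append, List.cons.injEq] at hv
      refine ⟨A, (z, 1) :: B, recs B ++ [0], rfl, by rw [h1], ?_⟩
      rw [if_pos hv.1.symm]; rfl
    | cons r Z =>
      rw [h2] at hv
      simp only [List.cons_append, recs_cons, List.cons.injEq] at hv
      refine ⟨P, r :: (Z ++ (z, 1) :: B), recs (Z ++ (z, 1) :: B) ++ [0], by rw [h1]; simp, rfl, ?_⟩
      have h3 := (hd rfl).1
      rw [h1] at h3
      simp only [recs_append, recs_cons, List.mem_append, List.mem_cons, not_or] at h3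
      rw [← hv.1, if_neg fun h => h3.2.1 h.symm]
      rfl

/-- Inserts the node in register 13 and moves the node of the special character; the nodes that
follow the insertion position are in the registers 14 and 15. -/
def insertProg : Program :=
  .seq (blk [.copy 30 rDollar, .copy 31 13]) <| .seq (linkProg false) <| .seq (unlinkProg false) <|
  .seq (blk [.load 44 rDollar fEL, .load 45 rDollar fBL, .store 13 fEL 44, .store 13 fBL 45]) <|
  .seq (.ite (.eq 45 11) (blk [.store 44 fEF 13]) .skip) <|
  .seq (.ite (.eq 15 rDollar) (blk [.copy 15 13]) .skip) <|
  .seq (blk [.load 30 15 fPrevU, .copy 31 rDollar, .omAfter rDollar 13, .omDelete rDollar,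
    .omAfter 30 rDollar]) <|
  .seq (linkProg false) <| .seq (blk [.load 30 14 fPrevV, .copy 31 13]) <| .seq (linkProg true) <|
  blk [.store rDollar fEL 13, .store rDollar fBL 11, .store 13 fEF rDollar, .store 13 fBF 11,
    .store 13 fChar rChar, .store 13 fLen 12]

/-- Registers below 30 other than 15 are unchanged. -/
def Fixed' (σ σ' : State) : Prop := ∀ r < 30, r ≠ 15 → σ'.reg r = σ.reg r

lemma Fixed'.trans {σ σ' σ'' : State} (h : Fixed' σ σ') (h' : Fixed' σ' σ'') : Fixed' σ σ'' :=
  fun r hr h15 => (h' r hr h15).trans (h r hr h15)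

lemma Fixed.fixed' {σ σ' : State} (h : Fixed σ σ') : Fixed' σ σ' := fun r hr _ => h r hr

lemma runs_insert {PU₀ QU₀ : List (ℕ × ℕ)} {C C' : List ℕ} (inv : Inv S σ TU TV) (hS : IsText S)
    (hc : dollar < c) (hw : width TU = S.length)
    (hT : TU = A ++ (d, 1) :: B) (hA : width A = rep S) (hz : z ∉ recs TU) (hz0 : z ≠ 0)
    (hU : TU = PU₀ ++ QU₀) (hPU : width PU₀ = insPos (bwt S) c) (hbu : recs QU₀ ++ [0] = bu :: C)
    (hV : TV = PV ++ QV) (hPV : width PV = insPos (bwt S) c) (hnv : recs QV ++ [0] = nv :: C')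
    (h0 : σ.reg rChar = c) (h3 : σ.reg rDollar = d) (h13 : σ.reg 13 = z) (h14 : σ.reg 14 = nv)
    (h15 : σ.reg 15 = bu) :
    ∃ PU QU, A ++ (z, 1) :: B = PU ++ QU ∧ width PU = insPos (bwt S) c ∧
      Runs W insertProg σ 50 (fun σ' => Fixed' σ σ' ∧
        Inv (c :: S) σ' (PU ++ (d, 1) :: QU) (PV ++ (z, 1) :: QV) ∧
        (∀ a, σ'.heap a fChar = if a = z then c else σ.heap a fChar) ∧
        σ'.btree = σ.btree) := by
  have m := inv.core.mesh
  have m' := m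
  rw [hT] at m'
  obtain ⟨PU, QU, C'', hPQ, hPU', hbu'⟩ := rename_parts (hT.symm.trans hU) m'.nodup m'.zero
    hbu z
  rw [hPU] at hPU'
  refine ⟨PU, QU, hPQ, hPU', ?_⟩
  have hzV : z ∉ recs TV := fun h => hz (inv.core.geo.perm_recs.mem_iff.1 h)
  have hd0 : d ≠ 0 := by rintro rfl; exact m'.zero (by simp)
  have hdz : d ≠ z := by rintro rfl; exact hz (by rw [hT]; simp)
  have hg := inv.core.geo.insert hS hc hT hA hV hPQ hPU' hPV m.pos hw
  have hpos := insPos_pos hS hc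
  obtain rfl | ⟨PU₁, pu, hPU₁⟩ := List.eq_nil_or_concat' PU
  · simp at hPU'; omega
  have hrecT : recs TU = recs A ++ d :: recs B := by rw [hT]; simp
  have hrecPQ : recs PU ++ recs QU = recs A ++ z :: recs B := by
    rw [← recs_append, ← hPQ]; simp
  have hnd : (recs A ++ d :: recs B).Nodup := by rw [← hrecT]; exact m.nodup
  have hz00 : 0 ∉ recs A ++ d :: recs B := by rw [← hrecT]; exact m.zero
  have hzT : z ∉ recs A ++ d :: recs B := by rw [← hrecT]; exact hz
  have hnd2 : (recs A ++ d :: z :: recs B).Nodup := by grind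
  have hz02 : 0 ∉ recs A ++ d :: z :: recs B := by grind
  -- registers
  refine (Runs.seq (n := 2) (n' := 48) (R := fun σ' => Fixed σ σ' ∧ σ'.heap = σ.heap ∧
    σ'.order = σ.order ∧ σ'.btree = σ.btree ∧ σ'.reg 30 = d ∧ σ'.reg 31 = z)
    (runs_blk ?_) ?_).le
  · refine ⟨fun r hr => ?_, rfl, rfl, rfl, ?_, ?_⟩ <;>
      simp [Function.update_apply, h13, rDollar]
    · rw [if_neg (by omega), if_neg (by omega)]
    · rw [← h3]; rfl
  rintro σ₁ ⟨f1, hh1, ho1, hb1, g30, g31⟩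
  refine (Runs.seq (n := 5) (n' := 43) (R := fun σ' => Frame σ₁ σ' ∧
    σ'.heap = linkAfter σ.heap false d z) (runs_link.mono le_rfl ?_) ?_).le
  · rintro σ₂ ⟨f2, hh2⟩; exact ⟨f2, by rw [hh2, hh1, g30, g31]⟩
  rintro σ₂ ⟨f2, hh2⟩
  refine (Runs.seq (n := 4) (n' := 39) (R := fun σ' => Frame σ₁ σ' ∧
    σ'.heap = unlink (linkAfter σ.heap false d z) false d) (runs_unlink.mono le_rfl ?_) ?_).le
  · rintro σ₃ ⟨f3, hh3⟩; exact ⟨f2.trans f3, by rw [hh3, hh2, f2.reg 30, g30]⟩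
  rintro σ₃ ⟨f3, hh3⟩
  have links3 : Links σ₃.heap false (recs A ++ z :: recs B) := by
    have l1 := m.links
    rw [hrecT, List.append_cons] at l1
    have := l1.insert (A := 0 :: recs A) (u := d) (x := z) (by simp) (by simpa using hzT) hz0
      (by simpa using hnd) (by simpa using hz00)
    rw [List.append_assoc] at this
    exact hh3 ▸ this.erase hnd2 hz02
  have k3 : ∀ a f, f ≠ fNextU → f ≠ fPrevU → σ₃.heap a f = σ.heap a f := by
    rw [hh3]; grind
  have fx3 : Fixed σ σ₃ := f1.trans f3.fixed
  have q3 : σ₃.reg 3 = d := (fx3 3 (by omega)).trans h3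
  have q13 : σ₃.reg 13 = z := (fx3 13 (by omega)).trans h13
  have q11 : σ₃.reg 11 = 0 := (fx3 11 (by omega)).trans inv.zero
  -- edge of the new node
  refine (Runs.seq (n := 4) (n' := 35) (R := fun σ' => Frame σ₃ σ' ∧
    σ'.heap = upd (upd σ₃.heap z fEL (σ.heap d fEL)) z fBL (σ.heap d fBL) ∧
    σ'.reg 44 = σ.heap d fEL ∧ σ'.reg 45 = σ.heap d fBL)
    (runs_blk ?_) ?_).le
  · have e1 := k3 d fEL (by decide) (by decide)
    have e2 := k3 d fBL (by decide) (by decide)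
    refine ⟨⟨fun r hr => runAll_reg hr, rfl, rfl⟩, ?_, ?_, ?_⟩
    · simp [rDollar, q3, q13, e1, e2]; rfl
    · simp [rDollar, q3, e1]
    · simp [rDollar, q3, e2]
  rintro σ₄ ⟨f4, hh4, r44, r45⟩
  have k4 : ∀ a f, a ≠ z ∨ f ≠ fEL ∧ f ≠ fBL → σ₄.heap a f = σ₃.heap a f := by
    rw [hh4]; grind
  have k4' : σ₄.heap z fEL = σ.heap d fEL ∧ σ₄.heap z fBL = σ.heap d fBL := by
    rw [hh4]; grind
  refine (Runs.seq (n := 2) (n' := 33) (R := fun σ' => Frame σ₃ σ' ∧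
    (∀ a f, f ≠ fEF → σ'.heap a f = σ₄.heap a f) ∧
    (∀ a, σ'.heap a fEF = if σ.heap d fBL = 0 ∧ a = σ.heap d fEL then z else σ.heap a fEF))
    (Runs.ite (n := 1) ?_ ?_) ?_).le
  · intro hb
    simp only [Test.Holds] at hb
    rw [f4.reg 11, q11, r45] at hb
    have e1 : σ₄.reg 13 = z := (f4.reg 13).trans q13
    refine runs_blk ⟨f4.trans ⟨fun r hr => rfl, rfl, rfl⟩, fun a f hf => ?_, fun a => ?_⟩
    · simp [hf]
    · simp [r44, e1, hb]
      grind
  · intro hb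
    simp only [Test.Holds] at hb
    rw [f4.reg 11, q11, r45] at hb
    refine (Runs.skip ⟨f4, fun a f _ => rfl, fun a => ?_⟩).le
    grind
  rintro σ₅ ⟨f5, k5, hEF⟩
  have m5 : Mesh σ₅.heap false (A ++ (z, 1) :: B) TV := by
    refine m'.rename (by rw [← hT]; exact hz) hz0 ?_ ?_ ?_ ?_ ?_ ?_ ?_ hEF ?_
    · exact links3.congr (by grind) (by grind)
    all_goals grind
  have k5' : ∀ a f, f = fChar ∨ f = fLen → σ₅.heap a f = σ.heap a f := by
    grind
  have fx5 : Fixed σ σ₅ := fx3.trans f5.fixed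
  -- insertion position in the list of repetitions
  refine (Runs.seq (n := 2) (n' := 31) (R := fun σ' => Fixed' σ σ' ∧ σ'.heap = σ₅.heap ∧
    σ'.order = σ.order ∧ σ'.btree = σ.btree ∧ σ'.reg 15 = if bu = d then z else bu)
    (Runs.ite (n := 1) ?_ ?_) ?_).le
  · intro hb
    simp only [Test.Holds, rDollar] at hb
    rw [fx5 15 (by omega), fx5 3 (by omega), h15] at hb
    have hb' : bu = d := hb.trans h3
    refine runs_blk ⟨fx5.fixed'.trans fun r _ h15 => ?_, rfl, ?_, ?_, ?_⟩
    · simp [h15]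
    · simp [f5.2.1, f3.2.1, ho1]
    · simp [f5.2.2, f3.2.2, hb1]
    · simp [hb', fx5 13, h13]
  · intro hb
    simp only [Test.Holds, rDollar] at hb
    rw [fx5 15 (by omega), fx5 3 (by omega), h15] at hb
    have hb' : bu ≠ d := fun h => hb (h.trans h3.symm)
    refine (Runs.skip ⟨fx5.fixed', rfl, ?_, ?_, ?_⟩).le
    · rw [f5.2.1, f3.2.1, ho1]
    · rw [f5.2.2, f3.2.2, hb1]
    · rw [fx5 15 (by omega), h15, if_neg hb']
  rintro σ₆ ⟨fx6, hh6, ho6, hb6, r15⟩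
  have links6 : Links σ₅.heap false (recs PU ++ recs QU) := by
    rw [hrecPQ]; simpa using m5.links
  have hprev : σ₅.heap (if bu = d then z else bu) fPrevU = pu.1 :=
    (links6.next (A := 0 :: recs PU₁) (x := pu.1) (by rw [hPU₁]; simp) hbu').2
  have p3 : σ₆.reg 3 = d := (fx6 3 (by omega) (by omega)).trans h3
  have p13 : σ₆.reg 13 = z := (fx6 13 (by omega) (by omega)).trans h13
  have hndPQ : (recs PU ++ recs QU).Nodup := by
    rw [hrecPQ]; simpa using m5.nodup
  have horder : insertAfter pu.1 d ((insertAfter d z (recs TU)).erase d) =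
      recs PU ++ d :: recs QU := by
    have e1 : d ∉ recs A := fun h => (List.nodup_append.1 hnd).2.2 d h d (by simp) rfl
    rw [hrecT, insertAfter_append e1, List.erase_append_right _ e1, List.erase_cons_head, ← hrecPQ,
      hPU₁, recs_append]
    simp only [recs_cons, recs_nil, List.append_assoc, List.singleton_append]
    refine insertAfter_append fun h => ?_
    rw [hPU₁, recs_append, recs_cons, recs_nil, List.append_assoc, List.singleton_append] at hndPQ
    exact (List.nodup_append.1 hndPQ).2.2 _ h pu.1 (by simp) rfl
  refine (Runs.seq (n := 5) (n' := 26) (R := fun σ' => Fixed' σ σ' ∧ σ'.heap = σ₅.heap ∧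
    σ'.order = recs PU ++ d :: recs QU ∧ σ'.btree = σ.btree ∧ σ'.reg 30 = pu.1 ∧ σ'.reg 31 = d)
    (runs_blk ?_) ?_).le
  · refine ⟨fx6.trans fun r hr _ => ?_, hh6, ?_, ?_, ?_, ?_⟩
    · exact runAll_reg hr
    · simp [rDollar, p3, p13, ho6, inv.order, r15, hh6, hprev,
        horder]
    · simp [hb6]
    · simp [r15, hh6, hprev]
    · simp [rDollar, p3]
  rintro σ₇ ⟨fx7, hh7, ho7, hb7, r30, r31⟩
  refine (Runs.seq (n := 5) (n' := 21) (R := fun σ' => Frame σ₇ σ' ∧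
    σ'.heap = linkAfter σ₅.heap false pu.1 d) (runs_link.mono le_rfl ?_) ?_).le
  · rintro σ₈ ⟨f8, hh8⟩; exact ⟨f8, by rw [hh8, hh7, r30, r31]⟩
  rintro σ₈ ⟨f8, hh8⟩
  have hdPQ : d ∉ recs PU ++ recs QU := by grind
  have hzPQ : 0 ∉ recs PU ++ recs QU := by rw [hrecPQ]; simpa using m5.zero
  have links8 : Links σ₈.heap false (recs PU ++ d :: recs QU) := by
    rw [hh8]
    exact links6.insert (A := 0 :: recs PU₁) (u := pu.1) (by rw [hPU₁]; simp) hdPQ hd0 hndPQ hzPQ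
  have k8 : ∀ a f, f ≠ fNextU → f ≠ fPrevU → σ₈.heap a f = σ₅.heap a f := by
    intro a f h1 h2
    rw [hh8, linkAfter_field h1 h2]
  -- insertion position in the list of F-intervals
  obtain ⟨A', pv, hPV'⟩ := exists_concat_zero (recs PV)
  have links5' : Links σ₅.heap true (recs PV ++ recs QV) := by
    have := m5.links'
    rw [hV] at this; simpa using this
  have hprev' : σ₈.heap nv fPrevV = pv := by
    rw [k8 _ _ (by decide) (by decide)]
    exact (links5'.next hPV' hnv).2
  have fx8 : Fixed' σ σ₈ := fx7.trans f8.fixed.fixed'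
  refine (Runs.seq (n := 2) (n' := 19) (R := fun σ' => Fixed' σ σ' ∧ σ'.heap = σ₈.heap ∧
    σ'.order = σ₈.order ∧ σ'.btree = σ₈.btree ∧ σ'.reg 30 = pv ∧ σ'.reg 31 = z)
    (runs_blk ?_) ?_).le
  · have e14 := (fx8 14 (by omega) (by omega)).trans h14
    have e13 := (fx8 13 (by omega) (by omega)).trans h13
    refine ⟨fx8.trans fun r hr _ => ?_, rfl, rfl, rfl, ?_, ?_⟩
    · exact runAll_reg hr
    · simp [e14, hprev']
    · simp [e13]
  rintro σ₉ ⟨fx9, hh9, ho9, hb9, s30, s31⟩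
  refine (Runs.seq (n := 5) (n' := 6) (R := fun σ' => Frame σ₉ σ' ∧
    σ'.heap = linkAfter σ₈.heap true pv z) (runs_link.mono le_rfl ?_) ?_).le
  · rintro σ₁₀ ⟨f10, hh10⟩; exact ⟨f10, by rw [hh10, hh9, s30, s31]⟩
  rintro σ₁₀ ⟨f10, hh10⟩
  have links10' : Links σ₁₀.heap true (recs PV ++ z :: recs QV) := by
    rw [hh10]
    have hv := m.nodup'
    have hv0 := m.zero'
    rw [hV, recs_append] at hv hv0 hzV
    exact (links5'.congr (fun a => k8 _ _ (by decide) (by decide))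
      (fun a => k8 _ _ (by decide) (by decide))).insert hPV' hzV hz0 hv hv0
  have k10 : ∀ a f, f ≠ fNextV → f ≠ fPrevV → σ₁₀.heap a f = σ₈.heap a f := by
    intro a f h1 h2
    rw [hh10, linkAfter_field h1 h2]
  have fx10 : Fixed' σ σ₁₀ := fx9.trans f10.fixed.fixed'
  have t0 : σ₁₀.reg 0 = c := (fx10 0 (by omega) (by omega)).trans h0
  have t3 : σ₁₀.reg 3 = d := (fx10 3 (by omega) (by omega)).trans h3
  have t13 : σ₁₀.reg 13 = z := (fx10 13 (by omega) (by omega)).trans h13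
  have t11 : σ₁₀.reg 11 = 0 := (fx10 11 (by omega) (by omega)).trans inv.zero
  have t12 : σ₁₀.reg 12 = 1 := (fx10 12 (by omega) (by omega)).trans inv.one
  obtain ⟨H, hH⟩ : ∃ H, H = upd (upd (upd (upd (upd (upd σ₁₀.heap d fEL z) d fBL 0) z fEF d)
    z fBF 0) z fChar c) z fLen 1 := ⟨_, rfl⟩
  have kH := fun a f => congrFun (congrFun hH a) f
  simp only [upd] at kH
  refine runs_blk ?_
  have hrun : runAll W [.store rDollar fEL 13, .store rDollar fBL 11, .store 13 fEF rDollar,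
      .store 13 fBF 11, .store 13 fChar rChar, .store 13 fLen 12] σ₁₀ =
      ⟨σ₁₀.reg, H, σ₁₀.order, σ₁₀.btree⟩ := by
    simp only [hH, runAll, run_store, rDollar, rChar, t0, t3, t13, t11, t12]
  rw [hrun]
  have m11 : Mesh H false (PU ++ (d, 1) :: QU) (PV ++ (z, 1) :: QV) := by
    have mm := m5
    rw [hPQ, hV] at mm
    clear r15 hprev hprev' hbu' hEF
    refine mm.insert (hPU'.trans hPV.symm) (by simpa using hdPQ) hd0 (hV ▸ hzV) hz0
      (links8.congr (by grind) (by grind)) (links10'.congr (by grind) (by grind))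
      ?_ ?_ ?_ ?_ ?_ ?_ ?_ ?_ <;> grind
  have hbt : σ₁₀.btree = σ.btree := by rw [f10.2.2, hb9, f8.2.2, hb7]
  refine ⟨fx10, ⟨⟨m11, hg, fun p hp => ?_, rfl⟩, ?_, ?_, ?_, t11, t12⟩, by grind, hbt⟩
  · by_cases hpz : p = (z, 1)
    · grind
    · have hp1 : p ∈ TU := by
        have : p ∈ PU ++ QU ↔ p ∈ A ++ (z, 1) :: B := by rw [hPQ]
        grind
      have hpz' : p.1 ≠ z := fun h => hz (h ▸ List.mem_map_of_mem hp1)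
      have := inv.core.len p hp1
      grind
  · simp only [recs_append, recs_cons]
    rw [f10.2.1, ho9, f8.2.1, ho7]
  · simp only [hbt]; exact inv.shape
  · simp only [hbt]
    have := inv.sub
    rw [hV] at this
    refine this.trans ?_
    simp

end

end RComp


namespace RComp

/-! ### Boundaries of a list of tiles -/

/-- A tile of `v` starts at position `p`, or the tiles end at `p` and `v` is the null pointer. -/
def At (T : DBWT) (p v : ℕ) : Prop := ∃ P Q C, T = P ++ Q ∧ width P = p ∧ recs Q ++ [0] = v :: C

lemma At.split {X Y : DBWT} {u l₁ l₂ p v : ℕ} (h : At (X ++ (u, l₁ + l₂) :: Y) p v) (x : ℕ) :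
    At (X ++ (u, l₁) :: (x, l₂) :: Y) p v := by
  obtain ⟨P, Q, C, h1, h2, h3⟩ := h
  have key : ∀ R : DBWT, X = P ++ R → Q = R ++ (u, l₁ + l₂) :: Y →
      At (X ++ (u, l₁) :: (x, l₂) :: Y) p v := by
    rintro R rfl rfl
    rcases R with _ | ⟨r, R⟩
    · exact ⟨P, (u, l₁) :: (x, l₂) :: Y, _, by simp, h2, by simp_all [recs]; rfl⟩
    · exact ⟨P, r :: R ++ (u, l₁) :: (x, l₂) :: Y, _, by simp, h2, by simp_all [recs]; rfl⟩
  rcases List.append_eq_append_iff.1 h1 with ⟨R, rfl, h4⟩ | ⟨R, h4, h5⟩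
  · rcases R with _ | ⟨r, R⟩
    · exact key [] (by simp) (by simpa using h4.symm)
    · obtain ⟨rfl, rfl⟩ : (u, l₁ + l₂) = r ∧ Y = R ++ Q := by simpa using h4
      exact ⟨X ++ (u, l₁) :: (x, l₂) :: R, Q, C, by simp, by rw [← h2]; simp; omega, h3⟩
  · exact key R h4 h5

lemma bd_lab (h : ℕ → ℕ → ℕ) (T : DBWT) : bd (lab h T) = bd T := by
  have : ∀ s, (ent s (lab h T)).map Prod.fst = (ent s T).map Prod.fst := by
    induction T with
    | nil => intro s; rfl
    | cons p T ih => intro s; simp [lab_cons, ih]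
  rw [bd, bd, this]

lemma mem_ent_lab {X Y T : DBWT} {y l : ℕ} (h : ℕ → ℕ → ℕ) (hT : T = X ++ (y, l) :: Y) :
    (width X, h y fChar, l) ∈ ent 0 (lab h T) := by
  rw [hT, lab_append, lab_cons, ent_append]; simp [width_lab]

lemma filter_recs {A B : DBWT} {d l : ℕ} (hn : (recs (A ++ (d, l) :: B)).Nodup) :
    (recs (A ++ (d, l) :: B)).filter (· ≠ d) = recs A ++ recs B := by
  simp only [recs, List.map_append, List.map_cons, List.nodup_append, List.nodup_cons,
    List.filter_append] at *
  rw [List.filter_cons_of_neg (by simp)]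
  congr 1 <;> refine List.filter_eq_self.2 fun a ha => ?_
  · simpa using hn.2.2 a ha d (by simp)
  · simpa using fun h : a = d => hn.2.1.1 (h ▸ ha)

/-- The B-tree contains only nodes that satisfy the three conditions, and all of them if `all`. -/
def BInv (all : Prop) (ch : ℕ → ℕ) (N : List ℕ) (d : ℕ) (J : List ℕ) : Prop :=
  BOnly ch N d J ∧ (all → BAll ch N d J)

variable {all : Prop} {ch ch' : ℕ → ℕ} {N J X Y : List ℕ} {a b d x u : ℕ}

lemma BInv.congr (h : BInv all ch N d J) (hch : ∀ a ∈ N, ch' a = ch a) : BInv all ch' N d J :=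
  ⟨h.1.congr hch, fun h' => (h.2 h').congr hch⟩

lemma BInv.rename (h : BInv all ch (X ++ u :: Y) d J) (hn : (X ++ u :: Y).Nodup)
    (hx : x ∉ X ++ Y) (hch : ch x = ch u) (hd : d ≠ u) :
    BInv all ch (X ++ x :: Y) d (J.map fun a => if a = u then x else a) :=
  ⟨h.1.rename hn hx hch hd, fun h' => (h.2 h').rename hn hx hch hd⟩

lemma BInv.double (h : ch a = ch b) :
    BInv all ch (X ++ a :: b :: Y) d J ↔ BInv all ch (X ++ b :: Y) d J := by
  simp only [BInv, BOnly.double h, BAll.double h]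

/-! ### The split-node step -/

lemma Runs.seq_blk {W n k : ℕ} {l : List Instr} {P : Program} {σ : State} {Q : State → Prop}
    (h : ∀ σ', σ' = runAll W l σ → Runs W P σ' n Q) (hk : l.length + n ≤ k := by
      simp only [List.length_cons, List.length_nil]; omega) :
    Runs W (.seq (blk l) P) σ k Q :=
  (Runs.seq (runs_blk (Q := (· = runAll W l σ)) rfl) h).mono hk fun _ h => h

section

variable {S : List ℕ} {W : ℕ} {σ : State} {TU TV A B A₀ B₀ A₁ B₁ : DBWT} {D : DBWT}
  {d z c x k α : ℕ} {all : Prop} {h : ℕ → ℕ → ℕ}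

lemma Inv.of_eq {σ' : State} (inv : Inv S σ TU TV) (h : σ'.heap = σ.heap)
    (ho : σ'.order = σ.order) (hb : σ'.btree = σ.btree) (hr : ∀ r < 14, σ'.reg r = σ.reg r) :
    Inv S σ' TU TV where
  core := h ▸ inv.core
  order := ho.trans inv.order
  shape := hb ▸ inv.shape
  sub := hb ▸ inv.sub
  zero := (hr 11 (by omega)).trans inv.zero
  one := (hr 12 (by omega)).trans inv.one

lemma Links.last_cases (hl : Links h false (recs (A ++ (d, k) :: B))) (h0 : h 0 fChar = 0)
    (hc : c ≠ 0) : (h (h d fPrevU) fChar = c ∧ lastHas c (lab h A) ∧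
      ∃ A' l, A = A' ++ [(h d fPrevU, l)]) ∨ (h (h d fPrevU) fChar ≠ c ∧ ¬ lastHas c
          (lab h A)) := by
  rcases List.eq_nil_or_concat A with rfl | ⟨A', ⟨y, l⟩, rfl⟩
  · have := (Links.next (X := []) (A := []) (x := 0) (Y := d :: recs B) hl rfl rfl).2
    right
    rw [show h d fPrevU = 0 from this, h0]
    exact ⟨hc.symm, by simp [lab, lastHas]⟩
  · have := (Links.next (X := recs A' ++ [y]) (A := 0 :: recs A') (x := y)
      (Y := d :: recs B) (by simpa [recs] using hl) rfl rfl).2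
    rw [show h d fPrevU = y from this]
    rcases eq_or_ne (h y fChar) c with h1 | h1
    · exact Or.inl ⟨h1, by simp [lab, lastHas, h1], A', l, by simp⟩
    · exact Or.inr ⟨h1, by simp [lab, lastHas, h1]⟩

lemma Links.head_cases (hl : Links h false (recs (A ++ (d, k) :: B))) (h0 : h 0 fChar = 0)
    (hc : c ≠ 0) : (h (h d fNextU) fChar = c ∧ headHas c (lab h B) ∧
      ∃ l B', B = (h d fNextU, l) :: B') ∨ (h (h d fNextU) fChar ≠ c ∧ ¬ headHas c (lab h B)) := by
  have hn : ∀ y C, recs B ++ [0] = y :: C → h d fNextU = y := fun y C hy =>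
    (Links.next (X := recs A ++ [d]) (A := 0 :: recs A) (x := d) (Y := recs B)
      (by simpa [recs] using hl) rfl hy).1
  rcases B with _ | ⟨⟨y, l⟩, B⟩
  · rw [hn 0 [] rfl, h0]
    exact Or.inr ⟨hc.symm, by simp [lab, headHas]⟩
  · rw [hn y _ rfl]
    rcases eq_or_ne (h y fChar) c with h1 | h1
    · exact Or.inl ⟨h1, by simp [lab, headHas, h1], l, B, rfl⟩
    · exact Or.inr ⟨h1, by simp [lab, headHas, h1]⟩

def locateProg : Program :=
  .seq (blk [.load 18 rDollar fPrevU, .load 19 18 fChar])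
    (.ite (.eq 19 rChar) (blk [.load 14 18 fNextV]) (blk [.load 14 rDollar fNextU]))

lemma runs_locate (inv : Inv S σ TU TV) (hS : IsText S) (hc : dollar < c)
    (hD : IsDBWT (lab σ.heap TU) (bwt S)) (hT : TU = A ++ (d, 1) :: B) (hA : width A = rep S)
    (hf : lastHas c (lab σ.heap A) ∨ headHas c (lab σ.heap B)) (h0 : σ.heap 0 fChar = 0)
    (hrc : σ.reg rChar = c) (hrd : σ.reg rDollar = d) :
    Runs W locateProg σ 4 (fun σ' => σ'.heap = σ.heap ∧ σ'.order = σ.order ∧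
      σ'.btree = σ.btree ∧ (∀ r < 18, r ≠ 14 → σ'.reg r = σ.reg r) ∧
      At TV (insPos (bwt S) c) (σ'.reg 14)) := by
  have hl' := inv.core.mesh.links'
  have hw : width TU = S.length := by rw [← hD.width_eq, width_lab]
  have hc' : c ≠ 0 := by unfold dollar at hc; omega
  have hchr : ∀ {X Y : DBWT} {y l q : ℕ}, TU = X ++ (y, l) :: Y → q < l →
      (bwt S).getD (width X + q) 0 = σ.heap y fChar := fun hX hq =>
    hD.getD (mem_ent_lab _ hX) hq
  have hcs := Links.last_cases (hT ▸ inv.core.mesh.links) h0 hc'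
  refine Runs.seq_blk (n := 2) fun σ₁ h1 => ?_
  have e18 : σ₁.reg 18 = σ.heap d fPrevU := by
    simp [h1, hrd]
  have e19 : σ₁.reg 19 = σ.heap (σ.heap d fPrevU) fChar := by
    simp [h1, hrd]
  have er : ∀ r < 18, σ₁.reg r = σ.reg r := fun r hr => by rw [h1]; exact runAll_reg hr
  have eh : σ₁.heap = σ.heap ∧ σ₁.order = σ.order ∧ σ₁.btree = σ.btree := by
    simp [h1]
  refine (Runs.ite (n := 1) (fun ht => ?_) fun ht => ?_)
  all_goals
    simp only [Test.Holds, e19, er rChar (by decide), hrc] at ht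
    refine runs_blk ?_
    simp only [runAll, Instr.run, State.setReg, Function.update_self, eh.1, e18,
      er rDollar (by decide), hrd]
    refine ⟨trivial, eh.2.1, eh.2.2, fun r hr hne => by rw [Function.update_of_ne hne, er r hr], ?_⟩
  · obtain ⟨-, -, A', l, rfl⟩ := hcs.resolve_right fun h => h.1 ht
    generalize σ.heap d fPrevU = y at *
    have hT' : TU = A' ++ (y, l) :: (d, 1) :: B := by rw [hT]; simp
    have hpos : 0 < l := inv.core.mesh.pos (y, l) (by rw [hT']; simp)
    have hA' : width A' + l = rep S := by simpa using hA
    obtain ⟨X', Y', hV, hX'⟩ := inv.core.geo.exists_parts hT'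
    obtain ⟨C, v, hv⟩ := recs_append_zero Y'
    have h3 := (Links.next (X := recs X' ++ [y]) (A := 0 :: recs X') (x := y)
      (Y := recs Y') (y := v) (B := C) (by rw [hV] at hl'; simpa [recs] using hl') rfl hv).1
    refine ⟨X' ++ [(y, l)], Y', C, by rw [hV]; simp, ?_, hv.trans (by rw [← h3]; rfl)⟩
    have h5 := hD.lf_add hS (mem_ent_lab _ hT') (q := l - 1) (by simp only; omega)
    rw [lf_rep_pred hS hc (p := width A' + (l - 1)) (by omega)
      (by rw [hchr hT' (by omega), ht]), h5]
    simp only [width_append, width_cons, width_nil, hX']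
    omega
  · have hh := hf.resolve_left (hcs.resolve_left fun h => ht h.1).2
    obtain ⟨hy, -, l, B, rfl⟩ := (Links.head_cases (hT ▸ inv.core.mesh.links) h0 hc').resolve_right
      fun h => h.2 hh
    generalize σ.heap d fNextU = y at *
    have hT' : TU = (A ++ [(d, 1)]) ++ (y, l) :: B := by rw [hT]; simp
    have hpos : 0 < l := inv.core.mesh.pos (y, l) (by rw [hT']; simp)
    obtain ⟨X', Y', hV, hX'⟩ := inv.core.geo.exists_parts hT'
    have hA' : width (A ++ [(d, 1)]) = rep S + 1 := by simp [hA]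
    refine ⟨X', (y, l) :: Y', _, hV, ?_, rfl⟩
    rw [hX', hA']
    refine (lf_rep_succ hS ?_ ?_).symm
    · rw [← hw, hT', width_append, hA', width_cons]; omega
    · rw [← hA', ← hy]; exact hchr (q := 0) hT' hpos

lemma lab_parts (hE : lab h TU = A₁ ++ (dollar, 1) :: B₁)
    (hne : ∀ p ∈ A₁ ++ B₁, p.1 ≠ dollar) (hd : d ∈ recs TU) (hdc : h d fChar = dollar) :
    ∃ A B, TU = A ++ (d, 1) :: B ∧ lab h A = A₁ ∧ lab h B = B₁ := by
  obtain ⟨A, R, rfl, hA, hR⟩ := List.map_eq_append_iff.1 hE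
  obtain ⟨⟨y, l⟩, B, rfl, hy, hB⟩ := List.map_eq_cons_iff.1 hR
  obtain ⟨hy, rfl⟩ : h y fChar = dollar ∧ l = 1 := by simpa using hy
  refine ⟨A, B, ?_, hA, hB⟩
  obtain ⟨p, hp, rfl⟩ := List.mem_map.1 hd
  have : ∀ p' ∈ A ++ B, h p'.1 fChar ≠ dollar := fun p' hp' => hne (h p'.1 fChar, p'.2) <| by
    rw [← hA, ← hB, ← List.map_append]; exact List.mem_map_of_mem hp'
  simp only [List.mem_append, List.mem_cons] at hp this
  rcases hp with hp | rfl | hp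
  exacts [absurd hdc (this p (Or.inl hp)), rfl, absurd hdc (this p (Or.inr hp))]

def cutProg : Program :=
  .seq locateProg <| .seq (blk [.load 20 14 fEF, .load 21 14 fBF]) <|
  .ite (.eq 21 11) (blk [.copy 15 20]) <|
  .seq (blk [.copy 30 20, .copy 31 16, .copy 32 11, .copy 33 21]) <|
  .seq splitProg (blk [.copy 15 16, .copy 17 12])

lemma exists_cut {p v : ℕ} (m : Mesh h false TU TV) (ha : At TV p v)
    (h0 : h 0 fBF = 0) : (h v fBF = 0 ∧ At TU p (h v fEF)) ∨
      ∃ X l₂ Y, TU = X ++ (h v fEF, h v fBF + l₂) :: Y ∧ width X + h v fBF = p ∧ 0 < h v fBF ∧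
        0 < l₂ := by
  obtain ⟨P, Q, C, hV, hP, hQ⟩ := ha
  rcases Q with _ | ⟨⟨y, l⟩, Q⟩
  · obtain rfl : 0 = v := by simpa [recs] using (List.cons_eq_cons.1 hQ).1
    refine Or.inl ⟨h0, TU, [], [], by simp, ?_, by simp [recs]; exact m.null'.symm⟩
    rw [← m.width_eq, hV, List.append_nil, hP]
  · obtain rfl : y = v := (List.cons_eq_cons.1 hQ).1
    have hl : 0 < l := m.pos' (y, l) (by rw [hV]; simp)
    have hw : p < width TU := by rw [← m.width_eq, hV]; simp; omega
    obtain ⟨e, he, h1, h2⟩ := exists_ent (s := 0) (Nat.zero_le p) (by simpa using hw)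
    obtain ⟨h3, h4⟩ := m.edges' (p, y, l) (by rw [hV, ← hP]; simp) e he h1 h2
    obtain ⟨X, Y, hT, hX⟩ := mem_ent.1 he
    replace h3 : h y fEF = e.2.1 := h3
    replace h4 : h y fBF = p - e.1 := h4
    rw [zero_add] at hX
    rcases Nat.eq_zero_or_pos (p - e.1) with h5 | h5
    · exact Or.inl ⟨h4.trans h5, X, e.2 :: Y, _, hT, by omega, by rw [h3]; rfl⟩
    · refine Or.inr ⟨X, e.1 + e.2.2 - p, Y, ?_, by omega, by omega, by omega⟩
      rw [h3, h4, show p - e.1 + (e.1 + e.2.2 - p) = e.2.2 by omega]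
      exact hT

lemma runs_cut (inv : Inv S σ TU TV) (hS : IsText S) (hc : dollar < c)
    (hD : IsDBWT D (bwt S)) (hlab : lab σ.heap TU = D) (hb : Balanced S D α)
    (set : Setup S D c A₀ B₀ A₁ B₁) (hf : FastApplies D c) (hd : d ∈ recs TU)
    (hdc : σ.heap d fChar = dollar) (h0 : σ.heap 0 fChar = 0) (h0' : σ.heap 0 fBF = 0)
    (hrc : σ.reg rChar = c) (hrd : σ.reg rDollar = d) (hx : x ∉ recs TU) (hx0 : x ≠ 0)
    (h16 : σ.reg 16 = x) (h17 : σ.reg 17 = 0) (hW : S.length + 1 < W)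
    (hB : BInv all (σ.heap · fChar) ((recs TU).filter (· ≠ d)) d σ.btree.inorder) :
    Runs W cutProg σ (24 * α + 83) (fun σ' => (∀ r < 14, σ'.reg r = σ.reg r) ∧
      σ'.reg 17 = (decide (Splits D c)).toNat ∧ ∃ A B TV', Inv S σ' (A ++ (d, 1) :: B) TV' ∧
      lab σ'.heap A = A₁ ∧ lab σ'.heap B = B₁ ∧
      (∀ a ∈ recs (A ++ (d, 1) :: B), a = x ∨ a ∈ recs TU) ∧
      At (A ++ (d, 1) :: B) (insPos (bwt S) c) (σ'.reg 15) ∧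
      At TV' (insPos (bwt S) c) (σ'.reg 14) ∧
      (∀ a, a ≠ x → σ'.heap a fChar = σ.heap a fChar) ∧
      BInv all (σ'.heap · fChar) (recs A ++ recs B) d σ'.btree.inorder) := by
  have hw : width TU = S.length := by rw [← hD.width_eq, ← hlab, width_lab]
  have hins := hD.ins_eq (c := c)
  obtain ⟨A, B, hT, hA, hB'⟩ := lab_parts (hlab.trans set.eq)
    (fun p hp => (List.mem_append.1 hp).elim (set.neA p) (set.neB p)) hd hdc
  refine (Runs.seq (n := 4) (n' := 24 * α + 79) (runs_locate inv hS hc (hlab ▸ hD) hT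
    (by rw [← width_lab σ.heap, hA, set.widthA]) (by rw [hA, hB']; exact set.fastApplies_iff.1 hf)
    h0 hrc hrd) fun σ₁ ⟨eh, eo, eb, er, hat⟩ => ?_).le
  refine Runs.seq_blk (n := 24 * α + 77) fun σ₂ h2 => ?_
  have e20 : σ₂.reg 20 = σ.heap (σ₁.reg 14) fEF := by
    simp [h2, eh]
  have e21 : σ₂.reg 21 = σ.heap (σ₁.reg 14) fBF := by
    simp [h2, eh]
  have er' : ∀ r < 18, r ≠ 14 → σ₂.reg r = σ.reg r := fun r hr hne => by
    rw [h2, ← er r hr hne]; exact runAll_reg hr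
  have e14 : σ₂.reg 14 = σ₁.reg 14 := by simp [h2]
  have eh' : σ₂.heap = σ.heap ∧ σ₂.order = σ.order ∧ σ₂.btree = σ.btree := by
    simp [h2, eh, eo, eb]
  have hcut := exists_cut inv.core.mesh hat h0'
  have inv' := inv.of_eq eh'.1 eh'.2.1 eh'.2.2 fun r hr => er' r (by omega) (by omega)
  refine Runs.ite (n := 24 * α + 76) (fun ht => ?_) fun ht => ?_
  all_goals simp only [Test.Holds, e21, inv'.zero] at ht
  · replace hcut := hcut.resolve_right (by rintro ⟨_, _, _, _, _, h, _⟩; omega)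
    have hns : ¬ Splits D c := by
      obtain ⟨P, Q, C, h3, h4, -⟩ := hcut.2
      exact not_splits_of_start (by rw [← hlab, h3, lab_append]) (by rw [width_lab, h4, hins])
    obtain ⟨-, rfl, rfl⟩ := set.ref.cases.resolve_right fun h => hns h.1
    refine (runs_blk ?_).mono (by simp) fun _ h => h
    simp only [runAll, Instr.run, State.setReg]
    refine ⟨fun r hr => ?_, ?_, A, B, TV, (hT ▸ inv).of_eq eh'.1 eh'.2.1 eh'.2.2 fun r hr => ?_,
      by rw [← hA, eh'.1], by rw [← hB', eh'.1], fun a ha => Or.inr (hT ▸ ha), ?_, ?_,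
      fun a _ => by rw [eh'.1], ?_⟩
    · simp only [Function.update_of_ne (show r ≠ 15 by omega)]; exact er' r (by omega) (by omega)
    · simp [er' 17, h17, hns]
    · simp only [Function.update_self, e20, ← hT]; exact hcut.2
    · simpa [e14] using hat
    · rw [eh'.1, eh'.2.2, ← filter_recs (hT ▸ inv.core.mesh.nodup), ← hT]; exact hB
    · simp only [Function.update_of_ne (show r ≠ 15 by omega)]; exact er' r (by omega) (by omega)
  · obtain ⟨X, l₂, Y, hX, hp, hl₁, hl₂⟩ := hcut.resolve_left fun h => ht h.1
    set u := σ.heap (σ₁.reg 14) fEF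
    set l₁ := σ.heap (σ₁.reg 14) fBF
    have hn := inv.core.mesh.nodup
    have he := mem_ent_lab σ.heap hX
    rw [hlab] at he
    have hsp : Splits D c := splits_iff.2 ⟨_, he, by simp only; omega, by simp only; omega⟩
    have hbal := hb.cnt_lt hS hD he
    rw [← hlab, bd_lab, ← inv.core.geo.bd_eq hn] at hbal
    have hud : u ≠ d := by
      rintro h
      have h5 := ent_eq_of_rec (s := 0) hn (e := (width X, u, l₁ + l₂)) (e' := (width A, d, 1))
        (by rw [hX]; simp) (by rw [hT]; simp) h
      simp only [Prod.mk.injEq] at h5; omega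
    have hxd : x ≠ d := fun h => hx (h ▸ hd)
    refine Runs.seq_blk (n := 24 * α + 72) fun σ₃ h3 => ?_
    have er3 : ∀ r < 30, σ₃.reg r = σ₂.reg r := fun r hr => by rw [h3]; exact runAll_reg hr
    have eh3 : σ₃.heap = σ.heap ∧ σ₃.order = σ.order ∧ σ₃.btree = σ.btree := by
      simp [h3, eh']
    obtain ⟨X', Y', hV, hrun⟩ := runs_split (W := W) (N := α)
      (inv.of_eq eh3.1 eh3.2.1 eh3.2.2 fun r hr =>
        (er3 r (by omega)).trans (er' r (by omega) (by omega)))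
      hX (hD.lf_add hS he (by simp only; omega)) hl₁ hl₂ hx hx0 hbal.1.le hbal.2.le (by omega)
      (by simp [h3, e20])
      (by simp [h3, er' 16, h16])
      (by simp [h3, inv'.zero])
      (by simp [h3, e21])
    refine Runs.seq (n := 24 * α + 70) (n' := 2) hrun fun σ₄ ⟨hfix, inv4, hch, hJ⟩ => runs_blk ?_
    have er4 : ∀ r < 18, r ≠ 14 → σ₄.reg r = σ.reg r := fun r hr hne =>
      (hfix r (by omega)).trans ((er3 r (by omega)).trans (er' r hr hne))
    have hchr : ∀ a, a ≠ x → σ₄.heap a fChar = σ.heap a fChar := fun a ha => by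
      rw [hch, if_neg ha, eh3.1]
    have hxc : σ₄.heap x fChar = σ₄.heap u fChar := by
      rw [hch, if_pos rfl, hchr u (fun h => hx (h ▸ hX ▸ by simp [recs])), eh3.1]
    have hlab4 : lab σ₄.heap (X ++ (u, l₁) :: (x, l₂) :: Y) = A₁ ++ (dollar, 1) :: B₁ := by
      obtain ⟨-, X₀, y, m₁, m₂, Y₀, hm₁, hm₂, -, hD', hw', hR⟩ :=
        set.ref.cases.resolve_left fun h => h.1 hsp
      have hD2 : D = lab σ.heap X ++ (σ.heap u fChar, l₁ + l₂) :: lab σ.heap Y := by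
        rw [← hlab, hX, lab_append, lab_cons]
      have he' : (width X₀, y, m₁ + m₂) ∈ ent 0 D := by rw [hD']; simp
      have h6 : (width X₀, y, m₁ + m₂) = (width X, σ.heap u fChar, l₁ + l₂) := by
        rcases ent_disjoint he' he with h | h | h
        · exact h
        all_goals simp only at h; omega
      simp only [Prod.mk.injEq] at h6
      obtain ⟨h7, h8⟩ := append_inj_of_width (hD'.symm.trans hD2) (hD' ▸ hD.1)
        (by rw [width_lab]; exact h6.1)
      obtain rfl : m₁ = l₁ := by omega
      have h9 : σ₄.heap u fChar = σ.heap u fChar :=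
        hchr u fun h => hx (h ▸ hX ▸ by simp [recs])
      have hx' : x ∉ recs X ∧ x ∉ recs Y := by grind [recs_append, recs_cons]
      rw [hR, lab_append, lab_cons, lab_cons, hxc, h9, h7,
        lab_congr fun a ha => hchr a fun h => hx'.1 (h ▸ ha),
        lab_congr fun a ha => hchr a fun h => hx'.2 (h ▸ ha), (List.cons_eq_cons.1 h8).2, h6.2.1]
      congr 4; omega
    obtain ⟨A', B'', hT4, hA4, hB4⟩ := lab_parts (d := d) hlab4 set.ref.ne (by
      rw [hX] at hd; simp only [recs_append, recs_cons, List.mem_append, List.mem_cons] at hd ⊢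
      tauto) (by rw [hchr d hxd.symm, hdc])
    simp only [runAll, Instr.run, State.setReg]
    refine ⟨fun r hr => ?_, ?_, A', B'', _, (hT4 ▸ inv4).of_eq rfl rfl rfl fun r hr => ?_, hA4, hB4,
      fun a ha => ?_, ?_, ?_, hchr, ?_⟩
    · rw [Function.update_of_ne (by omega), Function.update_of_ne (by omega)]
      exact er4 r (by omega) (by omega)
    · simp [hsp, inv4.one]
    · rw [hX]; rw [← hT4] at ha
      simp only [recs_append, recs_cons, List.mem_append, List.mem_cons] at ha ⊢; tauto
    · rw [← hT4]
      simp only [Function.update_of_ne (show 15 ≠ 17 by decide), Function.update_self]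
      rw [er4 16 (by omega) (by omega), h16]
      exact ⟨X ++ [(u, l₁)], (x, l₂) :: Y, _, by simp, by simp [hp], rfl⟩
    · rw [Function.update_of_ne (by omega), Function.update_of_ne (by omega), hfix 14 (by omega),
        er3 14 (by omega), e14]
      exact (hV ▸ hat).split x
    · rw [← filter_recs (hT4 ▸ inv4.core.mesh.nodup), ← hT4, hJ, eh3.2.2]
      rw [hX] at hB hn hx
      simp only [recs_append, recs_cons, List.filter_append] at hB hn hx ⊢
      rw [List.filter_cons_of_pos (by simpa using hud)] at hB ⊢
      rw [List.filter_cons_of_pos (by simpa using hxd)]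
      have hfn : ((recs X).filter (· ≠ d) ++ u :: (recs Y).filter (· ≠ d)).Nodup := by
        refine hn.sublist ?_
        exact List.filter_sublist.append (List.filter_sublist.cons_cons _)
      have hfx : x ∉ (recs X).filter (· ≠ d) ++ (recs Y).filter (· ≠ d) := fun h => hx <| by
        simp only [List.mem_append, List.mem_filter, List.mem_cons] at h ⊢; tauto
      refine (BInv.double hxc.symm).2 (BInv.rename (hB.congr fun a ha => hchr a fun h => hx ?_) hfn
        hfx hxc hud.symm)
      simp only [List.mem_append, List.mem_filter, List.mem_cons, h] at ha ⊢; tauto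
    · simp only
      rw [Function.update_of_ne (by omega), Function.update_of_ne (by omega)]

end

end RComp


namespace RComp

variable {S : List ℕ} {W : ℕ} {σ : State} {TU TV A B X Y A₀ B₀ A₁ B₁ D : DBWT}
  {d z c x α : ℕ} {all : Prop} {a : ℕ → ℕ}

/-! ### Replace-node, split-node and insert-node steps -/

def initProg : Program :=
  blk [.const 11 0, .const 12 1, .store 11 fChar 11, .store 11 fEL 11, .store 11 fEF 11,
    .store 11 fBF 11, .store 11 fNextU rHeadU, .store 11 fPrevU rTailU, .store 11 fNextV rHeadV,
    .store 11 fPrevV rTailV, .copy 13 rFresh, .add 16 rFresh 12, .add rFresh 16 12, .copy 17 11]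

lemma runs_init (hW : σ.reg rFresh + 2 < W) : Runs W initProg σ 14 (fun σ' =>
    (∀ r < 10, σ'.reg r = σ.reg r) ∧ σ'.reg 11 = 0 ∧ σ'.reg 12 = 1 ∧ σ'.reg 13 = σ.reg rFresh ∧
    σ'.reg 16 = σ.reg rFresh + 1 ∧ σ'.reg 17 = 0 ∧ σ'.reg rFresh = σ.reg rFresh + 2 ∧
    σ'.order = σ.order ∧ σ'.btree = σ.btree ∧ (∀ x, x ≠ 0 → ∀ f, σ'.heap x f = σ.heap x f) ∧
    σ'.heap 0 fChar = 0 ∧ σ'.heap 0 fBF = 0 ∧ (∀ s, σ'.heap 0 (fe s) = 0) ∧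
    σ'.heap 0 fNextU = σ.reg rHeadU ∧ σ'.heap 0 fPrevU = σ.reg rTailU ∧
    σ'.heap 0 fNextV = σ.reg rHeadV ∧ σ'.heap 0 fPrevV = σ.reg rTailV) := by
  have h1 : 1 % W = 1 := Nat.mod_eq_of_lt (by omega)
  have h2 : (σ.reg rFresh + 1) % W = σ.reg rFresh + 1 := Nat.mod_eq_of_lt (by omega)
  have h3 : (σ.reg rFresh + 1 + 1) % W = σ.reg rFresh + 1 + 1 := Nat.mod_eq_of_lt (by omega)
  have h0 : (0 : ℕ) % W = 0 := Nat.zero_mod W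
  simp only [rFresh] at h2 h3
  refine runs_blk ?_
  simp only [runAll, Instr.run, State.setReg, Function.update_apply, rFresh, rHeadU, rTailU,
    rHeadV, rTailV, fChar, fEL, fEF, fBF, fNextU, fPrevU, fNextV, fPrevV, h0, h1]
  refine ⟨fun r hr => ?_, ?_⟩
  · simp only [show r ≠ 17 by omega, show r ≠ 10 by omega, show r ≠ 16 by omega,
      show r ≠ 13 by omega, show r ≠ 12 by omega, show r ≠ 11 by omega, if_false]
  · refine ⟨?_, ?_, ?_, ?_, ?_, ?_, ?_, ?_, fun x hx f => ?_, ?_, ?_, fun s => ?_, ?_, ?_, ?_, ?_⟩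
    all_goals try simp [*]
    cases s <;> simp [fe, fEF, fEL]

lemma exists_insert_parts {PU QU : DBWT} {i : ℕ}
    (hn : (recs (A ++ (d, 1) :: B)).Nodup)
    (h1 : A ++ (z, 1) :: B = PU ++ QU) (h2 : width PU = i) :
    ∃ X Y, PU ++ (d, 1) :: QU = X ++ (z, 1) :: Y ∧ width X = shift i (width A) ∧
      (recs X ++ recs Y).filter (· ≠ d) = recs A ++ recs B := by
  have hf := filter_recs hn
  simp only [recs_append, recs_cons, List.filter_append] at hf
  rw [List.filter_cons_of_neg (by simp)] at hf
  have key : ∀ R : DBWT, A = PU ++ R → QU = R ++ (z, 1) :: B →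
      ∃ X Y, PU ++ (d, 1) :: QU = X ++ (z, 1) :: Y ∧ width X = shift i (width A) ∧
        (recs X ++ recs Y).filter (· ≠ d) = recs A ++ recs B := by
    rintro R rfl rfl
    refine ⟨PU ++ (d, 1) :: R, B, by simp, ?_, ?_⟩
    · simp [shift, ← h2]; omega
    · rw [← hf]; simp
  rcases List.append_eq_append_iff.1 h1 with ⟨R, rfl, h4⟩ | ⟨R, h4, h5⟩
  · rcases R with _ | ⟨r, R⟩
    · exact key [] (by simp) (by simpa using h4.symm)
    · obtain ⟨rfl, rfl⟩ : (z, 1) = r ∧ B = R ++ QU := by simpa using h4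
      refine ⟨A, R ++ (d, 1) :: QU, by simp, ?_, ?_⟩
      · simp [shift, ← h2]
      · rw [← hf]; simp
  · exact key R h4 h5

def prepareProg : Program := .seq initProg (.seq cutProg insertProg)

/-- The state after the steps of the update operation without merging. -/
structure Prepared (S : List ℕ) (D : DBWT) (c d z : ℕ) (all : Prop) (σ : State)
    (X Y TV A B : DBWT) :
    Prop where
  inv : Inv (c :: S) σ (X ++ (z, 1) :: Y) TV
  left : lab σ.heap X = (updateParts D c).1
  right : lab σ.heap Y = (updateParts D c).2
  chr : σ.heap z fChar = c
  parts : X ++ (z, 1) :: Y = A ++ (d, 1) :: B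
  dollar : σ.heap d fChar = dollar
  null : σ.heap 0 fChar = 0
  fresh : z ∉ σ.btree.inorder
  btree : BInv all (σ.heap · fChar) ((recs X ++ recs Y).filter (· ≠ d)) d σ.btree.inorder

lemma runs_prepare (st : Stores S D α σ a) (hS : IsText S) (hc : dollar < c)
    (hD : IsDBWT D (bwt S)) (hb : Balanced S D α) (set : Setup S D c A₀ B₀ A₁ B₁)
    (hf : FastApplies D c) (hO : BTreeOnly D σ a) (hall : all → BTreeAll D σ a)
    (hrc : σ.reg rChar = c) (hW : σ.reg rFresh + 2 < W) (hW' : S.length + 1 < W) :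
    Runs W prepareProg σ (24 * α + 147) (fun σ' => (∀ r < 10, σ'.reg r = σ.reg r) ∧
      σ'.reg rFresh = σ.reg rFresh + 2 ∧ σ'.reg 13 = σ.reg rFresh ∧
      σ'.reg 17 = (decide (Splits D c)).toNat ∧ ∃ X Y TV A B,
        Prepared S D c (σ.reg rDollar) (σ.reg rFresh) all σ' X Y TV A B ∧
        ∀ x ∈ recs (X ++ (σ.reg rFresh, 1) :: Y), x < σ.reg rFresh + 2) := by
  have hlen : dollarIdx D < D.length := by
    rw [set.eq, dollarIdx_eq set.neA]; simp
  have hfr := (st.addr_pos _ hlen).trans (st.addr_lt _ hlen)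
  have haddr : ∀ i < D.length, addr (tileU D a) i = a i := fun i hi => by
    simp [addr, tileU, hi]
  have hrecs : ∀ x ∈ recs (tileU D a), x < σ.reg rFresh := fun x hx => by
    rw [recs_tileU] at hx
    obtain ⟨i, hi, rfl⟩ := List.mem_map.1 hx
    exact st.addr_lt i (List.mem_range.1 hi)
  refine (Runs.seq (n' := 24 * α + 133) (runs_init hW) fun σ₁ ⟨er, e11, e12, e13, e16, e17, e10,
    eo, eb,
    eh, h0, h0', hE, g1, g2, g3, g4⟩ => ?_).le
  have co := st.core hS hD eh hE g1 g2 g3 g4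
  have hsub := st.inorder_sublist hS hD
  have inv : Inv S σ₁ (tileU D a) (tileV S D a) :=
    ⟨by rw [lab, co.dbwt]; exact co, by rw [eo, st.order, recs_tileU], eb ▸ st.btreeShape,
    eb ▸ hsub,
      e11, e12⟩
  obtain ⟨A, B, hT, hA, hd, -, hne⟩ := co.dollar_parts hS hD
  rw [haddr _ hlen, ← st.dollarNode] at hT hd
  have hbt : BInv all (σ₁.heap · fChar) (recs A ++ recs B) (σ.reg rDollar) σ₁.btree.inorder := by
    refine ⟨(co.bOnly_iff hT hd hne fun x hx =>
      co.geo.perm_recs.subset ((eb ▸ hsub).subset hx)).1 fun g hg h => hO g hg ?_,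
      fun h => (co.bAll_iff hT hd hne).1 fun g hg h' => ?_⟩
    · rwa [haddr g hg, eb] at h
    · rw [haddr g hg, eb]; exact hall h g hg h'
  rw [← filter_recs (hT ▸ co.mesh.nodup), ← hT] at hbt
  refine Runs.seq (n' := 50) (runs_cut (x := σ.reg rFresh + 1) inv hS hc hD co.dbwt hb set hf
    (by rw [hT]; simp) hd h0 h0' ((er 0 (by omega)).trans hrc) (er 3 (by omega))
    (fun h => by have := hrecs _ h; omega) (by omega) e16 e17 hW' hbt)
    fun σ₂ ⟨er2, e17', A', B', TV', inv2, hA', hB', hrec, hU, hV, hch, hbt2⟩ => ?_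
  obtain ⟨PU₀, QU₀, C, hU1, hU2, hU3⟩ := hU
  obtain ⟨PV, QV, C', hV1, hV2, hV3⟩ := hV
  have hz : σ.reg rFresh ∉ recs (A' ++ (σ.reg rDollar, 1) :: B') := fun h => by
    rcases hrec _ h with h | h
    · omega
    · exact absurd (hrecs _ h) (by omega)
  have hdz : σ.reg rDollar ≠ σ.reg rFresh := fun h => hz (by simp [h])
  have hwA : width A' = rep S := by
    rw [← width_lab σ₂.heap, hA', set.ref.widthA, set.widthA]
  obtain ⟨PU, QU, hPQ, hPU, hrun⟩ := runs_insert (W := W) inv2 hS hc (by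
    rw [← width_lab σ₂.heap, lab_append, lab_cons, hA', hB', ← hD.width_eq, set.eq]
    simp [set.ref.widthA, set.ref.widthB]) rfl hwA hz hfr.ne' hU1 hU2 hU3 hV1 hV2 hV3
    ((er2 0 (by omega)).trans ((er 0 (by omega)).trans hrc))
    ((er2 3 (by omega)).trans (er 3 (by omega))) ((er2 13 (by omega)).trans e13) rfl rfl
  refine hrun.mono le_rfl fun σ₃ ⟨hfix, inv3, hch3, hbt3⟩ => ?_
  have er3 : ∀ r < 14, σ₃.reg r = σ₁.reg r := fun r hr =>
    (hfix r (by omega) (by omega)).trans (er2 r hr)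
  obtain ⟨X, Y, hXY, hwX, hfil⟩ := exists_insert_parts inv2.core.mesh.nodup hPQ hPU
  have hlabz : ∀ T, σ.reg rFresh ∉ recs T → lab σ₃.heap T = lab σ₂.heap T := fun T hT =>
    lab_congr fun x hx => by rw [hch3, if_neg]; rintro rfl; exact hT hx
  have hdc : σ₃.heap (σ.reg rDollar) fChar = dollar := by
    rw [hch3, if_neg hdz, hch _ fun h => ?_, hd]
    have := hrecs (σ.reg rDollar) (by rw [hT]; simp)
    omega
  simp only [recs_append, recs_cons, List.mem_append, List.mem_cons, not_or] at hz
  have hl3 : lab σ₃.heap (X ++ (σ.reg rFresh, 1) :: Y) =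
      (updateParts D c).1 ++ (c, 1) :: (updateParts D c).2 := by
    obtain ⟨P, Q, q1, q2, q3⟩ := set.cut
    have q4 : lab σ₃.heap PU ++ lab σ₃.heap QU = P ++ Q := by
      rw [← lab_append, ← hPQ, lab_append, lab_cons, hlabz _ hz.1, hlabz _ hz.2.2, hA', hB', ← q1,
        hch3, if_pos rfl]
    have q5 := append_inj_of_width q4.symm (by
      rw [← q1]; intro p hp
      have := set.ref.pos p
      simp only [List.mem_append, List.mem_cons] at hp this
      rcases hp with h | rfl | h
      exacts [this (Or.inl h), one_pos, this (Or.inr h)])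
      (by rw [q2, width_lab, hPU, hD.ins_eq])
    rw [← hXY, lab_append, lab_cons, hdc, ← q5.1, ← q5.2, ← q3, slowUpdate]
  rw [lab_append, lab_cons] at hl3
  have hpos3 := (set.slow_isDBWT hS hc hD).1
  obtain ⟨hX, hY⟩ := append_inj_of_width hl3 (hl3 ▸ hpos3)
    (by rw [width_lab, hwX, hwA, set.width_parts hD])
  refine ⟨fun r hr => (er3 r (by omega)).trans (er r hr), (er3 10 (by omega)).trans e10,
    (er3 13 (by omega)).trans e13, (hfix 17 (by omega) (by omega)).trans e17', X, Y, _, PU, QU,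
    ⟨hXY ▸ inv3, hX, (List.cons_eq_cons.1 hY).2, by rw [hch3, if_pos rfl], hXY.symm, hdc, ?_, ?_,
      ?_⟩, fun x hx => ?_⟩
  · rw [hch3, if_neg hfr.ne, hch 0 (by omega), h0]
  · rw [hbt3]
    intro h
    have := inv2.core.geo.perm_recs.subset (inv2.sub.subset h)
    simp only [recs_append, recs_cons, List.mem_append, List.mem_cons] at this
    tauto
  · rw [hfil, hbt3]
    exact hbt2.congr fun x hx => by
      rw [hch3, if_neg]
      rintro rfl
      rcases List.mem_append.1 hx with h | h
      exacts [hz.1 h, hz.2.2 h]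
  · have h5 : x = σ.reg rDollar ∨ x ∈ recs (A' ++ (σ.reg rFresh, 1) :: B') := by
      rw [hPQ]; rw [← hXY] at hx
      simp only [recs_append, recs_cons, List.mem_append, List.mem_cons] at hx ⊢; tauto
    have h6 : x = σ.reg rFresh ∨ x ∈ recs (A' ++ (σ.reg rDollar, 1) :: B') := by
      simp only [recs_append, recs_cons, List.mem_append, List.mem_cons] at h5 ⊢; tauto
    rcases h6 with rfl | h6
    · omega
    · rcases hrec x h6 with rfl | h7
      · omega
      · have := hrecs x h7; omega

end RComp


namespace RComp

variable {S : List ℕ} {W : ℕ} {σ : State} {TU TV A B X Y A₀ B₀ A₁ B₁ D : DBWT}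
  {d z c x y m k l₁ l₂ α : ℕ} {all : Prop} {h : ℕ → ℕ → ℕ} {Z : Finset ℕ} {prev : Bool}

/-! ### Merging of adjacent nodes -/

lemma mem_recs_merge (hd : d ∈ recs (X ++ (x, l₁) :: (y, l₂) :: Y)) (h : y ≠ d) :
    d ∈ recs (X ++ (x, k) :: Y) := by
  simp only [recs_append, recs_cons, List.mem_append, List.mem_cons, h.symm, false_or] at hd ⊢
  exact hd

lemma recs_merge_subset (hd : d ∈ recs (X ++ (x, k) :: Y)) :
    d ∈ recs (X ++ (x, l₁) :: (y, l₂) :: Y) := by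
  simp only [recs_append, recs_cons, List.mem_append, List.mem_cons] at hd ⊢
  tauto

lemma runs_mergeTile (inv : Inv (c :: S) σ TU TV) (hT : TU = X ++ (x, l₁) :: (y, l₂) :: Y)
    (st : Step S D c Z (lab σ.heap TU)) (hS : IsText S) (hc : dollar < c) (hD : IsDBWT D (bwt S))
    (hα : 2 ≤ α) (hb : Balanced S D α) (hch : σ.heap x fChar = σ.heap y fChar)
    (hW : 2 * (S.length + 1) < W) (h30 : σ.reg 30 = y) (h31 : σ.reg 31 = x)
    (hJ : x ∉ σ.btree.inorder ∨ y ∉ σ.btree.inorder) :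
    Runs W mergeProg σ (32 * α + 30) (fun σ' => Fixed σ σ' ∧
      (∃ TV', Inv (c :: S) σ' (X ++ (x, l₁ + l₂) :: Y) TV') ∧
      (∀ a, σ'.heap a fChar = σ.heap a fChar) ∧
      σ'.btree.inorder = σ.btree.inorder.map (fun a => if a = y then x else a)) := by
  have hD' := st.isDBWT
  have hT' : TU = (X ++ [(x, l₁)]) ++ (y, l₂) :: Y := by rw [hT]; simp
  have e1 := mem_ent_lab σ.heap hT
  have e2 := mem_ent_lab σ.heap hT'
  have p1 := hD'.len_pos e1
  have p2 := hD'.len_pos e2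
  have hw := hD'.ent_le e2
  have hV := (st.cntV_le hS hc hD hα hb e2).1
  have hU := (st.cntU_le hS hc hD hα hb e2).1
  rw [bd_lab] at hV hU
  rw [← inv.core.geo.bd_eq inv.core.mesh.nodup] at hV
  simp only [width_append, width_cons, width_nil, add_zero] at p1 p2 hw hV hU e2
  have hlf : lf (c :: S) (width X + l₁) = lf (c :: S) (width X) + l₁ := by
    have h1 := hD'.lf_add (hS.cons hc) e1 (q := l₁ - 1) (by simp only; omega)
    have h2 := hD'.getD e1 (q := l₁ - 1) (by simp only; omega)
    have h3 := hD'.getD e2 (q := 0) p2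
    simp only at h1 h2 h3
    rw [show width X + l₁ = width X + (l₁ - 1) + 1 by omega, lf_succ (hS.cons hc) (by omega), h1]
    · omega
    · rw [h2, show width X + (l₁ - 1) + 1 = width X + l₁ + 0 by omega, h3, hch]
  obtain ⟨X', Y', -, -, hrun⟩ := runs_merge (W := W) (N := 2 * α) inv hT hlf hV hU (by
    rw [← width_lab σ.heap, hD'.width_eq]; exact hW) h30 h31 hJ
  exact hrun.mono (by omega) fun σ' ⟨h1, h2, h3, h4⟩ => ⟨h1, ⟨_, h2⟩, h3, h4⟩

def mergeStageProg : Program :=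
  .seq (blk [.load 18 13 fPrevU, .load 19 18 fChar, .load 20 13 fNextU, .load 21 20 fChar]) <|
  .ite (.eq 19 rChar)
    (.seq (blk [.copy 30 13, .copy 31 18, .copy 22 18]) <| .seq mergeProg <|
      .ite (.eq 21 rChar)
        (.ite (.eq rSplit 12) (.seq (blk [.copy 30 20, .copy 31 18]) mergeProg) .skip) .skip)
    (.seq (blk [.copy 30 20, .copy 31 13, .copy 22 13]) mergeProg)

/-- The state after merging; `m` is the record of the node that contains the new character. -/
structure Merged (S : List ℕ) (D : DBWT) (c d m : ℕ) (all : Prop) (σ : State) (TU TV : DBWT) :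
    Prop where
  inv : Inv (c :: S) σ TU TV
  step : ∃ Z, Step S D c Z (lab σ.heap TU)
  mem : d ∈ recs TU
  chr : σ.heap d fChar = dollar
  tile : ∃ X l Y, TU = X ++ (m, l) :: Y ∧ width X ≤ shift (insPos (bwt S) c) (rep S) ∧
    shift (insPos (bwt S) c) (rep S) < width X + l
  btree : BInv all (σ.heap · fChar) ((recs TU).filter (· ≠ d)) d σ.btree.inorder

set_option maxHeartbeats 400000 in
lemma runs_mergeStage (pr : Prepared S D c d z all σ X Y TV A B) (hS : IsText S) (hc : dollar < c)
    (hD : IsDBWT D (bwt S)) (hα : 2 ≤ α) (hb : Balanced S D α) (set : Setup S D c A₀ B₀ A₁ B₁)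
    (hf : FastApplies D c) (hW : 2 * (S.length + 1) < W) (hrc : σ.reg rChar = c)
    (h13 : σ.reg 13 = z) (hp : σ.reg rSplit = prev.toNat) :
    Runs W mergeStageProg σ (64 * α + 80) (fun σ' => (∀ r < 18, σ'.reg r = σ.reg r) ∧
      ∃ TU' TV', Merged S D c d (σ'.reg 22) all σ' TU' TV' ∧
        fastUpdate D c prev = some (lab σ'.heap TU') ∧
        ∀ x ∈ recs TU', x ∈ recs (X ++ (z, 1) :: Y)) := by
  have hl := pr.inv.core.mesh.links
  have hn := pr.inv.core.mesh.nodup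
  have hc0 : c ≠ 0 := by unfold dollar at hc; omega
  have hlab : lab σ.heap (X ++ (z, 1) :: Y) = slowUpdate D c := by
    rw [lab_append, lab_cons, pr.left, pr.right, pr.chr, slowUpdate]
  have hwX : width X = shift (insPos (bwt S) c) (rep S) := by
    rw [← width_lab σ.heap, pr.left, set.width_parts hD]
  have hL := (set.lastHas_iff hS hc hD).trans (set.ref.last c)
  have hR := (set.headHas_iff hS hc hD).trans (set.ref.head c)
  rw [← pr.left] at hL
  rw [← pr.right] at hR
  have hdc : ∀ {v}, σ.heap v fChar = c → v ≠ d := fun hv h => by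
    rw [h, pr.dollar] at hv; exact hc.ne hv
  have hd : d ∈ recs (X ++ (z, 1) :: Y) := by rw [pr.parts]; simp
  have fc := set.fast_cases hS hc hD hf prev
  rw [← hL, ← hR, ← pr.left, ← pr.right] at fc
  have hbt := pr.btree
  refine Runs.seq_blk (n := 64 * α + 76) fun σ₁ h1 => ?_
  have e18 : σ₁.reg 18 = σ.heap z fPrevU := by
    simp [h1, h13]
  have e19 : σ₁.reg 19 = σ.heap (σ.heap z fPrevU) fChar := by
    simp [h1, h13]
  have e20 : σ₁.reg 20 = σ.heap z fNextU := by
    simp [h1, h13]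
  have e21 : σ₁.reg 21 = σ.heap (σ.heap z fNextU) fChar := by
    simp [h1, h13]
  have er : ∀ r < 18, σ₁.reg r = σ.reg r := fun r hr => by rw [h1]; exact runAll_reg hr
  have eh : σ₁.heap = σ.heap ∧ σ₁.order = σ.order ∧ σ₁.btree = σ.btree := by
    simp [h1]
  clear h1
  have hcs := Links.last_cases hl pr.null hc0
  refine (Runs.ite (n := 64 * α + 70) (fun ht => ?_) fun ht => ?_).le
  all_goals simp only [Test.Holds, e19, er rChar (by decide), hrc] at ht
  · obtain ⟨hy, hlast, X₀, l, rfl⟩ := hcs.resolve_right fun h => h.1 ht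
    generalize σ.heap z fPrevU = y at *
    refine Runs.seq_blk (n := 64 * α + 67) fun σ₂ h2 => ?_
    have er2 : ∀ r < 22, σ₂.reg r = σ₁.reg r := fun r hr => by rw [h2]; exact runAll_reg hr
    have e22 : σ₂.reg 22 = y := by simp [h2, e18]
    have e30 : σ₂.reg 30 = z ∧ σ₂.reg 31 = y := by
      simp [h2, e18, er 13, h13]
    have eh2 : σ₂.heap = σ.heap ∧ σ₂.order = σ.order ∧ σ₂.btree = σ.btree := by
      simp [h2, eh]
    clear h2
    have hstep := set.step_slow hS hc hD
    rw [← hlab, ← eh2.1] at hstep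
    refine (Runs.seq (n := 32 * α + 30) (n' := 32 * α + 37) (runs_mergeTile
      (X := X₀) (l₁ := l) (l₂ := 1) (Y := Y) (pr.inv.of_eq eh2.1 eh2.2.1 eh2.2.2 fun r hr =>
      (er2 r (by omega)).trans (er r (by omega)))
      (by simp) hstep hS hc hD hα hb (by rw [eh2.1, hy, pr.chr]) hW e30.1 e30.2
      (Or.inr (eh2.2.2 ▸ pr.fresh))) fun σ₃ ⟨hfix, ⟨TV', inv3⟩, hch, hJ⟩ => ?_).le
    have hchr : ∀ a, σ₃.heap a fChar = σ.heap a fChar := fun a => by rw [hch, eh2.1]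
    have hJ3 : σ₃.btree.inorder = σ.btree.inorder := by
      rw [hJ, eh2.2.2]
      refine (List.map_congr_left fun a ha => if_neg ?_).trans (List.map_id _)
      rintro rfl; exact pr.fresh ha
    have er3 : ∀ r < 22, σ₃.reg r = σ₁.reg r := fun r hr =>
      (hfix r (by omega)).trans (er2 r hr)
    have hstepL := set.step_left hS hc hD (hL.1 hlast)
    have hlX : lab σ.heap (X₀ ++ [(y, l)]) = lab σ.heap X₀ ++ [(c, l)] := by
      rw [lab_append, lab_cons, hy]; rfl
    have hlab3 : lab σ₃.heap (X₀ ++ (y, l + 1) :: Y) =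
        mergeLeft (lab σ.heap (X₀ ++ [(y, l)])) c (lab σ.heap Y) := by
      rw [hlX, mergeLeft_eq, lab_congr fun a _ => hchr a, lab_append, lab_cons, hy]
    rw [← pr.left, ← pr.right, ← hlab3] at hstepL
    have hTz : X₀ ++ [(y, l)] ++ (z, 1) :: Y = X₀ ++ (y, l) :: (z, 1) :: Y := by simp
    have hdT : d ∈ recs (X₀ ++ (y, l + 1) :: Y) := mem_recs_merge (hTz ▸ hd) (hdc pr.chr)
    have hwX' : width X₀ + l = shift (insPos (bwt S) c) (rep S) := by simpa using hwX
    have mg : Merged S D c d (σ₃.reg 22) all σ₃ (X₀ ++ (y, l + 1) :: Y) TV' :=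
      ⟨inv3, ⟨_, hstepL⟩, hdT, (hchr d).trans pr.dollar,
        ⟨X₀, l + 1, Y, by rw [hfix 22 (by omega), e22], by omega, by omega⟩, by
        rw [hJ3]
        exact (by simpa using hbt : BInv all _ ((recs (X₀ ++ (y, l + 1) :: Y)).filter _) _ _).congr
          fun a _ => hchr a⟩
    have hres : ∀ x ∈ recs (X₀ ++ (y, l + 1) :: Y), x ∈ recs (X₀ ++ [(y, l)] ++ (z, 1) :: Y) := by
      rw [hTz]; exact fun x hx => recs_merge_subset hx
    have hcs' := Links.head_cases hl pr.null hc0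
    have fin : (¬ headHas c (lab σ.heap Y) ∨ prev = false) →
        (∀ r < 18, σ₃.reg r = σ.reg r) ∧
        ∃ TU' TV', Merged S D c d (σ₃.reg 22) all σ₃ TU' TV' ∧
          fastUpdate D c prev = some (lab σ₃.heap TU') ∧
          ∀ x ∈ recs TU', x ∈ recs (X₀ ++ [(y, l)] ++ (z, 1) :: Y) := fun h4 =>
      ⟨fun r hr => (er3 r (by omega)).trans (er r hr), _, _, mg, by
        rcases fc with ⟨-, -, h5⟩ | ⟨h5, -⟩ | ⟨-, h5, h6, -⟩
        · rw [h5, hlab3]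
        · exact absurd hlast h5
        · rcases h4 with h4 | h4
          exacts [absurd h5 h4, by simp [h4] at h6], hres⟩
    refine (Runs.ite (n := 32 * α + 33) (fun ht => ?_) fun ht => ?_).le
    all_goals simp only [Test.Holds, er3 21 (by omega), e21, er3 0 (by omega), rChar,
      er 0 (by omega), show σ.reg 0 = c from hrc] at ht
    swap
    · exact (Runs.skip (fin (Or.inl (hcs'.resolve_left fun h => ht h.1).2))).le
    obtain ⟨hw, hhead, l', Y₀, rfl⟩ := hcs'.resolve_right fun h => h.1 ht
    generalize σ.heap z fNextU = w at *
    refine (Runs.ite (n := 32 * α + 32) (fun ht' => ?_) fun ht' => ?_).le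
    all_goals simp only [Test.Holds, er3 2 (by omega), inv3.one, rSplit, er 2 (by omega),
      show σ.reg 2 = prev.toNat from hp] at ht'
    swap
    · exact (Runs.skip (fin (Or.inr (by rw [Bool.toNat_eq_one] at ht'; simpa using ht')))).le
    have hprev : prev = true := Bool.toNat_eq_one.1 ht'
    refine Runs.seq_blk (n := 32 * α + 30) fun σ₄ h4 => ?_
    have er4 : ∀ r < 30, σ₄.reg r = σ₃.reg r := fun r hr => by rw [h4]; exact runAll_reg hr
    have e40 : σ₄.reg 30 = w ∧ σ₄.reg 31 = y := by
      simp [h4, er3, e18, e20]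
    have eh4 : σ₄.heap = σ₃.heap ∧ σ₄.order = σ₃.order ∧ σ₄.btree = σ₃.btree := by
      simp [h4]
    clear h4
    rw [← eh4.1] at hstepL
    have hyd := hdc hy
    have hwd := hdc hw
    have hyw : σ.heap y fChar = σ.heap w fChar := hy.trans hw.symm
    have hn3 := inv3.core.mesh.nodup
    set p := (recs X₀).filter (· ≠ d)
    set q := (recs Y₀).filter (· ≠ d)
    have hfn : (p ++ y :: w :: q).Nodup := by
      refine hn3.sublist ?_
      simp only [recs_append, recs_cons]
      exact List.filter_sublist.append ((List.filter_sublist.cons_cons _).cons_cons _)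
    have hbt4 : BInv all (σ.heap · fChar) (p ++ w :: q) d σ.btree.inorder := by
      refine (BInv.double hyw).1 ?_
      simpa [List.filter_cons, hyd, hwd, p, q] using hbt
    simp only [List.nodup_append, List.nodup_cons, List.mem_cons, not_or] at hfn
    have hyJ : y ∉ σ.btree.inorder := fun h => by
      rcases hbt4.1 y h with h | h
      · exact hyd h
      · have := h.mem
        simp only [List.mem_append, List.mem_cons] at this
        rcases this with h | h | h
        exacts [hfn.2.2 y h y (Or.inl rfl) rfl, hfn.2.1.1.1 h, hfn.2.1.1.2 h]
    refine (runs_mergeTile (X := X₀) (l₁ := l + 1) (l₂ := l') (Y := Y₀)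
      (inv3.of_eq eh4.1 eh4.2.1 eh4.2.2 fun r hr => er4 r (by omega)) rfl hstepL hS hc hD hα hb
      (by rw [eh4.1, hchr, hchr, hyw]) hW e40.1 e40.2
      (Or.inl (by rw [eh4.2.2, hJ3]; exact hyJ))).mono le_rfl fun σ₅ ⟨hfix5, ⟨TV5, inv5⟩, hch5, hJ5⟩ => ?_
    have hchr5 : ∀ a, σ₅.heap a fChar = σ.heap a fChar := fun a => by rw [hch5, eh4.1, hchr]
    have hlab5 : lab σ₅.heap (X₀ ++ (y, l + 1 + l') :: Y₀) =
        mergeBoth (lab σ.heap (X₀ ++ [(y, l)])) c (lab σ.heap ((w, l') :: Y₀)) := by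
      rw [hlX, lab_cons, hw, mergeBoth_eq, lab_congr fun a _ => hchr5 a, lab_append, lab_cons, hy]
    have hstepB := set.step_both hS hc hD (hL.1 hlast) (hR.1 hhead)
    rw [← pr.left, ← pr.right, ← hlab5] at hstepB
    refine ⟨fun r hr => (hfix5 r (by omega)).trans ((er4 r (by omega)).trans
      ((er3 r (by omega)).trans (er r hr))), _, _, ⟨inv5, ⟨_, hstepB⟩, ?_,
      (hchr5 d).trans pr.dollar, ⟨X₀, l + 1 + l', Y₀, ?_, by omega, by omega⟩, ?_⟩, ?_, ?_⟩
    · exact mem_recs_merge hdT hwd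
    · rw [hfix5 22 (by omega), er4 22 (by omega), hfix 22 (by omega), e22]
    · have h6 := (hbt4.rename (x := y) (hn3.sublist (by
        simp only [recs_append, recs_cons]
        exact List.filter_sublist.append ((List.filter_sublist.cons_cons _).cons _))) (fun h => by
        rcases List.mem_append.1 h with h | h
        exacts [hfn.2.2 y h y (Or.inl rfl) rfl, hfn.2.1.1.2 h]) hyw hwd.symm).congr
        (ch' := (σ₅.heap · fChar)) fun a _ => hchr5 a
      rw [hJ5, eh4.2.2, hJ3]
      simpa [List.filter_cons, hyd, p, q] using h6
    · rcases fc with ⟨-, h5 | h5, -⟩ | ⟨h5, -⟩ | ⟨-, -, -, h5⟩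
      · exact absurd hhead h5
      · simp [hprev] at h5
      · exact absurd hlast h5
      · rw [h5, hlab5]
    · exact fun x hx => hres x (recs_merge_subset hx)
  · have hnl := (hcs.resolve_left fun h => ht h.1).2
    obtain ⟨-, hhead, hres⟩ := (fc.resolve_left fun h => hnl h.1).resolve_right fun h => hnl h.1
    obtain ⟨hw, -, l', Y₀, rfl⟩ := (Links.head_cases hl pr.null hc0).resolve_right
      fun h => h.2 hhead
    generalize σ.heap z fNextU = w at *
    refine Runs.seq_blk (n := 32 * α + 30) fun σ₂ h2 => ?_
    have er2 : ∀ r < 22, σ₂.reg r = σ₁.reg r := fun r hr => by rw [h2]; exact runAll_reg hr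
    have e22 : σ₂.reg 22 = z ∧ σ₂.reg 30 = w ∧ σ₂.reg 31 = z := by
      simp [h2, e20, er 13, h13]
    have eh2 : σ₂.heap = σ.heap ∧ σ₂.order = σ.order ∧ σ₂.btree = σ.btree := by
      simp [h2, eh]
    clear h2
    have hstep := set.step_slow hS hc hD
    rw [← hlab, ← eh2.1] at hstep
    refine (runs_mergeTile (X := X) (l₁ := 1) (l₂ := l') (Y := Y₀)
      (pr.inv.of_eq eh2.1 eh2.2.1 eh2.2.2 fun r hr => (er2 r (by omega)).trans (er r (by omega)))
      rfl hstep hS hc hD hα hb (by rw [eh2.1, hw, pr.chr]) hW e22.2.1 e22.2.2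
      (Or.inl (eh2.2.2 ▸ pr.fresh))).mono le_rfl fun σ₃ ⟨hfix, ⟨TV', inv3⟩, hch, hJ⟩ => ?_
    have hchr : ∀ a, σ₃.heap a fChar = σ.heap a fChar := fun a => by rw [hch, eh2.1]
    have hlab3 : lab σ₃.heap (X ++ (z, 1 + l') :: Y₀) =
        mergeRight (lab σ.heap X) c (lab σ.heap ((w, l') :: Y₀)) := by
      rw [lab_cons, hw, mergeRight_eq, lab_congr fun a _ => hchr a, lab_append, lab_cons, pr.chr]
    have hstepR := set.step_right hS hc hD (hR.1 hhead)
    rw [← pr.left, ← pr.right, ← hlab3] at hstepR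
    have hwd := hdc hw
    have hzd := hdc pr.chr
    refine ⟨fun r hr => (hfix r (by omega)).trans ((er2 r (by omega)).trans (er r hr)), _, _,
      ⟨inv3, ⟨_, hstepR⟩, ?_, (hchr d).trans pr.dollar, ⟨X, 1 + l', Y₀, ?_, by omega, by omega⟩,
      ?_⟩,
      by rw [hres, hlab3], fun x hx => ?_⟩
    · exact mem_recs_merge hd hwd
    · rw [hfix 22 (by omega), e22.1]
    · simp only [recs_cons, List.filter_append] at hbt
      rw [List.filter_cons_of_pos (by simpa using hwd)] at hbt
      have hs : ((recs X).filter (· ≠ d) ++ z :: w :: (recs Y₀).filter (· ≠ d)).Nodup := by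
        refine hn.sublist ?_
        simp only [recs_append, recs_cons]
        exact List.filter_sublist.append ((List.filter_sublist.cons_cons _).cons_cons _)
      have h6 := (hbt.rename (x := z) (hs.sublist ((List.Sublist.refl _).append
        (List.sublist_cons_self _ _))) (fun h => by
        simp only [List.nodup_append, List.nodup_cons, List.mem_cons, not_or] at hs
        rcases List.mem_append.1 h with h | h
        exacts [hs.2.2 z h z (Or.inl rfl) rfl, hs.2.1.1.2 h]) (pr.chr.trans hw.symm) hwd.symm).congr
        (ch' := (σ₃.heap · fChar)) fun a _ => hchr a
      rw [hJ, eh2.2.2]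
      simpa [List.filter_cons, hzd] using h6
    · exact recs_merge_subset hx

end RComp


namespace RComp

variable {S : List ℕ} {W : ℕ} {σ σ' : State} {s : Bool} {T T' TU TV X Y D : DBWT}
  {d c u m x α N : ℕ} {L K : List ℕ} {h h' : ℕ → ℕ → ℕ}

/-! ### The arrays of heavy nodes -/

lemma Mesh.congr (hm : Mesh h s T T') (hh : ∀ a, ∀ f < 10, h' a f = h a f) : Mesh h' s T T' := by
  have h1 : ∀ t, fn t < 10 ∧ fp t < 10 ∧ fe t < 10 ∧ fb t < 10 := by decide
  exact ⟨hm.pos, hm.pos', hm.nodup, hm.nodup', hm.zero, hm.zero', hm.width_eq,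
    hm.links.congr (fun a => hh a _ (h1 _).1) (fun a => hh a _ (h1 _).2.1),
    hm.links'.congr (fun a => hh a _ (h1 _).1) (fun a => hh a _ (h1 _).2.1),
    hm.edges.congr (fun a _ => hh a _ (h1 _).2.2.1) (fun a _ => hh a _ (h1 _).2.2.2),
    hm.edges'.congr (fun a _ => hh a _ (h1 _).2.2.1) (fun a _ => hh a _ (h1 _).2.2.2),
    (hh 0 _ (h1 _).2.2.1).trans hm.null, (hh 0 _ (h1 _).2.2.1).trans hm.null'⟩

lemma Core.congr (co : Core S D h TU TV) (hh : ∀ a, ∀ f < 10, h' a f = h a f) :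
    Core S D h' TU TV :=
  ⟨co.mesh.congr hh, co.geo, fun p hp => (hh _ _ (by decide)).trans (co.len p hp), by
    rw [← co.dbwt]; exact List.map_congr_left fun p _ => by rw [hh _ _ (by decide)]⟩

/-- The tile of `x` in `T` contains at least `α` starting positions of tiles of `T'`. -/
def Heavy (α : ℕ) (T T' : DBWT) (x : ℕ) : Prop :=
  ∃ p l, (p, x, l) ∈ ent 0 T ∧ α ≤ cnt (bd T') p (p + l)

/-- `L` lists the heavy tiles among those of `K`. -/
def Listed (α : ℕ) (T T' : DBWT) (L K : List ℕ) : Prop :=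
  L.Nodup ∧ ∀ x, x ∈ L ↔ x ∈ K ∧ Heavy α T T' x

def rNum (s : Bool) : ℕ := bif s then rNumV else rNumU
def fArr (s : Bool) : ℕ := bif s then fArrV else fArrU

/-- `L` is stored in the array of the heavy nodes of one side. -/
def Arr (s : Bool) (σ : State) (L : List ℕ) : Prop :=
  (List.range (σ.reg (rNum s))).map (fun q => σ.heap q (fArr s)) = L

def pushProg (s : Bool) : Program :=
  .seq (countNodeProg s) (.ite (.lt 46 rAlpha) .skip
    (blk [.store (rNum s) (fArr s) 30, .add (rNum s) (rNum s) 12]))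

/-- The array of one side is the only part of the state that may differ, apart from registers. -/
structure ArrFrame (s : Bool) (σ σ' : State) : Prop where
  reg : ∀ r < 30, r ≠ 18 → r ≠ rNum s → σ'.reg r = σ.reg r
  heap : ∀ a f, f ≠ fArr s → σ'.heap a f = σ.heap a f
  order : σ'.order = σ.order
  btree : σ'.btree = σ.btree

lemma ArrFrame.trans {σ'' : State} (h : ArrFrame s σ σ') (h' : ArrFrame s σ' σ'') :
    ArrFrame s σ σ'' :=
  ⟨fun r h1 h2 h3 => (h'.reg r h1 h2 h3).trans (h.reg r h1 h2 h3),
    fun a f hf => (h'.heap a f hf).trans (h.heap a f hf), h'.order.trans h.order,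
    h'.btree.trans h.btree⟩

lemma ArrFrame.lt (h : ArrFrame s σ σ') : ∀ a, ∀ f < 10, σ'.heap a f = σ.heap a f :=
  fun a f hf => h.heap a f (by cases s <;> simp only [fArr, fArrU, fArrV, cond] <;> omega)

lemma runs_push (hm : Mesh σ.heap s T T') (hu : u ∈ recs T)
    (hN : ∀ e ∈ ent 0 T, cnt (bd T') e.1 (e.1 + e.2.2) ≤ N) (hW : N < W) (h11 : σ.reg 11 = 0)
    (h12 : σ.reg 12 = 1) (h30 : σ.reg 30 = u) (hα : σ.reg rAlpha = α) (hL : Arr s σ L)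
    (hK : Listed α T T' L K) (huK : u ∉ K) (hW' : K.length + 1 < W) :
    Runs W (pushProg s) σ (4 * N + 11) (fun σ' => ArrFrame s σ σ' ∧
      ∃ L', Arr s σ' L' ∧ Listed α T T' L' (u :: K)) := by
  obtain ⟨e, he, heu⟩ := exists_ent_of_mem_recs (s := 0) hu
  obtain ⟨X, Y, hT, hX⟩ := mem_ent.1 he
  rw [zero_add] at hX
  obtain ⟨P, M, Q, hT', hP, hM, hQ, -⟩ := exists_parts_interval T' (width X) (width X + e.2.2)
  have hcnt := length_eq_cnt hm.pos' hT' hP hM hQ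
  have hheavy : Heavy α T T' u ↔ α ≤ M.length := by
    rw [hcnt, ← hX]
    refine ⟨fun ⟨p, l, h1, h2⟩ => ?_, fun h => ⟨e.1, e.2.2, heu ▸ he, h⟩⟩
    rw [← ent_eq_of_rec hm.nodup h1 he heu.symm]; exact h2
  have hlen : L.length ≤ K.length := (hK.1.subperm fun x hx => ((hK.2 x).1 hx).1).length_le
  have hreg : σ.reg (rNum s) = L.length := by rw [← hL]; simp
  refine (Runs.seq (n' := 3) (runs_countNode (N := N) (W := W) hm (heu ▸ hT) hT' hP hM hQ
    (by rw [hcnt, ← hX]; exact hN e he) hW h11 h12 h30)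
    fun σ₁ ⟨⟨er, eo, eb⟩, eh, e46⟩ => Runs.ite (n := 2) (fun ht => ?_) fun ht => ?_).le
  all_goals simp only [Test.Holds, e46, er rAlpha (by decide), hα] at ht
  · refine (Runs.skip ⟨⟨fun r hr _ _ => er r (by omega), fun a f _ => by rw [eh], eo, eb⟩, L, ?_,
      hK.1, fun x => (hK.2 x).trans ?_⟩).le
    · have : rNum s < 40 := by cases s <;> decide
      rw [Arr, er _ this, eh]; exact hL
    · rw [List.mem_cons]
      refine ⟨fun h => ⟨Or.inr h.1, h.2⟩, fun h => ⟨h.1.resolve_left ?_, h.2⟩⟩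
      rintro rfl
      exact absurd (hheavy.1 h.2) (by omega)
  · have hs : rNum s < 10 := by cases s <;> decide
    refine runs_blk ?_
    have e1 : σ₁.reg (rNum s) = L.length := (er _ (by omega)).trans hreg
    have e2 : (L.length + 1) % W = L.length + 1 := Nat.mod_eq_of_lt (by omega)
    simp only [runAll, Instr.run, State.setReg, er 30 (by omega), h30, er 12 (by omega), h12, e1,
      e2, eh]
    refine ⟨⟨fun r hr _ h2 => ?_, fun a f hf => if_neg fun h => hf h.2, eo, eb⟩, L ++ [u], ?_, ?_,
      ?_⟩
    · simp only [Function.update_of_ne h2]; exact er r (by omega)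
    · simp only [Arr, Function.update_self, List.range_succ, List.map_append, List.map_cons,
        List.map_nil, and_true, if_true]
      congr 1
      refine (List.map_congr_left fun q hq => if_neg ?_).trans (hreg ▸ hL)
      have := List.mem_range.1 hq
      omega
    · refine List.nodup_append.2 ⟨hK.1, by simp, fun a ha b hb => ?_⟩
      rintro rfl
      exact huK (List.mem_singleton.1 hb ▸ ((hK.2 a).1 ha).1)
    · intro x
      rw [List.mem_append, List.mem_singleton, List.mem_cons, hK.2 x]
      constructor
      · rintro (h | rfl)
        exacts [⟨Or.inr h.1, h.2⟩, ⟨Or.inl rfl, hheavy.2 (by omega)⟩]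
      · rintro ⟨rfl | h, h'⟩
        exacts [Or.inr rfl, Or.inl ⟨h, h'⟩]

/-- Loads the second candidate for a heavy node of one side. -/
def candidate (s : Bool) : List Instr :=
  bif s then [.load 30 22 fNextV] else [.load 18 rDollar fNextU, .load 30 18 fEF]

def candidateRec (h : ℕ → ℕ → ℕ) (d m : ℕ) (s : Bool) : ℕ :=
  bif s then h m fNextV else h (h d fNextU) fEF

def collectProg (s : Bool) : Program :=
  .seq (blk [.copy 30 22, .copy (rNum s) 11]) <| .seq (pushProg s) <| .seq (blk (candidate s)) <|
  .ite (.eq 30 11) .skip <| .ite (.eq 30 22) .skip (pushProg s)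

lemma runs_collect (hm : Mesh σ.heap s T T') (hu : m ∈ recs T)
    (hN : ∀ e ∈ ent 0 T, cnt (bd T') e.1 (e.1 + e.2.2) ≤ N) (hW : N + 2 < W) (h11 : σ.reg 11 = 0)
    (h12 : σ.reg 12 = 1) (h22 : σ.reg 22 = m) (hα : σ.reg rAlpha = α) (hd : σ.reg rDollar = d)
    (hw : candidateRec σ.heap d m s ≠ 0 → candidateRec σ.heap d m s ∈ recs T) :
    Runs W (collectProg s) σ (8 * N + 30) (fun σ' => ArrFrame s σ σ' ∧
      ∃ L K, Arr s σ' L ∧ Listed α T T' L K ∧ m ∈ K ∧ K.length ≤ 2 ∧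
        (candidateRec σ.heap d m s ≠ 0 → candidateRec σ.heap d m s ∈ K)) := by
  have hs : rNum s < 10 ∧ 7 < rNum s := by cases s <;> decide
  have hf : fArr s ≠ fNextU ∧ fArr s ≠ fNextV ∧ fArr s ≠ fEF := by cases s <;> decide
  refine Runs.seq_blk (n := 8 * N + 28) fun σ₁ h1 => ?_
  have fr : ArrFrame s σ σ₁ := by
    rw [h1]
    refine ⟨fun r h2 _ h4 => ?_, fun _ _ _ => rfl, rfl, rfl⟩
    simp only [runAll, Instr.run, State.setReg]
    rw [Function.update_of_ne h4, Function.update_of_ne (by omega)]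
  have e30 : σ₁.reg 30 = m ∧ σ₁.reg (rNum s) = 0 := by
    simp only [h1, runAll, Instr.run, State.setReg, h22, Function.update_self]
    rw [Function.update_of_ne (by omega), Function.update_self,
      Function.update_of_ne (by omega), h11]
    exact ⟨rfl, rfl⟩
  refine (Runs.seq (n' := 4 * N + 6 + 11) (runs_push (W := W) (L := []) (K := [])
    (hm.congr fr.lt) hu hN (by omega)
    ((fr.reg 11 (by omega) (by omega) (by omega)).trans h11)
    ((fr.reg 12 (by omega) (by omega) (by omega)).trans h12) e30.1
    ((fr.reg 1 (by omega) (by omega) (by omega)).trans hα)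
    (by rw [Arr, e30.2]; rfl) ⟨List.nodup_nil, by simp⟩ (by simp) (by simp; omega))
    fun σ₂ ⟨fr2, L, hL, hK⟩ => ?_).le
  replace fr := fr.trans fr2
  refine Runs.seq_blk (n := 4 * N + 13) (fun σ₃ h3 => ?_) (by
    cases s <;> simp only [candidate, cond, List.length_cons, List.length_nil] <;> omega)
  have fr3 : ArrFrame s σ σ₃ := by
    refine fr.trans ?_
    rw [h3]
    refine ⟨fun r h2 h3 _ => ?_, fun _ _ _ => by cases s <;> rfl, by cases s <;> rfl,
      by cases s <;> rfl⟩
    cases s <;> simp only [candidate, cond, runAll, Instr.run, State.setReg] <;>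
      repeat rw [Function.update_of_ne (by omega)]
  have e3 : σ₃.reg 30 = candidateRec σ.heap d m s ∧ σ₃.reg (rNum s) = σ₂.reg (rNum s) ∧
      σ₃.heap = σ₂.heap := by
    have q1 := fr.reg 22 (by omega) (by omega) (by omega)
    have q2 := fr.reg 3 (by omega) (by omega) (by omega)
    have q3 : σ.reg 3 = d := hd
    rw [h3]
    cases s <;> simp [candidate, candidateRec, q1, q2, h22, q3,
      rDollar, fr.heap _ _ hf.1.symm, fr.heap _ _ hf.2.1.symm,
      fr.heap _ _ hf.2.2.symm, rNum, rNumU, rNumV]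
  have hL3 : Arr s σ₃ L := by rw [Arr, e3.2.1, e3.2.2]; exact hL
  have r11 := (fr3.reg 11 (by omega) (by omega) (by omega)).trans h11
  have r22 := (fr3.reg 22 (by omega) (by omega) (by omega)).trans h22
  refine (Runs.ite (n := 4 * N + 12) (fun ht => ?_) fun ht => Runs.ite (n := 4 * N + 11)
    (fun ht' => ?_) fun ht' => ?_)
  all_goals simp only [Test.Holds, e3.1, r11] at ht
  · exact (Runs.skip ⟨fr3, L, _, hL3, hK, by simp, by simp, fun h => absurd ht h⟩).le
  all_goals simp only [Test.Holds, e3.1, r22] at ht'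
  · exact (Runs.skip ⟨fr3, L, _, hL3, hK, by simp, by simp, fun _ => by simp [ht']⟩).le
  · refine (runs_push (W := W) (hm.congr fr3.lt) (hw ht) hN (by omega) r11
      ((fr3.reg 12 (by omega) (by omega) (by omega)).trans h12) e3.1
      ((fr3.reg 1 (by omega) (by omega) (by omega)).trans hα) hL3 hK (by simpa using ht')
      (by simp; omega)).mono le_rfl fun σ₄ ⟨fr4, L', h5, h6⟩ =>
        ⟨fr3.trans fr4, L', _, h5, h6, by simp, by simp, fun _ => by simp⟩

end RComp


namespace RComp

variable {S : List ℕ} {W : ℕ} {σ : State} {T T' TU TV D : DBWT}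
  {d c m x α : ℕ} {L K : List ℕ} {h : ℕ → ℕ → ℕ} {all : Prop} {prev : Bool} {a : ℕ → ℕ}

lemma Core.perm_heavy (co : Core S D h TU TV) {f : ℕ → ℕ}
    (hT : ∀ e ∈ ent 0 TU, (f e.1, e.2) ∈ ent 0 T) (hn : (recs T).Nodup)
    (hr : ∀ x ∈ recs T, x ∈ recs TU) {p : ℕ → Prop} [DecidablePred p]
    (hp : ∀ i < D.length, p i ↔
      α ≤ cnt (bd T') (f (start D i)) (f (start D i) + (D.getD i (0, 0)).2))
    (hL : Listed α T T' L K) (hK : ∀ x, Heavy α T T' x → x ∈ K) :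
    L.Perm (((List.range D.length).filter (fun i => decide (p i))).map (addr TU)) := by
  have hnd := co.mesh.nodup
  rw [co.recs_eq] at hnd
  refine (List.perm_ext_iff_of_nodup hL.1 (hnd.sublist (List.filter_sublist.map _))).2 fun x => ?_
  rw [hL.2 x, and_iff_right_of_imp (hK x)]
  simp only [List.mem_map, List.mem_filter, List.mem_range, decide_eq_true_eq]
  constructor
  · rintro ⟨q, l, h1, h2⟩
    obtain ⟨i, hi, rfl⟩ := List.mem_map.1 (co.recs_eq ▸ hr x (mem_recs_of_ent h1))
    rw [List.mem_range] at hi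
    have h3 := ent_eq_of_rec hn h1 (hT _ (co.addr_mem hi)) rfl
    simp only [Prod.mk.injEq, true_and] at h3
    exact ⟨i, ⟨hi, (hp i hi).2 (by rw [← h3.1, ← h3.2]; exact h2)⟩, rfl⟩
  · rintro ⟨i, ⟨hi, h1⟩, rfl⟩
    exact ⟨_, _, hT _ (co.addr_mem hi), (hp i hi).1 h1⟩

lemma Merged.parts (mg : Merged S D c d m all σ TU TV) (hS : IsText S) (hc : dollar < c) :
    ∃ A B, TU = A ++ (d, 1) :: B ∧ width A = insPos (bwt S) c ∧
      ∀ p ∈ A ++ B, σ.heap p.1 fChar ≠ dollar := by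
  obtain ⟨Z, st⟩ := mg.step
  obtain ⟨A, B, h1, h2, -, -, h3⟩ := mg.inv.core.dollar_parts (hS.cons hc) st.isDBWT
  generalize addr TU (dollarIdx (lab σ.heap TU)) = d' at h1
  obtain rfl : d = d' := by
    have hd := mg.mem
    rw [h1, recs_append, recs_cons, List.mem_append, List.mem_cons] at hd
    rcases hd with h | h | h
    · obtain ⟨p, hp, rfl⟩ := List.mem_map.1 h
      exact absurd mg.chr (h3 p (by simp [hp]))
    · exact h
    · obtain ⟨p, hp, rfl⟩ := List.mem_map.1 h
      exact absurd mg.chr (h3 p (by simp [hp]))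
  exact ⟨A, B, h1, h2.trans (rep_cons hS hc), h3⟩

lemma mem_ent_lab' {e : ℕ × ℕ × ℕ} (he : e ∈ ent 0 T) :
    (e.1, h e.2.1 fChar, e.2.2) ∈ ent 0 (lab h T) := by
  obtain ⟨X, Y, hT, hX⟩ := mem_ent.1 he
  rw [hX, zero_add]
  exact mem_ent_lab h hT

lemma eq_of_overlap {e e' : ℕ × ℕ × ℕ} (he : e ∈ ent 0 T) (he' : e' ∈ ent 0 T) {p : ℕ}
    (h1 : e.1 ≤ p) (h2 : p < e.1 + e.2.2) (h3 : e'.1 ≤ p) (h4 : p < e'.1 + e'.2.2) : e = e' := by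
  rcases ent_disjoint he he' with h | h | h
  · exact h
  all_goals omega

lemma Merged.heavyU (mg : Merged S D c d m all σ TU TV) (hS : IsText S) (hc : dollar < c)
    (hD : IsDBWT D (bwt S)) (hα : 2 ≤ α) (hb : Balanced S D α) (hx : Heavy α TU TV x) :
    x = m ∨ x = candidateRec σ.heap d m false := by
  obtain ⟨Z, st⟩ := mg.step
  have hm := mg.inv.core.mesh
  obtain ⟨p, l, he, hcnt⟩ := hx
  have h1 := (st.cntV_le hS hc hD hα hb (mem_ent_lab' he)).2
  rw [bd_lab, ← mg.inv.core.geo.bd_eq hm.nodup] at h1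
  rcases h1 hcnt with h2 | ⟨hsp, h2⟩
  · obtain ⟨X, l', Y, hT, h3, h4⟩ := mg.tile
    have := eq_of_overlap he (e' := (width X, m, l')) (by rw [hT]; simp) h2.1 h2.2 h3 h4
    simp only [Prod.mk.injEq] at this
    exact Or.inl this.2.1
  · right
    obtain ⟨A, B, hT, hA, -⟩ := mg.parts hS hc
    obtain ⟨-, -, hi, -⟩ := splits_getD hS hc hD hsp
    have hrep : insPos (bwt S) c ≠ rep S := fun h => by
      obtain ⟨e, he, h5, h6⟩ := splits_iff.1 hsp
      rw [hD.ins_eq] at h5 h6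
      have := hD.bd_le he (hD.rep_mem_bd hS)
      omega
    have hsh : shift (insPos (bwt S) c) (insPos (bwt S) c) = insPos (bwt S) c + 1 := by simp [shift]
    obtain ⟨e', he', h5⟩ := mem_bd.1 (st.mem_bd_iff.2 (Or.inr ⟨_, Or.inr (mem_splitSet.2
      ⟨hsp, hD.ins_eq.symm⟩), hsh⟩))
    have h6 := st.isDBWT.ent_lt he'
    have h7 := st.isDBWT.width_eq
    rw [width_lab, hT] at h7
    rcases B with _ | ⟨⟨y, l'⟩, B⟩
    · simp [hA] at h7; simp at h6; omega
    · have hn : σ.heap d fNextU = y := (Links.next (X := recs A ++ [d]) (A := 0 :: recs A) (x := d)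
        (Y := y :: recs B) (by have := hm.links; rw [hT] at this; simpa [recs] using this) rfl
        rfl).1
      have hV := mg.inv.core.geo.compat (insPos (bwt S) c + 1, y, l') (by rw [hT]; simp [hA])
      simp only [← hsh, lf_cons_shift hS hc hi hrep] at hV
      exact (hm.edges' _ hV _ he h2.1 h2.2).1.symm.trans (by rw [candidateRec, cond, hn]; rfl)

lemma Merged.heavyV (mg : Merged S D c d m all σ TU TV) (hS : IsText S) (hc : dollar < c)
    (hD : IsDBWT D (bwt S)) (hα : 2 ≤ α) (hb : Balanced S D α) (hx : Heavy α TV TU x) :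
    x = m ∨ x = candidateRec σ.heap d m true := by
  obtain ⟨Z, st⟩ := mg.step
  have hm := mg.inv.core.mesh
  obtain ⟨q, l, he, hcnt⟩ := hx
  obtain ⟨e₀, he₀, heq⟩ := (mg.inv.core.geo.mem_ent hm.nodup).1 he
  obtain ⟨rfl, h0⟩ := Prod.mk.injEq _ _ _ _ ▸ heq
  obtain ⟨p, y, l'⟩ := e₀
  obtain ⟨rfl, rfl⟩ : y = x ∧ l' = l := by simpa using h0
  obtain ⟨X, k, Y, hT, h3, h4⟩ := mg.tile
  have h1 := (st.cntU_le hS hc hD hα hb (mem_ent_lab' he₀)).2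
  rw [bd_lab] at h1
  rcases h1 hcnt with h2 | h2
  · have := eq_of_overlap he₀ (e' := (width X, m, k)) (by rw [hT]; simp) h2.1 h2.2 h3 h4
    simp only [Prod.mk.injEq] at this
    exact Or.inl this.2.1
  · obtain ⟨X', Y', hV, hX'⟩ := mg.inv.core.geo.exists_parts hT
    have h5 := st.isDBWT.lf_add (hS.cons hc) (mem_ent_lab σ.heap hT)
      (q := shift (insPos (bwt S) c) (rep S) - width X) (by simp only; omega)
    simp only [Nat.add_sub_cancel' h3, lf_cons_rep hS hc, ← hX'] at h5
    simp only at h2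
    have hmV : (width X', m, k) ∈ ent 0 TV := by rw [hV]; simp
    by_cases h6 : lf (c :: S) p = insPos (bwt S) c + 1 ∧ width X' + k = insPos (bwt S) c + 1
    · right
      obtain ⟨P, Q, h7, h8⟩ := mem_ent.1 he
      have h9 := append_inj_of_width (P := X' ++ [(m, k)]) (Q := Y') (by rw [← h7, hV]; simp)
        (by have := hm.pos'; rw [hV] at this; simpa using this) (by simp at h8 ⊢; omega)
      rw [h9.2] at hV
      exact ((Links.next (X := recs X' ++ [m]) (A := 0 :: recs X') (x := m) (Y := y :: recs Q)
        (by have := hm.links'; rw [hV] at this; simpa [recs] using this) rfl rfl).1).symm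
    · left
      have := eq_of_overlap he hmV (p := if insPos (bwt S) c + 1 < width X' + k then
        insPos (bwt S) c + 1 else insPos (bwt S) c) (by split <;> simp only <;> omega)
        (by split <;> simp only <;> omega) (by split <;> simp only <;> omega)
        (by split <;> simp only <;> omega)
      simp only [Prod.mk.injEq] at this
      exact this.2.1

lemma Mesh.candidate_mem (hm : Mesh h false TU TV) (hp : ∀ x ∈ recs TU, x ∈ recs TV)
    (hT : d ∈ recs TU) (hm' : m ∈ recs TV) :
    (candidateRec h d m false ≠ 0 → candidateRec h d m false ∈ recs TU) ∧
      (candidateRec h d m true ≠ 0 → candidateRec h d m true ∈ recs TV) := by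
  have key : ∀ {s l x}, Links h s l → x ∈ l → h x (fn s) ≠ 0 → h x (fn s) ∈ l := by
    intro s l x hl hx h0
    obtain ⟨X, Y, rfl⟩ := List.append_of_mem hx
    obtain ⟨C, v, hv⟩ := exists_cons_zero Y
    have h1 := (Links.next (X := X ++ [x]) (A := 0 :: X) (x := x) (Y := Y) (by simpa using hl)
      rfl hv).1
    rw [h1] at h0 ⊢
    have : v ∈ Y ++ [0] := by rw [hv]; simp
    simp only [List.mem_append, List.mem_singleton, h0, or_false] at this
    simp [this]
  refine ⟨fun h0 => ?_, key hm.links' hm'⟩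
  have h1 : h d fNextU ≠ 0 := fun h1 => h0 (by rw [candidateRec, cond, h1]; exact hm.null')
  obtain ⟨e, he, h2⟩ := exists_ent_of_mem_recs (s := 0) (hp _ (key hm.links hT h1))
  have h3 := ent_pos hm.pos' he
  have h4 := (ent_le he).2
  rw [hm.width_eq] at h4
  obtain ⟨e', he', h5, h6⟩ := exists_ent (s := 0) (T := TU) (Nat.zero_le e.1) (by omega)
  rw [candidateRec, cond, show h d fNextU = e.2.1 from h2.symm]
  exact (hm.edges' e he e' he' h5 h6).1 ▸ mem_recs_of_ent he'

def finishProg : Program :=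
  .seq (collectProg false) <| .seq (collectProg true) <|
  blk [.copy rSplit 17, .load rHeadU 11 fNextU, .load rTailU 11 fPrevU, .load rHeadV 11 fNextV,
    .load rTailV 11 fPrevV]

lemma runs_finish (mg : Merged S D c d m all σ TU TV) (hS : IsText S) (hc : dollar < c)
    (hD : IsDBWT D (bwt S)) (hα : 2 ≤ α) (hb : Balanced S D α) (hW : 2 * α + 2 < W)
    (h22 : σ.reg 22 = m) (hrα : σ.reg rAlpha = α) (hrd : σ.reg rDollar = d)
    (hfr : ∀ x ∈ recs TU, x < σ.reg rFresh) :
    Runs W finishProg σ (32 * α + 65) (fun σ' => ∃ a',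
      Stores (c :: S) (lab σ.heap TU) α σ' a' ∧ σ'.reg rSplit = σ.reg 17 ∧
      (heavyLs (c :: S) (lab σ.heap TU) α).length ≤ 2 ∧
      (heavyFs (c :: S) (lab σ.heap TU) α).length ≤ 2 ∧
      BTreeOnly (lab σ.heap TU) σ' a' ∧ (all → BTreeAll (lab σ.heap TU) σ' a')) := by
  obtain ⟨Z, st⟩ := mg.step
  obtain ⟨A, B, hT, hA, hne⟩ := mg.parts hS hc
  have inv := mg.inv
  have co := inv.core
  have hm := co.mesh
  have hr : ∀ {x}, x ∈ recs TV ↔ x ∈ recs TU := co.geo.perm_recs.mem_iff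
  have hmU : m ∈ recs TU := by
    obtain ⟨X, l, Y, hX, -⟩ := mg.tile; rw [hX]; simp
  have hbd : bd TV = (bd (lab σ.heap TU)).image (lf (c :: S)) := by
    rw [bd_lab, co.geo.bd_eq hm.nodup]
  have hcm := hm.candidate_mem (fun x => hr.2) mg.mem (hr.2 hmU)
  refine (Runs.seq (n := 8 * (2 * α) + 30) (n' := 16 * α + 35) (runs_collect (d := d) hm hmU
    (fun e he => by rw [hbd]; exact (st.cntV_le hS hc hD hα hb (mem_ent_lab' he)).1) (by omega)
    inv.zero inv.one h22 hrα hrd hcm.1)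
    fun σ₁ ⟨fr, LU, KU, hLU, hKU, hmKU, hKU2, hcU⟩ => ?_).le
  have hcr : ∀ {h' : ℕ → ℕ → ℕ}, (∀ a, ∀ f < 10, h' a f = σ.heap a f) →
      candidateRec h' d m true = candidateRec σ.heap d m true := fun hh => hh _ _ (by decide)
  refine (Runs.seq (n := 8 * (2 * α) + 30) (n' := 5) (runs_collect (s := true) (d := d) (m := m)
    (hm.congr fr.lt).symm (hr.2 hmU)
    (fun e he => by
      obtain ⟨e₀, he₀, rfl⟩ := (co.geo.mem_ent hm.nodup).1 he
      rw [← bd_lab σ.heap]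
      exact (st.cntU_le hS hc hD hα hb (mem_ent_lab' he₀)).1) (by omega)
    ((fr.reg 11 (by decide) (by decide) (by decide)).trans inv.zero)
    ((fr.reg 12 (by decide) (by decide) (by decide)).trans inv.one)
    ((fr.reg 22 (by decide) (by decide) (by decide)).trans h22)
    ((fr.reg 1 (by decide) (by decide) (by decide)).trans hrα)
    ((fr.reg 3 (by decide) (by decide) (by decide)).trans hrd)
    (by rw [hcr fr.lt]; exact hcm.2))
    fun σ₂ ⟨fr2, LV, KV, hLV, hKV, hmKV, hKV2, hcV⟩ => runs_blk ?_).le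
  rw [hcr fr.lt] at hcV
  have hlt : ∀ a, ∀ f < 10, σ₂.heap a f = σ.heap a f := fun a f hf =>
    (fr2.lt a f hf).trans (fr.lt a f hf)
  have hreg : ∀ r < 30, r ≠ 18 → r ≠ 8 → r ≠ 9 → σ₂.reg r = σ.reg r := fun r h1 h2 h3 h4 =>
    (fr2.reg r h1 h2 h4).trans (fr.reg r h1 h2 h3)
  have r11 : σ₂.reg 11 = 0 := (hreg 11 (by decide) (by decide) (by decide)
      (by decide)).trans inv.zero
  have pU := co.perm_heavy (f := id) (fun e he => he) hm.nodup (fun _ h => h)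
    (p := HeavyL (c :: S) (lab σ.heap TU) α) (fun i hi => by
      rw [HeavyL, st.isDBWT.coveredByL_length hi, ← hbd]; rfl) hKU (fun x hx => by
      rcases mg.heavyU hS hc hD hα hb hx with rfl | h
      · exact hmKU
      · obtain ⟨p, l, he, -⟩ := hx
        rw [h]
        exact hcU (h ▸ fun h0 => hm.zero (h0 ▸ mem_recs_of_ent he)))
  have pV := co.perm_heavy (f := lf (c :: S)) co.geo.compat hm.nodup' (fun _ h => hr.1 h)
    (p := HeavyF (c :: S) (lab σ.heap TU) α) (fun i hi => by
      rw [HeavyF, st.isDBWT.coveredByF_length (hS.cons hc) hi, bd_lab]; rfl) hKV (fun x hx => by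
      rcases mg.heavyV hS hc hD hα hb hx with rfl | h
      · exact hmKV
      · obtain ⟨p, l, he, -⟩ := hx
        rw [h]
        exact hcV (h ▸ fun h0 => hm.zero' (h0 ▸ mem_recs_of_ent he)))
  have len2 : ∀ {T T' L K}, Listed α T T' L K → K.length ≤ 2 → L.length ≤ 2 := fun hL hK =>
    ((hL.1.subperm fun x hx => ((hL.2 x).1 hx).1).length_le).trans hK
  set σ₃ := runAll W _ σ₂ with h3
  have eh : σ₃.heap = σ₂.heap ∧ σ₃.order = σ.order ∧ σ₃.btree = σ.btree := by
    rw [← fr.order, ← fr2.order, ← fr.btree, ← fr2.btree]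
    exact ⟨rfl, rfl, rfl⟩
  have er : ∀ r < 30, 7 < r → σ₃.reg r = σ₂.reg r := fun r _ h7 => by
    simp only [h3, runAll, Instr.run, State.setReg, rSplit, rHeadU, rTailU, rHeadV, rTailV]
    repeat rw [Function.update_of_ne (by omega)]
  have er' : σ₃.reg rAlpha = σ₂.reg 1 ∧ σ₃.reg rDollar = σ₂.reg 3 ∧ σ₃.reg rSplit = σ₂.reg 17 ∧
      σ₃.reg rHeadU = σ₂.heap 0 fNextU ∧ σ₃.reg rTailU = σ₂.heap 0 fPrevU ∧
      σ₃.reg rHeadV = σ₂.heap 0 fNextV ∧ σ₃.reg rTailV = σ₂.heap 0 fPrevV := by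
    simp [h3, rSplit, rHeadU, rTailU, rHeadV, rTailV, rAlpha,
      rDollar, r11]
  clear_value σ₃
  clear h3
  have co' := co.congr (h' := σ₃.heap) fun a f hf => by rw [eh.1, hlt a f hf]
  have hchd : σ₃.heap d fChar = dollar := by rw [eh.1, hlt _ _ (by decide), mg.chr]
  have hne' : ∀ p ∈ A ++ B, σ₃.heap p.1 fChar ≠ dollar := fun p hp => by
    rw [eh.1, hlt _ _ (by decide)]; exact hne p hp
  have hbt : BInv all (σ₃.heap · fChar) (recs A ++ recs B) d σ₃.btree.inorder := by
    have := mg.btree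
    rw [hT, filter_recs (hT ▸ hm.nodup)] at this
    rw [eh.2.2]
    exact this.congr fun a _ => by rw [eh.1, hlt _ _ (by decide)]
  have hd3 : σ₃.reg rDollar = d :=
    er'.2.1.trans ((hreg 3 (by decide) (by decide) (by decide) (by decide)).trans hrd)
  have hsub : σ₃.btree.inorder.Sublist (recs TV) := eh.2.2 ▸ inv.sub
  refine ⟨addr TU, co'.stores (hS.cons hc) st.isDBWT
    (er'.1.trans ((hreg 1 (by decide) (by decide) (by decide) (by decide)).trans hrα))
    (fun x hx => ?_) (by rw [eh.1, er'.2.2.2.1]) (by rw [eh.1, er'.2.2.2.2.1])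
    (by rw [eh.1, er'.2.2.2.2.2.1]) (by rw [eh.1, er'.2.2.2.2.2.2]) (hd3.symm ▸ hT)
    (hA.trans (rep_cons hS hc).symm) (eh.2.1.trans inv.order) ?_ ?_ (eh.2.2 ▸ inv.shape) hsub,
    er'.2.2.1.trans (hreg 17 (by decide) (by decide) (by decide) (by decide)), ?_, ?_,
    (co'.bOnly_iff hT hchd hne' fun x hx => hr.1 (hsub.subset hx)).2 hbt.1,
    fun h => (co'.bAll_iff hT hchd hne').2 (hbt.2 h)⟩
  · rw [er rFresh (by decide) (by decide), hreg rFresh (by decide) (by decide) (by decide)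
      (by decide)]
    exact hfr x hx
  · refine List.Perm.trans (List.Perm.of_eq ?_) pU
    rw [← hLU, er rNumU (by decide) (by decide), eh.1]
    simp only [rNum, fArr, cond]
    rw [show σ₂.reg rNumU = σ₁.reg rNumU from fr2.reg 8 (by decide) (by decide) (by decide)]
    exact List.map_congr_left fun q _ => fr2.heap q fArrU (by decide)
  · refine List.Perm.trans (List.Perm.of_eq ?_) pV
    rw [← hLV, er rNumV (by decide) (by decide), eh.1]
    rfl
  · have := pU.length_eq; rw [List.length_map] at this
    exact this ▸ len2 hKU hKU2
  · have := pV.length_eq; rw [List.length_map] at this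
    exact this ▸ len2 hKV hKV2

/-- The modified fast update operation. -/
def updateProg : Program := .seq prepareProg (.seq mergeStageProg finishProg)

lemma runs_update (hα : 2 ≤ α) (hS : IsText S) (hc : dollar < c) (hD : IsDBWT D (bwt S))
    (hb : Balanced S D α) (hf : FastApplies D c)
    (hW : 10 * (σ.reg rFresh + S.length + α + c) ≤ W) (st : Stores S D α σ a)
    (hO : BTreeOnly D σ a) (hrc : σ.reg rChar = c) (hp : σ.reg rSplit = prev.toNat) :
    ∃ D', fastUpdate D c prev = some D' ∧ Runs W updateProg σ (300 * α) (fun σ' => ∃ a',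
      Stores (c :: S) D' α σ' a' ∧ σ'.reg rSplit = (decide (Splits D c)).toNat ∧
      IsDBWT D' (bwt (c :: S)) ∧ Balanced (c :: S) D' (2 * α + 1) ∧
      (heavyLs (c :: S) D' α).length ≤ 2 ∧ (heavyFs (c :: S) D' α).length ≤ 2 ∧
      BTreeOnly D' σ' a' ∧ (BTreeAll D σ a → BTreeAll D' σ' a')) := by
  obtain ⟨A₀, B₀, A₁, B₁, set⟩ := exists_setup hS hc hD
  obtain ⟨D', hD'⟩ := exists_fastUpdate hS hc hD hf prev
  refine ⟨D', hD', ?_⟩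
  have hS0 := hS.length_pos
  refine (Runs.seq (n' := 96 * α + 145) (runs_prepare st hS hc hD hb set hf hO id hrc
    (by omega) (by omega)) fun σ₁ ⟨er, e10, e13, e17, X, Y, TV, A, B, pr, hfr⟩ => ?_).le
  refine (Runs.seq (n' := 32 * α + 65) (runs_mergeStage (prev := prev) pr hS hc hD hα hb set hf
    (by omega) ((er 0 (by decide)).trans hrc) e13 ((er 2 (by decide)).trans hp))
    fun σ₂ ⟨er2, TU', TV', mg, hu, hsub⟩ => ?_).le
  obtain rfl := Option.some_injective _ (hu.symm.trans hD')
  obtain ⟨Z, step⟩ := mg.step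
  refine (runs_finish mg hS hc hD hα hb (by omega) rfl ((er2 1 (by decide)).trans
    ((er 1 (by decide)).trans st.alpha)) ((er2 3 (by decide)).trans (er 3 (by decide)))
    fun x hx => ?_).mono le_rfl fun σ₃ ⟨a', h1, h2, h3, h4, h5, h6⟩ =>
      ⟨a', h1, h2.trans ((er2 17 (by decide)).trans e17), step.isDBWT,
        step.balanced hS hc hD hα hb, h3, h4, h5, h6⟩
  rw [er2 rFresh (by decide), e10]
  exact hfr x (hsub x hx)

end RComp


theorem mainTheorem3 :
    -- the guarantees of the modified fast update operation
    (∃ (P : RComp.Program) (C K : ℕ), ∀ (W α c : ℕ) (S : List ℕ) (D : RComp.DBWT) (prev : Bool)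
      (σ : RComp.State) (a : ℕ → ℕ),
      2 ≤ α → RComp.IsText S → RComp.dollar < c →
      RComp.IsDBWT D (RComp.bwt S) → RComp.Balanced S D α → RComp.FastApplies D c →
      K * (σ.reg RComp.rFresh + S.length + α + c) ≤ W →
      RComp.Stores S D α σ a → RComp.BTreeOnly D σ a →
      σ.reg RComp.rChar = c → σ.reg RComp.rSplit = prev.toNat →
      ∃ (D' : RComp.DBWT) (t : ℕ) (σ' : RComp.State) (a' : ℕ → ℕ),
        RComp.fastUpdate D c prev = some D' ∧
        RComp.Exec W P σ t σ' ∧ t ≤ C * α ∧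
        RComp.Stores (c :: S) D' α σ' a' ∧
        σ'.reg RComp.rSplit = (decide (RComp.Splits D c)).toNat ∧
        RComp.IsDBWT D' (RComp.bwt (c :: S)) ∧
        RComp.Balanced (c :: S) D' (2 * α + 1) ∧
        (RComp.heavyLs (c :: S) D' α).length ≤ 2 ∧
        (RComp.heavyFs (c :: S) D' α).length ≤ 2 ∧
        RComp.BTreeOnly D' σ' a' ∧
        (RComp.BTreeAll D σ a → RComp.BTreeAll D' σ' a')) ∧
    -- the bounds on the number of DBWT-repetitions and on the number of balancing splits
    (∀ (T : List ℕ) (α : ℕ), RComp.IsText T → 2 ≤ α →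
      (∃ (D : RComp.DBWT) (b : Bool) (kSplit : ℕ), RComp.Run T α T.length D b kSplit) ∧
      ∀ (D : RComp.DBWT) (b : Bool) (kSplit : ℕ), RComp.Run T α T.length D b kSplit →
        RComp.IsDBWT D (RComp.bwt T) ∧ RComp.Balanced T D α ∧
        D.length ≤ RComp.numRuns (RComp.bwt T) + kSplit ∧
        (16 ≤ α → (kSplit : ℚ) ≤
          2 * (RComp.numRuns (RComp.bwt T) : ℚ) / (((⌈(α : ℚ) / 2⌉ : ℤ) : ℚ) - 7))) := by
  refine ⟨⟨RComp.updateProg, 300, 10, fun W α c S D prev σ a hα hS hc hD hb hf hW st hO hrc hp => ?_⟩,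
    fun T α hT hα => ⟨RComp.exists_run hT hα hT.length_pos le_rfl, fun D b kSplit h =>
    RComp.run_bounds hT hα h⟩⟩
  obtain ⟨D', hD', t, σ', hex, ht, a', h1, h2, h3, h4, h5, h6, h7, h8⟩ :=
    RComp.runs_update hα hS hc hD hb hf hW st hO hrc hp
  exact ⟨D', t, σ', a', hD', hex, ht, h1, h2, h3, h4, h5, h6, h7, h8⟩
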